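/- **Conventions.** Bigradings are by (intrinsic, homological) degree in $\frac12\mathbb Z\oplus\mathbb Z$; $\deg_h$ is the homological degree and $|\mathrm{id}|(x)=(-1)^{\deg_h x}x$. Differential algebras and right modules satisfy $\mu_1(ab)=(-1)^{\deg_h b}\mu_1(a)b+a\mu_1(b)$ and $m_1(xa)=(-1)^{\deg_h a}m_1(x)a+x\mu_1(a)$, and differentials have bidegree $(0,1)$. **The arc algebra.** Fix $n\ge 0$ and let $H^n$ be Khovanov's arc algebra over $\mathbb Z$. It has the $\mathbb Z$-basis $\beta$ of elements $h=(W(a)b,\sigma)$, where $a,b$ are crossingless matchings of $2n$ points and $\sigma$ labels each circle of $W(a)b$ by $+$ ($=1$) or $-$ ($=X$). Its product is induced by minimal saddle cobordisms $W(a)b\sqcup W(b)c\to W(a)c$ and the TQFT of $\mathbb Z[X]/X^2$. Put $e_L(h)=a$, $e_R(h)=b$, and $\deg h=n-\#\{\text{circles}\}+2\,\#\{\text{circles labelled }-\}$. The idempotents are $1_a=(W(a)a,\text{all }+)$. Let $m(W(a)b,\sigma)=(W(b)a,\sigma)$ be reflection across the line. Let $\beta_{mult}\subset\beta$ consist of the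 elements $(W(a)a',\text{all }+)$ with $a'$ obtained from $a$ by surgery on a bridge, and the elements $(W(a)a,\ -\text{ on exactly one circle})$. **The algebras $\mathcal B$ and $m(\mathcal B)^!$.** Let $R=\mathcal I_\beta=\prod_{h\in\beta}\mathbb Z$. Let $\mathcal B=\mathcal B_R(H^n)$ be the algebra of endomorphisms of the group $H^n$ (acting on the right) generated over $R$ by the maps $b_{*;h_1,h_2}=e(h_1,h_2)$, where $e(h_1,h_2)$ sends $h_1\mapsto h_2$ and all other elements of $\beta$ to $0$, for all $(h_1,h_2)$ such that $h_2$ occurs in the $\beta$-expansion of $h_1g$ for some $g\in\beta_{mult}$. It is a *bridge* generator $b_{\gamma;h_1,h_2}$ if $e_R(h_1)\ne e_R(h_2)$ ($\gamma$ being the bridge). Otherwise it is a *decoration* generator $b_{C;h_1,h_2}$, where $C$ is the circle whose label changes from $+$ to $-$. It has bidegree $(\frac12(\deg h_1-\deg h_2),0)$. Let $V$ be the free group on these generators, let $J$ be the kernel of $T_R(V)\to\mathcal B$, let $J_2=J\cap(V\oplus V\otimes_RV)$, let $I\subset V\otimes_R V$ be the projection of $J_2$, and let $\varphi:I\to V$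 be the map with $\varphi(r)+r\in J_2$. The dual is $\mathcal B^!=T_R(V^*)/(I^\perp)$, where $b^*$ has the opposite intrinsic degree to $b$ and homological degree $1$; its differential is determined by $\mu_1=\varphi^*:V^*\to I^*=(V^*\otimes_R V^*)/I^\perp$ on generators and by the Leibniz rule. Let $m(\mathcal B)^!$ be the same algebra with each idempotent $h$ replaced by $m(h)$; its generators $m(b^*_{*;m(h_1),m(h_2)})$, one for each generator $b_{*;m(h_1),m(h_2)}$ of $\mathcal B$, have left idempotent $h_1$ and right idempotent $h_2$. **The algebra $\mathcal B\odot m(\mathcal B)^!$.** It is the quotient of $T_R(V\oplus m(V^*))$ by $J_2$, by $m(I^\perp)$, and by the following relations, imposed whenever all generators that occur exist: 1. $b_{\gamma;h_1,h_2}\,m(b^*_{\eta';m(h_2),m(h_3)})=m(b^*_{\eta;m(h_1),m(h_2')})\,b_{\gamma';h_2',h_3}$ for bridge generators; 2. $b_{C;h_1,h_2}\,m(b^*_{\eta;m(h_2),m(h_3)})=m(b^*_{\eta;m(h_1),m(h_2')})\,b_{C;h_2',h_3}$ for a decoration generator of $\mathcal B$ and a bridge generator of $m(\mathcal B)^!$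 (on the right, $C$ stands for the circle that is decorated); 3. $b_{\gamma;h_1,h_2}\,m(b^*_{C;m(h_2),m(h_3)})=m(b^*_{C;m(h_1),m(h_2')})\,b_{\gamma;h_2',h_3}$ if $C$ is disjoint from the circles involved in surgery on $\gamma$; 4. $b_{C;h_1,h_2}\,m(b^*_{C';m(h_2),m(h_3)})=m(b^*_{C';m(h_1),m(h_2')})\,b_{C;h_2',h_3}$ for two different circles $C,C'$; 5. $b_{\gamma;h_1,h_2}\,m(b^*_{C;m(h_2),m(h_3)})=m(b^*_{C';m(h_1),m(h_2')})\,b_{\gamma;h_2',h_3}+m(b^*_{C'';m(h_1),m(h_2'')})\,b_{\gamma;h_2'',h_3}$ if $\gamma$ joins $C'$ and $C''$ to $C$; and $b_{\gamma;h_1,h_2'}\,m(b^*_{C';m(h_2'),m(h_3)})+b_{\gamma;h_1,h_2''}\,m(b^*_{C'';m(h_2''),m(h_3)})=m(b^*_{C;m(h_1),m(h_2)})\,b_{\gamma;h_2,h_3}$ if $\gamma$ splits $C$ into $C'$ and $C''$. Its differential is zero on $R$ and on $V$, is the differential of $m(\mathcal B)^!$ on the generators $m(b^*)$, and satisfies the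 Leibniz rule. The mirror of an algebra, module or Type D structure over $R$ is the same object with each idempotent $h$ replaced by $m(h)$. Let $\mathcal K$ be the rank-one DD bimodule over $\mathcal B\odot m(\mathcal B)^!$ and its mirror with DD operation $$\delta_{\mathcal K}(h)=\sum_{b=hb}b\otimes(b^*)^{op}+\sum_{m(b^*)=h\,m(b^*)}m(b^*)\otimes (m(b))^{op},$$ the sums being over generators with left idempotent $h$. **Complexes of modules.** Let $M$ be a chain complex of projective graded right $H^n$-modules, regarded as a differential bigraded module, with $M=\bigoplus_{i\in S}x_iH^n$, where $S$ is finite, the $x_i$ are homogeneous, and $x_iH^n\cong 1_{e(x_i)}H^n$ via $x_i\mapsto 1_{e(x_i)}$. Write $$d(x_i)=\sum_j c_{i,j}\,x_j+\sum_j\sum_{\deg h'>0}\tilde c_{i,j;h'}\,x_jh'.$$ Then $M$ satisfies $C_{module}$ if $\tilde c_{i,j;h'}=0$ unless $h'\in\beta_{mult}$. A complex $N=\bigoplus_i H^nx_i$ of left modules satisfies $C_{module}$ if the complex of right modules $m(N)$ (same group, grading and differential, with $x\cdot h=m(h)x$) does. For $M$ satisfying $C_{module}$, let $\widehat A(M)$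 be the group $M$ with basis $\{x_ih:e_L(h)=e(x_i)\}$. Here $x_ih$ has right idempotent $h$ and, if $x_i$ has bidegree $(j,k)$ in $M$, bidegree $(-j-\frac12\deg h,\,k)$ in $\widehat A(M)$. The differential is $m_1(x_ih)=\sum_jc_{i,j}x_jh$. The right action $m_2$ of $\mathcal B\odot m(\mathcal B)^!$ is determined by $$m_2(x_ih,b_{*;h,h''})=x_ih'',\qquad m_2(x_ih,m(b^*_{*;m(h),m(h'')}))=\sum_j\sum_{h'\in\beta_{mult}}\tilde c_{i,j;h'}\,\tilde{\tilde c}_{h'h;h''}\,x_jh'',$$ where $\tilde{\tilde c}_{h'h;h''}$ is the coefficient of $h''$ in $h'h$, and by associativity. For $N$ satisfying $C_{module}$, let $$\widehat D(N)=m\big(\widehat A(m(N))\boxtimes\mathcal K\big),\qquad \delta^{\boxtimes}=m_1+\xi\circ(m_2\otimes\mathrm{id})\circ(\mathrm{id}\otimes\delta_{\mathcal K}),\qquad \xi(x\otimes a^{op})=(-1)^{(\deg_hx)(\deg_ha)}a\otimes x.$$ **Theorem.** For every $n\ge0$ the following hold. - There is exactly one differential on $\mathcal B\odot m(\mathcal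 B)^!$ as prescribed. With it, $\mathcal B\odot m(\mathcal B)^!$ is a differential bigraded algebra, finitely generated over $\mathbb Z$, whose part in bidegree $(0,0)$ is $R$. The operation $\delta_{\mathcal K}$ satisfies the axioms of a rank-one Type DD bimodule over $\mathcal B\odot m(\mathcal B)^!$ and its mirror. - If $M$ is a complex of right modules satisfying $C_{module}$, there is exactly one right action $m_2$ as prescribed. With it, $\widehat A(M)$ is a differential bigraded right module over $\mathcal B\odot m(\mathcal B)^!$, and hence a Type A structure with $m_i=0$ for $i>2$. - If $N$ is a complex of left modules satisfying $C_{module}$, then $\widehat A(m(N))$ is likewise well defined, and $\widehat D(N)$ is a Type D structure over $\mathcal B\odot m(\mathcal B)^!$: its operation $\delta$ takes values in $(\mathcal B\odot m(\mathcal B)^!)\otimes_R\widehat D(N)$, is $R$-linear, has bidegree $(0,1)$, and satisfies $(\mu_1\otimes|\mathrm{id}|)\circ\delta+(\mu_2\otimes\mathrm{id})\circ(\mathrm{id}\otimes\delta)\circ\delta=0$. -/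

import Mathlib

universe u

open scoped TensorProduct

noncomputable section

namespace BorderedKh


/-! ## Bordered algebra

Bigradings are by (intrinsic, homological) degree; the intrinsic degree may be a half-integer and is
recorded as a rational number.  The idempotent ring is `R = ∏_{h : ι} ℤ e_h`, for a finite type `ι`,
so that an `R`-module is an abelian group with a complete system of orthogonal projections. -/

section Algebra

/-- Multiplication by `f k` in homological degree `k`, on a bigraded abelian group. -/
def degMap {X : Type u} [AddCommGroup X] (gr : ℚ × ℤ → Submodule ℤ X) (f : ℤ → ℤ) : X →ₗ[ℤ] X :=
  open Classical in
  if h : DirectSum.IsInternal gr then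
    (DirectSum.toModule ℤ (ℚ × ℤ) X fun p => f p.2 • (gr p).subtype) ∘ₗ
      (LinearEquiv.ofBijective (DirectSum.coeLinearMap gr) h).symm.toLinearMap
  else 0

theorem degMap_of_mem {X : Type u} [AddCommGroup X] {gr : ℚ × ℤ → Submodule ℤ X}
    (hgr : DirectSum.IsInternal gr) (f : ℤ → ℤ) {p : ℚ × ℤ} {x : X} (hx : x ∈ gr p) :
    degMap gr f x = f p.2 • x := by
  have key : (LinearEquiv.ofBijective (DirectSum.coeLinearMap gr) hgr).symm x
      = DirectSum.lof ℤ (ℚ × ℤ) (fun p => gr p) p ⟨x, hx⟩ := by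
    rw [LinearEquiv.symm_apply_eq]
    exact (DirectSum.coeLinearMap_lof gr p ⟨x, hx⟩).symm
  unfold degMap
  rw [dif_pos hgr]
  simp only [LinearMap.comp_apply, LinearEquiv.coe_coe]
  rw [key, DirectSum.toModule_lof]
  simp

/-- The operator `|id|`, multiplication by `(-1)^{deg_h}`. -/
def sgn {X : Type u} [AddCommGroup X] (gr : ℚ × ℤ → Submodule ℤ X) : X →ₗ[ℤ] X :=
  degMap gr fun k => (k.negOnePow : ℤ)

/-- Projection onto the part of even homological degree. -/
def evenPart {X : Type u} [AddCommGroup X] (gr : ℚ × ℤ → Submodule ℤ X) : X →ₗ[ℤ] X :=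
  degMap gr fun k => if Even k then 1 else 0

/-- Projection onto the part of odd homological degree. -/
def oddPart {X : Type u} [AddCommGroup X] (gr : ℚ × ℤ → Submodule ℤ X) : X →ₗ[ℤ] X :=
  degMap gr fun k => if Even k then 0 else 1

/-- The part of bidegree `q` of a tensor product of bigraded abelian groups. -/
def tensorGr {X : Type*} {Y : Type*} [AddCommGroup X] [AddCommGroup Y]
    (grX : ℚ × ℤ → Submodule ℤ X) (grY : ℚ × ℤ → Submodule ℤ Y) (q : ℚ × ℤ) :
    Submodule ℤ (X ⊗[ℤ] Y) :=
  Submodule.span ℤ {t | ∃ p p' x y, x ∈ grX p ∧ y ∈ grY p' ∧ p + p' = q ∧ t = x ⊗ₜ[ℤ] y}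

/-- The data of a differential bigraded algebra over `R = ∏_{h : ι} ℤ e_h`. -/
structure DGData (ι : Type) where
  A : Type
  [ring : Ring A]
  /-- the elementary idempotents -/
  e : ι → A
  gr : ℚ × ℤ → Submodule ℤ A
  /-- the differential `μ₁` -/
  d : A →ₗ[ℤ] A

attribute [instance] DGData.ring

variable {ι : Type} [Fintype ι]

/-- The axioms of a differential bigraded algebra, finitely generated over `ℤ`, over the idempotent
ring `R`. -/
structure IsDGAlgebra (𝒜 : DGData ι) : Prop where
  finite : Module.Finite ℤ 𝒜.A
  idem_mul : ∀ h, 𝒜.e h * 𝒜.e h = 𝒜.e h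
  idem_orth : ∀ h k, h ≠ k → 𝒜.e h * 𝒜.e k = 0
  idem_sum : ∑ h, 𝒜.e h = 1
  internal : DirectSum.IsInternal 𝒜.gr
  one_mem : (1 : 𝒜.A) ∈ 𝒜.gr 0
  mul_mem : ∀ p q a b, a ∈ 𝒜.gr p → b ∈ 𝒜.gr q → a * b ∈ 𝒜.gr (p + q)
  /-- the part in bidegree `(0,0)` is the idempotent ring -/
  idem_free : LinearIndependent ℤ 𝒜.e
  gr_zero : 𝒜.gr 0 = Submodule.span ℤ (Set.range 𝒜.e)
  d_mem : ∀ p a, a ∈ 𝒜.gr p → 𝒜.d a ∈ 𝒜.gr (p + (0, 1))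
  d_d : ∀ a, 𝒜.d (𝒜.d a) = 0
  d_idem_left : ∀ h a, 𝒜.d (𝒜.e h * a) = 𝒜.e h * 𝒜.d a
  d_idem_right : ∀ h a, 𝒜.d (a * 𝒜.e h) = 𝒜.d a * 𝒜.e h
  leibniz : ∀ a b p, b ∈ 𝒜.gr p →
    𝒜.d (a * b) = (p.2.negOnePow : ℤ) • (𝒜.d a * b) + a * 𝒜.d b

/-- The data of a right module with a bigrading and a differential. The ring homomorphism into the
opposite of the endomorphism ring is the (associative, unital) right action. -/
structure RightModData (𝒜 : DGData ι) where
  X : Type u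
  [group : AddCommGroup X]
  gr : ℚ × ℤ → Submodule ℤ X
  ρ : 𝒜.A →+* (Module.End ℤ X)ᵐᵒᵖ
  d : X →ₗ[ℤ] X

attribute [instance] RightModData.group

/-- The right action `m₂(x, a)`. -/
def RightModData.act {𝒜 : DGData ι} (ℳ : RightModData.{u} 𝒜) : ℳ.X →ₗ[ℤ] 𝒜.A →ₗ[ℤ] ℳ.X :=
  LinearMap.mk₂ ℤ (fun x a => (ℳ.ρ a).unop x)
    (fun x y a => map_add _ x y) (fun c x a => map_smul _ c x)
    (fun x a b => by simp) (fun c x a => by simp)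

/-- The axioms of a (finitely generated) differential bigraded right module. -/
structure IsRightDGModule {𝒜 : DGData ι} (ℳ : RightModData.{u} 𝒜) : Prop where
  finite : Module.Finite ℤ ℳ.X
  internal : DirectSum.IsInternal ℳ.gr
  act_mem : ∀ p q x a, x ∈ ℳ.gr p → a ∈ 𝒜.gr q → ℳ.act x a ∈ ℳ.gr (p + q)
  d_mem : ∀ p x, x ∈ ℳ.gr p → ℳ.d x ∈ ℳ.gr (p + (0, 1))
  d_d : ∀ x, ℳ.d (ℳ.d x) = 0
  leibniz : ∀ x a q, a ∈ 𝒜.gr q →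
    ℳ.d (ℳ.act x a) = (q.2.negOnePow : ℤ) • ℳ.act (ℳ.d x) a + ℳ.act x (𝒜.d a)

/-- The data of a Type A structure: `m x [a₁, …, a_{i-1}]` is `m_i(x, a₁, …, a_{i-1})`, and `ε h` is
the right action of the elementary idempotent `e_h`. -/
structure TypeAData (𝒜 : DGData ι) where
  X : Type u
  [group : AddCommGroup X]
  gr : ℚ × ℤ → Submodule ℤ X
  ε : ι → X →ₗ[ℤ] X
  m : X → List 𝒜.A → X

attribute [instance] TypeAData.group

open Classical in
/-- The axioms of a strictly unital Type A structure (`𝒜_∞`-module). Lists `l` of pairs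
`(a, q)` record algebra elements together with a bidegree. -/
structure IsTypeA {𝒜 : DGData ι} (𝒳 : TypeAData.{u} 𝒜) : Prop where
  finite : Module.Finite ℤ 𝒳.X
  internal : DirectSum.IsInternal 𝒳.gr
  idem_comp : ∀ h k x, 𝒳.ε h (𝒳.ε k x) = if h = k then 𝒳.ε h x else 0
  idem_sum : ∀ x, ∑ h, 𝒳.ε h x = x
  idem_mem : ∀ h p x, x ∈ 𝒳.gr p → 𝒳.ε h x ∈ 𝒳.gr p
  /- the `m_i` are multi-additive and `R`-linear maps on the tensor products over `R` -/
  add_left : ∀ x y l, 𝒳.m (x + y) l = 𝒳.m x l + 𝒳.m y l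
  add_right : ∀ x l a b l',
    𝒳.m x (l ++ (a + b) :: l') = 𝒳.m x (l ++ a :: l') + 𝒳.m x (l ++ b :: l')
  balanced_left : ∀ x h a l, 𝒳.m (𝒳.ε h x) (a :: l) = 𝒳.m x ((𝒜.e h * a) :: l)
  balanced : ∀ x l a h b l',
    𝒳.m x (l ++ (a * 𝒜.e h) :: b :: l') = 𝒳.m x (l ++ a :: (𝒜.e h * b) :: l')
  linear_one : ∀ x h, 𝒳.m (𝒳.ε h x) [] = 𝒳.ε h (𝒳.m x [])
  linear : ∀ x l a h, 𝒳.m x (l ++ [a * 𝒜.e h]) = 𝒳.ε h (𝒳.m x (l ++ [a]))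
  /- `m_i` has bidegree `(0, 2 - i)` -/
  degree : ∀ (x : 𝒳.X) (p : ℚ × ℤ) (l : List (𝒜.A × (ℚ × ℤ))), x ∈ 𝒳.gr p →
    (∀ y ∈ l, y.1 ∈ 𝒜.gr y.2) →
    𝒳.m x (l.map Prod.fst) ∈ 𝒳.gr (p + (l.map Prod.snd).sum + (0, 1 - (l.length : ℤ)))
  /- the `𝒜_∞` relation with `n = l.length + 1` inputs; in the first sum `j = t + 1` and
  `i = l.length - t + 1` -/
  relation : ∀ (x : 𝒳.X) (l : List (𝒜.A × (ℚ × ℤ))), (∀ y ∈ l, y.1 ∈ 𝒜.gr y.2) →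
    (∑ t ∈ Finset.range (l.length + 1),
      (((((t : ℤ) + 1) * (((l.length : ℤ) - t + 1) + 1)
          + ((t : ℤ) + 1) * ((l.drop t).map fun y => y.2.2).sum).negOnePow : ℤˣ) : ℤ) •
        𝒳.m (𝒳.m x ((l.take t).map Prod.fst)) ((l.drop t).map Prod.fst))
    + (∑ k ∈ Finset.range l.length,
        (((((l.length : ℤ) + 2) + ((l.drop (k + 1)).map fun y => y.2.2).sum).negOnePow : ℤˣ) : ℤ) •
        𝒳.m x ((l.take k).map Prod.fst
          ++ 𝒜.d ((l.map Prod.fst).getD k 0) :: (l.drop (k + 1)).map Prod.fst))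
    + (∑ k ∈ Finset.range (l.length - 1),
        ((((k : ℤ) + 1).negOnePow : ℤˣ) : ℤ) •
        𝒳.m x ((l.take k).map Prod.fst
          ++ ((l.map Prod.fst).getD k 0 * (l.map Prod.fst).getD (k + 1) 0)
            :: (l.drop (k + 2)).map Prod.fst)) = 0
  unital : ∀ x, 𝒳.m x [1] = x
  unital_higher : ∀ x l, 1 < l.length → (1 : 𝒜.A) ∈ l → 𝒳.m x l = 0

/-- A differential module regarded as a Type A structure with `m_i = 0` for `i > 2`. -/
def RightModData.toTypeA {𝒜 : DGData ι} (ℳ : RightModData.{u} 𝒜) : TypeAData.{u} 𝒜 where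
  X := ℳ.X
  gr := ℳ.gr
  ε h := ℳ.act.flip (𝒜.e h)
  m x l := match l with
    | [] => ℳ.d x
    | [a] => ℳ.act x a
    | _ => 0

/-- The data of a left Type D structure. Here `ε h` is the left action of `e_h`; the group
`A ⊗_R X` is identified with the subgroup `balancedTensor` of `A ⊗_ℤ X`. -/
structure TypeDData (𝒜 : DGData ι) where
  X : Type u
  [group : AddCommGroup X]
  gr : ℚ × ℤ → Submodule ℤ X
  ε : ι → X →ₗ[ℤ] X
  δ : X →ₗ[ℤ] 𝒜.A ⊗[ℤ] X

attribute [instance] TypeDData.group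

/-- `A ⊗_R X = ⨁_h A e_h ⊗_ℤ e_h X`, as a subgroup of `A ⊗_ℤ X`. -/
def balancedTensor (𝒜 : DGData ι) {X : Type u} [AddCommGroup X] (ε : ι → X →ₗ[ℤ] X) :
    Submodule ℤ (𝒜.A ⊗[ℤ] X) :=
  Submodule.span ℤ {t | ∃ h a x, t = (a * 𝒜.e h) ⊗ₜ[ℤ] ε h x}

open Classical in
/-- The axioms of a Type D structure. -/
structure IsTypeD {𝒜 : DGData ι} (𝒟 : TypeDData.{u} 𝒜) : Prop where
  internal : DirectSum.IsInternal 𝒟.gr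
  /-- `X` is a finite direct sum of modules `R e_h` with shifted bigrading -/
  free : ∃ (T : Type) (_ : Fintype T) (y : Module.Basis T ℤ 𝒟.X) (s : T → ι) (p : T → ℚ × ℤ),
    ∀ t, y t ∈ 𝒟.gr (p t) ∧ ∀ h, 𝒟.ε h (y t) = if h = s t then y t else 0
  δ_mem : ∀ x, 𝒟.δ x ∈ balancedTensor 𝒜 𝒟.ε
  δ_linear : ∀ h x,
    𝒟.δ (𝒟.ε h x) = TensorProduct.map (LinearMap.mulLeft ℤ (𝒜.e h)) LinearMap.id (𝒟.δ x)
  δ_degree : ∀ p x, x ∈ 𝒟.gr p → 𝒟.δ x ∈ tensorGr 𝒜.gr 𝒟.gr (p + (0, 1))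
  /-- `(μ₁ ⊗ |id|) ∘ δ + (μ₂ ⊗ id) ∘ (id ⊗ δ) ∘ δ = 0` -/
  relation : ∀ x, TensorProduct.map 𝒜.d (sgn 𝒟.gr) (𝒟.δ x)
    + TensorProduct.map (LinearMap.mul' ℤ 𝒜.A) LinearMap.id
        ((TensorProduct.assoc ℤ 𝒜.A 𝒜.A 𝒟.X).symm
          (TensorProduct.map LinearMap.id 𝒟.δ (𝒟.δ x))) = 0

/-- The product `(a ⊗ a') ⋆ (b ⊗ b') = (-1)^{(deg_h b)(deg_h a')} a b ⊗ a' b'`; in terms of the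
opposite algebra in the second factor this is `(μ₂ ⊗ μ₂) ∘ σ` applied to
`a ⊗ b ⊗ (b')^op ⊗ (a')^op`. -/
def starProd (𝒜 𝒜' : DGData ι) :
    (𝒜.A ⊗[ℤ] 𝒜'.A) →ₗ[ℤ] (𝒜.A ⊗[ℤ] 𝒜'.A) →ₗ[ℤ] (𝒜.A ⊗[ℤ] 𝒜'.A) :=
  TensorProduct.map₂ (LinearMap.mul ℤ 𝒜.A) ((LinearMap.mul ℤ 𝒜'.A).comp (evenPart 𝒜'.gr))
  + TensorProduct.map₂ ((LinearMap.mul ℤ 𝒜.A).compl₂ (sgn 𝒜.gr))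
      ((LinearMap.mul ℤ 𝒜'.A).comp (oddPart 𝒜'.gr))

/-- The axioms of a rank-one Type DD bimodule `R → A ⊗_R (A')^op` over `A` and `A'`, where `δ h` is
the value at `e_h`. The underlying group of `(A')^op` is `A'`, and the left (right) action of
`e_h` on it is right (left) multiplication by `e_h` in `A'`. -/
structure IsRankOneDD (𝒜 𝒜' : DGData ι) (δ : ι → 𝒜.A ⊗[ℤ] 𝒜'.A) : Prop where
  mem : ∀ h, δ h ∈ Submodule.span ℤ
    {t | ∃ k a a', t = (𝒜.e h * a * 𝒜.e k) ⊗ₜ[ℤ] (𝒜'.e h * a' * 𝒜'.e k)}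
  degree : ∀ h, δ h ∈ tensorGr 𝒜.gr 𝒜'.gr (0, 1)
  relation : ∀ h, TensorProduct.map 𝒜.d (sgn 𝒜'.gr) (δ h)
    + TensorProduct.map LinearMap.id 𝒜'.d (δ h)
    + starProd 𝒜 𝒜' (δ h) (∑ k, δ k) = 0

/-- `ξ(x ⊗ a') = (-1)^{(deg_h x)(deg_h a')} a' ⊗ x`. -/
def xiMap (𝒜' : DGData ι) {X : Type u} [AddCommGroup X] (gr : ℚ × ℤ → Submodule ℤ X) :
    (X ⊗[ℤ] 𝒜'.A) →ₗ[ℤ] (𝒜'.A ⊗[ℤ] X) :=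
  (TensorProduct.comm ℤ X 𝒜'.A).toLinearMap ∘ₗ
    (TensorProduct.map LinearMap.id (evenPart 𝒜'.gr) + TensorProduct.map (sgn gr) (oddPart 𝒜'.gr))

/-- The operation `δ^⊠ = m₁ + ξ ∘ (m₂ ⊗ id) ∘ (id ⊗ δ)` of a box tensor product, where `m₁(x)` stands
for `1 ⊗ m₁(x) = ∑_h e_h ⊗ e_h m₁(x)`, and `(m₂ ⊗ id) ∘ (id ⊗ δ)` sends `x` to
`∑_h m₂(x, δ(e_h))`. -/
def boxMap {𝒜 : DGData ι} (ℳ : RightModData.{u} 𝒜) (𝒜' : DGData ι)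
    (δ : ι → 𝒜.A ⊗[ℤ] 𝒜'.A) : ℳ.X →ₗ[ℤ] 𝒜'.A ⊗[ℤ] ℳ.X :=
  (∑ h, TensorProduct.mk ℤ 𝒜'.A ℳ.X (𝒜'.e h) ∘ₗ ℳ.act.flip (𝒜.e h) ∘ₗ ℳ.d :
    ℳ.X →ₗ[ℤ] 𝒜'.A ⊗[ℤ] ℳ.X)
  + (xiMap 𝒜' ℳ.gr ∘ₗ ((LinearMap.rTensorHom 𝒜'.A ∘ₗ ℳ.act).flip (∑ h, δ h)) :
    ℳ.X →ₗ[ℤ] 𝒜'.A ⊗[ℤ] ℳ.X)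

/-- The box tensor product of a differential right `A`-module with a rank-one DD bimodule over `A`
and `A'`: the right action of `R` is viewed as a left action. -/
def boxDD {𝒜 : DGData ι} (ℳ : RightModData.{u} 𝒜) (𝒜' : DGData ι)
    (δ : ι → 𝒜.A ⊗[ℤ] 𝒜'.A) : TypeDData.{u} 𝒜' where
  X := ℳ.X
  gr := ℳ.gr
  ε h := ℳ.act.flip (𝒜.e h)
  δ := boxMap ℳ 𝒜' δ

end Algebra

/-! ## Khovanov's arc algebra -/

section Arc

/-- A crossingless matching of the points `0, …, 2n - 1`. -/
@[ext] structure Matching (n : ℕ) where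
  f : Fin (2 * n) → Fin (2 * n)
  invol : ∀ p, f (f p) = p
  ne : ∀ p, f p ≠ p
  noncrossing : ∀ p q, ¬ (p < q ∧ q < f p ∧ f p < f q)

variable {n : ℕ}

/-- `p` and `q` lie on the same circle of `W(a)b`. -/
def SameCircle (a b : Matching n) : Fin (2 * n) → Fin (2 * n) → Prop :=
  Relation.EqvGen fun p q => q = a.f p ∨ q = b.f p

/-- `p` and `q` lie in the same component of the minimal cobordism from `W(a)b ⊔ W(b)c` to
`W(a)c` (one saddle for each arc of `b`). -/
def SameComp (a b c : Matching n) : Fin (2 * n) → Fin (2 * n) → Prop :=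
  Relation.EqvGen fun p q => q = a.f p ∨ q = b.f p ∨ q = c.f p

open Classical in
/-- The circles of `W(a)b`, each represented by its set of points on the line. -/
def circles (a b : Matching n) : Finset (Finset (Fin (2 * n))) :=
  Finset.univ.image fun p => Finset.univ.filter fun q => SameCircle a b p q

open Classical in
/-- The components of the minimal cobordism, each represented by its set of points. -/
def comps (a b c : Matching n) : Finset (Finset (Fin (2 * n))) :=
  Finset.univ.image fun p => Finset.univ.filter fun q => SameComp a b c p q

/-- The additive basis `β` of `H^n`: elements `(W(a)b, σ)`, where `σ` labels the circles of `W(a)b`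
by signs. The labelling is recorded as a function on points which is constant on circles;
`neg p = true` means that the circle through `p` is labelled `-`. -/
@[ext] structure ArcBasis (n : ℕ) where
  a : Matching n
  b : Matching n
  neg : Fin (2 * n) → Bool
  neg_left : ∀ p, neg (a.f p) = neg p
  neg_right : ∀ p, neg (b.f p) = neg p

instance : Finite (Matching n) :=
  Finite.of_injective Matching.f fun _ _ h => Matching.ext h

instance : Finite (ArcBasis n) :=
  Finite.of_injective (fun h : ArcBasis n => (h.a, h.b, h.neg)) fun x y h => by
    simp only [Prod.mk.injEq] at h
    exact ArcBasis.ext h.1 h.2.1 h.2.2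

instance : Fintype (Matching n) := Fintype.ofFinite _

instance : Fintype (ArcBasis n) := Fintype.ofFinite _

instance : DecidableEq (Matching n) := Classical.decEq _

instance : DecidableEq (ArcBasis n) := Classical.decEq _

/-- The idempotent `1_a = (W(a)a, all +)`. -/
def idemBasis (a : Matching n) : ArcBasis n := ⟨a, a, fun _ => false, fun _ => rfl, fun _ => rfl⟩

/-- Reflection of `(W(a)b, σ)` across the line. -/
def ArcBasis.mirror (h : ArcBasis n) : ArcBasis n := ⟨h.b, h.a, h.neg, h.neg_right, h.neg_left⟩

theorem ArcBasis.mirror_mirror (h : ArcBasis n) : h.mirror.mirror = h := rfl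

/-- The circles labelled `-` (when `s = true`) or `+` (when `s = false`). -/
def ArcBasis.signed (h : ArcBasis n) (s : Bool) : Finset (Finset (Fin (2 * n))) :=
  (circles h.a h.b).filter fun C => ∀ p ∈ C, h.neg p = s

/-- The intrinsic degree in `H^n`: `n` minus the number of circles, plus twice the number of
circles labelled `-`. -/
def ArcBasis.deg (h : ArcBasis n) : ℤ :=
  (n : ℤ) - (circles h.a h.b).card + 2 * (h.signed true).card

/-- The genus of the component `K` of the minimal cobordism: its Euler characteristic
`2 - 2g - #(boundary circles)` is minus the number of its saddles, i.e. of arcs of `b` in `K`. -/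
def genus (a b c : Matching n) (K : Finset (Fin (2 * n))) : ℕ :=
  (K.card / 2 + 2 - (((circles a b).filter (· ⊆ K)).card + ((circles b c).filter (· ⊆ K)).card
    + ((circles a c).filter (· ⊆ K)).card)) / 2

/-- The coefficient of `h₃` in the product `h₁ h₂`: the matrix entry, for the minimal cobordism, of
the two-dimensional TQFT of `ℤ[X]/X²` (with `+ = 1`, `- = X`, `Δ 1 = 1 ⊗ X + X ⊗ 1`,
`Δ X = X ⊗ X`). A component of genus `g` multiplies its inputs, multiplies the result by
`(2X)^g`, and comultiplies to the outputs, so its matrix entry is `2^g` if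
(number of inputs `-`) `+ g +` (number of outputs `+`) is `1`, and `0` otherwise. -/
def mulCoeff (h₁ h₂ h₃ : ArcBasis n) : ℤ :=
  if h₁.b = h₂.a ∧ h₃.a = h₁.a ∧ h₃.b = h₂.b then
    ∏ K ∈ comps h₁.a h₁.b h₂.b,
      if ((h₁.signed true).filter (· ⊆ K)).card + ((h₂.signed true).filter (· ⊆ K)).card
          + genus h₁.a h₁.b h₂.b K + ((h₃.signed false).filter (· ⊆ K)).card = 1
      then 2 ^ genus h₁.a h₁.b h₂.b K else 0
  else 0

/-- The underlying group of Khovanov's arc algebra `H^n`, free on `β`. -/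
abbrev ArcAlg (n : ℕ) : Type := ArcBasis n → ℤ

/-- The basis element of `H^n` given by `h ∈ β`. -/
def bas (h : ArcBasis n) : ArcAlg n := Pi.single h 1

/-- The multiplication of `H^n`. -/
def arcMul (u v : ArcAlg n) : ArcAlg n :=
  fun h₃ => ∑ h₁, ∑ h₂, u h₁ * v h₂ * mulCoeff h₁ h₂ h₃

/-- The unit of `H^n`. -/
def arcOne : ArcAlg n := ∑ a, bas (idemBasis a)

/-- `a'` is obtained from `a` by surgery on a bridge: two arcs `{p, a p}`, `{q, a q}` are replaced
by `{p, q}`, `{a p, a q}`. -/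
def Surgery (a a' : Matching n) : Prop :=
  ∃ p q, q ≠ p ∧ q ≠ a.f p ∧ a'.f p = q ∧ a'.f (a.f p) = a.f q ∧
    ∀ r, r ≠ p → r ≠ q → r ≠ a.f p → r ≠ a.f q → a'.f r = a.f r

/-- The multiplicative generators `β_mult`: the elements `h_γ = (W(a)a', all +)` for `a'` obtained
from `a` by surgery on a bridge `γ`, and `h_α = (W(a)a, - exactly on the circle W(α)α)` for an
arc `α = {p, a p}` of `a`. -/
def IsMultGen (g : ArcBasis n) : Prop :=
  (Surgery g.a g.b ∧ ∀ p, g.neg p = false) ∨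
  (g.a = g.b ∧ ∃ p, ∀ q, g.neg q = true ↔ q = p ∨ q = g.a.f p)

/-! ### Mirror symmetry of the arc algebra -/

theorem sameCircle_comm (a b : Matching n) : SameCircle a b = SameCircle b a := by
  unfold SameCircle
  congr 1
  funext p q
  exact propext or_comm

theorem circles_comm (a b : Matching n) : circles a b = circles b a := by
  unfold circles
  rw [sameCircle_comm]

theorem comps_comm (a b c : Matching n) : comps a b c = comps c b a := by
  have : SameComp a b c = SameComp c b a := by
    unfold SameComp
    congr 1
    funext p q
    exact propext ⟨fun h => by tauto, fun h => by tauto⟩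
  unfold comps
  rw [this]

theorem ArcBasis.signed_mirror (h : ArcBasis n) (s : Bool) : h.mirror.signed s = h.signed s := by
  unfold ArcBasis.signed ArcBasis.mirror
  simp only
  rw [circles_comm]

theorem ArcBasis.deg_mirror (h : ArcBasis n) : h.mirror.deg = h.deg := by
  unfold ArcBasis.deg
  rw [ArcBasis.signed_mirror]
  unfold ArcBasis.mirror
  simp only
  rw [circles_comm]

theorem genus_comm (a b c : Matching n) (K : Finset (Fin (2 * n))) :
    genus a b c K = genus c b a K := by
  unfold genus
  rw [circles_comm a b, circles_comm b c, circles_comm a c]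
  congr 2
  omega

theorem mulCoeff_mirror (h₁ h₂ h₃ : ArcBasis n) :
    mulCoeff h₂.mirror h₁.mirror h₃.mirror = mulCoeff h₁ h₂ h₃ := by
  unfold mulCoeff
  simp only [ArcBasis.signed_mirror]
  by_cases hc : h₁.b = h₂.a ∧ h₃.a = h₁.a ∧ h₃.b = h₂.b
  · have hc' : h₂.mirror.b = h₁.mirror.a ∧ h₃.mirror.a = h₂.mirror.a ∧
        h₃.mirror.b = h₁.mirror.b := ⟨hc.1.symm, hc.2.2, hc.2.1⟩
    rw [if_pos hc, if_pos hc']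
    have e1 : h₂.mirror.a = h₂.b := rfl
    have e2 : h₂.mirror.b = h₁.b := hc.1.symm
    have e3 : h₁.mirror.b = h₁.a := rfl
    rw [e1, e2, e3, comps_comm]
    refine Finset.prod_congr rfl fun K _ => ?_
    rw [genus_comm h₂.b h₁.b h₁.a, add_comm ((h₂.signed true).filter (· ⊆ K)).card]
  · have hc' : ¬ (h₂.mirror.b = h₁.mirror.a ∧ h₃.mirror.a = h₂.mirror.a ∧
        h₃.mirror.b = h₁.mirror.b) := fun h => hc ⟨h.1.symm, h.2.2, h.2.1⟩
    rw [if_neg hc, if_neg hc']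

/-- The anti-automorphism of `H^n` given by reflection across the line. -/
def mirrorAlg : ArcAlg n →ₗ[ℤ] ArcAlg n := LinearMap.funLeft ℤ ℤ ArcBasis.mirror

/-- Reflection as a bijection of `β`. -/
def mirrorEquiv : ArcBasis n ≃ ArcBasis n :=
  ⟨ArcBasis.mirror, ArcBasis.mirror, ArcBasis.mirror_mirror, ArcBasis.mirror_mirror⟩

theorem mirrorAlg_bas (h : ArcBasis n) : mirrorAlg (bas h) = bas h.mirror := by
  funext k
  have hiff : k.mirror = h ↔ k = h.mirror :=
    ⟨fun e => by rw [← e]; rfl, fun e => by rw [e]; rfl⟩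
  simp only [mirrorAlg, LinearMap.funLeft_apply, bas, Pi.single_apply, hiff]

theorem mirrorAlg_one : mirrorAlg (arcOne : ArcAlg n) = arcOne := by
  unfold arcOne
  rw [map_sum]
  exact Finset.sum_congr rfl fun a _ => mirrorAlg_bas _

theorem mirrorAlg_mul (u v : ArcAlg n) :
    mirrorAlg (arcMul u v) = arcMul (mirrorAlg v) (mirrorAlg u) := by
  funext h₃
  simp only [mirrorAlg, LinearMap.funLeft_apply, arcMul]
  rw [Finset.sum_comm]
  refine Fintype.sum_equiv mirrorEquiv _ _ fun h₂ => ?_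
  refine Fintype.sum_equiv mirrorEquiv _ _ fun h₁ => ?_
  have e1 : (mirrorEquiv h₂).mirror = h₂ := rfl
  have e2 : (mirrorEquiv h₁).mirror = h₁ := rfl
  rw [e1, e2, ← mulCoeff_mirror h₁ h₂ h₃.mirror]
  change _ = v h₂ * u h₁ * mulCoeff h₂.mirror h₁.mirror h₃
  rw [ArcBasis.mirror_mirror]
  ring

end Arc

/-! ## The algebras `B`, `m(B)^!` and `B ⊙ m(B)^!` -/

section BomB

variable (n : ℕ)

/-- The pairs `(h₁, h₂)` such that `h₂` occurs in the expansion of `h₁ g` for some `g ∈ β_mult`. -/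
def RightEdge {n : ℕ} (h₁ h₂ : ArcBasis n) : Prop := ∃ g, IsMultGen g ∧ mulCoeff h₁ g h₂ ≠ 0

/-- The multiplicative generators `e(h₁, h₂)` of `B = B_R(H^n)`, with left idempotent `src = h₁` and
right idempotent `tgt = h₂`. This is a basis of `V = V_B`, and of `V^*` through the dual basis. -/
@[ext] structure Edge where
  src : ArcBasis n
  tgt : ArcBasis n
  edge : RightEdge src tgt

instance : Finite (Edge n) :=
  Finite.of_injective (fun e : Edge n => (e.src, e.tgt)) fun x y h => by
    simp only [Prod.mk.injEq] at h
    exact Edge.ext h.1 h.2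

instance : Fintype (Edge n) := Fintype.ofFinite _

instance : DecidableEq (Edge n) := Classical.decEq _

/-- Composable pairs of generators: a basis of `V ⊗_R V`, and of `V^* ⊗_R V^*`, where `R = I_β`. -/
@[ext] structure EdgePair where
  fst : Edge n
  snd : Edge n
  comp : fst.tgt = snd.src

instance : Finite (EdgePair n) :=
  Finite.of_injective (fun e : EdgePair n => (e.fst, e.snd)) fun x y h => by
    simp only [Prod.mk.injEq] at h
    exact EdgePair.ext h.1 h.2

instance : Fintype (EdgePair n) := Fintype.ofFinite _

variable {n}

/-- The homomorphism `e(h₁, h₂)` of `H^n` which sends `h₁` to `h₂` and all other elements of `β` to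
zero, as a matrix unit. Homomorphisms act on the right, so that
`e(h₁, h₂) e(h₂, h₃) = e(h₁, h₃)` has left idempotent `h₁` and right idempotent `h₃`. -/
def Edge.hom (e : Edge n) : Matrix (ArcBasis n) (ArcBasis n) ℤ := Matrix.single e.src e.tgt 1

/-- `v + r ∈ V ⊕ (V ⊗_R V)` lies in `J₂ = J ∩ (V ⊕ (V ⊗_R V))`, where `J` is the kernel of the map
from `T(V)` onto the subalgebra `B ⊆ Hom(H^n, H^n)`. -/
def MemJTwo (v : Edge n → ℤ) (r : EdgePair n → ℤ) : Prop :=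
  ∑ e, v e • e.hom + ∑ p, r p • (p.fst.hom * p.snd.hom) = 0

/-- The image `I` of `J₂` in `V ⊗_R V`. -/
def MemI (r : EdgePair n → ℤ) : Prop := ∃ v, MemJTwo v r

/-- The pairing of `V^* ⊗_R V^*` with `V ⊗_R V`. -/
def pairing (ψ r : EdgePair n → ℤ) : ℤ := ∑ p, ψ p * r p

/-- The annihilator `I^⊥ ⊆ V^* ⊗_R V^*` of `I`. -/
def MemIPerp (ψ : EdgePair n → ℤ) : Prop := ∀ r, MemI r → pairing ψ r = 0

open Classical in
/-- An element of `V^* ⊗_R V^*` representing `φ^*(e^*) ∈ I^* = (V^* ⊗_R V^*) / I^⊥`, where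
`φ : I → V` is characterized by `φ(r) + r ∈ J₂`; see `pairing_phiStar`. -/
def phiStar (e : Edge n) : EdgePair n → ℤ :=
  fun p => if p.fst.src = e.src ∧ p.snd.tgt = e.tgt then -1 else 0

theorem MemJTwo.coeff {v : Edge n → ℤ} {r : EdgePair n → ℤ} (h : MemJTwo v r) (e : Edge n) :
    v e = pairing (phiStar e) r := by
  classical
  have h1 := congrFun (congrFun h e.src) e.tgt
  have key : ∀ p : EdgePair n, (p.fst.hom * p.snd.hom) = Matrix.single p.fst.src p.snd.tgt 1 := by
    intro p
    unfold Edge.hom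
    rw [p.comp, Matrix.single_mul_single_same]
    simp
  simp only [key] at h1
  simp only [Edge.hom, Matrix.add_apply, Matrix.sum_apply, Matrix.smul_apply, Matrix.single_apply,
    Matrix.zero_apply, smul_eq_mul, mul_ite, mul_one, mul_zero] at h1
  have h2 : (∑ x : Edge n, if x.src = e.src ∧ x.tgt = e.tgt then v x else 0) = v e := by
    rw [Finset.sum_eq_single e]
    · simp
    · intro b _ hb
      rw [if_neg]
      exact fun hh => hb (Edge.ext hh.1 hh.2)
    · simp
  rw [h2] at h1
  have h3 : pairing (phiStar e) r
      = - ∑ p : EdgePair n, if p.fst.src = e.src ∧ p.snd.tgt = e.tgt then r p else 0 := by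
    unfold pairing phiStar
    rw [← Finset.sum_neg_distrib]
    refine Finset.sum_congr rfl fun p _ => ?_
    split_ifs <;> simp
  rw [h3]
  linarith

/-- `φ` is well defined: `J₂ ∩ V = 0`. -/
theorem MemJTwo.unique {v v' : Edge n → ℤ} {r : EdgePair n → ℤ} (h : MemJTwo v r)
    (h' : MemJTwo v' r) : v = v' := by
  funext e
  rw [h.coeff e, h'.coeff e]

/-- The map `φ : I → V`, extended by zero outside `I`. -/
def phi (r : EdgePair n → ℤ) : Edge n → ℤ :=
  open Classical in if h : MemI r then h.choose else 0

/-- On `I`, the functional `phiStar e` is `e^* ∘ φ`. -/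
theorem pairing_phiStar (e : Edge n) (r : EdgePair n → ℤ) (h : MemI r) :
    pairing (phiStar e) r = phi r e := by
  unfold phi
  rw [dif_pos h]
  exact (h.choose_spec.coeff e).symm

/-- The generators of `B ⊙ m(B)^!` as a ring: the elementary idempotents `h ∈ β`, the generators
`e = e(h₁, h₂)` of `B`, and the generators `m(e^*)` of `m(B)^!`. -/
inductive Letter (n : ℕ) : Type
  | idem (h : ArcBasis n)
  | right (e : Edge n)
  | left (e : Edge n)

/-- The free ring on the letters, of which `T(V_full)` is a quotient. -/
abbrev FreeAlg (n : ℕ) : Type := FreeAlgebra ℤ (Letter n)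

/-- The elementary idempotent given by `h ∈ β`. -/
def idemF (h : ArcBasis n) : FreeAlg n := FreeAlgebra.ι ℤ (Letter.idem h)

/-- The generator `e` of `B`, with left idempotent `e.src` and right idempotent `e.tgt`. -/
def rightF (e : Edge n) : FreeAlg n := FreeAlgebra.ι ℤ (Letter.right e)

/-- The generator `m(e^*)` of `m(B)^!`, with left idempotent `m(e.src)` and right idempotent
`m(e.tgt)`. -/
def leftF (e : Edge n) : FreeAlg n := FreeAlgebra.ι ℤ (Letter.left e)

/-- The points at which the labels of `h` and `k` differ. -/
def flipped (h k : ArcBasis n) : Finset (Fin (2 * n)) :=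
  Finset.univ.filter fun p => h.neg p ≠ k.neg p

/-- `h ⟶ k` supports a bridge generator `b_{γ;h,k}` of `B`. -/
def Edge.IsBridge (e : Edge n) : Prop := e.src.b ≠ e.tgt.b

/-- `e = b_{C;h,k}` is a decoration generator of `B`; `C` is the circle `flipped h k`. -/
def Edge.IsDec (e : Edge n) : Prop := e.src.b = e.tgt.b

/-- The generator `e` of `B` goes from `h` to `k`. -/
def Edge.From (e : Edge n) (h k : ArcBasis n) : Prop := e.src = h ∧ e.tgt = k

/-- The generator `m(e^*)` of `m(B)^!` goes from `h` to `k`, so that `m(e^*) = m(b^*_{*;m(h),m(k)})`. -/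
def Edge.MirrorFrom (e : Edge n) (h k : ArcBasis n) : Prop :=
  e.src = h.mirror ∧ e.tgt = k.mirror

/-- The defining relations of `B ⊙ m(B)^! = T(V_full) / J_full`. In the relations of `J_extra`,
the edges `r, r', …` give generators of `B` and the edges `l, l', …` give generators `m(l^*)` of
`m(B)^!`. -/
inductive Rel (n : ℕ) : FreeAlg n → FreeAlg n → Prop
  /- the relations of the tensor algebra `T(V_full)` over `I_β` -/
  | idem_mul (h) : Rel n (idemF h * idemF h) (idemF h)
  | idem_orth (h k) : h ≠ k → Rel n (idemF h * idemF k) 0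
  | idem_sum : Rel n (∑ h, idemF h) 1
  | right_src (e) : Rel n (idemF e.src * rightF e) (rightF e)
  | right_tgt (e) : Rel n (rightF e * idemF e.tgt) (rightF e)
  | left_src (e) : Rel n (idemF e.src.mirror * leftF e) (leftF e)
  | left_tgt (e) : Rel n (leftF e * idemF e.tgt.mirror) (leftF e)
  /- the linear-quadratic relations of `B` -/
  | relB (v r) : MemJTwo v r →
      Rel n (∑ e, v e • rightF e + ∑ p, r p • (rightF p.fst * rightF p.snd)) 0
  /- the relations `m(I^⊥)` of `m(B)^!` -/
  | relDual (ψ) : MemIPerp ψ → Rel n (∑ p, ψ p • (leftF p.fst * leftF p.snd)) 0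
  /- two bridges -/
  | extra₁ (h₁ h₂ h₂' h₃) (r l l' r' : Edge n) :
      r.From h₁ h₂ → l.MirrorFrom h₂ h₃ → l'.MirrorFrom h₁ h₂' → r'.From h₂' h₃ →
      r.IsBridge → l.IsBridge → l'.IsBridge → r'.IsBridge →
      Rel n (rightF r * leftF l) (leftF l' * rightF r')
  /- a decoration of `B` and a bridge of `m(B)^!` -/
  | extra₂ (h₁ h₂ h₂' h₃) (r l l' r' : Edge n) :
      r.From h₁ h₂ → l.MirrorFrom h₂ h₃ → l'.MirrorFrom h₁ h₂' → r'.From h₂' h₃ →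
      r.IsDec → l.IsBridge → l'.IsBridge → r'.IsDec →
      Rel n (rightF r * leftF l) (leftF l' * rightF r')
  /- a bridge `γ` of `B` and a decoration of `m(B)^!` on a circle `C` disjoint from the support of
  `γ` -/
  | extra₃ (h₁ h₂ h₂' h₃) (r l l' r' : Edge n) :
      r.From h₁ h₂ → l.MirrorFrom h₂ h₃ → l'.MirrorFrom h₁ h₂' → r'.From h₂' h₃ →
      r.IsBridge → l.IsDec → l'.IsDec → r'.IsBridge →
      flipped h₂ h₃ = flipped h₁ h₂' → (∀ p ∈ flipped h₂ h₃, h₁.b.f p = h₂.b.f p) →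
      Rel n (rightF r * leftF l) (leftF l' * rightF r')
  /- decorations on two different circles -/
  | extra₄ (h₁ h₂ h₂' h₃) (r l l' r' : Edge n) :
      r.From h₁ h₂ → l.MirrorFrom h₂ h₃ → l'.MirrorFrom h₁ h₂' → r'.From h₂' h₃ →
      r.IsDec → l.IsDec → l'.IsDec → r'.IsDec →
      flipped h₂ h₃ = flipped h₁ h₂' → flipped h₁ h₂ = flipped h₂' h₃ →
      Rel n (rightF r * leftF l) (leftF l' * rightF r')
  /- a bridge of `B` joining the circles `C'` and `C''` to the circle `C` -/
  | extra₅_join (h₁ h₂ h₂' h₂'' h₃) (r l l' r' l'' r'' : Edge n) :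
      r.From h₁ h₂ → l.MirrorFrom h₂ h₃ → l'.MirrorFrom h₁ h₂' → r'.From h₂' h₃ →
      l''.MirrorFrom h₁ h₂'' → r''.From h₂'' h₃ →
      r.IsBridge → l.IsDec → l'.IsDec → r'.IsBridge → l''.IsDec → r''.IsBridge →
      Disjoint (flipped h₁ h₂') (flipped h₁ h₂'') →
      flipped h₂ h₃ = flipped h₁ h₂' ∪ flipped h₁ h₂'' →
      Rel n (rightF r * leftF l) (leftF l' * rightF r' + leftF l'' * rightF r'')
  /- a bridge of `B` splitting the circle `C` into the circles `C'` and `C''` -/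
  | extra₅_split (h₁ h₂ h₂' h₂'' h₃) (r l r' l' r'' l'' : Edge n) :
      l.MirrorFrom h₁ h₂ → r.From h₂ h₃ → r'.From h₁ h₂' → l'.MirrorFrom h₂' h₃ →
      r''.From h₁ h₂'' → l''.MirrorFrom h₂'' h₃ →
      r.IsBridge → l.IsDec → l'.IsDec → r'.IsBridge → l''.IsDec → r''.IsBridge →
      Disjoint (flipped h₂' h₃) (flipped h₂'' h₃) →
      flipped h₁ h₂ = flipped h₂' h₃ ∪ flipped h₂'' h₃ →
      Rel n (rightF r' * leftF l' + rightF r'' * leftF l'') (leftF l * rightF r)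

/-- The underlying ring of `B ⊙ m(B)^!`. -/
def FullAlg (n : ℕ) : Type := RingQuot (Rel n)

instance : Ring (FullAlg n) := inferInstanceAs (Ring (RingQuot (Rel n)))

/-- The quotient map. -/
def toFull (n : ℕ) : FreeAlg n →+* FullAlg n := RingQuot.mkRingHom (Rel n)

/-- The class of a letter. -/
def letterA (x : Letter n) : FullAlg n := toFull n (FreeAlgebra.ι ℤ x)

/-- The elementary idempotent of `B ⊙ m(B)^!` given by `h ∈ β`. -/
def idemA (h : ArcBasis n) : FullAlg n := letterA (Letter.idem h)

/-- The generator `e` of `B`, as an element of `B ⊙ m(B)^!`. -/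
def rightA (e : Edge n) : FullAlg n := letterA (Letter.right e)

/-- The generator `m(e^*)` of `m(B)^!`, as an element of `B ⊙ m(B)^!`. -/
def leftA (e : Edge n) : FullAlg n := letterA (Letter.left e)

/-- The bidegree of a generator: `e(h₁, h₂)` has intrinsic degree `(deg h₁ - deg h₂)/2` and
homological degree `0`; its dual generator has the opposite intrinsic degree and homological
degree `1`. -/
def Letter.deg : Letter n → ℚ × ℤ
  | .idem _ => 0
  | .right e => (((e.src.deg : ℚ) - e.tgt.deg) / 2, 0)
  | .left e => (-(((e.src.deg : ℚ) - e.tgt.deg) / 2), 1)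

/-- The part of `B ⊙ m(B)^!` of bidegree `p`: the span of the words of bidegree `p`. -/
def fullGr (n : ℕ) (p : ℚ × ℤ) : Submodule ℤ (FullAlg n) :=
  Submodule.span ℤ {a | ∃ w : List (Letter n), (w.map Letter.deg).sum = p ∧
    a = (w.map letterA).prod}

/-- `d` is the differential of `B ⊙ m(B)^!`: zero on `B`, given on the generators of `m(B)^!` by the
mirror of `φ^*`, and extended by the Leibniz rule. -/
structure IsFullDifferential (d : FullAlg n →ₗ[ℤ] FullAlg n) : Prop where
  idem : ∀ h, d (idemA h) = 0
  right : ∀ e, d (rightA e) = 0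
  left : ∀ e, d (leftA e) = ∑ p, phiStar e p • (leftA p.fst * leftA p.snd)
  leibniz : ∀ a b p, b ∈ fullGr n p → d (a * b) = (p.2.negOnePow : ℤ) • (d a * b) + a * d b

/-- `B ⊙ m(B)^!` with the differential `d`, over the idempotent ring `I_β`. -/
def fullDG (d : FullAlg n →ₗ[ℤ] FullAlg n) : DGData (ArcBasis n) where
  A := FullAlg n
  e := idemA
  gr := fullGr n
  d := d

/-- The mirror of an algebra over `I_β`: the same ring, with mirrored idempotents. -/
def DGData.mirror (𝒜 : DGData (ArcBasis n)) : DGData (ArcBasis n) where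
  A := 𝒜.A
  e h := 𝒜.e h.mirror
  gr := 𝒜.gr
  d := 𝒜.d

/-- The mirror of a Type D structure over an algebra over `I_β`. -/
def TypeDData.mirror {𝒜 : DGData (ArcBasis n)} (𝒟 : TypeDData.{u} 𝒜) :
    TypeDData.{u} 𝒜.mirror where
  X := 𝒟.X
  gr := 𝒟.gr
  ε h := 𝒟.ε h.mirror
  δ := 𝒟.δ

/-- The DD operation `δ₁ + δ₂` of the rank-one DD bimodule over `B ⊙ m(B)^!` and its mirror, at the
idempotent `h`. Here `δ₁(h) = ∑ b ⊗ (b^*)^op` over the generators `b` of `B` with left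
idempotent `h`, and `δ₂(h) = ∑ m(b^*) ⊗ (m(b))^op` over the generators `m(b^*)` of `m(B)^!` with left
idempotent `h`. The ring underlying the mirror is `B ⊙ m(B)^!` itself, so `b^*` and `m(b)` are
given there by `m(b^*)` and `b`. -/
def ddMap (d : FullAlg n →ₗ[ℤ] FullAlg n) (h : ArcBasis n) :
    (fullDG d).A ⊗[ℤ] (fullDG d).mirror.A :=
  (∑ b : Edge n, if b.src = h then (rightA b : FullAlg n) ⊗ₜ[ℤ] (leftA b : FullAlg n) else 0)
  + ∑ b : Edge n, if b.src.mirror = h then (leftA b : FullAlg n) ⊗ₜ[ℤ] (rightA b : FullAlg n)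
      else 0

end BomB

/-! ## Complexes of `H^n`-modules -/

section Complexes

/-- A chain complex of graded right `H^n`-modules, as a differential bigraded module. -/
structure RightComplex (n : ℕ) where
  M : Type u
  [group : AddCommGroup M]
  act : M →ₗ[ℤ] ArcAlg n →ₗ[ℤ] M
  act_one : ∀ x, act x arcOne = x
  act_mul : ∀ x u v, act (act x u) v = act x (arcMul u v)
  gr : ℤ × ℤ → Submodule ℤ M
  internal : DirectSum.IsInternal gr
  act_mem : ∀ j k x h, x ∈ gr (j, k) → act x (bas h) ∈ gr (j + h.deg, k)
  d : M →ₗ[ℤ] M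
  d_mem : ∀ j k x, x ∈ gr (j, k) → d x ∈ gr (j, k + 1)
  d_d : ∀ x, d (d x) = 0
  d_act : ∀ x u, d (act x u) = act (d x) u

attribute [instance] RightComplex.group

/-- A chain complex of graded left `H^n`-modules, as a differential bigraded module. -/
structure LeftComplex (n : ℕ) where
  M : Type u
  [group : AddCommGroup M]
  act : ArcAlg n →ₗ[ℤ] M →ₗ[ℤ] M
  act_one : ∀ x, act arcOne x = x
  act_mul : ∀ x u v, act u (act v x) = act (arcMul u v) x
  gr : ℤ × ℤ → Submodule ℤ M
  internal : DirectSum.IsInternal gr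
  act_mem : ∀ j k x h, x ∈ gr (j, k) → act (bas h) x ∈ gr (j + h.deg, k)
  d : M →ₗ[ℤ] M
  d_mem : ∀ j k x, x ∈ gr (j, k) → d x ∈ gr (j, k + 1)
  d_d : ∀ x, d (d x) = 0
  d_act : ∀ x u, d (act u x) = act u (d x)

attribute [instance] LeftComplex.group

variable {n : ℕ}

/-- A presentation `M = ⨁_{i ∈ S} x_i H^n` of a finitely generated projective complex: the `x_i` are
homogeneous, and `x_i H^n ≅ 1_{e i} H^n` through `x_i ↦ 1_{e i}`, so that the elements `x_i h` with
`h ∈ β` and `e_L(h) = e i` form a `ℤ`-basis of `M`. -/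
structure RightComplex.Generators (M : RightComplex.{u} n) where
  S : Type
  [fintype : Fintype S]
  x : S → M.M
  e : S → Matching n
  deg : S → ℤ × ℤ
  homog : ∀ i, x i ∈ M.gr (deg i)
  act_idem : ∀ i, M.act (x i) (bas (idemBasis (e i))) = x i
  indep : LinearIndependent ℤ
    fun p : {p : S × ArcBasis n // p.2.a = e p.1} => M.act (x p.1.1) (bas p.1.2)
  span : ⊤ ≤ Submodule.span ℤ (Set.range
    fun p : {p : S × ArcBasis n // p.2.a = e p.1} => M.act (x p.1.1) (bas p.1.2))

attribute [instance] RightComplex.Generators.fintype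

/-- The analogous presentation `N = ⨁_{i ∈ S} H^n x_i` of a complex of left modules. -/
structure LeftComplex.Generators (N : LeftComplex.{u} n) where
  S : Type
  [fintype : Fintype S]
  x : S → N.M
  e : S → Matching n
  deg : S → ℤ × ℤ
  homog : ∀ i, x i ∈ N.gr (deg i)
  act_idem : ∀ i, N.act (bas (idemBasis (e i))) (x i) = x i
  indep : LinearIndependent ℤ
    fun p : {p : S × ArcBasis n // p.2.b = e p.1} => N.act (bas p.1.2) (x p.1.1)
  span : ⊤ ≤ Submodule.span ℤ (Set.range
    fun p : {p : S × ArcBasis n // p.2.b = e p.1} => N.act (bas p.1.2) (x p.1.1))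

attribute [instance] LeftComplex.Generators.fintype

/-- The mirror `m(N)` of a complex of left modules: the complex of right modules with the same
underlying bigraded group and differential, on which `H^n` acts by `x · h = m(h) x`. -/
def LeftComplex.mirror (N : LeftComplex.{u} n) : RightComplex.{u} n where
  M := N.M
  act := (N.act.comp mirrorAlg).flip
  act_one x := by
    simp only [LinearMap.flip_apply, LinearMap.comp_apply, mirrorAlg_one, N.act_one]
  act_mul x u v := by
    simp only [LinearMap.flip_apply, LinearMap.comp_apply, mirrorAlg_mul, N.act_mul]
  gr := N.gr
  internal := N.internal
  act_mem j k x h hx := by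
    simp only [LinearMap.flip_apply, LinearMap.comp_apply, mirrorAlg_bas]
    rw [← h.deg_mirror]
    exact N.act_mem j k x h.mirror hx
  d := N.d
  d_mem := N.d_mem
  d_d := N.d_d
  d_act x u := by
    simp only [LinearMap.flip_apply, LinearMap.comp_apply, N.d_act]

/-- The generators `m(x_i)` of `m(N)`. -/
def LeftComplex.Generators.mirror {N : LeftComplex.{u} n} (X : N.Generators) :
    N.mirror.Generators :=
  let t : {p : X.S × ArcBasis n // p.2.a = X.e p.1} ≃ {p : X.S × ArcBasis n // p.2.b = X.e p.1} :=
    ((Equiv.refl X.S).prodCongr mirrorEquiv).subtypeEquiv fun _ => Iff.rfl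
  have ht : (fun p : {p : X.S × ArcBasis n // p.2.a = X.e p.1} =>
        N.mirror.act (X.x p.1.1) (bas p.1.2))
      = (fun p : {p : X.S × ArcBasis n // p.2.b = X.e p.1} => N.act (bas p.1.2) (X.x p.1.1)) ∘ t := by
    funext p
    change N.act (mirrorAlg (bas p.1.2)) (X.x p.1.1) = _
    rw [mirrorAlg_bas]
    rfl
  { S := X.S
    x := X.x
    e := X.e
    deg := X.deg
    homog := X.homog
    act_idem := fun i => by
      change N.act (mirrorAlg (bas (idemBasis (X.e i)))) (X.x i) = _
      rw [mirrorAlg_bas]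
      exact X.act_idem i
    indep := by
      rw [ht]
      exact X.indep.comp t t.injective
    span := by
      rw [ht]
      exact X.span.trans (le_of_eq (congrArg (Submodule.span ℤ) (t.surjective.range_comp _).symm)) }

namespace RightComplex.Generators

variable {M : RightComplex.{u} n} (X : M.Generators)

/-- The element `x_i · h`. -/
def el (i : X.S) (h : ArcBasis n) : M.M := M.act (X.x i) (bas h)

/-- The `ℤ`-basis `{x_i · h : e_L(h) = e i}` of `M`. -/
def basis : Module.Basis {p : X.S × ArcBasis n // p.2.a = X.e p.1} ℤ M.M :=
  Module.Basis.mk X.indep X.span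

/-- The coefficient of `x_j · h` in `d(x_i)`. -/
def coeff (i j : X.S) (h : ArcBasis n) : ℤ :=
  if hh : h.a = X.e j then X.basis.repr (M.d (X.x i)) ⟨(j, h), hh⟩ else 0

/-- The coefficient `c_{i,j}` of `x_j` in `d(x_i)`. -/
def c (i j : X.S) : ℤ := X.coeff i j (idemBasis (X.e j))

/-- The condition `C_module`: only `x_j` and `x_j · h` with `h ∈ β_mult` occur in `d(x_i)`. -/
def CModule : Prop := ∀ i j h, h.deg ≠ 0 → ¬ IsMultGen h → X.coeff i j h = 0

/-- The differential `m₁(x_i · h) = ∑_j c_{i,j} x_j · h` on `Â(M)`. -/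
def mOne : M.M →ₗ[ℤ] M.M :=
  X.basis.constr ℤ fun p => ∑ j, X.c p.1.1 j • X.el j p.1.2

/-- The bigrading on `Â(M)`: if `x_i` has bidegree `(j, k)`, then `x_i · h` has bidegree
`(-j - (deg h)/2, k)`. -/
def hatGr (p : ℚ × ℤ) : Submodule ℤ M.M :=
  Submodule.span ℤ {y | ∃ i h, h.a = X.e i ∧ y = X.el i h ∧
    p = (-((X.deg i).1 : ℚ) - (h.deg : ℚ) / 2, (X.deg i).2)}

open Classical in
/-- `ρ` is the right action `m₂` of `B ⊙ m(B)^!` on `Â(M)` with the prescribed values on generators: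
* `(x_i h) · k` is `x_i h` if `k = h`, and zero otherwise, for an elementary idempotent `k`;
* `m₂(x_i h, b_{*;h,h''}) = x_i h''` for generators of `B`;
* `m₂(x_i h, m(b^*_{*;m(h),m(h'')})) = ∑_j ∑_{h' ∈ β_mult} c̃_{i,j;h'} c̃̃_{h'h;h''} x_j h''` for
  generators of `m(B)^!`, where `c̃̃_{h'h;h''}` is the coefficient of `h''` in `h'h`. -/
structure IsFullAction (ρ : FullAlg n →+* (Module.End ℤ M.M)ᵐᵒᵖ) : Prop where
  idem : ∀ k i h, h.a = X.e i → (ρ (idemA k)).unop (X.el i h) = if k = h then X.el i h else 0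
  right : ∀ (b : Edge n) i h, h.a = X.e i →
    (ρ (rightA b)).unop (X.el i h) = if b.src = h then X.el i b.tgt else 0
  left : ∀ (b : Edge n) i h, h.a = X.e i →
    (ρ (leftA b)).unop (X.el i h) = if b.src.mirror = h then
      ∑ j, ∑ h' ∈ Finset.univ.filter IsMultGen,
        (X.coeff i j h' * mulCoeff h' h b.tgt.mirror) • X.el j b.tgt.mirror else 0

/-- `Â(M)`, with the action `ρ` of `B ⊙ m(B)^!`. -/
def hatA (d : FullAlg n →ₗ[ℤ] FullAlg n) (ρ : FullAlg n →+* (Module.End ℤ M.M)ᵐᵒᵖ) :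
    RightModData.{u} (fullDG d) where
  X := M.M
  gr := X.hatGr
  ρ := ρ
  d := X.mOne

end RightComplex.Generators

namespace LeftComplex.Generators

variable {N : LeftComplex.{u} n} (X : N.Generators)

/-- `C_module` for complexes of left modules. -/
def CModule : Prop := X.mirror.CModule

/-- `D̂(N) = m(Â(m(N)) ⊠ K)`, where `K` is the rank-one DD bimodule over `B ⊙ m(B)^!` and its
mirror, and `ρ` is the action of `B ⊙ m(B)^!` on `Â(m(N))`. -/
def hatD (d : FullAlg n →ₗ[ℤ] FullAlg n) (ρ : FullAlg n →+* (Module.End ℤ N.mirror.M)ᵐᵒᵖ) :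
    TypeDData.{u} (fullDG d) :=
  (boxDD (X.mirror.hatA d ρ) (fullDG d).mirror (ddMap d)).mirror

end LeftComplex.Generators

end Complexes

end BorderedKh

end

noncomputable section
namespace BorderedKh

/-! ## Circles under surgery -/

section Saddles

/-! The combinatorics rests on one planar fact. Arcs of a crossingless matching join points of
opposite parity, so a circle of `W(a)b` consists of two cycles of the permutation `a ∘ b`, one on
each parity class. On a parity class, surgery on a bridge exchanges two values of this permutation,
which cuts one cycle in two or fuses two. Hence a saddle joins two circles or splits one
(`SurgeryAt.joins_or`), and the cobordisms for right multiplication by `β_mult` have genus zero. The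
corresponding structure constants are 0 or 1 and are given by explicit label rules, and the
generators of `B` become the edges of a finite graph on `β` along which `deg` grows by 1 (bridges)
or by 2 (decorations).

Two facts about this graph carry the algebra. Surgeries on the two sides of the line commute as
operators (`rbMat_mul_lbMat`), so there are as many paths "right bridge, left bridge" as paths "left
bridge, right bridge" between given ends. And the paths made of a bridge and a decoration are
classified (`bridgeDecPaths`): the configurations are exactly those of relations (3) and (5).

Let `r` and `l` be the matrices of the generators of `B` and of `m(B)^!`. The relations `J₂` say
that `r_{hm} r_{mk}` depends only on `h` and `k`, and equals `r_{hk}` if this is a generator. The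
relations `I^⊥` say that `(l²)_{hk} = 0` unless `h ⟶ k` is a generator. Relations (1)-(5) exchange
`r` and `l`. Data of this kind form an `IsRep`, and `IsRep.lift` is the universal property; the
structures on the algebra are then obtained by exhibiting further representations. Upper triangular
2 × 2 matrices encode the differential, since their product is the Leibniz rule and `d l = -l²`;
monomials in a group ring encode the bigrading; the ring `R` itself detects the idempotents;
endomorphisms of `M` give the action. The differential respects (3)-(5) because, in the degrees that
matter, `l²` is the square of the bridge part of `l`, and bridges are exchanged by (1) and (2).

For the DD equation, `δ` is the sum of all `r ⊗ l + l ⊗ r`. In its square, `rr ⊗ ll` collapses to `r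
⊗ l²` and cancels against the differential, while the mixed terms `rl ⊗ lr` and `lr ⊗ rl` agree by
the exchange relations and their mirrors and carry opposite signs.

For a complex, write `d = m₁ + d̃`. The component of `d² = 0` that fixes `h` gives `m₁² = 0`, and
the others give `∑ l l = -(m₁ l + l m₁)` for the operators `l` cut out of `d̃`. This is at the same
time the relation `I^⊥` and the Leibniz rule for the generators of `m(B)^!`. The Type D equation
follows by letting the first factor of the DD identities act on the module. -/

theorem sameCycle_of_not_sameCycle {α : Type*} [Finite α] (σ τ : Equiv.Perm α) (S : α → Prop)
    (hS : ∀ z, S z → S (σ z)) {x y : α} (hy : S y) (hx' : τ x = σ y)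
    (hz : ∀ z, S z → z ≠ x → z ≠ y → τ z = σ z) (h : ¬ σ.SameCycle x y) : τ.SameCycle x y := by
  classical
  have hex : ∃ m, 0 < m ∧ (σ ^ m) y = y := by
    obtain ⟨m, hm, h1⟩ := (isOfFinOrder_of_finite σ).exists_pow_eq_one
    exact ⟨m, hm, by rw [h1]; rfl⟩
  have hm := Nat.find_spec hex
  set m := Nat.find hex with hmdef
  have hSp : ∀ j, S ((σ ^ j) y) := by
    intro j
    induction j with
    | zero => exact hy
    | succ j ih => rw [pow_succ']; exact hS _ ih
  -- The first step of `τ` jumps from `x` onto the `σ`-cycle of `y`; from then on `τ` follows `σ`.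
  -- Neither exceptional point occurs before time `m`: `x` lies on another cycle, and `m` is the
  -- first return to `y`.
  have key : ∀ j, j + 1 ≤ m → (τ ^ (j + 1)) x = (σ ^ (j + 1)) y := by
    intro j
    induction j with
    | zero => intro _; simpa using hx'
    | succ j ih =>
      intro hj
      rw [pow_succ', pow_succ' σ, Equiv.Perm.mul_apply, Equiv.Perm.mul_apply, ih (by omega)]
      refine hz _ (hSp _) ?_ ?_
      · intro e
        exact h (Equiv.Perm.SameCycle.symm ⟨((j + 1 : ℕ) : ℤ), by rw [zpow_natCast]; exact e⟩)
      · intro e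
        exact Nat.find_min hex (m := j + 1) (by omega) ⟨by omega, e⟩
  obtain ⟨j, hj⟩ : ∃ j, m = j + 1 := ⟨m - 1, by omega⟩
  refine ⟨((j + 1 : ℕ) : ℤ), ?_⟩
  rw [zpow_natCast, key j (by omega), ← hj]
  exact hm.2

/-- Starting at `y`, `τ` enters the arc `σ x, …, σ^m x = y` and then closes up, because `τ y = σ x`.
The arc does not contain `x`. -/
theorem not_sameCycle_of_sameCycle {α : Type*} [Finite α] (σ τ : Equiv.Perm α) (S : α → Prop)
    (hS : ∀ z, S z → S (σ z)) {x y : α} (hx : S x) (hxy : x ≠ y)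
    (hy' : τ y = σ x)
    (hz : ∀ z, S z → z ≠ x → z ≠ y → τ z = σ z) (h : σ.SameCycle x y) : ¬ τ.SameCycle x y := by
  classical
  have hex : ∃ m, (σ ^ m) x = y := by
    obtain ⟨m, -, h1⟩ := h.exists_pow_eq'
    exact ⟨m, h1⟩
  have hm := Nat.find_spec hex
  set m := Nat.find hex with hmdef
  have hmin : ∀ j, j < m → (σ ^ j) x ≠ y := fun j hj => Nat.find_min hex hj
  have hSp : ∀ j, S ((σ ^ j) x) := by
    intro j
    induction j with
    | zero => exact hx
    | succ j ih => rw [pow_succ']; exact hS _ ih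
  have hne : ∀ j, 0 < j → j ≤ m → (σ ^ j) x ≠ x := by
    intro j hj hjm e
    rcases eq_or_lt_of_le hjm with rfl | hlt
    · exact hxy (e.symm.trans hm)
    · refine hmin (m - j) (by omega) ?_
      have : (σ ^ (m - j)) ((σ ^ j) x) = y := by
        rw [← Equiv.Perm.mul_apply, ← pow_add, Nat.sub_add_cancel hjm]; exact hm
      rwa [e] at this
  have hm0 : 0 < m := by
    rcases Nat.eq_zero_or_pos m with h0 | h0
    · rw [h0] at hm; exact absurd hm hxy
    · exact h0
  have inv : ∀ k : ℕ, ∃ j, 0 < j ∧ j ≤ m ∧ (τ ^ k) y = (σ ^ j) x := by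
    intro k
    induction k with
    | zero => exact ⟨m, hm0, le_rfl, hm.symm⟩
    | succ k ih =>
      obtain ⟨j, hj0, hjm, e⟩ := ih
      rw [pow_succ', Equiv.Perm.mul_apply, e]
      rcases eq_or_lt_of_le hjm with rfl | hlt
      · exact ⟨1, one_pos, hm0, by rw [hm, hy', pow_one]⟩
      · refine ⟨j + 1, by omega, hlt, ?_⟩
        rw [hz _ (hSp j) (hne j hj0 hjm) (hmin j hlt), pow_succ', Equiv.Perm.mul_apply]
  intro h'
  obtain ⟨k, -, e⟩ := h'.symm.exists_pow_eq'
  obtain ⟨j, hj0, hjm, e'⟩ := inv k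
  exact hne j hj0 hjm (e'.symm.trans e)

/-! ### Matchings, parity, and circles as cycles of a permutation -/

variable {n : ℕ}

theorem Matching.f_inj (a : Matching n) {p q : Fin (2 * n)} (h : a.f p = a.f q) : p = q := by
  rw [← a.invol p, h, a.invol]

theorem Matching.f_lt_of_lt (a : Matching n) {p q : Fin (2 * n)} (h1 : p < q) (h2 : q < a.f p) :
    p < a.f q ∧ a.f q < a.f p := by
  have h3 := a.noncrossing p q
  have h4 := a.noncrossing (a.f q) p
  rw [a.invol] at h4
  have h5 : a.f q ≠ a.f p := fun e => h1.ne' (a.f_inj e)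
  have h6 : a.f q ≠ p := fun e => h2.ne (by rw [← e, a.invol])
  constructor
  · by_contra hc
    exact h4 ⟨lt_of_le_of_ne (not_lt.1 hc) h6, h1, h2⟩
  · by_contra hc
    exact h3 ⟨h1, h2, lt_of_le_of_ne (not_lt.1 hc) (Ne.symm h5)⟩

/-- Since arcs do not cross, the matching restricts to a fixed-point-free involution of the points
strictly under the arc, so their number is even. -/
theorem Matching.parity_of_lt (a : Matching n) {p : Fin (2 * n)} (h : p < a.f p) :
    (a.f p).val % 2 ≠ p.val % 2 := by
  have hcard : Even (Finset.Ioo p (a.f p)).card := by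
    have : ∑ _x ∈ Finset.Ioo p (a.f p), (1 : ZMod 2) = 0 := by
      refine Finset.sum_involution (fun x _ => a.f x) (fun x _ => by decide)
        (fun x _ _ => a.ne x) (fun x hx => ?_) (fun x _ => a.invol x)
      rw [Finset.mem_Ioo] at hx ⊢
      exact a.f_lt_of_lt hx.1 hx.2
    rw [Finset.sum_const, nsmul_eq_mul, mul_one] at this
    exact (ZMod.natCast_eq_zero_iff_even).1 this
  rw [Fin.card_Ioo] at hcard
  have h' : p.val < (a.f p).val := h
  rw [Nat.even_iff] at hcard
  omega

theorem Matching.parity (a : Matching n) (p : Fin (2 * n)) : (a.f p).val % 2 ≠ p.val % 2 := by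
  rcases lt_or_gt_of_ne (a.ne p) with h | h
  · have := a.parity_of_lt (p := a.f p) (by rw [a.invol]; exact h)
    rw [a.invol] at this
    exact this.symm
  · exact a.parity_of_lt h

/-- A matching as a permutation. -/
def Matching.perm (a : Matching n) : Equiv.Perm (Fin (2 * n)) := ⟨a.f, a.f, a.invol, a.invol⟩

theorem SameCircle.refl (a b : Matching n) (p) : SameCircle a b p p := Relation.EqvGen.refl _

theorem SameCircle.symm {a b : Matching n} {p q} (h : SameCircle a b p q) : SameCircle a b q p :=
  Relation.EqvGen.symm _ _ h

theorem SameCircle.trans {a b : Matching n} {p q r} (h : SameCircle a b p q)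
    (h' : SameCircle a b q r) : SameCircle a b p r := Relation.EqvGen.trans _ _ _ h h'

theorem SameCircle.left (a b : Matching n) (p) : SameCircle a b p (a.f p) := .rel _ _ (.inl rfl)

theorem SameCircle.right (a b : Matching n) (p) : SameCircle a b p (b.f p) := .rel _ _ (.inr rfl)

/-- Circles are the finest equivalence relation containing the arcs. -/
theorem SameCircle.le {a b : Matching n} {T : Fin (2 * n) → Fin (2 * n) → Prop}
    (hT : Equivalence T) (ha : ∀ p, T p (a.f p)) (hb : ∀ p, T p (b.f p)) {p q}
    (h : SameCircle a b p q) : T p q := by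
  induction h with
  | rel x y h => rcases h with rfl | rfl; exacts [ha _, hb _]
  | refl x => exact hT.refl x
  | symm x y _ ih => exact hT.symm ih
  | trans x y z _ _ ih ih' => exact hT.trans ih ih'

theorem SameCircle.equivalence (a b : Matching n) : Equivalence (SameCircle a b) :=
  ⟨SameCircle.refl a b, SameCircle.symm, SameCircle.trans⟩

theorem sameCircle_of_sameCycle {a b : Matching n} {p q : Fin (2 * n)}
    (h : (a.perm * b.perm).SameCycle p q) : SameCircle a b p q := by
  obtain ⟨k, -, rfl⟩ := h.exists_pow_eq'
  induction k with
  | zero => exact .refl _ _ _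
  | succ k ih =>
    rw [pow_succ', Equiv.Perm.mul_apply]
    refine (ih ?_).trans ((SameCircle.right a b _).trans (SameCircle.left a b _))
    exact ⟨k, by rw [zpow_natCast]⟩

/-- The permutation `a ∘ b` walks along a circle two arcs at a time, so it visits exactly the points
of one parity. The predicate `G` extends the cycle of `p` to points of the other parity through `b`,
and is invariant under both matchings. -/
theorem sameCycle_of_sameCircle {a b : Matching n} {p q : Fin (2 * n)} (h : SameCircle a b p q)
    (hpq : q.val % 2 = p.val % 2) : (a.perm * b.perm).SameCycle p q := by
  let σ := a.perm * b.perm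
  let G : Fin (2 * n) → Prop := fun y =>
    (y.val % 2 = p.val % 2 ∧ σ.SameCycle p y) ∨ (y.val % 2 ≠ p.val % 2 ∧ σ.SameCycle p (b.f y))
  have hσ : ∀ z, σ (b.f z) = a.f z := fun z => by
    change a.f (b.f (b.f z)) = a.f z
    rw [b.invol]
  have hσ' : ∀ z, σ (b.f (a.f z)) = z := fun z => by rw [hσ, a.invol]
  have hb : ∀ y, G y → G (b.f y) := by
    intro y hy
    have := b.parity y
    rcases hy with ⟨h1, h2⟩ | ⟨h1, h2⟩
    · exact .inr ⟨by omega, by rw [b.invol]; exact h2⟩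
    · exact .inl ⟨by omega, h2⟩
  have ha : ∀ y, G y → G (a.f y) := by
    intro y hy
    have := a.parity y
    rcases hy with ⟨h1, h2⟩ | ⟨h1, h2⟩
    · refine .inr ⟨by omega, ?_⟩
      rw [← Equiv.Perm.sameCycle_apply_right, hσ']
      exact h2
    · refine .inl ⟨by omega, ?_⟩
      rw [← hσ, Equiv.Perm.sameCycle_apply_right]
      exact h2
  have hG : ∀ {x y}, SameCircle a b x y → (G x ↔ G y) := by
    intro x y hxy
    refine hxy.le (T := fun x y => (G x ↔ G y)) ⟨fun _ => Iff.rfl, fun h => h.symm,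
      fun h h' => h.trans h'⟩ (fun y => ⟨ha y, fun h => ?_⟩) (fun y => ⟨hb y, fun h => ?_⟩)
    · have := ha _ h; rwa [a.invol] at this
    · have := hb _ h; rwa [b.invol] at this
  rcases (hG h).1 (.inl ⟨rfl, Equiv.Perm.SameCycle.refl _ _⟩) with h1 | h1
  · exact h1.2
  · exact absurd hpq h1.1

/-- `b'` is obtained from `b` by replacing the arcs `{p, b p}`, `{q, b q}` by `{p, q}`,
`{b p, b q}`. -/
structure SurgeryAt (b b' : Matching n) (p q : Fin (2 * n)) : Prop where
  ne : q ≠ p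
  ne' : q ≠ b.f p
  eq : b'.f p = q
  eq' : b'.f (b.f p) = b.f q
  off : ∀ r, r ≠ p → r ≠ q → r ≠ b.f p → r ≠ b.f q → b'.f r = b.f r

theorem surgery_iff {b b' : Matching n} : Surgery b b' ↔ ∃ p q, SurgeryAt b b' p q :=
  ⟨fun ⟨p, q, h1, h2, h3, h4, h5⟩ => ⟨p, q, h1, h2, h3, h4, h5⟩,
    fun ⟨p, q, h⟩ => ⟨p, q, h.1, h.2, h.3, h.4, h.5⟩⟩

variable {a b b' : Matching n} {p q : Fin (2 * n)}

theorem SurgeryAt.symm (h : SurgeryAt b b' p q) : SurgeryAt b' b p (b.f p) where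
  ne := b.ne p
  ne' := by rw [h.eq]; exact h.ne'.symm
  eq := rfl
  eq' := by rw [h.eq, h.eq']
  off r h1 h2 h3 h4 := by
    rw [h.eq] at h3
    rw [h.eq'] at h4
    exact (h.off r h1 h3 h2 h4).symm

theorem Surgery.symm (h : Surgery b b') : Surgery b' b := by
  obtain ⟨p, q, h⟩ := surgery_iff.1 h
  exact surgery_iff.2 ⟨_, _, h.symm⟩

theorem SurgeryAt.matching_ne (h : SurgeryAt b b' p q) : b ≠ b' := by
  rintro rfl
  exact h.ne' h.eq.symm

theorem Surgery.ne (h : Surgery b b') : b ≠ b' := by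
  obtain ⟨p, q, h⟩ := surgery_iff.1 h
  exact h.matching_ne

theorem SurgeryAt.eq_q (h : SurgeryAt b b' p q) : b'.f q = p := by rw [← h.eq, b'.invol]

theorem SurgeryAt.eq_bq (h : SurgeryAt b b' p q) : b'.f (b.f q) = b.f p := by
  rw [← h.eq', b'.invol]

/-- The relation obtained from `E` by identifying the classes of `u` and `v`. -/
def JoinRel {α : Type*} (E : α → α → Prop) (u v : α) (x y : α) : Prop :=
  E x y ∨ (E x u ∧ E v y) ∨ (E x v ∧ E u y)

theorem JoinRel.equivalence {α : Type*} {E : α → α → Prop} (hE : Equivalence E) (u v : α) :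
    Equivalence (JoinRel E u v) := by
  have hs := fun {x y} => @Equivalence.symm _ _ hE x y
  have ht := fun {x y z} => @Equivalence.trans _ _ hE x y z
  refine ⟨fun x => .inl (hE.refl x), ?_, ?_⟩
  · rintro x y (h | ⟨h, h'⟩ | ⟨h, h'⟩)
    · exact .inl (hs h)
    · exact .inr (.inr ⟨hs h', hs h⟩)
    · exact .inr (.inl ⟨hs h', hs h⟩)
  · rintro x y z (h | ⟨h, h'⟩ | ⟨h, h'⟩) (k | ⟨k, k'⟩ | ⟨k, k'⟩)
    · exact .inl (ht h k)
    · exact .inr (.inl ⟨ht h k, k'⟩)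
    · exact .inr (.inr ⟨ht h k, k'⟩)
    · exact .inr (.inl ⟨h, ht h' k⟩)
    · exact .inr (.inl ⟨h, k'⟩)
    · exact .inl (ht h k')
    · exact .inr (.inr ⟨h, ht h' k⟩)
    · exact .inl (ht h k')
    · exact .inr (.inr ⟨h, k'⟩)

/-- Each arc of `b'` is an arc of `b`, or joins `p` to `q`, or joins their old partners; the last
two become trivial once the circles of `p` and `q` are identified. -/
theorem SurgeryAt.le_join (h : SurgeryAt b b' p q) (a : Matching n) {x y}
    (hxy : SameCircle a b' x y) : JoinRel (SameCircle a b) p q x y := by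
  have hJ := JoinRel.equivalence (SameCircle.equivalence a b) p q
  have hpq : JoinRel (SameCircle a b) p q p q := .inr (.inl ⟨.refl _ _ _, .refl _ _ _⟩)
  have hp : JoinRel (SameCircle a b) p q p (b.f p) := .inl (.right _ _ _)
  have hq : JoinRel (SameCircle a b) p q q (b.f q) := .inl (.right _ _ _)
  refine hxy.le hJ (fun x => .inl (.left _ _ _)) fun x => ?_
  by_cases h1 : x = p
  · subst h1; rw [h.eq]; exact hpq
  by_cases h2 : x = q
  · subst h2; rw [h.eq_q]; exact hJ.symm hpq
  by_cases h3 : x = b.f p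
  · subst h3; rw [h.eq']; exact hJ.trans (hJ.symm hp) (hJ.trans hpq hq)
  by_cases h4 : x = b.f q
  · subst h4; rw [h.eq_bq]; exact hJ.trans (hJ.symm hq) (hJ.trans (hJ.symm hpq) hp)
  rw [h.off x h1 h2 h3 h4]
  exact .inl (.right _ _ _)

/-- This is the orientability of the saddle: it excludes a saddle from one circle to one circle. On
the points with the parity of `p`, the permutations `a ∘ b` and `a ∘ b'` differ by exchanging their
values at `p` and `b q`, so exactly one of them has these two points on a common cycle. Moreover `b
q` shares a circle with `q` before the surgery, and with `b p` after it. -/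
theorem SurgeryAt.sameCircle_iff (h : SurgeryAt b b' p q) (a : Matching n) :
    SameCircle a b p q ↔ ¬ SameCircle a b' p (b.f p) := by
  have hp1 := b.parity p
  have hp2 := b.parity q
  have hp3 : q.val % 2 ≠ p.val % 2 := by rw [← h.eq]; exact b'.parity p
  have e1 : SameCircle a b p q ↔ (a.perm * b.perm).SameCycle p (b.f q) := by
    refine ⟨fun hh => sameCycle_of_sameCircle (hh.trans (.right _ _ _)) (by omega), fun hh => ?_⟩
    exact (sameCircle_of_sameCycle hh).trans (SameCircle.right _ _ _).symm
  have e2 : SameCircle a b' p (b.f p) ↔ (a.perm * b'.perm).SameCycle p (b.f q) := by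
    have hr : SameCircle a b' (b.f p) (b.f q) := by
      rw [← h.eq']; exact .right _ _ _
    refine ⟨fun hh => sameCycle_of_sameCircle (hh.trans hr) (by omega), fun hh => ?_⟩
    exact (sameCircle_of_sameCycle hh).trans hr.symm
  have hx : (a.perm * b'.perm) p = (a.perm * b.perm) (b.f q) := by
    change a.f (b'.f p) = a.f (b.f (b.f q))
    rw [h.eq, b.invol]
  have hy : (a.perm * b'.perm) (b.f q) = (a.perm * b.perm) p := by
    change a.f (b'.f (b.f q)) = a.f (b.f p)
    rw [h.eq_bq]
  -- On the other parity class the permutations differ at `q` and `b p` as well, so the comparison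
  -- is confined to the class of `p`.
  let S : Fin (2 * n) → Prop := fun z => z.val % 2 = p.val % 2
  have hS : ∀ z, S z → S ((a.perm * b.perm) z) := by
    intro z hz
    change (a.f (b.f z)).val % 2 = p.val % 2
    have h1 := a.parity (b.f z)
    have h2 := b.parity z
    have h3 : z.val % 2 = p.val % 2 := hz
    omega
  have hz : ∀ z, S z → z ≠ p → z ≠ b.f q → (a.perm * b'.perm) z = (a.perm * b.perm) z := by
    intro z hz h1 h2
    change a.f (b'.f z) = a.f (b.f z)
    have h3 : z.val % 2 = p.val % 2 := hz
    rw [h.off z h1 (fun e => hp3 (by rw [← e]; exact h3)) (fun e => hp1 (by rw [← e]; exact h3)) h2]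
  rw [e1, e2]
  refine ⟨fun hh => ?_, fun hh => ?_⟩
  · refine not_sameCycle_of_sameCycle _ _ S hS rfl (fun e => ?_) hy hz hh
    exact h.ne' (by rw [e, b.invol])
  · by_contra hc
    refine hh (sameCycle_of_not_sameCycle _ _ S hS ?_ hx hz hc)
    change (b.f q).val % 2 = p.val % 2
    omega

/-- `E'` is obtained from `E` by joining the different classes of `u` and `v`. -/
structure Joins {α : Type*} (E E' : α → α → Prop) (u v : α) : Prop where
  not_rel : ¬ E u v
  iff : ∀ x y, E' x y ↔ JoinRel E u v x y

section Joins

variable {α : Type*} {E E' : α → α → Prop} {u v x y : α}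

theorem Joins.le (hJ : Joins E E' u v) (h : E x y) : E' x y := (hJ.iff x y).2 (.inl h)

theorem Joins.rel (hJ : Joins E E' u v) (hE : Equivalence E) : E' u v :=
  (hJ.iff u v).2 (.inr (.inl ⟨hE.refl _, hE.refl _⟩))

theorem Joins.of_rel (hJ : Joins E E' u v) (h : E' u y) :
    E u y ∨ E v y := by
  rcases (hJ.iff u y).1 h with h | ⟨-, h⟩ | ⟨h, -⟩
  · exact .inl h
  · exact .inr h
  · exact absurd h hJ.not_rel

theorem Joins.of_not_rel (hJ : Joins E E' u v) (hE : Equivalence E) (hE' : Equivalence E')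
    (hx : ¬ E' u x) (h : E' x y) : E x y := by
  rcases (hJ.iff x y).1 h with h | ⟨h, -⟩ | ⟨h, -⟩
  · exact h
  · exact absurd (hE'.symm (hJ.le h)) hx
  · exact absurd (hE'.trans (hJ.rel hE) (hE'.symm (hJ.le h))) hx

theorem Joins.iff_of_not_rel (hJ : Joins E E' u v) (hE : Equivalence E) (hE' : Equivalence E')
    (hx : ¬ E' u x) : E' x y ↔ E x y :=
  ⟨hJ.of_not_rel hE hE' hx, hJ.le⟩

end Joins

/-- Surgery on a bridge joins two circles or splits a circle. -/
theorem SurgeryAt.joins_or (h : SurgeryAt b b' p q) (a : Matching n) :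
    Joins (SameCircle a b) (SameCircle a b') p q ∨
      Joins (SameCircle a b') (SameCircle a b) p (b.f p) := by
  have key := h.sameCircle_iff a
  have hE := SameCircle.equivalence a b
  have hE' := SameCircle.equivalence a b'
  have l1 := fun {x y} => h.le_join a (x := x) (y := y)
  have l2 := fun {x y} => h.symm.le_join a (x := x) (y := y)
  have hbp : SameCircle a b p (b.f p) := .right _ _ _
  have hpq : SameCircle a b' p q := by rw [← h.eq]; exact .right _ _ _
  -- Each circle relation is contained in the other one with a pair of classes identified. The
  -- relation that already relates its pair therefore contains the other relation, and equals the
  -- join.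
  by_cases hc : SameCircle a b p q
  · right
    refine ⟨key.1 hc, fun x y => ⟨l2, ?_⟩⟩
    have hle : ∀ {x y}, SameCircle a b' x y → SameCircle a b x y := by
      intro x y hxy
      rcases l1 hxy with h1 | ⟨h1, h2⟩ | ⟨h1, h2⟩
      · exact h1
      · exact h1.trans (hc.trans h2)
      · exact h1.trans (hc.symm.trans h2)
    rintro (h1 | ⟨h1, h2⟩ | ⟨h1, h2⟩)
    · exact hle h1
    · exact (hle h1).trans (hbp.trans (hle h2))
    · exact (hle h1).trans (hbp.symm.trans (hle h2))
  · left
    have hc' : SameCircle a b' p (b.f p) := by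
      by_contra hh
      exact hc (key.2 hh)
    refine ⟨hc, fun x y => ⟨l1, ?_⟩⟩
    have hle : ∀ {x y}, SameCircle a b x y → SameCircle a b' x y := by
      intro x y hxy
      rcases l2 hxy with h1 | ⟨h1, h2⟩ | ⟨h1, h2⟩
      · exact h1
      · exact h1.trans (hc'.trans h2)
      · exact h1.trans (hc'.symm.trans h2)
    rintro (h1 | ⟨h1, h2⟩ | ⟨h1, h2⟩)
    · exact hle h1
    · exact (hle h1).trans (hpq.trans (hle h2))
    · exact (hle h1).trans (hpq.symm.trans (hle h2))

end Saddles

end BorderedKh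
end

noncomputable section
namespace BorderedKh

/-! ## Multiplication by the generators of the arc algebra -/

section Products

variable {n : ℕ}

open Classical in
/-- The class of `x`. -/
def cls (E : Fin (2 * n) → Fin (2 * n) → Prop) (x : Fin (2 * n)) : Finset (Fin (2 * n)) :=
  Finset.univ.filter fun y => E x y

open Classical in
/-- The set of classes. -/
def classes (E : Fin (2 * n) → Fin (2 * n) → Prop) : Finset (Finset (Fin (2 * n))) :=
  Finset.univ.image fun x => cls E x

variable {E E' J : Fin (2 * n) → Fin (2 * n) → Prop} {u v : Fin (2 * n)}

theorem mem_cls {x y : Fin (2 * n)} : y ∈ cls E x ↔ E x y := by simp [cls]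

theorem mem_classes {C : Finset (Fin (2 * n))} : C ∈ classes E ↔ ∃ x, cls E x = C := by
  simp [classes]

theorem cls_mem_classes (x : Fin (2 * n)) : cls E x ∈ classes E := mem_classes.2 ⟨x, rfl⟩

theorem cls_eq_iff (hE : Equivalence E) {x y : Fin (2 * n)} : cls E x = cls E y ↔ E x y := by
  constructor
  · intro h
    have : y ∈ cls E y := mem_cls.2 (hE.refl y)
    rw [← h] at this
    exact mem_cls.1 this
  · intro h
    ext z
    rw [mem_cls, mem_cls]
    exact ⟨fun k => hE.trans (hE.symm h) k, fun k => hE.trans h k⟩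

theorem circles_eq (a b : Matching n) : circles a b = classes (SameCircle a b) := rfl

theorem comps_eq (a b c : Matching n) : comps a b c = classes (SameComp a b c) := rfl

theorem cls_subset_cls_iff (hE : Equivalence E) (hJ : Equivalence J) (hle : ∀ x y, E x y → J x y)
    {x y : Fin (2 * n)} : cls E y ⊆ cls J x ↔ J x y := by
  constructor
  · intro h
    exact mem_cls.1 (h (mem_cls.2 (hE.refl y)))
  · intro h z hz
    exact mem_cls.2 (hJ.trans h (hle _ _ (mem_cls.1 hz)))

theorem SameComp.equivalence (a b c : Matching n) : Equivalence (SameComp a b c) :=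
  ⟨fun _ => .refl _, fun h => .symm _ _ h, fun h h' => .trans _ _ _ h h'⟩

theorem sameComp_left {a b c : Matching n} {x y} (h : SameCircle a b x y) :
    SameComp a b c x y := by
  refine h.le (SameComp.equivalence a b c) (fun p => .rel _ _ (.inl rfl))
    (fun p => .rel _ _ (.inr (.inl rfl)))

theorem sameComp_right {a b c : Matching n} {x y} (h : SameCircle b c x y) :
    SameComp a b c x y := by
  refine h.le (SameComp.equivalence a b c) (fun p => .rel _ _ (.inr (.inl rfl)))
    (fun p => .rel _ _ (.inr (.inr rfl)))

theorem sameComp_outer {a b c : Matching n} {x y} (h : SameCircle a c x y) :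
    SameComp a b c x y := by
  refine h.le (SameComp.equivalence a b c) (fun p => .rel _ _ (.inl rfl))
    (fun p => .rel _ _ (.inr (.inr rfl)))

theorem SameComp.le {a b c : Matching n} {T : Fin (2 * n) → Fin (2 * n) → Prop}
    (hT : Equivalence T) (h1 : ∀ x y, SameCircle a b x y → T x y)
    (h2 : ∀ x y, SameCircle a c x y → T x y) {x y} (h : SameComp a b c x y) : T x y := by
  induction h with
  | rel x y h =>
    rcases h with rfl | rfl | rfl
    exacts [h1 _ _ (.left _ _ _), h1 _ _ (.right _ _ _), h2 _ _ (.right _ _ _)]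
  | refl x => exact hT.refl x
  | symm x y _ ih => exact hT.symm ih
  | trans x y z _ _ ih ih' => exact hT.trans ih ih'

/-- A count of boundary circles. The component `K` contains a circle of `W(a)b` and one of `W(a)c`;
since circles of `W(b)c` have at most two points off `T`, it contains at least `(|K| - 2)/2` of
those. The numerator in `genus` is then at most 1, and the halving turns it into 0. -/
theorem genus_eq_zero {a b c : Matching n} (T : Finset (Fin (2 * n))) (hT : T.card ≤ 2)
    (h : ∀ x, x ∉ T → ∀ y, y ∉ T → SameCircle b c x y → y = x ∨ y = b.f x)
    {K : Finset (Fin (2 * n))} (hK : K ∈ comps a b c) : genus a b c K = 0 := by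
  classical
  rw [comps_eq, mem_classes] at hK
  obtain ⟨x, rfl⟩ := hK
  set K := cls (SameComp a b c) x with hKdef
  have hJ := SameComp.equivalence a b c
  have hx : SameComp a b c x x := hJ.refl x
  have c1 : 1 ≤ ((circles a b).filter (· ⊆ K)).card := by
    refine Finset.card_pos.2 ⟨cls (SameCircle a b) x, Finset.mem_filter.2 ⟨cls_mem_classes x, ?_⟩⟩
    exact (cls_subset_cls_iff (SameCircle.equivalence a b) hJ fun _ _ => sameComp_left).2 hx
  have c3 : 1 ≤ ((circles a c).filter (· ⊆ K)).card := by
    refine Finset.card_pos.2 ⟨cls (SameCircle a c) x, Finset.mem_filter.2 ⟨cls_mem_classes x, ?_⟩⟩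
    exact (cls_subset_cls_iff (SameCircle.equivalence a c) hJ fun _ _ => sameComp_outer).2 hx
  have c2 : (K \ T).card ≤ 2 * ((circles b c).filter (· ⊆ K)).card := by
    have h1 : (K \ T).card ≤ 2 * ((K \ T).image (cls (SameCircle b c))).card := by
      refine Finset.card_le_mul_card_image _ _ fun C hC => ?_
      obtain ⟨y, hy, rfl⟩ := Finset.mem_image.1 hC
      refine (Finset.card_le_card (t := {y, b.f y}) fun z hz => ?_).trans Finset.card_le_two
      rw [Finset.mem_filter, Finset.mem_sdiff, cls_eq_iff (SameCircle.equivalence b c)] at hz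
      rw [Finset.mem_insert, Finset.mem_singleton]
      exact h y (Finset.mem_sdiff.1 hy).2 z hz.1.2 hz.2.symm
    refine h1.trans (Nat.mul_le_mul_left 2 (Finset.card_le_card fun C hC => ?_))
    obtain ⟨y, hy, rfl⟩ := Finset.mem_image.1 hC
    refine Finset.mem_filter.2 ⟨cls_mem_classes y, ?_⟩
    refine (cls_subset_cls_iff (SameCircle.equivalence b c) hJ fun _ _ => sameComp_right).2 ?_
    exact mem_cls.1 (Finset.mem_sdiff.1 hy).1
  have h4 : K.card ≤ (K \ T).card + T.card := by
    have := Finset.le_card_sdiff T K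
    omega
  unfold genus
  omega

theorem ArcBasis.neg_of_sameCircle (h : ArcBasis n) {x y} (hxy : SameCircle h.a h.b x y) :
    h.neg x = h.neg y :=
  hxy.le (T := fun x y => h.neg x = h.neg y) ⟨fun _ => rfl, Eq.symm, Eq.trans⟩
    (fun p => (h.neg_left p).symm) (fun p => (h.neg_right p).symm)

/-- The relation of lying on the same circle of `h`. -/
abbrev ArcBasis.rel (h : ArcBasis n) : Fin (2 * n) → Fin (2 * n) → Prop := SameCircle h.a h.b

theorem ArcBasis.equivalence (h : ArcBasis n) : Equivalence h.rel := SameCircle.equivalence _ _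

theorem mem_signed {h : ArcBasis n} {s : Bool} {C : Finset (Fin (2 * n))} :
    C ∈ h.signed s ↔ ∃ x, cls h.rel x = C ∧ h.neg x = s := by
  unfold ArcBasis.signed
  rw [Finset.mem_filter, circles_eq, mem_classes]
  constructor
  · rintro ⟨⟨x, rfl⟩, h2⟩
    exact ⟨x, rfl, h2 x (mem_cls.2 (.refl _ _ _))⟩
  · rintro ⟨x, rfl, h2⟩
    exact ⟨⟨x, rfl⟩, fun p hp => by rw [← h.neg_of_sameCircle (mem_cls.1 hp), h2]⟩

/-- The number of circles of `h` labelled by `s` in `K`. -/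
abbrev ArcBasis.cnt (h : ArcBasis n) (s : Bool) (K : Finset (Fin (2 * n))) : ℕ :=
  ((h.signed s).filter (· ⊆ K)).card

theorem ArcBasis.cnt_single (h : ArcBasis n) (s : Bool) (hJ : Equivalence J)
    (hle : ∀ x y, h.rel x y → J x y) {x : Fin (2 * n)} (hx : ∀ y, J x y → h.rel x y) :
    h.cnt s (cls J x) = if h.neg x = s then 1 else 0 := by
  have key : (h.signed s).filter (· ⊆ cls J x) = if h.neg x = s then {cls h.rel x} else ∅ := by
    ext C
    rw [Finset.mem_filter, mem_signed]
    constructor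
    · rintro ⟨⟨y, rfl, h2⟩, h3⟩
      rw [cls_subset_cls_iff h.equivalence hJ hle] at h3
      have := hx _ h3
      rw [h.neg_of_sameCircle this, if_pos h2, Finset.mem_singleton, cls_eq_iff h.equivalence]
      exact this.symm
    · split_ifs with hs
      · rw [Finset.mem_singleton]
        rintro rfl
        exact ⟨⟨x, rfl, hs⟩, (cls_subset_cls_iff h.equivalence hJ hle).2 (hJ.refl x)⟩
      · intro h; simp at h
  unfold ArcBasis.cnt
  rw [key]
  split_ifs <;> simp

theorem ArcBasis.cnt_double (h : ArcBasis n) (s : Bool) (hJ : Equivalence J)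
    (hle : ∀ x y, h.rel x y → J x y) {u v : Fin (2 * n)} (huv : ¬ h.rel u v) (hJ' : J u v)
    (hx : ∀ y, J u y → h.rel u y ∨ h.rel v y) :
    h.cnt s (cls J u) = (if h.neg u = s then 1 else 0) + if h.neg v = s then 1 else 0 := by
  classical
  have key : (h.signed s).filter (· ⊆ cls J u) = (if h.neg u = s then {cls h.rel u} else ∅) ∪
      if h.neg v = s then {cls h.rel v} else ∅ := by
    ext C
    rw [Finset.mem_filter, mem_signed, Finset.mem_union]
    constructor
    · rintro ⟨⟨y, rfl, h2⟩, h3⟩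
      rw [cls_subset_cls_iff h.equivalence hJ hle] at h3
      rcases hx _ h3 with h4 | h4
      · left
        rw [h.neg_of_sameCircle h4, if_pos h2, Finset.mem_singleton, cls_eq_iff h.equivalence]
        exact h4.symm
      · right
        rw [h.neg_of_sameCircle h4, if_pos h2, Finset.mem_singleton, cls_eq_iff h.equivalence]
        exact h4.symm
    · rintro (h1 | h1) <;> split_ifs at h1 with hs
      · rw [Finset.mem_singleton] at h1
        subst h1
        exact ⟨⟨u, rfl, hs⟩, (cls_subset_cls_iff h.equivalence hJ hle).2 (hJ.refl u)⟩
      · simp at h1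
      · rw [Finset.mem_singleton] at h1
        subst h1
        exact ⟨⟨v, rfl, hs⟩, (cls_subset_cls_iff h.equivalence hJ hle).2 hJ'⟩
      · simp at h1
  have hne : cls h.rel u ≠ cls h.rel v := fun e => huv ((cls_eq_iff h.equivalence).1 e)
  unfold ArcBasis.cnt
  rw [key]
  split_ifs <;> simp [hne]

/-- In genus zero every component contributes 0 or 1, so the product over components is the
indicator of one condition. Indexing the components by points makes the condition checkable
pointwise. -/
theorem mulCoeff_of_genus {h g k : ArcBasis n} (hc : h.b = g.a ∧ k.a = h.a ∧ k.b = g.b)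
    (hg : ∀ K ∈ comps h.a h.b g.b, genus h.a h.b g.b K = 0) {P : Prop} [Decidable P]
    (hP : (∀ x, h.cnt true (cls (SameComp h.a h.b g.b) x)
      + g.cnt true (cls (SameComp h.a h.b g.b) x)
        + k.cnt false (cls (SameComp h.a h.b g.b) x) = 1) ↔ P) :
    mulCoeff h g k = if P then 1 else 0 := by
  classical
  unfold mulCoeff
  rw [if_pos hc]
  have : ∀ K ∈ comps h.a h.b g.b,
      (if ((h.signed true).filter (· ⊆ K)).card + ((g.signed true).filter (· ⊆ K)).card
          + genus h.a h.b g.b K + ((k.signed false).filter (· ⊆ K)).card = 1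
        then (2 : ℤ) ^ genus h.a h.b g.b K else 0)
      = if h.cnt true K + g.cnt true K + k.cnt false K = 1 then 1 else 0 := by
    intro K hK
    rw [hg K hK, add_zero, pow_zero]
  rw [Finset.prod_congr rfl this]
  by_cases hp : P
  · rw [if_pos hp]
    refine Finset.prod_eq_one fun K hK => ?_
    rw [comps_eq] at hK
    obtain ⟨x, rfl⟩ := mem_classes.1 hK
    exact if_pos (hP.2 hp x)
  · rw [if_neg hp]
    have hn : ¬ ∀ x, h.cnt true (cls (SameComp h.a h.b g.b) x)
      + g.cnt true (cls (SameComp h.a h.b g.b) x)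
        + k.cnt false (cls (SameComp h.a h.b g.b) x) = 1 := fun hh => hp (hP.1 hh)
    obtain ⟨x, hx⟩ := not_forall.1 hn
    exact Finset.prod_eq_zero (i := cls (SameComp h.a h.b g.b) x) (cls_mem_classes x) (if_neg hx)

/-- The rule for decorating the circle of `p`. -/
structure FlipRule {α : Type*} (E : α → α → Prop) (p : α) (N N' : α → Bool) : Prop where
  src : N p = false
  tgt : N' p = true
  off : ∀ x, ¬ E p x → N' x = N x

/-- The rule for joining the circles of `u` and `v` to one circle of `E'`. -/
structure MergeRule {α : Type*} (E' : α → α → Prop) (u v : α) (N N' : α → Bool) : Prop where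
  off : ∀ x, ¬ E' u x → N' x = N x
  on : N' u = (N u || N v)
  not_both : ¬ (N u = true ∧ N v = true)

/-- The rule for splitting a circle of `E` into the circles of `u` and `v`. -/
structure SplitRule {α : Type*} (E : α → α → Prop) (u v : α) (N N' : α → Bool) : Prop where
  off : ∀ x, ¬ E u x → N' x = N x
  on : N u = (N' u && N' v)
  not_both : ¬ (N' u = false ∧ N' v = false)

/-- The element `(W(b)b', all +)`. -/
def plusElt (b b' : Matching n) : ArcBasis n := ⟨b, b', fun _ => false, fun _ => rfl, fun _ => rfl⟩

theorem plusElt_cnt (b b' : Matching n) (K) : (plusElt b b').cnt true K = 0 := by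
  unfold ArcBasis.cnt
  rw [Finset.card_eq_zero, Finset.filter_eq_empty_iff]
  intro C hC
  obtain ⟨x, -, h2⟩ := mem_signed.1 hC
  exact absurd h2 Bool.false_ne_true

/-- The circles of `W(b)b'` are the pairs `{x, b x}` and one circle through the four ends of the two
arcs at the bridge; these are the classes of `T`. Without `q` and `b q`, only `p` and `b p` remain
on the large circle. -/
theorem SurgeryAt.sameCircle {b b' : Matching n} {p q : Fin (2 * n)} (h : SurgeryAt b b' p q)
    {x y} (hxy : SameCircle b b' x y) (hx : x ≠ q ∧ x ≠ b.f q) (hy : y ≠ q ∧ y ≠ b.f q) :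
    y = x ∨ y = b.f x := by
  let S : Fin (2 * n) → Prop := fun x => x = p ∨ x = b.f p ∨ x = q ∨ x = b.f q
  have hS : ∀ x, S x → S (b.f x) := by
    rintro x (rfl | rfl | rfl | rfl)
    · exact .inr (.inl rfl)
    · exact .inl (b.invol _)
    · exact .inr (.inr (.inr rfl))
    · exact .inr (.inr (.inl (b.invol _)))
  let T : Fin (2 * n) → Fin (2 * n) → Prop := fun x y => (y = x ∨ y = b.f x) ∨ (S x ∧ S y)
  have hT : Equivalence T := by
    refine ⟨fun x => .inl (.inl rfl), ?_, ?_⟩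
    · rintro x y ((rfl | rfl) | ⟨h, h'⟩)
      · exact .inl (.inl rfl)
      · exact .inl (.inr (b.invol _).symm)
      · exact .inr ⟨h', h⟩
    · rintro x y z ((rfl | rfl) | ⟨h, h'⟩) ((rfl | rfl) | ⟨k, k'⟩)
      · exact .inl (.inl rfl)
      · exact .inl (.inr rfl)
      · exact .inr ⟨k, k'⟩
      · exact .inl (.inr rfl)
      · exact .inl (.inl (b.invol _))
      · exact .inr ⟨by have := hS _ k; rwa [b.invol] at this, k'⟩
      · exact .inr ⟨h, h'⟩
      · exact .inr ⟨h, hS _ h'⟩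
      · exact .inr ⟨h, k'⟩
  have : T x y := by
    refine hxy.le hT (fun x => .inl (.inr rfl)) fun x => ?_
    by_cases h1 : x = p
    · subst h1; exact .inr ⟨.inl rfl, by rw [h.eq]; exact .inr (.inr (.inl rfl))⟩
    by_cases h2 : x = q
    · subst h2; exact .inr ⟨.inr (.inr (.inl rfl)), by rw [h.eq_q]; exact .inl rfl⟩
    by_cases h3 : x = b.f p
    · subst h3; exact .inr ⟨.inr (.inl rfl), by rw [h.eq']; exact .inr (.inr (.inr rfl))⟩
    by_cases h4 : x = b.f q
    · subst h4; exact .inr ⟨.inr (.inr (.inr rfl)), by rw [h.eq_bq]; exact .inr (.inl rfl)⟩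
    exact .inl (.inr (h.off x h1 h2 h3 h4))
  rcases this with h1 | ⟨h1, h2⟩
  · exact h1
  · have h1' : x = p ∨ x = b.f p := by tauto
    have h2' : y = p ∨ y = b.f p := by tauto
    rcases h1' with rfl | rfl <;> rcases h2' with rfl | rfl
    · exact .inl rfl
    · exact .inr rfl
    · exact .inr (b.invol _).symm
    · exact .inl rfl

theorem Surgery.genus_eq_zero {a b b' : Matching n} (h : Surgery b b') {K}
    (hK : K ∈ comps a b b') : genus a b b' K = 0 := by
  classical
  obtain ⟨p, q, h⟩ := surgery_iff.1 h
  refine BorderedKh.genus_eq_zero {q, b.f q} Finset.card_le_two (fun x hx y hy hxy => ?_) hK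
  simp only [Finset.mem_insert, Finset.mem_singleton, not_or] at hx hy
  exact h.sameCircle hxy hx hy

theorem sameCircle_self {b : Matching n} {x y} : SameCircle b b x y ↔ y = x ∨ y = b.f x := by
  constructor
  · intro h
    refine h.le (T := fun x y => y = x ∨ y = b.f x) ⟨fun x => .inl rfl, ?_, ?_⟩ (fun _ => .inr rfl)
      (fun _ => .inr rfl)
    · rintro x y (rfl | rfl)
      · exact .inl rfl
      · exact .inr (b.invol _).symm
    · rintro x y z (rfl | rfl) (rfl | rfl)
      · exact .inl rfl
      · exact .inr rfl
      · exact .inr rfl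
      · exact .inl (b.invol _)
  · rintro (rfl | rfl)
    · exact .refl _ _ _
    · exact .left _ _ _

theorem genus_self {a b : Matching n} {K} (hK : K ∈ comps a b b) : genus a b b K = 0 :=
  genus_eq_zero ∅ (by simp) (fun _ _ _ _ h => sameCircle_self.1 h) hK

open Classical in
-- The components of the cobordism are the circles of `k`. Each has one output, and one input from
-- `h`, except that the circle through `u` has two. The requirement that the count in `mulCoeff` be
-- 1 is then the multiplication table of `ℤ[X]/X²`.
theorem mulCoeff_merge {h k : ArcBasis n} (hs : Surgery h.b k.b) (ha : h.a = k.a)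
    (hJ : Joins h.rel k.rel u v) :
    mulCoeff h (plusElt h.b k.b) k = if MergeRule k.rel u v h.neg k.neg then 1 else 0 := by
  have hg : ∀ K ∈ comps h.a h.b (plusElt h.b k.b).b, genus h.a h.b (plusElt h.b k.b).b K = 0 :=
    fun K hK => hs.genus_eq_zero hK
  have hcomp : SameComp h.a h.b (plusElt h.b k.b).b = k.rel := by
    funext x y
    refine propext ⟨fun hh => hh.le k.equivalence (fun _ _ => hJ.le) (fun x y hxy => ?_),
      fun hh => ?_⟩
    · rw [ha] at hxy; exact hxy
    · refine sameComp_outer ?_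
      rw [ha]; exact hh
  refine mulCoeff_of_genus (g := plusElt h.b k.b) ⟨rfl, ha.symm, rfl⟩ hg ?_
  rw [hcomp]
  have hout : ∀ x, k.cnt false (cls k.rel x) = if k.neg x = false then 1 else 0 := fun x =>
    k.cnt_single false k.equivalence (fun _ _ h => h) (fun _ h => h)
  have hin : ∀ x, ¬ k.rel u x → h.cnt true (cls k.rel x) = if h.neg x = true then 1 else 0 :=
    fun x hx => h.cnt_single true k.equivalence (fun _ _ => hJ.le)
      (fun _ hy => hJ.of_not_rel h.equivalence k.equivalence hx hy)
  have hin' := h.cnt_double true k.equivalence (fun _ _ => hJ.le) hJ.not_rel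
    (hJ.rel h.equivalence) (fun _ => hJ.of_rel)
  constructor
  · intro hh
    have hu := hh u
    rw [hout, hin', plusElt_cnt] at hu
    refine ⟨fun x hx => ?_, ?_, ?_⟩
    · have := hh x
      rw [hout, hin x hx, plusElt_cnt] at this
      revert this
      cases h.neg x <;> cases k.neg x <;> simp
    · revert hu
      cases h.neg u <;> cases h.neg v <;> cases k.neg u <;> simp
    · revert hu
      cases h.neg u <;> cases h.neg v <;> cases k.neg u <;> simp
  · intro hh x
    by_cases hx : k.rel u x
    · rw [← (cls_eq_iff k.equivalence).2 hx, hout, hin', plusElt_cnt]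
      have h1 := hh.on
      have h2 := hh.not_both
      revert h1 h2
      cases h.neg u <;> cases h.neg v <;> cases k.neg u <;> simp
    · rw [hout, hin x hx, plusElt_cnt, hh.off x hx]
      cases h.neg x <;> simp

open Classical in
-- Now the components are the circles of `h`, and the one through `u` has two outputs. The
-- requirement becomes `Δ 1 = 1 ⊗ X + X ⊗ 1` and `Δ X = X ⊗ X`.
theorem mulCoeff_split {h k : ArcBasis n} (hs : Surgery h.b k.b) (ha : h.a = k.a)
    (hJ : Joins k.rel h.rel u v) :
    mulCoeff h (plusElt h.b k.b) k = if SplitRule h.rel u v h.neg k.neg then 1 else 0 := by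
  have hg : ∀ K ∈ comps h.a h.b (plusElt h.b k.b).b, genus h.a h.b (plusElt h.b k.b).b K = 0 :=
    fun K hK => hs.genus_eq_zero hK
  have hcomp : SameComp h.a h.b (plusElt h.b k.b).b = h.rel := by
    funext x y
    refine propext ⟨fun hh => hh.le h.equivalence (fun _ _ h => h) (fun x y hxy => ?_),
      fun hh => sameComp_left hh⟩
    rw [ha] at hxy; exact hJ.le hxy
  refine mulCoeff_of_genus (g := plusElt h.b k.b) ⟨rfl, ha.symm, rfl⟩ hg ?_
  rw [hcomp]
  have hin : ∀ x, h.cnt true (cls h.rel x) = if h.neg x = true then 1 else 0 := fun x =>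
    h.cnt_single true h.equivalence (fun _ _ h => h) (fun _ h => h)
  have hout : ∀ x, ¬ h.rel u x → k.cnt false (cls h.rel x) = if k.neg x = false then 1 else 0 :=
    fun x hx => k.cnt_single false h.equivalence (fun _ _ => hJ.le)
      (fun _ hy => hJ.of_not_rel k.equivalence h.equivalence hx hy)
  have hout' := k.cnt_double false h.equivalence (fun _ _ => hJ.le) hJ.not_rel
    (hJ.rel k.equivalence) (fun _ => hJ.of_rel)
  constructor
  · intro hh
    have hu := hh u
    rw [hin, hout', plusElt_cnt] at hu
    refine ⟨fun x hx => ?_, ?_, ?_⟩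
    · have := hh x
      rw [hin, hout x hx, plusElt_cnt] at this
      revert this
      cases h.neg x <;> cases k.neg x <;> simp
    · revert hu
      cases h.neg u <;> cases k.neg v <;> cases k.neg u <;> simp
    · revert hu
      cases h.neg u <;> cases k.neg v <;> cases k.neg u <;> simp
  · intro hh x
    by_cases hx : h.rel u x
    · rw [← (cls_eq_iff h.equivalence).2 hx, hin, hout', plusElt_cnt]
      have h1 := hh.on
      have h2 := hh.not_both
      revert h1 h2
      cases h.neg u <;> cases k.neg v <;> cases k.neg u <;> simp
    · rw [hin, hout x hx, plusElt_cnt, hh.off x hx]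
      cases h.neg x <;> simp

theorem sameComp_self (a b : Matching n) : SameComp a b b = SameCircle a b := by
  funext x y
  exact propext ⟨fun hh => hh.le (SameCircle.equivalence a b) (fun _ _ h => h) (fun _ _ h => h),
    sameComp_left⟩

/-- The generator `h_α` given by the arc `α` of `b` through `p`. -/
def decElt (b : Matching n) (p : Fin (2 * n)) : ArcBasis n where
  a := b
  b := b
  neg q := decide (q = p ∨ q = b.f p)
  neg_left q := by
    refine decide_eq_decide.2 ?_
    rw [or_comm]
    refine or_congr ⟨fun h => b.f_inj h, fun h => by rw [h]⟩ ⟨fun h => ?_, fun h => ?_⟩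
    · rw [← h, b.invol]
    · rw [h, b.invol]
  neg_right q := by
    refine decide_eq_decide.2 ?_
    rw [or_comm]
    refine or_congr ⟨fun h => b.f_inj h, fun h => by rw [h]⟩ ⟨fun h => ?_, fun h => ?_⟩
    · rw [← h, b.invol]
    · rw [h, b.invol]

theorem isMultGen_iff {g : ArcBasis n} : IsMultGen g ↔
    (Surgery g.a g.b ∧ g = plusElt g.a g.b) ∨ ∃ p, g = decElt g.a p := by
  refine or_congr (and_congr_right fun _ => ⟨fun h => ?_, fun h p => ?_⟩) ⟨?_, ?_⟩
  · exact ArcBasis.ext rfl rfl (funext h)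
  · rw [h]; rfl
  · rintro ⟨h1, p, h2⟩
    refine ⟨p, ArcBasis.ext rfl h1.symm (funext fun q => ?_)⟩
    rw [Bool.eq_iff_iff, h2, decElt, decide_eq_true_iff]
  · rintro ⟨p, h⟩
    have h1 : g.a = g.b := (congrArg ArcBasis.b h).symm
    refine ⟨h1, p, fun q => ?_⟩
    conv_lhs => rw [h]
    rw [decElt, decide_eq_true_iff]

open Classical in
theorem decElt_cnt (b : Matching n) (p : Fin (2 * n)) (a : Matching n) (x : Fin (2 * n)) :
    (decElt b p).cnt true (cls (SameCircle a b) x) = if SameCircle a b p x then 1 else 0 := by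
  have hE := SameCircle.equivalence a b
  have hle : ∀ x y, (decElt b p).rel x y → SameCircle a b x y := by
    intro x y h
    rcases sameCircle_self.1 h with rfl | rfl
    · exact .refl _ _ _
    · exact .right _ _ _
  have key : ((decElt b p).signed true).filter (· ⊆ cls (SameCircle a b) x)
      = if SameCircle a b p x then {cls (decElt b p).rel p} else ∅ := by
    ext C
    rw [Finset.mem_filter, mem_signed]
    constructor
    · rintro ⟨⟨y, rfl, h2⟩, h3⟩
      rw [cls_subset_cls_iff (decElt b p).equivalence hE hle] at h3
      rw [decElt, decide_eq_true_iff] at h2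
      have h4 : (decElt b p).rel p y := sameCircle_self.2 h2
      have h5 := (hle _ _ h4).trans h3.symm
      rw [if_pos h5, Finset.mem_singleton, cls_eq_iff (decElt b p).equivalence]
      exact h4.symm
    · split_ifs with hs
      · rw [Finset.mem_singleton]
        rintro rfl
        refine ⟨⟨p, rfl, decide_eq_true (.inl rfl)⟩, ?_⟩
        exact (cls_subset_cls_iff (decElt b p).equivalence hE hle).2 hs.symm
      · intro h; simp at h
  unfold ArcBasis.cnt
  rw [key]
  split_ifs <;> simp

open Classical in
-- The element `h_α` multiplies the circle containing `α` by `X`: the label `+` turns into `-`, and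
-- the label `-` gives zero.
theorem mulCoeff_dec {h k : ArcBasis n} (ha : h.a = k.a) (hb : h.b = k.b) (p : Fin (2 * n)) :
    mulCoeff h (decElt h.b p) k = if FlipRule h.rel p h.neg k.neg then 1 else 0 := by
  have hg : ∀ K ∈ comps h.a h.b (decElt h.b p).b, genus h.a h.b (decElt h.b p).b K = 0 :=
    fun K hK => genus_self hK
  have hcomp : SameComp h.a h.b (decElt h.b p).b = h.rel := sameComp_self _ _
  have hk : k.rel = h.rel := by unfold ArcBasis.rel; rw [ha, hb]
  refine mulCoeff_of_genus (g := decElt h.b p) ⟨rfl, ha.symm, hb.symm⟩ hg ?_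
  rw [hcomp]
  have hin : ∀ x, h.cnt true (cls h.rel x) = if h.neg x = true then 1 else 0 := fun x =>
    h.cnt_single true h.equivalence (fun _ _ h => h) (fun _ h => h)
  have hout : ∀ x, k.cnt false (cls h.rel x) = if k.neg x = false then 1 else 0 := fun x => by
    rw [← hk]
    exact k.cnt_single false k.equivalence (fun _ _ h => h) (fun _ h => h)
  have hgc := fun x => decElt_cnt h.b p h.a x
  simp only [hin, hout, hgc]
  constructor
  · intro hh
    have hp := hh p
    rw [if_pos (SameCircle.refl _ _ _)] at hp
    refine ⟨?_, ?_, fun x hx => ?_⟩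
    · revert hp
      cases h.neg p <;> cases k.neg p <;> simp
    · revert hp
      cases h.neg p <;> cases k.neg p <;> simp
    · have hx' := hh x
      rw [if_neg hx] at hx'
      revert hx'
      cases h.neg x <;> cases k.neg x <;> simp
  · intro hh x
    by_cases hx : h.rel p x
    · rw [if_pos hx, ← h.neg_of_sameCircle hx, ← k.neg_of_sameCircle (x := p) (show k.rel p x by rw [hk]; exact hx), hh.src,
        hh.tgt]
      simp
    · rw [if_neg hx, hh.off x hx]
      cases h.neg x <;> simp

theorem mulCoeff_idem {h k : ArcBasis n} :
    mulCoeff h (idemBasis h.b) k = if h = k then 1 else 0 := by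
  classical
  by_cases hc : k.a = h.a ∧ k.b = h.b
  · have hg : ∀ K ∈ comps h.a h.b (idemBasis h.b).b, genus h.a h.b (idemBasis h.b).b K = 0 :=
      fun K hK => genus_self hK
    have hcomp : SameComp h.a h.b (idemBasis h.b).b = h.rel := sameComp_self _ _
    have hk : k.rel = h.rel := by unfold ArcBasis.rel; rw [hc.1, hc.2]
    refine mulCoeff_of_genus (g := idemBasis h.b) ⟨rfl, hc.1, hc.2⟩ hg ?_
    rw [hcomp]
    have hin : ∀ x, h.cnt true (cls h.rel x) = if h.neg x = true then 1 else 0 := fun x =>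
      h.cnt_single true h.equivalence (fun _ _ h => h) (fun _ h => h)
    have hout : ∀ x, k.cnt false (cls h.rel x) = if k.neg x = false then 1 else 0 := fun x => by
      rw [← hk]
      exact k.cnt_single false k.equivalence (fun _ _ h => h) (fun _ h => h)
    have hgc := plusElt_cnt h.b h.b
    have hgc' : ∀ K, (idemBasis h.b).cnt true K = 0 := hgc
    simp only [hin, hout, hgc']
    constructor
    · intro hh
      refine ArcBasis.ext hc.1.symm hc.2.symm (funext fun x => ?_)
      have := hh x
      revert this
      cases h.neg x <;> cases k.neg x <;> simp
    · rintro rfl x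
      cases h.neg x <;> simp
  · unfold mulCoeff
    rw [if_neg, if_neg]
    · rintro rfl; exact hc ⟨rfl, rfl⟩
    · exact fun h => hc h.2

end Products

end BorderedKh
end

noncomputable section
namespace BorderedKh

/-! ## The generators of `B` as a graph on `β` -/

section EdgeGraph

variable {n : ℕ}

theorem RightEdge.a_eq {h k : ArcBasis n} (e : RightEdge h k) : h.a = k.a := by
  obtain ⟨g, -, hg⟩ := e
  unfold mulCoeff at hg
  by_contra hc
  exact hg (if_neg fun hh => hc hh.2.1.symm)

/-- `h ⟶ k` is a bridge generator of `B`. -/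
def RB (h k : ArcBasis n) : Prop := RightEdge h k ∧ h.b ≠ k.b

/-- `h ⟶ k` is a decoration generator of `B`. -/
def RD (h k : ArcBasis n) : Prop := RightEdge h k ∧ h.b = k.b

/-- `k` is obtained from `h` by decorating the circle of `p`. -/
structure DecAt (p : Fin (2 * n)) (h k : ArcBasis n) : Prop where
  a_eq : h.a = k.a
  b_eq : h.b = k.b
  rule : FlipRule h.rel p h.neg k.neg

theorem mulCoeff_ne {h g k : ArcBasis n} (h0 : mulCoeff h g k ≠ 0) :
    h.b = g.a ∧ k.a = h.a ∧ k.b = g.b := by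
  unfold mulCoeff at h0
  by_contra hc
  exact h0 (if_neg hc)

theorem decElt_isMultGen (b : Matching n) (p : Fin (2 * n)) : IsMultGen (decElt b p) :=
  isMultGen_iff.2 (.inr ⟨p, rfl⟩)

theorem plusElt_isMultGen {b b' : Matching n} (h : Surgery b b') : IsMultGen (plusElt b b') :=
  isMultGen_iff.2 (.inl ⟨h, rfl⟩)

theorem isMultGen_bridge {g : ArcBasis n} (hg : IsMultGen g) (hne : g.a ≠ g.b) :
    Surgery g.a g.b ∧ g = plusElt g.a g.b := by
  rcases isMultGen_iff.1 hg with h | ⟨p, h⟩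
  · exact h
  · exact absurd (congrArg ArcBasis.b h).symm hne

theorem isMultGen_dec {g : ArcBasis n} (hg : IsMultGen g) (he : g.a = g.b) :
    ∃ p, g = decElt g.a p := by
  rcases isMultGen_iff.1 hg with ⟨h, -⟩ | h
  · exact absurd he h.ne
  · exact h

/-- The multiplicative generator behind a bridge edge is determined by the two right matchings, so
the existential quantifier in `RightEdge` disappears. -/
theorem rb_iff {h k : ArcBasis n} :
    RB h k ↔ h.a = k.a ∧ Surgery h.b k.b ∧ mulCoeff h (plusElt h.b k.b) k ≠ 0 := by
  constructor
  · rintro ⟨⟨g, hg, h0⟩, hne⟩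
    have hc := mulCoeff_ne h0
    rw [hc.1, hc.2.2] at hne
    have := isMultGen_bridge hg hne
    rw [hc.1, hc.2.2]
    exact ⟨hc.2.1.symm, this.1, by rw [← this.2]; exact h0⟩
  · rintro ⟨h1, h2, h3⟩
    exact ⟨⟨_, plusElt_isMultGen h2, h3⟩, h2.ne⟩

/-- The arc of the multiplicative generator matters only through its circle, so a decoration can be
recorded by any point of that circle. -/
theorem rd_iff {h k : ArcBasis n} : RD h k ↔ ∃ p, DecAt p h k := by
  classical
  constructor
  · rintro ⟨⟨g, hg, h0⟩, he⟩
    have hc := mulCoeff_ne h0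
    have he' := he
    rw [hc.1, hc.2.2] at he'
    obtain ⟨p, hp⟩ := isMultGen_dec hg he'
    rw [hp, ← hc.1, mulCoeff_dec hc.2.1.symm he] at h0
    exact ⟨p, hc.2.1.symm, he, by by_contra hh; exact h0 (if_neg hh)⟩
  · rintro ⟨p, h1, h2, h3⟩
    refine ⟨⟨_, decElt_isMultGen h.b p, ?_⟩, h2⟩
    rw [mulCoeff_dec h1 h2, if_pos h3]
    exact one_ne_zero

theorem RB.a_eq {h k : ArcBasis n} (e : RB h k) : h.a = k.a := e.1.a_eq

theorem RB.surgery {h k : ArcBasis n} (e : RB h k) : Surgery h.b k.b := (rb_iff.1 e).2.1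

theorem rb_merge {h k : ArcBasis n} {u v : Fin (2 * n)} (hs : Surgery h.b k.b) (ha : h.a = k.a)
    (hJ : Joins h.rel k.rel u v) : RB h k ↔ MergeRule k.rel u v h.neg k.neg := by
  classical
  rw [rb_iff, mulCoeff_merge hs ha hJ]
  simp [hs, ha]

theorem rb_split {h k : ArcBasis n} {u v : Fin (2 * n)} (hs : Surgery h.b k.b) (ha : h.a = k.a)
    (hJ : Joins k.rel h.rel u v) : RB h k ↔ SplitRule h.rel u v h.neg k.neg := by
  classical
  rw [rb_iff, mulCoeff_split hs ha hJ]
  simp [hs, ha]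

/-- The circles of `h` and `k` under surgery. -/
theorem Surgery.joins_or {b b' : Matching n} (hs : Surgery b b') (a : Matching n) : ∃ u v,
    (Joins (SameCircle a b) (SameCircle a b') u v ∧
      ∀ r, b.f r ≠ b'.f r → SameCircle a b' u r) ∨
    (Joins (SameCircle a b') (SameCircle a b) u v ∧
      ∀ r, b.f r ≠ b'.f r → SameCircle a b u r) := by
  obtain ⟨p, q, h⟩ := surgery_iff.1 hs
  have key : ∀ r, b.f r ≠ b'.f r → r = p ∨ r = q ∨ r = b.f p ∨ r = b.f q := by
    intro r hr
    by_contra hc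
    simp only [not_or] at hc
    exact hr (h.off r hc.1 hc.2.1 hc.2.2.1 hc.2.2.2).symm
  have gen : ∀ {E : Fin (2 * n) → Fin (2 * n) → Prop}, Equivalence E → E p q → E p (b.f p) →
      E q (b.f q) → ∀ r, b.f r ≠ b'.f r → E p r := by
    intro E hE h1 h2 h3 r hr
    rcases key r hr with rfl | rfl | rfl | rfl
    exacts [hE.refl _, h1, h2, hE.trans h1 h3]
  rcases h.joins_or a with hJ | hJ
  · refine ⟨p, q, .inl ⟨hJ, gen (SameCircle.equivalence _ _) (hJ.rel (SameCircle.equivalence _ _))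
      (hJ.le (.right _ _ _)) (hJ.le (.right _ _ _))⟩⟩
  · refine ⟨p, b.f p, .inr ⟨hJ, gen (SameCircle.equivalence _ _) ?_ (.right _ _ _)
      (.right _ _ _)⟩⟩
    refine hJ.le ?_
    rw [← h.eq]
    exact .right _ _ _

/-! ### Degrees -/

/-- Sending a circle to the circle of `k` that contains it is a bijection on circles labelled `s`,
because the label `s` on the joined circle comes from exactly one of the two circles. For merges
this applies to `-`, and for splits, read backwards, to `+`. -/
theorem card_signed_of_joins {h k : ArcBasis n} {u v : Fin (2 * n)} (s : Bool)
    (hJ : Joins h.rel k.rel u v)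
    (hoff : ∀ x, ¬ k.rel u x → (k.neg x = s ↔ h.neg x = s))
    (hon : k.neg u = s ↔ (h.neg u = s ∨ h.neg v = s)) (hnb : ¬ (h.neg u = s ∧ h.neg v = s)) :
    (h.signed s).card = (k.signed s).card := by
  classical
  let φ : Finset (Fin (2 * n)) → Finset (Fin (2 * n)) := fun C => C.biUnion (cls k.rel)
  have hφ : ∀ x, φ (cls h.rel x) = cls k.rel x := by
    intro x
    ext y
    simp only [φ, Finset.mem_biUnion, mem_cls]
    exact ⟨fun ⟨z, h1, h2⟩ => (hJ.le h1).trans h2, fun h1 => ⟨x, .refl _ _ _, h1⟩⟩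
  refine Finset.card_bij (fun C _ => φ C) ?_ ?_ ?_
  · intro C hC
    obtain ⟨x, rfl, hx⟩ := mem_signed.1 hC
    rw [hφ]
    refine mem_signed.2 ⟨x, rfl, ?_⟩
    by_cases hc : k.rel u x
    · rw [← k.neg_of_sameCircle hc, hon]
      rcases hJ.of_rel hc with h1 | h1
      · exact .inl (by rw [h.neg_of_sameCircle h1, hx])
      · exact .inr (by rw [h.neg_of_sameCircle h1, hx])
    · exact (hoff x hc).2 hx
  · intro C hC C' hC' heq
    obtain ⟨x, rfl, hx⟩ := mem_signed.1 hC
    obtain ⟨y, rfl, hy⟩ := mem_signed.1 hC'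
    rw [hφ, hφ, cls_eq_iff k.equivalence] at heq
    rw [cls_eq_iff h.equivalence]
    by_cases hc : k.rel u x
    · have hc' := SameCircle.trans hc heq
      rcases hJ.of_rel hc with h1 | h1 <;> rcases hJ.of_rel hc' with h2 | h2
      · exact h1.symm.trans h2
      · exact absurd ⟨by rw [h.neg_of_sameCircle h1, hx], by rw [h.neg_of_sameCircle h2, hy]⟩ hnb
      · exact absurd ⟨by rw [h.neg_of_sameCircle h2, hy], by rw [h.neg_of_sameCircle h1, hx]⟩ hnb
      · exact h1.symm.trans h2
    · exact hJ.of_not_rel h.equivalence k.equivalence hc heq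
  · intro C hC
    obtain ⟨x, rfl, hx⟩ := mem_signed.1 hC
    by_cases hc : k.rel u x
    · rw [← k.neg_of_sameCircle hc, hon] at hx
      rcases hx with hx | hx
      · refine ⟨cls h.rel u, mem_signed.2 ⟨u, rfl, hx⟩, ?_⟩
        rw [hφ]
        exact (cls_eq_iff k.equivalence).2 hc
      · refine ⟨cls h.rel v, mem_signed.2 ⟨v, rfl, hx⟩, ?_⟩
        rw [hφ]
        exact (cls_eq_iff k.equivalence).2 ((hJ.rel h.equivalence).symm.trans hc)
    · exact ⟨cls h.rel x, mem_signed.2 ⟨x, rfl, (hoff x hc).1 hx⟩, hφ x⟩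

theorem card_circles_of_joins {a b a' b' : Matching n} {u v : Fin (2 * n)}
    (hJ : Joins (SameCircle a b) (SameCircle a' b') u v) :
    (circles a b).card = (circles a' b').card + 1 := by
  classical
  have hE := SameCircle.equivalence a b
  have hE' := SameCircle.equivalence a' b'
  let φ : Finset (Fin (2 * n)) → Finset (Fin (2 * n)) :=
    fun C => C.biUnion (cls (SameCircle a' b'))
  have hφ : ∀ x, φ (cls (SameCircle a b) x) = cls (SameCircle a' b') x := by
    intro x
    ext y
    simp only [φ, Finset.mem_biUnion, mem_cls]
    exact ⟨fun ⟨z, h1, h2⟩ => (hJ.le h1).trans h2, fun h1 => ⟨x, .refl _ _ _, h1⟩⟩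
  -- The circle of `v` is left out, so that the circle of `u` alone represents the joined circle.
  have hmem : cls (SameCircle a b) v ∈ circles a b := cls_mem_classes v
  rw [← Finset.card_erase_add_one hmem, Nat.add_right_cancel_iff]
  refine Finset.card_bij (fun C _ => φ C) ?_ ?_ ?_
  · intro C hC
    obtain ⟨x, rfl⟩ := mem_classes.1 (Finset.mem_of_mem_erase hC)
    rw [hφ]
    exact cls_mem_classes x
  · intro C hC C' hC' heq
    obtain ⟨x, rfl⟩ := mem_classes.1 (Finset.mem_of_mem_erase hC)
    obtain ⟨y, rfl⟩ := mem_classes.1 (Finset.mem_of_mem_erase hC')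
    have h1 := Finset.ne_of_mem_erase hC
    have h2 := Finset.ne_of_mem_erase hC'
    rw [Ne, cls_eq_iff hE] at h1 h2
    rw [hφ, hφ, cls_eq_iff hE', hJ.iff] at heq
    rw [cls_eq_iff hE]
    rcases heq with h | ⟨-, h⟩ | ⟨h, -⟩
    · exact h
    · exact absurd h.symm h2
    · exact absurd h h1
  · intro C hC
    obtain ⟨x, rfl⟩ := mem_classes.1 hC
    by_cases hc : SameCircle a b x v
    · refine ⟨cls (SameCircle a b) u, Finset.mem_erase.2 ⟨?_, cls_mem_classes u⟩, ?_⟩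
      · rw [Ne, cls_eq_iff hE]
        exact hJ.not_rel
      · rw [hφ, cls_eq_iff hE']
        exact (hJ.rel hE).trans (hJ.le hc.symm)
    · exact ⟨cls (SameCircle a b) x, Finset.mem_erase.2 ⟨by rw [Ne, cls_eq_iff hE]; exact hc,
        cls_mem_classes x⟩, hφ x⟩

theorem ArcBasis.card_circles (h : ArcBasis n) :
    (circles h.a h.b).card = (h.signed true).card + (h.signed false).card := by
  classical
  rw [← Finset.card_union_of_disjoint]
  · congr 1
    ext C
    rw [Finset.mem_union, mem_signed, mem_signed, circles_eq, mem_classes]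
    constructor
    · rintro ⟨x, rfl⟩
      cases hx : h.neg x
      · exact .inr ⟨x, rfl, hx⟩
      · exact .inl ⟨x, rfl, hx⟩
    · rintro (⟨x, rfl, -⟩ | ⟨x, rfl, -⟩) <;> exact ⟨x, rfl⟩
  · rw [Finset.disjoint_left]
    intro C h1 h2
    obtain ⟨x, rfl, hx⟩ := mem_signed.1 h1
    obtain ⟨y, hxy, hy⟩ := mem_signed.1 h2
    rw [cls_eq_iff h.equivalence] at hxy
    rw [h.neg_of_sameCircle hxy, hx] at hy
    exact absurd hy Bool.noConfusion

/-- A merge loses a circle and keeps the number of minus signs. A split gains a circle and keeps the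
number of plus signs, so it gains a minus sign. Both raise the degree by 1. -/
theorem RB.deg_eq {h k : ArcBasis n} (e : RB h k) : k.deg = h.deg + 1 := by
  have ha := e.a_eq
  have hs := e.surgery
  obtain ⟨u, v, ⟨hJ, -⟩ | ⟨hJ, -⟩⟩ := hs.joins_or h.a
  · have hJ' : Joins h.rel k.rel u v := by
      have : k.rel = SameCircle h.a k.b := by rw [ha]
      rw [this]; exact hJ
    have hr := (rb_merge hs ha hJ').1 e
    have h1 := card_circles_of_joins hJ'
    have h2 := card_signed_of_joins true hJ' (fun x hx => by rw [hr.off x hx])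
      (by rw [hr.on, Bool.or_eq_true]) hr.not_both
    unfold ArcBasis.deg
    omega
  · have hJ' : Joins k.rel h.rel u v := by
      have : k.rel = SameCircle h.a k.b := by rw [ha]
      rw [this]; exact hJ
    have hr := (rb_split hs ha hJ').1 e
    have h1 := card_circles_of_joins hJ'
    have h2 := card_signed_of_joins false hJ' (fun x hx => by rw [hr.off x hx])
      (by rw [hr.on, Bool.and_eq_false_iff]) hr.not_both
    have h3 := h.card_circles
    have h4 := k.card_circles
    unfold ArcBasis.deg
    omega

theorem DecAt.rel_eq {p : Fin (2 * n)} {h k : ArcBasis n} (e : DecAt p h k) : k.rel = h.rel := by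
  unfold ArcBasis.rel
  rw [e.a_eq, e.b_eq]

theorem DecAt.neg_src {p : Fin (2 * n)} {h k : ArcBasis n} (e : DecAt p h k) {x} (hx : h.rel p x) :
    h.neg x = false := by rw [← h.neg_of_sameCircle hx]; exact e.rule.src

theorem DecAt.neg_tgt {p : Fin (2 * n)} {h k : ArcBasis n} (e : DecAt p h k) {x} (hx : h.rel p x) :
    k.neg x = true := by
  rw [← k.neg_of_sameCircle (x := p) (show k.rel p x by rw [e.rel_eq]; exact hx)]
  exact e.rule.tgt

theorem DecAt.deg_eq {p : Fin (2 * n)} {h k : ArcBasis n} (e : DecAt p h k) :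
    k.deg = h.deg + 2 := by
  classical
  have key : k.signed true = insert (cls h.rel p) (h.signed true) := by
    ext C
    rw [Finset.mem_insert, mem_signed, mem_signed, e.rel_eq]
    constructor
    · rintro ⟨x, rfl, hx⟩
      by_cases hc : h.rel p x
      · exact .inl ((cls_eq_iff h.equivalence).2 hc).symm
      · exact .inr ⟨x, rfl, by rw [← e.rule.off x hc, hx]⟩
    · rintro (rfl | ⟨x, rfl, hx⟩)
      · exact ⟨p, rfl, e.rule.tgt⟩
      · refine ⟨x, rfl, ?_⟩
        by_cases hc : h.rel p x
        · exact e.neg_tgt hc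
        · rw [e.rule.off x hc, hx]
  have hn : cls h.rel p ∉ h.signed true := by
    intro hh
    obtain ⟨x, hx, hx'⟩ := mem_signed.1 hh
    rw [cls_eq_iff h.equivalence] at hx
    rw [e.neg_src hx.symm] at hx'
    exact absurd hx' Bool.noConfusion
  have hcard := congrArg Finset.card key
  rw [Finset.card_insert_of_notMem hn] at hcard
  have hc : circles k.a k.b = circles h.a h.b := by rw [e.a_eq, e.b_eq]
  unfold ArcBasis.deg
  rw [hc, hcard]
  push_cast
  ring

theorem RD.deg_eq {h k : ArcBasis n} (e : RD h k) : k.deg = h.deg + 2 := by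
  obtain ⟨p, hp⟩ := rd_iff.1 e
  exact hp.deg_eq

theorem RightEdge.deg_lt {h k : ArcBasis n} (e : RightEdge h k) : h.deg < k.deg := by
  by_cases hb : h.b = k.b
  · have := RD.deg_eq ⟨e, hb⟩
    omega
  · have := RB.deg_eq ⟨e, hb⟩
    omega

theorem two_le_card_circle (a b : Matching n) {C : Finset (Fin (2 * n))} (hC : C ∈ circles a b) :
    2 ≤ C.card := by
  obtain ⟨x, rfl⟩ := mem_classes.1 hC
  have h : ({x, a.f x} : Finset (Fin (2 * n))) ⊆ cls (SameCircle a b) x := by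
    intro y hy
    rw [Finset.mem_insert, Finset.mem_singleton] at hy
    rw [mem_cls]
    rcases hy with rfl | rfl
    · exact .refl _ _ _
    · exact .left _ _ _
  have := Finset.card_le_card h
  rwa [Finset.card_pair (a.ne x).symm] at this

theorem sum_card_circles (a b : Matching n) : ∑ C ∈ circles a b, C.card = 2 * n := by
  classical
  have h := Finset.card_eq_sum_card_fiberwise (f := cls (SameCircle a b)) (s := Finset.univ)
    (t := circles a b) (fun x _ => cls_mem_classes x)
  rw [Finset.card_univ, Fintype.card_fin] at h
  refine Eq.trans (Finset.sum_congr rfl fun C hC => ?_) h.symm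
  obtain ⟨x, rfl⟩ := mem_classes.1 hC
  congr 1
  ext y
  rw [mem_cls, Finset.mem_filter, cls_eq_iff (SameCircle.equivalence a b)]
  exact ⟨fun h => ⟨Finset.mem_univ _, h.symm⟩, fun h => h.2.symm⟩

/-- Every circle contains at least two of the `2n` points, so there are at most `n` circles. Degree
zero forces equality and no minus sign; when all circles have two points, the two matchings
coincide. -/
theorem ArcBasis.eq_idem_of_deg {h : ArcBasis n} (hd : h.deg = 0) : h = idemBasis h.b := by
  have h1 := sum_card_circles h.a h.b
  have h2 : ∑ C ∈ circles h.a h.b, 2 ≤ ∑ C ∈ circles h.a h.b, C.card :=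
    Finset.sum_le_sum fun C hC => two_le_card_circle _ _ hC
  have h2' := h2
  rw [h1, Finset.sum_const, smul_eq_mul] at h2'
  unfold ArcBasis.deg at hd
  have h3 : (h.signed true).card = 0 := by omega
  have h4 : (circles h.a h.b).card = n := by omega
  have h5 : ∀ C ∈ circles h.a h.b, 2 = C.card := by
    refine (Finset.sum_eq_sum_iff_of_le fun C hC => two_le_card_circle _ _ hC).1 ?_
    rw [h1, Finset.sum_const, smul_eq_mul, h4, mul_comm]
  have hab : h.a = h.b := by
    refine Matching.ext (funext fun x => ?_)
    by_contra hne
    have hx := h5 _ (cls_mem_classes (E := SameCircle h.a h.b) x)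
    have hsub : ({x, h.a.f x, h.b.f x} : Finset (Fin (2 * n))) ⊆ cls (SameCircle h.a h.b) x := by
      intro y hy
      simp only [Finset.mem_insert, Finset.mem_singleton] at hy
      rw [mem_cls]
      rcases hy with rfl | rfl | rfl
      exacts [.refl _ _ _, .left _ _ _, .right _ _ _]
    have := Finset.card_le_card hsub
    rw [Finset.card_eq_three.2 ⟨x, h.a.f x, h.b.f x, (h.a.ne x).symm, (h.b.ne x).symm, hne, rfl⟩]
      at this
    omega
  refine ArcBasis.ext hab rfl (funext fun x => ?_)
  change h.neg x = false
  by_contra hc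
  rw [Bool.not_eq_false] at hc
  have : cls h.rel x ∈ h.signed true := mem_signed.2 ⟨x, rfl, hc⟩
  rw [Finset.card_eq_zero.1 h3] at this
  exact absurd this (Finset.notMem_empty _)

theorem idemBasis_deg (a : Matching n) : (idemBasis a).deg = 0 := by
  have h1 := sum_card_circles a a
  have h2 : ∀ C ∈ circles a a, C.card = 2 := by
    intro C hC
    obtain ⟨x, rfl⟩ := mem_classes.1 hC
    have : cls (SameCircle a a) x = {x, a.f x} := by
      ext y
      rw [mem_cls, sameCircle_self, Finset.mem_insert, Finset.mem_singleton]
    rw [this, Finset.card_pair (a.ne x).symm]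
  rw [Finset.sum_congr rfl h2, Finset.sum_const, smul_eq_mul] at h1
  have h3 : ((idemBasis a).signed true).card = 0 := by
    rw [Finset.card_eq_zero, Finset.eq_empty_iff_forall_notMem]
    intro C hC
    obtain ⟨x, -, hx⟩ := mem_signed.1 hC
    exact absurd hx Bool.noConfusion
  unfold ArcBasis.deg
  rw [h3]
  change (n : ℤ) - ((circles a a).card : ℤ) + 2 * ((0 : ℕ) : ℤ) = 0
  omega

end EdgeGraph

end BorderedKh
end

noncomputable section
namespace BorderedKh

/-! ## Decorations and surgeries -/

/-! ### Labels under decorations, merges and splits -/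

section LabelRules

variable {α : Type*} {E E' : α → α → Prop} {u v x y : α} {N₁ N₃ M M' : α → Bool}

/-- `N` is constant on the classes of `E`. -/
def ConstOn (E : α → α → Prop) (N : α → Bool) : Prop := ∀ x y, E x y → N x = N y

/-- The labelling with all signs reversed. -/
def negLabel (N : α → Bool) : α → Bool := fun x => !N x

@[simp] theorem negLabel_negLabel (N : α → Bool) : negLabel (negLabel N) = N := by
  funext x; simp [negLabel]

theorem ConstOn.negLabel {N : α → Bool} (h : ConstOn E N) : ConstOn E (negLabel N) := by
  intro x y hxy
  unfold BorderedKh.negLabel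
  rw [h x y hxy]

theorem FlipRule.negLabel {N N' : α → Bool} (h : FlipRule E x N N') :
    FlipRule E x (negLabel N') (negLabel N) := by
  refine ⟨?_, ?_, fun y hy => ?_⟩ <;> unfold BorderedKh.negLabel
  · rw [h.tgt]; rfl
  · rw [h.src]; rfl
  · rw [h.off y hy]

/-- The self-duality of the Frobenius algebra `ℤ[X]/X²` which exchanges `1` and `X`: reversing all
signs and the direction of time turns a split into a merge. The statements about splits below are
those about merges read through this duality. -/
theorem SplitRule.negLabel {N N' : α → Bool} (h : SplitRule E u v N N') :
    MergeRule E u v (negLabel N') (negLabel N) := by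
  refine ⟨fun x hx => ?_, ?_, ?_⟩ <;> unfold BorderedKh.negLabel
  · rw [h.off x hx]
  · rw [h.on, Bool.not_and]
  · have := h.not_both
    simpa using this

theorem MergeRule.negLabel {N N' : α → Bool} (h : MergeRule E u v N N') :
    SplitRule E u v (negLabel N') (negLabel N) := by
  refine ⟨fun x hx => ?_, ?_, ?_⟩ <;> unfold BorderedKh.negLabel
  · rw [h.off x hx]
  · rw [h.on, Bool.not_or]
  · have := h.not_both
    simpa using this

theorem FlipRule.of_rel {N N' : α → Bool} (hE : Equivalence E) (hN : ConstOn E N)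
    (hN' : ConstOn E N') (h : FlipRule E x N N') (hxy : E x y) : FlipRule E y N N' :=
  ⟨by rw [← hN _ _ hxy]; exact h.src, by rw [← hN' _ _ hxy]; exact h.tgt,
    fun z hz => h.off z fun hxz => hz (hE.trans (hE.symm hxy) hxz)⟩

theorem FlipRule.unique {N N' N'' : α → Bool} (hN' : ConstOn E N') (hN'' : ConstOn E N'')
    (h : FlipRule E x N N') (h' : FlipRule E x N N'') : N' = N'' := by
  funext y
  by_cases hy : E x y
  · rw [← hN' _ _ hy, ← hN'' _ _ hy, h.tgt, h'.tgt]
  · rw [h.off y hy, h'.off y hy]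

theorem FlipRule.unique_src {N N' N'' : α → Bool} (hN' : ConstOn E N') (hN'' : ConstOn E N'')
    (h : FlipRule E x N' N) (h' : FlipRule E x N'' N) : N' = N'' := by
  have := FlipRule.unique hN'.negLabel hN''.negLabel h.negLabel h'.negLabel
  rw [← negLabel_negLabel N', this, negLabel_negLabel]

theorem MergeRule.unique {N N' N'' : α → Bool} (hN' : ConstOn E N') (hN'' : ConstOn E N'')
    (h : MergeRule E u v N N') (h' : MergeRule E u v N N'') : N' = N'' := by
  funext y
  by_cases hy : E u y
  · rw [← hN' _ _ hy, ← hN'' _ _ hy, h.on, h'.on]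
  · rw [h.off y hy, h'.off y hy]

theorem SplitRule.unique_src {N N' N'' : α → Bool} (hN' : ConstOn E N') (hN'' : ConstOn E N'')
    (h : SplitRule E u v N' N) (h' : SplitRule E u v N'' N) : N' = N'' := by
  have := MergeRule.unique hN'.negLabel hN''.negLabel h.negLabel h'.negLabel
  rw [← negLabel_negLabel N', this, negLabel_negLabel]

/-- The merge is linear over `X`. If `x` lies on the merged circle, both inputs of `N₁` must be `1`:
one because it gets decorated, the other because otherwise the merge after the decoration would be
`X · X = 0`. -/
theorem merge_of_flip_merge (hJ : Joins E E' u v) (hE : Equivalence E) (hE' : Equivalence E')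
    (h₁ : ConstOn E N₁) (hM : ConstOn E M) (h₃ : ConstOn E' N₃) (hM' : ConstOn E' M')
    (hf : FlipRule E x N₁ M) (hm : MergeRule E' u v M N₃) (hf' : FlipRule E' x M' N₃) :
    MergeRule E' u v N₁ M' := by
  by_cases hx : E' u x
  · have h3 : N₃ u = true := by rw [h₃ u x hx]; exact hf'.tgt
    have hmu : M' u = false := by rw [hM' u x hx]; exact hf'.src
    have hon := hm.on
    have hnb := hm.not_both
    have key : N₁ u = false ∧ N₁ v = false := by
      rcases hJ.of_rel hx with hc | hc
      · have h1 : N₁ u = false := by rw [h₁ u x hc]; exact hf.src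
        have h2 : M u = true := by rw [hM u x hc]; exact hf.tgt
        have h4 : M v = N₁ v := hf.off v fun hh => hJ.not_rel (hE.trans hc hh)
        refine ⟨h1, ?_⟩
        cases hv : N₁ v
        · rfl
        · exact absurd ⟨h2, h4.trans hv⟩ hnb
      · have h1 : N₁ v = false := by rw [h₁ v x hc]; exact hf.src
        have h2 : M v = true := by rw [hM v x hc]; exact hf.tgt
        have h4 : M u = N₁ u := hf.off u fun hh => hJ.not_rel (hE.symm (hE.trans hc hh))
        refine ⟨?_, h1⟩
        cases hv : N₁ u
        · rfl
        · exact absurd ⟨h4.trans hv, h2⟩ hnb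
    refine ⟨fun y hy => ?_, by rw [hmu, key.1, key.2]; rfl, by rw [key.1]; simp⟩
    have hxy : ¬ E' x y := fun hh => hy (hE'.trans hx hh)
    rw [← hf'.off y hxy, hm.off y hy, hf.off y fun hh => hxy (hJ.le hh)]
  · have hxu : ¬ E' x u := fun hh => hx (hE'.symm hh)
    have hxv : ¬ E' x v := fun hh => hx (hE'.trans (hJ.rel hE) (hE'.symm hh))
    have e1 : M u = N₁ u := hf.off u fun hh => hxu (hJ.le hh)
    have e2 : M v = N₁ v := hf.off v fun hh => hxv (hJ.le hh)
    refine ⟨fun y hy => ?_, by rw [← hf'.off u hxu, hm.on, e1, e2], by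
      rw [← e1, ← e2]; exact hm.not_both⟩
    by_cases hxy : E' x y
    · rw [← hM' x y hxy, hf'.src,
        ← h₁ x y ((hJ.iff_of_not_rel hE hE' hx).1 hxy), hf.src]
    · rw [← hf'.off y hxy, hm.off y hy, hf.off y fun hh => hxy (hJ.le hh)]

/-- This makes the missing vertex of the square exist: the circle of `x` ends with label `-`, so its
decoration can be undone after the merge. -/
theorem neg_of_flip_merge (hJ : Joins E E' u v) (hM : ConstOn E M) (h₃ : ConstOn E' N₃)
    (hf : FlipRule E x N₁ M) (hm : MergeRule E' u v M N₃) : N₃ x = true := by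
  by_cases hx : E' u x
  · rw [← h₃ u x hx, hm.on, Bool.or_eq_true]
    rcases hJ.of_rel hx with hc | hc
    · exact .inl (by rw [hM u x hc]; exact hf.tgt)
    · exact .inr (by rw [hM v x hc]; exact hf.tgt)
  · rw [hm.off x hx, hf.tgt]

/-- If `x` lies on the merged circle, the product is `1` before the decoration, so both inputs are
`1`. Decorating one input first makes exactly one of them `X`, and the merge is still allowed. -/
theorem merge_of_merge_flip (hJ : Joins E E' u v) (hE : Equivalence E) (hE' : Equivalence E')
    (hM : ConstOn E M) (h₃ : ConstOn E' N₃) (hM' : ConstOn E' M')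
    (hm : MergeRule E' u v N₁ M') (hf' : FlipRule E' x M' N₃) (hf : FlipRule E x N₁ M) :
    MergeRule E' u v M N₃ := by
  by_cases hx : E' u x
  · have h3 : N₃ u = true := by rw [h₃ u x hx]; exact hf'.tgt
    have hmu : M' u = false := by rw [hM' u x hx]; exact hf'.src
    have hon := hm.on
    rw [hmu, eq_comm, Bool.or_eq_false_iff] at hon
    have key : (M u = true ∧ M v = false) ∨ (M u = false ∧ M v = true) := by
      rcases hJ.of_rel hx with hc | hc
      · refine .inl ⟨by rw [hM u x hc]; exact hf.tgt, ?_⟩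
        rw [hf.off v fun hh => hJ.not_rel (hE.trans hc hh), hon.2]
      · refine .inr ⟨?_, by rw [hM v x hc]; exact hf.tgt⟩
        rw [hf.off u fun hh => hJ.not_rel (hE.symm (hE.trans hc hh)), hon.1]
    refine ⟨fun y hy => ?_, ?_, ?_⟩
    · have hxy : ¬ E' x y := fun hh => hy (hE'.trans hx hh)
      rw [hf'.off y hxy, hm.off y hy, hf.off y fun hh => hxy (hJ.le hh)]
    · rw [h3]
      rcases key with ⟨k1, k2⟩ | ⟨k1, k2⟩ <;> rw [k1, k2] <;> rfl
    · rcases key with ⟨k1, k2⟩ | ⟨k1, k2⟩ <;> rw [k1, k2] <;> simp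
  · have hxu : ¬ E' x u := fun hh => hx (hE'.symm hh)
    have hxv : ¬ E' x v := fun hh => hx (hE'.trans (hJ.rel hE) (hE'.symm hh))
    have e1 : M u = N₁ u := hf.off u fun hh => hxu (hJ.le hh)
    have e2 : M v = N₁ v := hf.off v fun hh => hxv (hJ.le hh)
    refine ⟨fun y hy => ?_, by rw [hf'.off u hxu, hm.on, e1, e2], by
      rw [e1, e2]; exact hm.not_both⟩
    by_cases hxy : E' x y
    · rw [← h₃ x y hxy, hf'.tgt, ← hM x y ((hJ.iff_of_not_rel hE hE' hx).1 hxy), hf.tgt]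
    · rw [hf'.off y hxy, hm.off y hy, hf.off y fun hh => hxy (hJ.le hh)]

theorem neg_of_merge_flip (hJ : Joins E E' u v) (h₁ : ConstOn E N₁) (hM' : ConstOn E' M')
    (hm : MergeRule E' u v N₁ M') (hf' : FlipRule E' x M' N₃) : N₁ x = false := by
  by_cases hx : E' u x
  · have hon := hm.on
    rw [hM' u x hx, hf'.src, eq_comm, Bool.or_eq_false_iff] at hon
    rcases hJ.of_rel hx with hc | hc
    · rw [← h₁ u x hc]; exact hon.1
    · rw [← h₁ v x hc]; exact hon.2
  · rw [← hm.off x hx]; exact hf'.src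

theorem split_of_flip_split (hJ : Joins E' E u v) (hE : Equivalence E) (hE' : Equivalence E')
    (h₁ : ConstOn E N₁) (hM : ConstOn E M) (hM' : ConstOn E' M')
    (hf : FlipRule E x N₁ M) (hm : SplitRule E u v M N₃) (hf' : FlipRule E' x M' N₃) :
    SplitRule E u v N₁ M' := by
  have := (merge_of_merge_flip hJ hE' hE hM'.negLabel h₁.negLabel hM.negLabel
    hm.negLabel hf.negLabel hf'.negLabel).negLabel
  simpa using this

theorem split_of_split_flip (hJ : Joins E' E u v) (hE : Equivalence E) (hE' : Equivalence E')
    (h₁ : ConstOn E N₁) (hM : ConstOn E M) (h₃ : ConstOn E' N₃) (hM' : ConstOn E' M')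
    (hm : SplitRule E u v N₁ M') (hf' : FlipRule E' x M' N₃) (hf : FlipRule E x N₁ M) :
    SplitRule E u v M N₃ := by
  have := (merge_of_flip_merge hJ hE' hE h₃.negLabel hM'.negLabel h₁.negLabel hM.negLabel
    hf'.negLabel hm.negLabel hf.negLabel).negLabel
  simpa using this

theorem neg_of_flip_split (hJ : Joins E' E u v) (hM : ConstOn E M) (h₃ : ConstOn E' N₃)
    (hf : FlipRule E x N₁ M) (hm : SplitRule E u v M N₃) : N₃ x = true := by
  have := neg_of_merge_flip hJ h₃.negLabel hM.negLabel hm.negLabel hf.negLabel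
  simpa [negLabel] using this

theorem neg_of_split_flip (hJ : Joins E' E u v) (h₁ : ConstOn E N₁) (hM' : ConstOn E' M')
    (hm : SplitRule E u v N₁ M') (hf' : FlipRule E' x M' N₃) : N₁ x = false := by
  have := neg_of_flip_merge hJ hM'.negLabel h₁.negLabel hf'.negLabel hm.negLabel
  simpa [negLabel] using this

/-- This and the next lemma determine which circles can be decorated before the merge: only the
circle of `x` if it is away from the merge, and only one of the two joined circles otherwise. -/
theorem flip_circle_of_off (hx : ¬ E' u x) (hm : MergeRule E' u v N₁ M)
    (hf : FlipRule E' x M N₃) {M'' : α → Bool} (hf' : FlipRule E y N₁ M'')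
    (hm' : MergeRule E' u v M'' N₃) : E y x := by
  by_contra hc
  have h1 := hm'.off x hx
  rw [hf'.off x hc, ← hm.off x hx, hf.src, hf.tgt] at h1
  exact absurd h1 Bool.noConfusion

theorem flip_circle_of_on (hx : E' u x) (hM : ConstOn E' M) (h₃ : ConstOn E' N₃)
    (hm : MergeRule E' u v N₁ M) (hf : FlipRule E' x M N₃) {M'' : α → Bool}
    (hf' : FlipRule E y N₁ M'') (hm' : MergeRule E' u v M'' N₃) : E y u ∨ E y v := by
  by_contra hc
  rw [not_or] at hc
  have h0 := hm.on
  rw [hM u x hx, hf.src] at h0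
  have h1 := hm'.on
  rw [h₃ u x hx, hf.tgt, hf'.off u hc.1, hf'.off v hc.2, ← h0] at h1
  exact absurd h1 Bool.noConfusion

end LabelRules

/-! ### Paths formed by a bridge and a decoration -/

section Paths

variable {n : ℕ}

theorem ArcBasis.constOn (h : ArcBasis n) : ConstOn h.rel h.neg :=
  fun _ _ hxy => h.neg_of_sameCircle hxy

open Classical in
/-- `h` with the circle of `p` labelled by `s`. -/
def ArcBasis.relabel (h : ArcBasis n) (p : Fin (2 * n)) (s : Bool) : ArcBasis n where
  a := h.a
  b := h.b
  neg x := if h.rel p x then s else h.neg x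
  neg_left x := by
    have : h.rel p (h.a.f x) ↔ h.rel p x :=
      ⟨fun k => k.trans (SameCircle.left _ _ _).symm, fun k => k.trans (.left _ _ _)⟩
    simp only [this, h.neg_left]
  neg_right x := by
    have : h.rel p (h.b.f x) ↔ h.rel p x :=
      ⟨fun k => k.trans (SameCircle.right _ _ _).symm, fun k => k.trans (.right _ _ _)⟩
    simp only [this, h.neg_right]

theorem DecAt.eq {p : Fin (2 * n)} {h k k' : ArcBasis n} (e : DecAt p h k) (e' : DecAt p h k') :
    k = k' := by
  refine ArcBasis.ext (e.a_eq.symm.trans e'.a_eq) (e.b_eq.symm.trans e'.b_eq) ?_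
  have h1 := k.constOn
  have h2 := k'.constOn
  rw [e.rel_eq] at h1
  rw [e'.rel_eq] at h2
  exact FlipRule.unique h1 h2 e.rule e'.rule

theorem DecAt.eq_src {p : Fin (2 * n)} {h h' k : ArcBasis n} (e : DecAt p h k)
    (e' : DecAt p h' k) : h = h' := by
  refine ArcBasis.ext (e.a_eq.trans e'.a_eq.symm) (e.b_eq.trans e'.b_eq.symm) ?_
  have h1 := h.constOn
  have h2 := h'.constOn
  rw [← e.rel_eq] at h1
  rw [← e'.rel_eq] at h2
  have r1 := e.rule
  have r2 := e'.rule
  rw [← e.rel_eq] at r1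
  rw [← e'.rel_eq] at r2
  exact FlipRule.unique_src h1 h2 r1 r2

theorem decAt_relabel {p : Fin (2 * n)} {h : ArcBasis n} (hp : h.neg p = false) :
    DecAt p h (h.relabel p true) :=
  ⟨rfl, rfl, hp, if_pos (SameCircle.refl _ _ _), fun _ hx => if_neg hx⟩

theorem relabel_decAt {p : Fin (2 * n)} {k : ArcBasis n} (hp : k.neg p = true) :
    DecAt p (k.relabel p false) k :=
  ⟨rfl, rfl, if_pos (SameCircle.refl _ _ _), hp, fun _ hx => (if_neg hx).symm⟩

theorem DecAt.of_rel {p q : Fin (2 * n)} {h k : ArcBasis n} (e : DecAt p h k) (hpq : h.rel p q) :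
    DecAt q h k := by
  refine ⟨e.a_eq, e.b_eq, FlipRule.of_rel h.equivalence h.constOn ?_ e.rule hpq⟩
  rw [← e.rel_eq]; exact k.constOn

theorem flipped_of_decAt {p : Fin (2 * n)} {h k : ArcBasis n} (e : DecAt p h k) :
    flipped h k = cls h.rel p := by
  ext x
  unfold flipped
  rw [Finset.mem_filter, mem_cls]
  constructor
  · rintro ⟨-, hx⟩
    by_contra hc
    exact hx (e.rule.off x hc).symm
  · intro hx
    rw [e.neg_src hx, e.neg_tgt hx]
    exact ⟨Finset.mem_univ _, Bool.noConfusion⟩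

/-- Decorations commute with surgeries. -/
theorem exists_decAt_rb_iff (x : Fin (2 * n)) (h₁ h₃ : ArcBasis n) :
    (∃ m, DecAt x h₁ m ∧ RB m h₃) ↔ ∃ m, RB h₁ m ∧ DecAt x m h₃ := by
  constructor
  · rintro ⟨m, hd, hr⟩
    have ha : h₁.a = h₃.a := hd.a_eq.trans hr.a_eq
    have hs : Surgery h₁.b h₃.b := by rw [hd.b_eq]; exact hr.surgery
    have hm : m.rel = h₁.rel := hd.rel_eq
    have hcm : ConstOn h₁.rel m.neg := by rw [← hm]; exact m.constOn
    have h3 : h₃.rel = SameCircle h₁.a h₃.b := by unfold ArcBasis.rel; rw [ha]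
    obtain ⟨u, v, ⟨hJ, -⟩ | ⟨hJ, -⟩⟩ := hs.joins_or h₁.a
    · rw [← h3] at hJ
      have hJm : Joins m.rel h₃.rel u v := by rw [hm]; exact hJ
      have hr' := (rb_merge hr.surgery hr.a_eq hJm).1 hr
      -- The missing vertex is forced: it is `h₃` with the decoration on the circle of `x` undone.
      have hd' := relabel_decAt (neg_of_flip_merge hJ hcm h₃.constOn hd.rule hr')
      refine ⟨_, (rb_merge (k := h₃.relabel x false) hs ha hJ).2 ?_, hd'⟩
      exact merge_of_flip_merge hJ h₁.equivalence h₃.equivalence h₁.constOn hcm h₃.constOn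
        (ArcBasis.constOn (h₃.relabel x false)) hd.rule hr' hd'.rule
    · rw [← h3] at hJ
      have hJm : Joins h₃.rel m.rel u v := by rw [hm]; exact hJ
      have hr' := (rb_split hr.surgery hr.a_eq hJm).1 hr
      rw [hm] at hr'
      have hd' := relabel_decAt (neg_of_flip_split hJ hcm h₃.constOn hd.rule hr')
      refine ⟨_, (rb_split (k := h₃.relabel x false) hs ha hJ).2 ?_, hd'⟩
      exact split_of_flip_split hJ h₁.equivalence h₃.equivalence h₁.constOn hcm
        (ArcBasis.constOn (h₃.relabel x false)) hd.rule hr' hd'.rule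
  · rintro ⟨m, hr, hd⟩
    have ha : h₁.a = h₃.a := hr.a_eq.trans hd.a_eq
    have hs : Surgery h₁.b h₃.b := by rw [← hd.b_eq]; exact hr.surgery
    have hm : h₃.rel = m.rel := hd.rel_eq
    have hcm : ConstOn h₃.rel m.neg := by rw [hm]; exact m.constOn
    have h3 : h₃.rel = SameCircle h₁.a h₃.b := by unfold ArcBasis.rel; rw [ha]
    have hf : FlipRule h₃.rel x m.neg h₃.neg := by rw [hm]; exact hd.rule
    obtain ⟨u, v, ⟨hJ, -⟩ | ⟨hJ, -⟩⟩ := hs.joins_or h₁.a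
    · rw [← h3] at hJ
      have hJm : Joins h₁.rel m.rel u v := by rw [← hm]; exact hJ
      have hr' := (rb_merge hr.surgery hr.a_eq hJm).1 hr
      rw [← hm] at hr'
      have hd' := decAt_relabel (neg_of_merge_flip hJ h₁.constOn hcm hr' hf)
      refine ⟨_, hd', (rb_merge (h := h₁.relabel x true) hs ha hJ).2 ?_⟩
      exact merge_of_merge_flip hJ h₁.equivalence h₃.equivalence
        (ArcBasis.constOn (h₁.relabel x true)) h₃.constOn hcm hr' hf hd'.rule
    · rw [← h3] at hJ
      have hJm : Joins m.rel h₁.rel u v := by rw [← hm]; exact hJ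
      have hr' := (rb_split hr.surgery hr.a_eq hJm).1 hr
      have hd' := decAt_relabel (neg_of_split_flip hJ h₁.constOn hcm hr' hf)
      refine ⟨_, hd', (rb_split (h := h₁.relabel x true) hs ha hJ).2 ?_⟩
      exact split_of_split_flip hJ h₁.equivalence h₃.equivalence h₁.constOn
        (ArcBasis.constOn (h₁.relabel x true)) h₃.constOn hcm hr' hf hd'.rule

/-- The paths `h₁ ⟶ h₃` formed by a bridge and a decoration, in either order. -/
inductive BridgeDecPaths (h₁ h₃ : ArcBasis n) : Prop
  | empty : (∀ m, ¬ (RB h₁ m ∧ RD m h₃)) → (∀ m, ¬ (RD h₁ m ∧ RB m h₃)) → BridgeDecPaths h₁ h₃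
  | disjoint (m m') : (∀ x, RB h₁ x ∧ RD x h₃ ↔ x = m) → (∀ x, RD h₁ x ∧ RB x h₃ ↔ x = m') →
      flipped m h₃ = flipped h₁ m' → (∀ p ∈ flipped m h₃, h₁.b.f p = m.b.f p) →
      BridgeDecPaths h₁ h₃
  | join (m m' m'') : (∀ x, RB h₁ x ∧ RD x h₃ ↔ x = m) →
      (∀ x, RD h₁ x ∧ RB x h₃ ↔ x = m' ∨ x = m'') →
      Disjoint (flipped h₁ m') (flipped h₁ m'') →
      flipped m h₃ = flipped h₁ m' ∪ flipped h₁ m'' → BridgeDecPaths h₁ h₃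
  | split (m m' m'') : (∀ x, RB h₁ x ∧ RD x h₃ ↔ x = m' ∨ x = m'') →
      (∀ x, RD h₁ x ∧ RB x h₃ ↔ x = m) →
      Disjoint (flipped m' h₃) (flipped m'' h₃) →
      flipped h₁ m = flipped m' h₃ ∪ flipped m'' h₃ → BridgeDecPaths h₁ h₃

/-- A merge is determined by its source, so the path "bridge, decoration" is unique. Its decoration
can be moved before the merge onto any circle contained in the circle of `x`. There is one such
circle away from the merge, and there are two, the joined ones, on the merged circle. -/
theorem bridgeDecPaths_merge {h₁ h₃ : ArcBasis n} {u v : Fin (2 * n)}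
    (hJ : Joins h₁.rel h₃.rel u v)
    (hsupp : ∀ r, h₁.b.f r ≠ h₃.b.f r → h₃.rel u r) {m : ArcBasis n} {x : Fin (2 * n)}
    (hr : RB h₁ m) (hd : DecAt x m h₃) : BridgeDecPaths h₁ h₃ := by
  have hm : h₃.rel = m.rel := hd.rel_eq
  have hcm : ConstOn h₃.rel m.neg := by rw [hm]; exact m.constOn
  have hf : FlipRule h₃.rel x m.neg h₃.neg := by rw [hm]; exact hd.rule
  have hJm : Joins h₁.rel m.rel u v := by rw [← hm]; exact hJ
  have hr' := (rb_merge hr.surgery hr.a_eq hJm).1 hr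
  rw [← hm] at hr'
  have hRL : ∀ y, RB h₁ y ∧ RD y h₃ ↔ y = m := by
    refine fun y => ⟨fun ⟨h1, h2⟩ => ?_, fun h => by rw [h]; exact ⟨hr, rd_iff.2 ⟨x, hd⟩⟩⟩
    obtain ⟨z, hz⟩ := rd_iff.1 h2
    have hy : h₃.rel = y.rel := hz.rel_eq
    have hJy : Joins h₁.rel y.rel u v := by rw [← hy]; exact hJ
    have h1' := (rb_merge h1.surgery h1.a_eq hJy).1 h1
    rw [← hy] at h1'
    refine ArcBasis.ext (hz.a_eq.trans hd.a_eq.symm) (hz.b_eq.trans hd.b_eq.symm) ?_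
    exact MergeRule.unique (by rw [hy]; exact y.constOn) hcm h1' hr'
  have hLR : ∀ y z, DecAt z h₁ y → RB y h₃ → FlipRule h₁.rel z h₁.neg y.neg ∧
      MergeRule h₃.rel u v y.neg h₃.neg := by
    intro y z h1 h2
    refine ⟨h1.rule, (rb_merge h2.surgery h2.a_eq ?_).1 h2⟩
    rw [h1.rel_eq]; exact hJ
  have hmk : ∀ z, h₃.rel x z → ∃ y, DecAt z h₁ y ∧ RB y h₃ := by
    intro z hz
    refine (exists_decAt_rb_iff z h₁ h₃).2 ⟨m, hr, hd.of_rel ?_⟩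
    rw [← hm]; exact hz
  by_cases hx : h₃.rel u x
  · obtain ⟨m', hm'⟩ := hmk u hx.symm
    obtain ⟨m'', hm''⟩ := hmk v (hx.symm.trans (hJ.rel h₁.equivalence))
    refine .join m m' m'' hRL (fun y => ⟨fun ⟨h1, h2⟩ => ?_, ?_⟩) ?_ ?_
    · obtain ⟨z, hz⟩ := rd_iff.1 h1
      have := hLR y z hz h2
      rcases flip_circle_of_on hx hcm h₃.constOn hr' hf this.1 this.2 with hc | hc
      · exact .inl ((hz.of_rel hc).eq hm'.1)
      · exact .inr ((hz.of_rel hc).eq hm''.1)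
    · rintro (rfl | rfl)
      · exact ⟨rd_iff.2 ⟨_, hm'.1⟩, hm'.2⟩
      · exact ⟨rd_iff.2 ⟨_, hm''.1⟩, hm''.2⟩
    · rw [flipped_of_decAt hm'.1, flipped_of_decAt hm''.1, Finset.disjoint_left]
      intro y hy hy'
      rw [mem_cls] at hy hy'
      exact hJ.not_rel (hy.trans hy'.symm)
    · rw [flipped_of_decAt hm'.1, flipped_of_decAt hm''.1, flipped_of_decAt hd, ← hm]
      ext y
      rw [Finset.mem_union, mem_cls, mem_cls, mem_cls]
      constructor
      · exact fun hy => hJ.of_rel (hx.trans hy)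
      · rintro (hy | hy)
        · exact hx.symm.trans (hJ.le hy)
        · exact hx.symm.trans ((hJ.rel h₁.equivalence).trans (hJ.le hy))
  · obtain ⟨m', hm'⟩ := hmk x (.refl _ _ _)
    refine .disjoint m m' hRL (fun y => ⟨fun ⟨h1, h2⟩ => ?_, ?_⟩) ?_ ?_
    · obtain ⟨z, hz⟩ := rd_iff.1 h1
      have := hLR y z hz h2
      exact (hz.of_rel (flip_circle_of_off hx hr' hf this.1 this.2)).eq hm'.1
    · rintro rfl
      exact ⟨rd_iff.2 ⟨_, hm'.1⟩, hm'.2⟩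
    · rw [flipped_of_decAt hm'.1, flipped_of_decAt hd, ← hm]
      ext y
      rw [mem_cls, mem_cls]
      exact hJ.iff_of_not_rel h₁.equivalence h₃.equivalence hx
    -- The points where the surgery changes the matching all lie on the merged circle, hence not on
    -- the decorated one.
    · intro p hp
      rw [flipped_of_decAt hd, ← hm, mem_cls] at hp
      by_contra hc
      rw [hd.b_eq] at hc
      exact hx ((hsupp p hc).trans hp.symm)

/-- Dual to the merge: a split is determined by its target, so now the path "decoration, bridge" is
unique, and its decoration can be moved behind the split onto one or both of the new circles. -/
theorem bridgeDecPaths_split {h₁ h₃ : ArcBasis n} {u v : Fin (2 * n)}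
    (hJ : Joins h₃.rel h₁.rel u v)
    (hsupp : ∀ r, h₁.b.f r ≠ h₃.b.f r → h₁.rel u r) {m : ArcBasis n} {x : Fin (2 * n)}
    (hd : DecAt x h₁ m) (hr : RB m h₃) : BridgeDecPaths h₁ h₃ := by
  have hm : m.rel = h₁.rel := hd.rel_eq
  have hcm : ConstOn h₁.rel m.neg := by rw [← hm]; exact m.constOn
  have hJm : Joins h₃.rel m.rel u v := by rw [hm]; exact hJ
  have hr' := (rb_split hr.surgery hr.a_eq hJm).1 hr
  rw [hm] at hr'
  have hLR : ∀ y, RD h₁ y ∧ RB y h₃ ↔ y = m := by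
    refine fun y => ⟨fun ⟨h1, h2⟩ => ?_, fun h => by rw [h]; exact ⟨rd_iff.2 ⟨x, hd⟩, hr⟩⟩
    obtain ⟨z, hz⟩ := rd_iff.1 h1
    have hy : y.rel = h₁.rel := hz.rel_eq
    have hJy : Joins h₃.rel y.rel u v := by rw [hy]; exact hJ
    have h2' := (rb_split h2.surgery h2.a_eq hJy).1 h2
    rw [hy] at h2'
    refine ArcBasis.ext (hz.a_eq.symm.trans hd.a_eq) (hz.b_eq.symm.trans hd.b_eq) ?_
    exact SplitRule.unique_src (by rw [← hy]; exact y.constOn) hcm h2' hr'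
  have hRL : ∀ y z, RB h₁ y → DecAt z y h₃ → FlipRule h₃.rel z y.neg h₃.neg ∧
      SplitRule h₁.rel u v h₁.neg y.neg := by
    intro y z h1 h2
    refine ⟨by rw [h2.rel_eq]; exact h2.rule, (rb_split h1.surgery h1.a_eq ?_).1 h1⟩
    rw [← h2.rel_eq]; exact hJ
  have hmk : ∀ z, h₁.rel x z → ∃ y, RB h₁ y ∧ DecAt z y h₃ := fun z hz =>
    (exists_decAt_rb_iff z h₁ h₃).1 ⟨m, hd.of_rel hz, hr⟩
  by_cases hx : h₁.rel u x
  · obtain ⟨m', hm'⟩ := hmk u hx.symm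
    obtain ⟨m'', hm''⟩ := hmk v (hx.symm.trans (hJ.rel h₃.equivalence))
    refine .split m m' m'' (fun y => ⟨fun ⟨h1, h2⟩ => ?_, ?_⟩) hLR ?_ ?_
    · obtain ⟨z, hz⟩ := rd_iff.1 h2
      have := hRL y z h1 hz
      rcases flip_circle_of_on hx hcm.negLabel h₁.constOn.negLabel hr'.negLabel hd.rule.negLabel
        this.1.negLabel this.2.negLabel with hc | hc
      · rw [hz.rel_eq] at hc
        exact .inl ((hz.of_rel hc).eq_src hm'.2)
      · rw [hz.rel_eq] at hc
        exact .inr ((hz.of_rel hc).eq_src hm''.2)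
    · rintro (rfl | rfl)
      · exact ⟨hm'.1, rd_iff.2 ⟨_, hm'.2⟩⟩
      · exact ⟨hm''.1, rd_iff.2 ⟨_, hm''.2⟩⟩
    · rw [flipped_of_decAt hm'.2, flipped_of_decAt hm''.2, ← hm'.2.rel_eq, ← hm''.2.rel_eq,
        Finset.disjoint_left]
      intro y hy hy'
      rw [mem_cls] at hy hy'
      exact hJ.not_rel (hy.trans hy'.symm)
    · rw [flipped_of_decAt hm'.2, flipped_of_decAt hm''.2, flipped_of_decAt hd, ← hm'.2.rel_eq,
        ← hm''.2.rel_eq]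
      ext y
      rw [Finset.mem_union, mem_cls, mem_cls, mem_cls]
      constructor
      · exact fun hy => hJ.of_rel (hx.trans hy)
      · rintro (hy | hy)
        · exact hx.symm.trans (hJ.le hy)
        · exact hx.symm.trans ((hJ.rel h₃.equivalence).trans (hJ.le hy))
  · obtain ⟨m', hm'⟩ := hmk x (.refl _ _ _)
    refine .disjoint m' m (fun y => ⟨fun ⟨h1, h2⟩ => ?_, ?_⟩) hLR ?_ ?_
    · obtain ⟨z, hz⟩ := rd_iff.1 h2
      have := hRL y z h1 hz
      have hc := flip_circle_of_off hx hr'.negLabel hd.rule.negLabel this.1.negLabel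
        this.2.negLabel
      rw [hz.rel_eq] at hc
      exact (hz.of_rel hc).eq_src hm'.2
    · rintro rfl
      exact ⟨hm'.1, rd_iff.2 ⟨_, hm'.2⟩⟩
    · rw [flipped_of_decAt hm'.2, flipped_of_decAt hd, ← hm'.2.rel_eq]
      ext y
      rw [mem_cls, mem_cls]
      exact (hJ.iff_of_not_rel h₃.equivalence h₁.equivalence hx).symm
    · intro p hp
      rw [flipped_of_decAt hm'.2, ← hm'.2.rel_eq, mem_cls] at hp
      by_contra hc
      rw [hm'.2.b_eq] at hc
      exact hx ((hsupp p hc).trans (hJ.le hp).symm)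

/-- Since decorations move across bridges in both directions, a path of one kind always yields one
of the other. Whichever of merge and split occurs, the path needed to start the argument is
therefore available. -/
theorem bridgeDecPaths (h₁ h₃ : ArcBasis n) : BridgeDecPaths h₁ h₃ := by
  by_cases hne : (∃ m, RB h₁ m ∧ RD m h₃) ∨ ∃ m, RD h₁ m ∧ RB m h₃
  · have hex : ∃ x, (∃ m, RB h₁ m ∧ DecAt x m h₃) ∧ ∃ m, DecAt x h₁ m ∧ RB m h₃ := by
      rcases hne with ⟨m, h1, h2⟩ | ⟨m, h1, h2⟩
      · obtain ⟨x, hx⟩ := rd_iff.1 h2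
        exact ⟨x, ⟨m, h1, hx⟩, (exists_decAt_rb_iff x h₁ h₃).2 ⟨m, h1, hx⟩⟩
      · obtain ⟨x, hx⟩ := rd_iff.1 h1
        exact ⟨x, (exists_decAt_rb_iff x h₁ h₃).1 ⟨m, hx, h2⟩, ⟨m, hx, h2⟩⟩
    obtain ⟨x, ⟨m, hr, hd⟩, m', hd', hr'⟩ := hex
    have ha : h₁.a = h₃.a := hr.a_eq.trans hd.a_eq
    have hs : Surgery h₁.b h₃.b := by rw [← hd.b_eq]; exact hr.surgery
    have h3 : h₃.rel = SameCircle h₁.a h₃.b := by unfold ArcBasis.rel; rw [ha]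
    obtain ⟨u, v, ⟨hJ, hsupp⟩ | ⟨hJ, hsupp⟩⟩ := hs.joins_or h₁.a
    · rw [← h3] at hJ hsupp
      exact bridgeDecPaths_merge hJ hsupp hr hd
    · rw [← h3] at hJ
      exact bridgeDecPaths_split hJ hsupp hd' hr'
  · rw [not_or, not_exists, not_exists] at hne
    exact .empty hne.1 hne.2

end Paths

end BorderedKh
end

noncomputable section
namespace BorderedKh

/-! ## Pairs of surgeries -/

section Squares

variable {n : ℕ}

/-- `h ⟶ k` is a bridge generator of `m(B)^!`. -/
def LB (h k : ArcBasis n) : Prop := RB h.mirror k.mirror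

theorem decAt_mirror {p : Fin (2 * n)} {h k : ArcBasis n} :
    DecAt p h.mirror k.mirror ↔ DecAt p h k := by
  have hrel : ∀ h : ArcBasis n, h.mirror.rel = h.rel := fun h => sameCircle_comm _ _
  constructor
  · rintro ⟨h1, h2, h3⟩
    rw [hrel] at h3
    exact ⟨h2, h1, h3⟩
  · rintro ⟨h1, h2, h3⟩
    refine ⟨h2, h1, ?_⟩
    rw [hrel]
    exact h3

theorem exists_decAt_lb_iff (x : Fin (2 * n)) (h₁ h₃ : ArcBasis n) :
    (∃ m, DecAt x h₁ m ∧ LB m h₃) ↔ ∃ m, LB h₁ m ∧ DecAt x m h₃ := by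
  have := exists_decAt_rb_iff x h₁.mirror h₃.mirror
  constructor
  · rintro ⟨m, h1, h2⟩
    obtain ⟨m', h3, h4⟩ := this.1 ⟨m.mirror, decAt_mirror.2 h1, h2⟩
    exact ⟨m'.mirror, h3, decAt_mirror.1 h4⟩
  · rintro ⟨m, h1, h2⟩
    obtain ⟨m', h3, h4⟩ := this.2 ⟨m.mirror, h1, decAt_mirror.2 h2⟩
    exact ⟨m'.mirror, decAt_mirror.1 h3, h4⟩

theorem LB.b_eq {h k : ArcBasis n} (e : LB h k) : h.b = k.b := RB.a_eq e

theorem LB.surgery {h k : ArcBasis n} (e : LB h k) : Surgery h.a k.a := RB.surgery e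

theorem LB.deg_eq {h k : ArcBasis n} (e : LB h k) : k.deg = h.deg + 1 := by
  have := RB.deg_eq e
  rwa [ArcBasis.deg_mirror, ArcBasis.deg_mirror] at this

/-- In products with a matrix of decorations, every entry has at most one nonzero summand. Comparing
two entries is then a matter of existence of a path. -/
theorem sum_ite_unique {α : Type*} [Fintype α] {M : Type*} [AddCommMonoid M] {P Q : α → Prop}
    [DecidablePred P] [DecidablePred Q] (hP : ∀ x y, P x → P y → x = y)
    (hQ : ∀ x y, Q x → Q y → x = y) (h : (∃ x, P x) ↔ ∃ x, Q x) (c : M) :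
    (∑ x, if P x then c else 0) = ∑ x, if Q x then c else 0 := by
  by_cases he : ∃ x, P x
  · obtain ⟨x, hx⟩ := he
    obtain ⟨y, hy⟩ := h.1 ⟨x, hx⟩
    rw [Finset.sum_eq_single x (fun z _ hz => if_neg fun hh => hz (hP _ _ hh hx)) (by simp),
      Finset.sum_eq_single y (fun z _ hz => if_neg fun hh => hz (hQ _ _ hh hy)) (by simp),
      if_pos hx, if_pos hy]
  · have he' := fun hq => he (h.2 hq)
    rw [Finset.sum_eq_zero fun x _ => if_neg fun hh => he ⟨x, hh⟩,
      Finset.sum_eq_zero fun x _ => if_neg fun hh => he' ⟨x, hh⟩]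

open Classical in
/-- The matrix of decorations at `p`. -/
def decMat (p : Fin (2 * n)) : Matrix (ArcBasis n) (ArcBasis n) ℤ :=
  Matrix.of fun h k => if DecAt p h k then 1 else 0

open Classical in
/-- The matrix of right bridges to `b'`. -/
def rbMat (b' : Matching n) : Matrix (ArcBasis n) (ArcBasis n) ℤ :=
  Matrix.of fun h k => if RB h k ∧ k.b = b' then 1 else 0

open Classical in
/-- The matrix of left bridges to `a'`. -/
def lbMat (a' : Matching n) : Matrix (ArcBasis n) (ArcBasis n) ℤ :=
  Matrix.of fun h k => if LB h k ∧ k.a = a' then 1 else 0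

theorem decMat_mul_rbMat (p : Fin (2 * n)) (b' : Matching n) :
    decMat p * rbMat b' = rbMat b' * decMat p := by
  classical
  ext h k
  rw [Matrix.mul_apply, Matrix.mul_apply]
  simp only [decMat, rbMat, Matrix.of_apply, ← ite_and, mul_ite, mul_one, mul_zero]
  refine sum_ite_unique ?_ ?_ ?_ 1
  · rintro x y ⟨-, h1⟩ ⟨-, h2⟩
    exact h1.eq h2
  · rintro x y ⟨h1, -⟩ ⟨h2, -⟩
    exact h1.eq_src h2
  · have := exists_decAt_rb_iff p h k
    constructor
    · rintro ⟨x, ⟨h1, h2⟩, h3⟩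
      obtain ⟨m, h4, h5⟩ := this.1 ⟨x, h3, h1⟩
      exact ⟨m, h5, h4, by rw [h5.b_eq, h2]⟩
    · rintro ⟨x, h3, h1, h2⟩
      obtain ⟨m, h4, h5⟩ := this.2 ⟨x, h1, h3⟩
      exact ⟨m, ⟨h5, by rw [← h3.b_eq, h2]⟩, h4⟩

theorem decMat_mul_lbMat (p : Fin (2 * n)) (a' : Matching n) :
    decMat p * lbMat a' = lbMat a' * decMat p := by
  classical
  ext h k
  rw [Matrix.mul_apply, Matrix.mul_apply]
  simp only [decMat, lbMat, Matrix.of_apply, ← ite_and, mul_ite, mul_one, mul_zero]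
  refine sum_ite_unique ?_ ?_ ?_ 1
  · rintro x y ⟨-, h1⟩ ⟨-, h2⟩
    exact h1.eq h2
  · rintro x y ⟨h1, -⟩ ⟨h2, -⟩
    exact h1.eq_src h2
  · have := exists_decAt_lb_iff p h k
    constructor
    · rintro ⟨x, ⟨h1, h2⟩, h3⟩
      obtain ⟨m, h4, h5⟩ := this.1 ⟨x, h3, h1⟩
      exact ⟨m, h5, h4, by rw [h5.a_eq, h2]⟩
    · rintro ⟨x, h3, h1, h2⟩
      obtain ⟨m, h4, h5⟩ := this.2 ⟨x, h1, h3⟩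
      exact ⟨m, ⟨h5, by rw [← h3.a_eq, h2]⟩, h4⟩

/-- The circles must be different, because the first decoration leaves the label `-` on its circle;
so the two decorations do not interact. -/
theorem exists_decAt_comm {p q : Fin (2 * n)} {h k : ArcBasis n}
    (hh : ∃ m, DecAt p h m ∧ DecAt q m k) : ∃ m, DecAt q h m ∧ DecAt p m k := by
  obtain ⟨m, h1, h2⟩ := hh
  have hpq : ¬ h.rel q p := fun hc => by
    have h3 : m.neg q = true := h1.neg_tgt hc.symm
    rw [h2.rule.src] at h3
    exact absurd h3 Bool.noConfusion
  have hrel : k.rel = h.rel := h2.rel_eq.trans h1.rel_eq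
  have hq : h.neg q = false := by
    rw [← h1.rule.off q fun hc => hpq hc.symm]; exact h2.rule.src
  have hd := decAt_relabel hq
  refine ⟨_, hd, h1.a_eq.trans h2.a_eq, h1.b_eq.trans h2.b_eq, ?_, ?_, fun x hx => ?_⟩
  · rw [hd.rule.off p hpq]; exact h1.rule.src
  · rw [h2.rule.off p (by rw [h1.rel_eq]; exact hpq)]; exact h1.rule.tgt
  · rw [hd.rel_eq] at hx
    by_cases hc : h.rel q x
    · rw [hd.neg_tgt hc]
      exact h2.neg_tgt (by rw [h1.rel_eq]; exact hc)
    · rw [hd.rule.off x hc, h2.rule.off x (by rw [h1.rel_eq]; exact hc), h1.rule.off x hx]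

theorem decMat_comm (p q : Fin (2 * n)) : decMat p * decMat q = decMat q * decMat p := by
  classical
  ext h k
  rw [Matrix.mul_apply, Matrix.mul_apply]
  simp only [decMat, Matrix.of_apply, ← ite_and, mul_ite, mul_one, mul_zero]
  refine sum_ite_unique ?_ ?_ ?_ 1
  · rintro x y ⟨-, h1⟩ ⟨-, h2⟩
    exact h1.eq h2
  · rintro x y ⟨-, h1⟩ ⟨-, h2⟩
    exact h1.eq h2
  · constructor
    · rintro ⟨m, h1, h2⟩
      obtain ⟨m', h3, h4⟩ := exists_decAt_comm ⟨m, h2, h1⟩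
      exact ⟨m', h4, h3⟩
    · rintro ⟨m, h1, h2⟩
      obtain ⟨m', h3, h4⟩ := exists_decAt_comm ⟨m, h2, h1⟩
      exact ⟨m', h4, h3⟩

open Matrix in
theorem single_vecMul_decMat {p : Fin (2 * n)} {h k : ArcBasis n} (e : DecAt p h k) :
    Pi.single h 1 ᵥ* decMat p = Pi.single k 1 := by
  classical
  ext m
  rw [Matrix.single_one_vecMul, Pi.single_apply]
  simp only [decMat, Matrix.row, Matrix.of_apply]
  exact if_congr ⟨fun e' => e'.eq e, fun e' => by rw [e']; exact e⟩ rfl rfl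

open Matrix in
theorem plus_vecMul_decMat {a b : Matching n} {p q : Fin (2 * n)} (h : SameCircle a b p q) :
    Pi.single (plusElt a b) 1 ᵥ* decMat p = Pi.single (plusElt a b) 1 ᵥ* decMat q := by
  have h1 : DecAt p (plusElt a b) _ := decAt_relabel rfl
  rw [single_vecMul_decMat h1, single_vecMul_decMat (h1.of_rel h)]

open Matrix in
theorem plus_vecMul_rbMat_merge {a b b' : Matching n} {u v : Fin (2 * n)} (hs : Surgery b b')
    (hJ : Joins (SameCircle a b) (SameCircle a b') u v) :
    Pi.single (plusElt a b) 1 ᵥ* rbMat b' = Pi.single (plusElt a b') 1 := by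
  classical
  ext m
  rw [Matrix.single_one_vecMul, Pi.single_apply]
  simp only [rbMat, Matrix.row, Matrix.of_apply]
  have h0 : RB (plusElt a b) (plusElt a b') :=
    (rb_merge (h := plusElt a b) (k := plusElt a b') hs rfl hJ).2 ⟨fun _ _ => rfl, rfl, by simp [plusElt]⟩
  refine if_congr ⟨fun ⟨h1, h2⟩ => ?_, fun h => by rw [h]; exact ⟨h0, rfl⟩⟩ rfl rfl
  have h3 : a = m.a := h1.a_eq
  have hrel : m.rel = SameCircle a b' := by unfold ArcBasis.rel; rw [← h3, h2]
  have hJ' : Joins (plusElt a b).rel m.rel u v := by rw [hrel]; exact hJ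
  have h4 := (rb_merge (h1.surgery) h1.a_eq hJ').1 h1
  refine ArcBasis.ext h3.symm h2 ?_
  refine MergeRule.unique m.constOn (fun _ _ _ => rfl) h4 ⟨fun _ _ => rfl, rfl, by simp [plusElt]⟩

open Matrix in
-- This is `Δ 1 = X ⊗ 1 + 1 ⊗ X`. Writing the result as decorations of the all-plus element allows
-- it to be moved through further surgeries.
theorem plus_vecMul_rbMat_split {a b b' : Matching n} {u v : Fin (2 * n)} (hs : Surgery b b')
    (hJ : Joins (SameCircle a b') (SameCircle a b) u v) :
    Pi.single (plusElt a b) 1 ᵥ* rbMat b'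
      = Pi.single (plusElt a b') 1 ᵥ* (decMat u + decMat v) := by
  classical
  have hu : DecAt u (plusElt a b') _ := decAt_relabel rfl
  have hv : DecAt v (plusElt a b') _ := decAt_relabel rfl
  set k := (plusElt a b').relabel u true
  set l := (plusElt a b').relabel v true
  rw [Matrix.vecMul_add, single_vecMul_decMat hu, single_vecMul_decMat hv]
  have hku : k.neg u = true := hu.rule.tgt
  have hkv : k.neg v = false := hu.rule.off v hJ.not_rel
  have hlv : l.neg v = true := hv.rule.tgt
  have hlu : l.neg u = false := hv.rule.off u fun h => hJ.not_rel h.symm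
  have hkl : k ≠ l := fun e => by rw [e, hlu] at hku; exact absurd hku Bool.noConfusion
  have hRk : RB (plusElt a b) k := (rb_split (h := plusElt a b) (k := k) hs rfl hJ).2
    ⟨fun x hx => hu.rule.off x fun h => hx (hJ.le h), by rw [hku, hkv]; rfl, by rw [hku]; simp⟩
  have hRl : RB (plusElt a b) l := (rb_split (h := plusElt a b) (k := l) hs rfl hJ).2
    ⟨fun x hx => hv.rule.off x fun h => hx ((hJ.rel (SameCircle.equivalence _ _)).trans (hJ.le h)),
      by rw [hlu, hlv]; rfl, by rw [hlv]; simp⟩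
  ext m
  rw [Matrix.single_one_vecMul, Pi.add_apply, Pi.single_apply, Pi.single_apply]
  simp only [rbMat, Matrix.row, Matrix.of_apply]
  by_cases h1 : m = k
  · subst h1
    rw [if_pos ⟨hRk, rfl⟩, if_pos rfl, if_neg hkl]; rfl
  by_cases h2 : m = l
  · subst h2
    rw [if_pos ⟨hRl, rfl⟩, if_pos rfl, if_neg h1]; rfl
  rw [if_neg h1, if_neg h2, if_neg]
  · rfl
  rintro ⟨h3, h4⟩
  have h5 : a = m.a := h3.a_eq
  have hrel : m.rel = SameCircle a b' := by unfold ArcBasis.rel; rw [← h5, h4]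
  have hJ' : Joins m.rel (plusElt a b).rel u v := by rw [hrel]; exact hJ
  have h6 := (rb_split (h3.surgery) h3.a_eq hJ').1 h3
  have hon : (false : Bool) = (m.neg u && m.neg v) := h6.on
  have key : ∀ w w', m.neg w = true → m.neg w' = false →
      (∀ y, SameCircle a b u y → SameCircle a b' w y ∨ SameCircle a b' w' y) →
      (∀ y, SameCircle a b' w y → SameCircle a b u y) →
      m = (plusElt a b').relabel w true := by
    intro w w' hw hw' hcov hsub
    refine ArcBasis.ext h5.symm h4 (funext fun y => ?_)
    by_cases hy : SameCircle a b u y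
    · rcases hcov y hy with h | h
      · rw [← m.neg_of_sameCircle (x := w) (show m.rel w y by rw [hrel]; exact h), hw]
        exact (if_pos h).symm
      · rw [← m.neg_of_sameCircle (x := w') (show m.rel w' y by rw [hrel]; exact h), hw']
        refine (if_neg fun hc => ?_).symm
        have : m.neg w = m.neg w' :=
          m.neg_of_sameCircle (show m.rel w w' by rw [hrel]; exact SameCircle.trans hc h.symm)
        rw [hw, hw'] at this
        exact absurd this Bool.noConfusion
    · rw [h6.off y hy]
      exact (if_neg fun hc => hy (hsub y hc)).symm
  have hJr := hJ.rel (SameCircle.equivalence a b')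
  cases hmu : m.neg u <;> cases hmv : m.neg v
  · exact h6.not_both ⟨hmu, hmv⟩
  · exact h2 (key v u hmv hmu (fun y hy => (hJ.of_rel hy).symm) fun y hy => hJr.trans (hJ.le hy))
  · exact h1 (key u v hmu hmv (fun y hy => hJ.of_rel hy) fun y hy => hJ.le hy)
  · rw [hmu, hmv] at hon; exact absurd hon Bool.noConfusion

open Matrix in
theorem plus_vecMul_lbMat_merge {a a' b : Matching n} {u v : Fin (2 * n)} (hs : Surgery a a')
    (hJ : Joins (SameCircle a b) (SameCircle a' b) u v) :
    Pi.single (plusElt a b) 1 ᵥ* lbMat a' = Pi.single (plusElt a' b) 1 := by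
  rw [sameCircle_comm a, sameCircle_comm a'] at hJ
  have := plus_vecMul_rbMat_merge hs hJ
  ext m
  have h := congrFun this m.mirror
  rw [Matrix.single_one_vecMul] at h ⊢
  refine Eq.trans h ?_
  rw [Pi.single_apply, Pi.single_apply]
  exact if_congr ⟨fun e => congrArg ArcBasis.mirror e, fun e => congrArg ArcBasis.mirror e⟩ rfl rfl

open Matrix in
theorem plus_vecMul_lbMat_split {a a' b : Matching n} {u v : Fin (2 * n)} (hs : Surgery a a')
    (hJ : Joins (SameCircle a' b) (SameCircle a b) u v) :
    Pi.single (plusElt a b) 1 ᵥ* lbMat a'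
      = Pi.single (plusElt a' b) 1 ᵥ* (decMat u + decMat v) := by
  classical
  rw [sameCircle_comm a, sameCircle_comm a'] at hJ
  have := plus_vecMul_rbMat_split hs hJ
  ext m
  have h := congrFun this m.mirror
  rw [Matrix.single_one_vecMul] at h ⊢
  refine Eq.trans h ?_
  rw [Matrix.single_one_vecMul, Matrix.single_one_vecMul]
  simp only [Matrix.row, Matrix.add_apply, decMat, Matrix.of_apply]
  have key : ∀ w, DecAt w (plusElt b a') m.mirror ↔ DecAt w (plusElt a' b) m := fun w => by
    rw [← decAt_mirror]
    exact Iff.rfl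
  simp only [key]

open Matrix in
/-- Surgeries on the two sides commute. -/
theorem plus_vecMul_comm (a a' b b' : Matching n) (hb : Surgery b b') (ha : Surgery a a') :
    (Pi.single (plusElt a b) 1 ᵥ* rbMat b') ᵥ* lbMat a'
      = (Pi.single (plusElt a b) 1 ᵥ* lbMat a') ᵥ* rbMat b' := by
  obtain ⟨p, q, hR⟩ := surgery_iff.1 hb
  obtain ⟨r, s, hL⟩ := surgery_iff.1 ha
  have cR := hR.joins_or a
  have cR' := hR.joins_or a'
  have cL := hL.joins_or b
  have cL' := hL.joins_or b'
  rw [sameCircle_comm b, sameCircle_comm b] at cL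
  rw [sameCircle_comm b', sameCircle_comm b'] at cL'
  have comm₁ : ∀ (x : ArcBasis n → ℤ) (u v : Fin (2 * n)), (x ᵥ* (decMat u + decMat v)) ᵥ* lbMat a'
      = (x ᵥ* lbMat a') ᵥ* (decMat u + decMat v) := by
    intro x u v
    rw [Matrix.vecMul_vecMul, Matrix.vecMul_vecMul, add_mul, mul_add, decMat_mul_lbMat,
      decMat_mul_lbMat]
  have comm₂ : ∀ (x : ArcBasis n → ℤ) (u v : Fin (2 * n)), (x ᵥ* (decMat u + decMat v)) ᵥ* rbMat b'
      = (x ᵥ* rbMat b') ᵥ* (decMat u + decMat v) := by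
    intro x u v
    rw [Matrix.vecMul_vecMul, Matrix.vecMul_vecMul, add_mul, mul_add, decMat_mul_rbMat,
      decMat_mul_rbMat]
  have comm₃ : ∀ (x : ArcBasis n → ℤ) (u v u' v' : Fin (2 * n)),
      (x ᵥ* (decMat u + decMat v)) ᵥ* (decMat u' + decMat v')
      = (x ᵥ* (decMat u' + decMat v')) ᵥ* (decMat u + decMat v) := by
    intro x u v u' v'
    rw [Matrix.vecMul_vecMul, Matrix.vecMul_vecMul]
    congr 1
    simp only [add_mul, mul_add, decMat_comm u' u, decMat_comm u' v, decMat_comm v' u,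
      decMat_comm v' v]
    abel
  -- Each of the four sides of the square is a merge or a split. Counting the circles of `W(a')b'`
  -- along both routes leaves six of the sixteen combinations.
  rcases cR with cR | cR <;> rcases cR' with cR' | cR' <;> rcases cL with cL | cL <;>
    rcases cL' with cL' | cL' <;>
    have n1 := card_circles_of_joins cR <;> have n2 := card_circles_of_joins cR' <;>
    have n3 := card_circles_of_joins cL <;> have n4 := card_circles_of_joins cL' <;>
    first
    | omega
    | skip
  · rw [plus_vecMul_rbMat_merge hb cR, plus_vecMul_lbMat_merge ha cL', plus_vecMul_lbMat_merge ha cL,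
      plus_vecMul_rbMat_merge hb cR']
  · rw [plus_vecMul_rbMat_merge hb cR, plus_vecMul_lbMat_split ha cL', plus_vecMul_lbMat_split ha cL,
      comm₂, plus_vecMul_rbMat_merge hb cR']
  -- Both routes merge and then split, and give `Δ 1` on two circles of `W(a')b'`. These are the
  -- same two circles: `r` and `a r` lie on the circle of `W(a')b` through `p`, which splits into
  -- the circles of `p` and `b p`, and they are on different circles of `W(a')b'`.
  · rw [plus_vecMul_rbMat_merge hb cR, plus_vecMul_lbMat_split ha cL', plus_vecMul_lbMat_merge ha cL,
      plus_vecMul_rbMat_split hb cR']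
    have e_rt : SameCircle a b r (a.f r) := .left _ _ _
    have e_rs : SameCircle a' b r s := by rw [← hL.eq]; exact .left _ _ _
    have e_rs' : SameCircle a' b' r s := by rw [← hL.eq]; exact .left _ _ _
    have e_pq : SameCircle a' b' p q := by rw [← hR.eq]; exact .right _ _ _
    have h1 : SameCircle a b r p ∨ SameCircle a b r q := by
      rcases (cR.iff r s).1 (cL'.le e_rs') with h | ⟨h, -⟩ | ⟨h, -⟩
      · exact absurd h cL.not_rel
      · exact .inl h
      · exact .inr h
    have h2 : SameCircle a' b p r := by
      rcases h1 with h | h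
      · exact (cL.le h).symm
      · exact (cR'.le e_pq).trans (cL.le h).symm
    have h3 := h2.trans (cL.le e_rt)
    rcases cR'.of_rel h2 with h4 | h4 <;> rcases cR'.of_rel h3 with h5 | h5
    · exact absurd (h4.symm.trans h5) cL'.not_rel
    · rw [Matrix.vecMul_add, Matrix.vecMul_add, plus_vecMul_decMat h4, plus_vecMul_decMat h5]
    · rw [Matrix.vecMul_add, Matrix.vecMul_add, plus_vecMul_decMat h4, plus_vecMul_decMat h5,
        add_comm]
    · exact absurd (h4.symm.trans h5) cL'.not_rel
  -- Both routes split and then merge, which is a component of genus one with value `2X`. All four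
  -- points concerned lie on one circle of `W(a')b'`, so both sides are twice the same decoration.
  · rw [plus_vecMul_rbMat_split hb cR, comm₁, plus_vecMul_lbMat_merge ha cL',
      plus_vecMul_lbMat_split ha cL, comm₂, plus_vecMul_rbMat_merge hb cR']
    have e_rs : SameCircle a' b r s := by rw [← hL.eq]; exact .left _ _ _
    have e_pt : SameCircle a b p (b.f p) := .right _ _ _
    have e_pt' : SameCircle a' b' p (b.f p) := cR'.le (.right _ _ _)
    have e_rt' : SameCircle a' b' r (a.f r) := cL'.le (.left _ _ _)
    have h2 : SameCircle a' b' p r := by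
      rcases (cR.iff r s).1 (cL.le e_rs) with h | ⟨h, -⟩ | ⟨h, -⟩
      · exact absurd h cL'.not_rel
      · exact (cL'.le h).symm
      · exact e_pt'.trans (cL'.le h).symm
    rw [Matrix.vecMul_add, Matrix.vecMul_add, plus_vecMul_decMat e_pt'.symm,
      plus_vecMul_decMat e_rt'.symm, plus_vecMul_decMat h2]
  · rw [plus_vecMul_rbMat_split hb cR, comm₁, plus_vecMul_lbMat_merge ha cL',
      plus_vecMul_lbMat_merge ha cL, plus_vecMul_rbMat_split hb cR']
  · rw [plus_vecMul_rbMat_split hb cR, comm₁, plus_vecMul_lbMat_split ha cL',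
      plus_vecMul_lbMat_split ha cL, comm₂, plus_vecMul_rbMat_split hb cR', comm₃]

/-- Every element of `β` is an all-plus element decorated circle by circle, and decorations commute
with surgeries on either side. Induction on the number of points labelled `-` reduces the claim to
all-plus elements. -/
theorem rbMat_mul_lbMat (a' b' : Matching n) : rbMat b' * lbMat a' = lbMat a' * rbMat b' := by
  classical
  have key : ∀ (N : ℕ) (h : ArcBasis n), (Finset.univ.filter fun p => h.neg p = true).card = N →
      Matrix.vecMul (Matrix.vecMul (Pi.single h 1) (rbMat b')) (lbMat a')
        = Matrix.vecMul (Matrix.vecMul (Pi.single h 1) (lbMat a')) (rbMat b') := by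
    intro N
    induction N using Nat.strong_induction_on with
    | _ N ih =>
      intro h hN
      by_cases hp : ∃ p, h.neg p = true
      · obtain ⟨p, hp⟩ := hp
        have hd := relabel_decAt hp
        rw [← single_vecMul_decMat hd]
        have hlt : (Finset.univ.filter fun q => (h.relabel p false).neg q = true).card < N := by
          rw [← hN]
          refine Finset.card_lt_card (Finset.ssubset_iff_of_subset ?_ |>.2 ⟨p, ?_, ?_⟩)
          · intro q hq
            rw [Finset.mem_filter] at hq ⊢
            refine ⟨hq.1, ?_⟩
            by_contra hc
            have h1 : h.neg q = (h.relabel p false).neg q := hd.rule.off q fun hh => by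
              rw [hd.neg_src hh] at hq
              exact absurd hq.2 Bool.noConfusion
            exact hc (h1.trans hq.2)
          · simp [hp]
          · rw [Finset.mem_filter, hd.rule.src]
            simp
        have e := ih _ hlt (h.relabel p false) rfl
        have e' := congrArg (fun x => Matrix.vecMul x (decMat p)) e
        have k1 : decMat p * rbMat b' * lbMat a' = rbMat b' * lbMat a' * decMat p := by
          rw [decMat_mul_rbMat, mul_assoc, decMat_mul_lbMat, mul_assoc]
        have k2 : decMat p * lbMat a' * rbMat b' = lbMat a' * rbMat b' * decMat p := by
          rw [decMat_mul_lbMat, mul_assoc, decMat_mul_rbMat, mul_assoc]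
        simp only [Matrix.vecMul_vecMul] at e' ⊢
        rw [k1, k2]
        exact e'
      · have hh : h = plusElt h.a h.b := by
          refine ArcBasis.ext rfl rfl (funext fun x => ?_)
          change h.neg x = false
          cases hx : h.neg x
          · rfl
          · exact absurd ⟨x, hx⟩ hp
        by_cases hs : Surgery h.b b' ∧ Surgery h.a a'
        · rw [hh]
          exact plus_vecMul_comm h.a a' h.b b' hs.1 hs.2
        · rw [Matrix.vecMul_vecMul, Matrix.vecMul_vecMul]
          ext m
          rw [Matrix.single_one_vecMul, Matrix.single_one_vecMul]
          simp only [Matrix.row]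
          rw [Matrix.mul_apply, Matrix.mul_apply, Finset.sum_eq_zero, Finset.sum_eq_zero]
          · intro y _
            simp only [rbMat, lbMat, Matrix.of_apply, ← ite_and, mul_ite, mul_one, mul_zero]
            refine if_neg fun ⟨⟨h1, h2⟩, h3, h4⟩ => hs ⟨?_, ?_⟩
            · rw [h3.b_eq, ← h2]; exact h1.surgery
            · rw [← h4]; exact h3.surgery
          · intro y _
            simp only [rbMat, lbMat, Matrix.of_apply, ← ite_and, mul_ite, mul_one, mul_zero]
            refine if_neg fun ⟨⟨h1, h2⟩, h3, h4⟩ => hs ⟨?_, ?_⟩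
            · rw [← h4]; exact h3.surgery
            · rw [h3.a_eq, ← h2]; exact h1.surgery
  refine Matrix.ext_of_single_vecMul fun h => ?_
  have := key _ h rfl
  rwa [Matrix.vecMul_vecMul, Matrix.vecMul_vecMul] at this

end Squares

end BorderedKh
end

noncomputable section
namespace BorderedKh

/-! ## Representations of `B ⊙ m(B)^!` -/

section Representations

variable {n : ℕ}

/-- `h ⟶ k` is a generator of `m(B)^!`. -/
def LeftEdge (h k : ArcBasis n) : Prop := RightEdge h.mirror k.mirror

/-- The configurations of the relations (1)-(4). -/
def SquareCond (h₁ h₂ h₂' h₃ : ArcBasis n) : Prop :=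
  (RB h₁ h₂ ∧ LB h₂ h₃ ∧ LB h₁ h₂' ∧ RB h₂' h₃) ∨
  (RD h₁ h₂ ∧ LB h₂ h₃ ∧ LB h₁ h₂' ∧ RD h₂' h₃) ∨
  (RB h₁ h₂ ∧ RD h₂ h₃ ∧ RD h₁ h₂' ∧ RB h₂' h₃ ∧
    flipped h₂ h₃ = flipped h₁ h₂' ∧ ∀ p ∈ flipped h₂ h₃, h₁.b.f p = h₂.b.f p) ∨
  (RD h₁ h₂ ∧ RD h₂ h₃ ∧ RD h₁ h₂' ∧ RD h₂' h₃ ∧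
    flipped h₂ h₃ = flipped h₁ h₂' ∧ flipped h₁ h₂ = flipped h₂' h₃)

/-- Elements of a ring which satisfy the relations of `B ⊙ m(B)^!`: the idempotents, and the matrices
of the generators of `B` and of `m(B)^!`. -/
structure IsRep {A : Type*} [Ring A] (e : ArcBasis n → A)
    (r l : Matrix (ArcBasis n) (ArcBasis n) A) : Prop where
  idem_mul : ∀ h, e h * e h = e h
  idem_orth : ∀ h k, h ≠ k → e h * e k = 0
  idem_sum : ∑ h, e h = 1
  right_supp : ∀ h k, ¬ RightEdge h k → r h k = 0
  left_supp : ∀ h k, ¬ LeftEdge h k → l h k = 0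
  right_src : ∀ h k, RightEdge h k → e h * r h k = r h k
  right_tgt : ∀ h k, RightEdge h k → r h k * e k = r h k
  left_src : ∀ h k, LeftEdge h k → e h * l h k = l h k
  left_tgt : ∀ h k, LeftEdge h k → l h k * e k = l h k
  quad : ∃ Q : ArcBasis n → ArcBasis n → A, (∀ h k, RightEdge h k → r h k = Q h k) ∧
    ∀ h m k, RightEdge h m → RightEdge m k → r h m * r m k = Q h k
  dual : ∀ h k, ¬ LeftEdge h k → (l * l) h k = 0
  square : ∀ h₁ h₂ h₂' h₃, SquareCond h₁ h₂ h₂' h₃ → r h₁ h₂ * l h₂ h₃ = l h₁ h₂' * r h₂' h₃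
  join : ∀ h₁ h₂ h₂' h₂'' h₃, RB h₁ h₂ → RD h₂ h₃ → RD h₁ h₂' → RB h₂' h₃ → RD h₁ h₂'' →
    RB h₂'' h₃ → Disjoint (flipped h₁ h₂') (flipped h₁ h₂'') →
    flipped h₂ h₃ = flipped h₁ h₂' ∪ flipped h₁ h₂'' →
    r h₁ h₂ * l h₂ h₃ = l h₁ h₂' * r h₂' h₃ + l h₁ h₂'' * r h₂'' h₃
  split : ∀ h₁ h₂ h₂' h₂'' h₃, RD h₁ h₂ → RB h₂ h₃ → RB h₁ h₂' → RD h₂' h₃ → RB h₁ h₂'' →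
    RD h₂'' h₃ → Disjoint (flipped h₂' h₃) (flipped h₂'' h₃) →
    flipped h₁ h₂ = flipped h₂' h₃ ∪ flipped h₂'' h₃ →
    r h₁ h₂' * l h₂' h₃ + r h₁ h₂'' * l h₂'' h₃ = l h₁ h₂ * r h₂ h₃

/-- A decoration changes neither matching, so `B` and `m(B)^!` have decorations at the same pairs.
Hence `RD` serves for both, and only bridges need the two versions `RB` and `LB`. -/
theorem rd_mirror {h k : ArcBasis n} : RD h.mirror k.mirror ↔ RD h k := by
  rw [rd_iff, rd_iff]
  exact exists_congr fun p => decAt_mirror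

theorem RD.a_eq {h k : ArcBasis n} (e : RD h k) : h.a = k.a := e.1.a_eq

theorem RD.leftEdge {h k : ArcBasis n} (e : RD h k) : LeftEdge h k := (rd_mirror.2 e).1

theorem LB.leftEdge {h k : ArcBasis n} (e : LB h k) : LeftEdge h k := RB.rightEdge e where
  RB.rightEdge {h k : ArcBasis n} (e : RB h k) : RightEdge h k := e.1

theorem leftEdge_cases {h k : ArcBasis n} (e : LeftEdge h k) : LB h k ∨ RD h k := by
  by_cases hb : h.mirror.b = k.mirror.b
  · exact .inr (rd_mirror.1 ⟨e, hb⟩)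
  · exact .inl ⟨e, hb⟩

theorem rightEdge_cases {h k : ArcBasis n} (e : RightEdge h k) : RB h k ∨ RD h k := by
  by_cases hb : h.b = k.b
  · exact .inr ⟨e, hb⟩
  · exact .inl ⟨e, hb⟩

/-! ### Linear-quadratic relations -/

theorem edgePair_hom (p : EdgePair n) :
    p.fst.hom * p.snd.hom = Matrix.single p.fst.src p.snd.tgt (1 : ℤ) := by
  unfold Edge.hom
  rw [p.comp, Matrix.single_mul_single_same, one_mul]

/-- An element of `J₂` is a linear relation between matrix units. The linear map `e(h, k) ↦ Q h k`
carries it to any family that depends only on the ends of edges and paths. -/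
theorem sum_memJTwo {A : Type*} [AddCommGroup A] (Q : ArcBasis n → ArcBasis n → A)
    {v : Edge n → ℤ} {r : EdgePair n → ℤ} (h : MemJTwo v r) :
    ∑ e, v e • Q e.src e.tgt + ∑ p, r p • Q p.fst.src p.snd.tgt = 0 := by
  let φ : Matrix (ArcBasis n) (ArcBasis n) ℤ →ₗ[ℤ] A :=
    ∑ h, ∑ k, (LinearMap.toSpanSingleton ℤ A (Q h k)) ∘ₗ (Matrix.entryLinearMap ℤ ℤ h k)
  have hφ : ∀ h k, φ (Matrix.single h k 1) = Q h k := by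
    intro h k
    simp only [φ, LinearMap.sum_apply, LinearMap.comp_apply, Matrix.entryLinearMap_apply,
      LinearMap.toSpanSingleton_apply]
    rw [Finset.sum_eq_single h, Finset.sum_eq_single k]
    · simp
    · intro j _ hj
      rw [Matrix.single_apply_of_ne _ _ _ _ _ (fun hh => hj hh.2.symm), zero_smul]
    · simp
    · intro j _ hj
      refine Finset.sum_eq_zero fun i _ => ?_
      rw [Matrix.single_apply_of_ne _ _ _ _ _ (fun hh => hj hh.1.symm), zero_smul]
    · simp
  have := congrArg φ h
  rw [map_add, map_sum, map_sum, map_zero] at this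
  simp only [map_smul, edgePair_hom, hφ] at this
  simpa only [Edge.hom, hφ] using this

theorem sum_edgePair {A : Type*} [AddCommMonoid A] (h k : ArcBasis n)
    (g : ArcBasis n → A) (hg : ∀ m, ¬ (RightEdge h m ∧ RightEdge m k) → g m = 0)
    [∀ p : EdgePair n, Decidable (p.fst.src = h ∧ p.snd.tgt = k)] :
    (∑ p : EdgePair n, if p.fst.src = h ∧ p.snd.tgt = k then g p.fst.tgt else 0) = ∑ m, g m := by
  classical
  rw [← Finset.sum_filter, ← Finset.sum_filter_of_ne (s := Finset.univ) (f := g)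
    (p := fun m => RightEdge h m ∧ RightEdge m k) (fun m _ hm => by
      by_contra hc; exact hm (hg m hc))]
  refine Finset.sum_bij (fun p _ => p.fst.tgt) ?_ ?_ ?_ (fun _ _ => rfl)
  · intro p hp
    rw [Finset.mem_filter] at hp ⊢
    refine ⟨Finset.mem_univ _, by rw [← hp.2.1]; exact p.fst.edge, ?_⟩
    rw [← hp.2.2, p.comp]; exact p.snd.edge
  · intro p hp q hq hpq
    rw [Finset.mem_filter] at hp hq
    refine EdgePair.ext (Edge.ext (hp.2.1.trans hq.2.1.symm) hpq)
      (Edge.ext ?_ (hp.2.2.trans hq.2.2.symm))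
    rw [← p.comp, ← q.comp]
    exact hpq
  · intro m hm
    rw [Finset.mem_filter] at hm
    exact ⟨⟨⟨h, m, hm.2.1⟩, ⟨m, k, hm.2.2⟩, rfl⟩, by simp, rfl⟩

/-- A path minus a parallel generator lies in `J₂`, so the path lies in `I`. With the next two
lemmas this describes `I^⊥`: functions on paths which are constant on classes of parallel paths and
vanish on classes containing a generator. It is spanned by the indicators of the remaining classes.
-/
theorem MemIPerp.zero_of_edge {ψ : EdgePair n → ℤ} (hψ : MemIPerp ψ) (p : EdgePair n)
    (h : RightEdge p.fst.src p.snd.tgt) : ψ p = 0 := by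
  classical
  have := hψ (Pi.single p 1) ⟨Pi.single ⟨_, _, h⟩ (-1), by
    unfold MemJTwo
    rw [Finset.sum_eq_single_of_mem (⟨_, _, h⟩ : Edge n) (Finset.mem_univ _) (fun b _ hb => by
        rw [Pi.single_eq_of_ne hb, zero_smul]),
      Finset.sum_eq_single_of_mem p (Finset.mem_univ _) (fun b _ hb => by
        rw [Pi.single_eq_of_ne hb, zero_smul]), Pi.single_eq_same, Pi.single_eq_same, edgePair_hom]
    simp [Edge.hom]⟩
  unfold pairing at this
  rw [Finset.sum_eq_single_of_mem p (Finset.mem_univ _) (fun b _ hb => by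
    rw [Pi.single_eq_of_ne hb, mul_zero]), Pi.single_eq_same, mul_one] at this
  exact this

theorem MemIPerp.eq_of_parallel {ψ : EdgePair n → ℤ} (hψ : MemIPerp ψ) (p q : EdgePair n)
    (h : p.fst.src = q.fst.src) (h' : p.snd.tgt = q.snd.tgt) : ψ p = ψ q := by
  classical
  have := hψ (Pi.single p 1 - Pi.single q 1) ⟨0, by
    unfold MemJTwo
    simp only [Pi.zero_apply, zero_smul, Finset.sum_const_zero, zero_add, Pi.sub_apply, sub_smul,
      Finset.sum_sub_distrib]
    rw [Finset.sum_eq_single_of_mem p (Finset.mem_univ _) (fun b _ hb => by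
        rw [Pi.single_eq_of_ne hb, zero_smul]),
      Finset.sum_eq_single_of_mem q (Finset.mem_univ _) (fun b _ hb => by
        rw [Pi.single_eq_of_ne hb, zero_smul]), Pi.single_eq_same, Pi.single_eq_same, edgePair_hom,
      edgePair_hom, h, h', sub_self]⟩
  unfold pairing at this
  simp only [Pi.sub_apply, mul_sub, Finset.sum_sub_distrib] at this
  rw [Finset.sum_eq_single_of_mem p (Finset.mem_univ _) (fun b _ hb => by
      rw [Pi.single_eq_of_ne hb, mul_zero]),
    Finset.sum_eq_single_of_mem q (Finset.mem_univ _) (fun b _ hb => by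
      rw [Pi.single_eq_of_ne hb, mul_zero]), Pi.single_eq_same, Pi.single_eq_same, mul_one,
    mul_one] at this
  exact sub_eq_zero.1 this

open Classical in
theorem memIPerp_indicator {h k : ArcBasis n} (hk : ¬ RightEdge h k) :
    MemIPerp fun p => if p.fst.src = h ∧ p.snd.tgt = k then 1 else 0 := by
  rintro r ⟨v, hv⟩
  have h1 := congrFun (congrFun hv h) k
  simp only [edgePair_hom] at h1
  simp only [Edge.hom, Matrix.add_apply, Matrix.sum_apply, Matrix.smul_apply,
    Matrix.single_apply, Matrix.zero_apply, smul_eq_mul, mul_ite, mul_one, mul_zero] at h1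
  rw [Finset.sum_eq_zero, zero_add] at h1
  · unfold pairing
    simpa only [ite_mul, one_mul, zero_mul] using h1
  · intro e _
    refine if_neg fun hh => hk ?_
    rw [← hh.1, ← hh.2]
    exact e.edge

theorem sum_memIPerp {A : Type*} [AddCommGroup A] (g : ArcBasis n → ArcBasis n → ArcBasis n → A)
    (hg : ∀ h m k, ¬ (RightEdge h m ∧ RightEdge m k) → g h m k = 0)
    (hs : ∀ h k, ¬ RightEdge h k → ∑ m, g h m k = 0) {ψ : EdgePair n → ℤ} (hψ : MemIPerp ψ) :
    ∑ p, ψ p • g p.fst.src p.fst.tgt p.snd.tgt = 0 := by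
  classical
  have key : ∀ p : EdgePair n, ψ p • g p.fst.src p.fst.tgt p.snd.tgt
      = ∑ h, ∑ k, if p.fst.src = h ∧ p.snd.tgt = k then ψ p • g h p.fst.tgt k else 0 := by
    intro p
    rw [Finset.sum_eq_single p.fst.src, Finset.sum_eq_single p.snd.tgt, if_pos ⟨rfl, rfl⟩]
    · exact fun j _ hj => if_neg fun hh => hj hh.2.symm
    · simp
    · exact fun j _ hj => Finset.sum_eq_zero fun i _ => if_neg fun hh => hj hh.1.symm
    · simp
  rw [Finset.sum_congr rfl fun p _ => key p, Finset.sum_comm]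
  refine Finset.sum_eq_zero fun h _ => ?_
  rw [Finset.sum_comm]
  refine Finset.sum_eq_zero fun k _ => ?_
  by_cases hk : RightEdge h k
  · refine Finset.sum_eq_zero fun p _ => ?_
    split_ifs with hh
    · rw [hψ.zero_of_edge p (by rw [hh.1, hh.2]; exact hk), zero_smul]
    · rfl
  · by_cases hp : ∃ p : EdgePair n, p.fst.src = h ∧ p.snd.tgt = k
    · obtain ⟨p, hp⟩ := hp
      have : ∀ q : EdgePair n, (if q.fst.src = h ∧ q.snd.tgt = k then ψ q • g h q.fst.tgt k else 0)
          = if q.fst.src = h ∧ q.snd.tgt = k then (fun m => ψ p • g h m k) q.fst.tgt else 0 := by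
        intro q
        split_ifs with hq
        · rw [hψ.eq_of_parallel q p (hq.1.trans hp.1.symm) (hq.2.trans hp.2.symm)]
        · rfl
      rw [Finset.sum_congr rfl fun q _ => this q, sum_edgePair h k (fun m => ψ p • g h m k)
        (fun m hm => by rw [hg h m k hm, smul_zero]), ← Finset.smul_sum, hs h k hk, smul_zero]
    · exact Finset.sum_eq_zero fun q _ => if_neg fun hq => hp ⟨q, hq⟩

/-! ### The universal property -/

theorem from_isBridge {r : Edge n} {h k : ArcBasis n} (hf : r.From h k) (hb : r.IsBridge) :
    RB h k := by
  obtain ⟨rfl, rfl⟩ := hf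
  exact ⟨r.edge, hb⟩

theorem from_isDec {r : Edge n} {h k : ArcBasis n} (hf : r.From h k) (hb : r.IsDec) :
    RD h k := by
  obtain ⟨rfl, rfl⟩ := hf
  exact ⟨r.edge, hb⟩

theorem mirrorFrom_isBridge {r : Edge n} {h k : ArcBasis n} (hf : r.MirrorFrom h k)
    (hb : r.IsBridge) : LB h k := by
  unfold LB
  rw [← hf.1, ← hf.2]
  exact ⟨r.edge, hb⟩

theorem mirrorFrom_isDec {r : Edge n} {h k : ArcBasis n} (hf : r.MirrorFrom h k) (hb : r.IsDec) :
    RD h k := by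
  rw [← rd_mirror, ← hf.1, ← hf.2]
  exact ⟨r.edge, hb⟩

/-- The value of a representation on a generator. -/
def letterVal {A : Type*} (e : ArcBasis n → A) (r l : Matrix (ArcBasis n) (ArcBasis n) A) :
    Letter n → A
  | .idem h => e h
  | .right x => r x.src x.tgt
  | .left x => l x.src.mirror x.tgt.mirror

theorem IsRep.sound {A : Type*} [Ring A] {e : ArcBasis n → A}
    {r l : Matrix (ArcBasis n) (ArcBasis n) A} (H : IsRep e r l) {x y : FreeAlg n}
    (hxy : Rel n x y) :
    FreeAlgebra.lift ℤ (letterVal e r l) x = FreeAlgebra.lift ℤ (letterVal e r l) y := by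
  have hi : ∀ h, FreeAlgebra.lift ℤ (letterVal e r l) (idemF h) = e h := fun h =>
    FreeAlgebra.lift_ι_apply _ _
  have hr : ∀ x, FreeAlgebra.lift ℤ (letterVal e r l) (rightF x) = r x.src x.tgt := fun h =>
    FreeAlgebra.lift_ι_apply _ _
  have hl : ∀ x, FreeAlgebra.lift ℤ (letterVal e r l) (leftF x) = l x.src.mirror x.tgt.mirror :=
    fun h => FreeAlgebra.lift_ι_apply _ _
  have hr' : ∀ {x : Edge n} {h k}, x.From h k → r x.src x.tgt = r h k := by
    rintro x h k ⟨rfl, rfl⟩; rfl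
  have hl' : ∀ {x : Edge n} {h k}, x.MirrorFrom h k → l x.src.mirror x.tgt.mirror = l h k := by
    rintro x h k ⟨h1, h2⟩
    rw [h1, h2]; rfl
  induction hxy with
  | idem_mul h => rw [map_mul, hi, H.idem_mul]
  | idem_orth h k hk => rw [map_mul, hi, hi, H.idem_orth h k hk, map_zero]
  | idem_sum => rw [map_sum, map_one, ← H.idem_sum]; exact Finset.sum_congr rfl fun h _ => hi h
  | right_src x => rw [map_mul, hi, hr, H.right_src _ _ x.edge]
  | right_tgt x => rw [map_mul, hi, hr, H.right_tgt _ _ x.edge]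
  | left_src x => rw [map_mul, hi, hl, H.left_src x.src.mirror x.tgt.mirror x.edge]
  | left_tgt x => rw [map_mul, hi, hl, H.left_tgt x.src.mirror x.tgt.mirror x.edge]
  | relB v s hv =>
    obtain ⟨Q, hQ, hQ'⟩ := H.quad
    rw [map_add, map_sum, map_sum, map_zero, ← sum_memJTwo Q hv]
    congr 1
    · refine Finset.sum_congr rfl fun x _ => ?_
      rw [map_smul, hr, hQ _ _ x.edge]
    · refine Finset.sum_congr rfl fun p _ => ?_
      rw [map_smul, map_mul, hr, hr, p.comp, hQ' _ _ _ (by rw [← p.comp]; exact p.fst.edge)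
        p.snd.edge]
  | relDual ψ hψ =>
    rw [map_sum, map_zero, ← sum_memIPerp
      (fun h m k => l h.mirror m.mirror * l m.mirror k.mirror) ?_ ?_ hψ]
    · refine Finset.sum_congr rfl fun p _ => ?_
      rw [map_smul, map_mul, hl, hl, p.comp]
    · intro h m k hmk
      rw [not_and_or] at hmk
      rcases hmk with hc | hc
      · rw [H.left_supp h.mirror m.mirror hc, zero_mul]
      · rw [H.left_supp m.mirror k.mirror hc, mul_zero]
    · intro h k hk
      rw [← H.dual h.mirror k.mirror hk, Matrix.mul_apply]
      exact Fintype.sum_equiv mirrorEquiv _ _ fun m => rfl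
  | extra₁ h₁ h₂ h₂' h₃ a b b' a' f1 f2 f3 f4 c1 c2 c3 c4 =>
    rw [map_mul, map_mul, hr, hr, hl, hl, hr' f1, hr' f4, hl' f2, hl' f3]
    exact H.square _ _ _ _ (.inl ⟨from_isBridge f1 c1, mirrorFrom_isBridge f2 c2,
      mirrorFrom_isBridge f3 c3, from_isBridge f4 c4⟩)
  | extra₂ h₁ h₂ h₂' h₃ a b b' a' f1 f2 f3 f4 c1 c2 c3 c4 =>
    rw [map_mul, map_mul, hr, hr, hl, hl, hr' f1, hr' f4, hl' f2, hl' f3]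
    exact H.square _ _ _ _ (.inr (.inl ⟨from_isDec f1 c1, mirrorFrom_isBridge f2 c2,
      mirrorFrom_isBridge f3 c3, from_isDec f4 c4⟩))
  | extra₃ h₁ h₂ h₂' h₃ a b b' a' f1 f2 f3 f4 c1 c2 c3 c4 d1 d2 =>
    rw [map_mul, map_mul, hr, hr, hl, hl, hr' f1, hr' f4, hl' f2, hl' f3]
    exact H.square _ _ _ _ (.inr (.inr (.inl ⟨from_isBridge f1 c1, mirrorFrom_isDec f2 c2,
      mirrorFrom_isDec f3 c3, from_isBridge f4 c4, d1, d2⟩)))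
  | extra₄ h₁ h₂ h₂' h₃ a b b' a' f1 f2 f3 f4 c1 c2 c3 c4 d1 d2 =>
    rw [map_mul, map_mul, hr, hr, hl, hl, hr' f1, hr' f4, hl' f2, hl' f3]
    exact H.square _ _ _ _ (.inr (.inr (.inr ⟨from_isDec f1 c1, mirrorFrom_isDec f2 c2,
      mirrorFrom_isDec f3 c3, from_isDec f4 c4, d1, d2⟩)))
  | extra₅_join h₁ h₂ h₂' h₂'' h₃ a b b' a' b'' a'' f1 f2 f3 f4 f5 f6 c1 c2 c3 c4 c5 c6 d1 d2 =>
    rw [map_mul, map_add, map_mul, map_mul, hr, hr, hr, hl, hl, hl, hr' f1, hl' f2, hl' f3, hr' f4,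
      hl' f5, hr' f6]
    exact H.join _ _ _ _ _ (from_isBridge f1 c1) (mirrorFrom_isDec f2 c2) (mirrorFrom_isDec f3 c3)
      (from_isBridge f4 c4) (mirrorFrom_isDec f5 c5) (from_isBridge f6 c6) d1 d2
  | extra₅_split h₁ h₂ h₂' h₂'' h₃ a b a' b' a'' b'' f1 f2 f3 f4 f5 f6 c1 c2 c3 c4 c5 c6 d1 d2 =>
    rw [map_mul, map_add, map_mul, map_mul, hr, hr, hr, hl, hl, hl, hl' f1, hr' f2, hr' f3, hl' f4,
      hr' f5, hl' f6]
    exact H.split _ _ _ _ _ (mirrorFrom_isDec f1 c2) (from_isBridge f2 c1) (from_isBridge f3 c4)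
      (mirrorFrom_isDec f4 c3) (from_isBridge f5 c6) (mirrorFrom_isDec f6 c5) d1 d2

/-- The ring homomorphism given by a representation. -/
def IsRep.lift {A : Type*} [Ring A] {e : ArcBasis n → A}
    {r l : Matrix (ArcBasis n) (ArcBasis n) A} (H : IsRep e r l) : FullAlg n →+* A :=
  RingQuot.lift ⟨(FreeAlgebra.lift ℤ (letterVal e r l)).toRingHom, fun _ _ hxy => H.sound hxy⟩

theorem IsRep.lift_letter {A : Type*} [Ring A] {e : ArcBasis n → A}
    {r l : Matrix (ArcBasis n) (ArcBasis n) A} (H : IsRep e r l) (x : Letter n) :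
    H.lift (letterA x) = letterVal e r l x := by
  unfold IsRep.lift letterA toFull
  refine (RingQuot.lift_mkRingHom_apply _ _ _).trans ?_
  exact FreeAlgebra.lift_ι_apply _ _

/-- The matrix of the generators of `B`. -/
def rightMat : Matrix (ArcBasis n) (ArcBasis n) (FullAlg n) := fun h k =>
  open Classical in if e : RightEdge h k then rightA ⟨h, k, e⟩ else 0

/-- The matrix of the generators of `m(B)^!`. -/
def leftMat : Matrix (ArcBasis n) (ArcBasis n) (FullAlg n) := fun h k =>
  open Classical in if e : LeftEdge h k then leftA ⟨h.mirror, k.mirror, e⟩ else 0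

theorem rightMat_of {h k : ArcBasis n} (e : RightEdge h k) : rightMat h k = rightA ⟨h, k, e⟩ :=
  dif_pos e

theorem leftMat_of {h k : ArcBasis n} (e : LeftEdge h k) :
    leftMat h k = leftA ⟨h.mirror, k.mirror, e⟩ := dif_pos e

theorem rightA_eq (x : Edge n) : rightA x = rightMat x.src x.tgt := (rightMat_of x.edge).symm

theorem leftA_eq (x : Edge n) : leftA x = leftMat x.src.mirror x.tgt.mirror :=
  (leftMat_of (h := x.src.mirror) (k := x.tgt.mirror) x.edge).symm

theorem toFull_rightF (x : Edge n) : toFull n (rightF x) = rightA x := rfl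

theorem toFull_leftF (x : Edge n) : toFull n (leftF x) = leftA x := rfl

theorem toFull_rel {x y : FreeAlg n} (h : Rel n x y) : toFull n x = toFull n y :=
  RingQuot.mkRingHom_rel h

theorem rb_from {h k : ArcBasis n} (e : RB h k) :
    Edge.From ⟨h, k, e.1⟩ h k ∧ Edge.IsBridge ⟨h, k, e.1⟩ := ⟨⟨rfl, rfl⟩, e.2⟩

theorem lb_from {h k : ArcBasis n} (e : LB h k) :
    Edge.MirrorFrom ⟨h.mirror, k.mirror, e.1⟩ h k ∧ Edge.IsBridge ⟨h.mirror, k.mirror, e.1⟩ :=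
  ⟨⟨rfl, rfl⟩, e.2⟩

theorem rd_from {h k : ArcBasis n} (e : RD h k) :
    Edge.From ⟨h, k, e.1⟩ h k ∧ Edge.IsDec ⟨h, k, e.1⟩ := ⟨⟨rfl, rfl⟩, e.2⟩

theorem ld_from {h k : ArcBasis n} (e : RD h k) :
    Edge.MirrorFrom ⟨h.mirror, k.mirror, e.leftEdge⟩ h k ∧
      Edge.IsDec ⟨h.mirror, k.mirror, e.leftEdge⟩ := ⟨⟨rfl, rfl⟩, e.a_eq⟩

theorem rightA_mul_of_parallel (p q : EdgePair n) (h : p.fst.src = q.fst.src)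
    (h' : p.snd.tgt = q.snd.tgt) :
    (rightA p.fst * rightA p.snd : FullAlg n) = rightA q.fst * rightA q.snd := by
  classical
  have hJ : MemJTwo 0 (Pi.single p 1 - Pi.single q 1) := by
    unfold MemJTwo
    simp only [Pi.zero_apply, zero_smul, Finset.sum_const_zero, zero_add, Pi.sub_apply, sub_smul,
      Finset.sum_sub_distrib]
    rw [Finset.sum_eq_single_of_mem p (Finset.mem_univ _) (fun b _ hb => by
        rw [Pi.single_eq_of_ne hb, zero_smul]),
      Finset.sum_eq_single_of_mem q (Finset.mem_univ _) (fun b _ hb => by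
        rw [Pi.single_eq_of_ne hb, zero_smul]), Pi.single_eq_same, Pi.single_eq_same, edgePair_hom,
      edgePair_hom, h, h', sub_self]
  have := toFull_rel (Rel.relB _ _ hJ)
  simp only [Pi.zero_apply, zero_smul, Finset.sum_const_zero, zero_add, Pi.sub_apply, sub_smul,
    Finset.sum_sub_distrib] at this
  rw [Finset.sum_eq_single_of_mem p (Finset.mem_univ _) (fun b _ hb => by
      rw [Pi.single_eq_of_ne hb, zero_smul]),
    Finset.sum_eq_single_of_mem q (Finset.mem_univ _) (fun b _ hb => by
      rw [Pi.single_eq_of_ne hb, zero_smul]), Pi.single_eq_same, Pi.single_eq_same, one_smul,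
    one_smul, map_sub, map_mul, map_mul, map_zero, toFull_rightF, toFull_rightF, toFull_rightF,
    toFull_rightF] at this
  exact sub_eq_zero.1 this

theorem rightA_mul_of_edge (p : EdgePair n) (h : RightEdge p.fst.src p.snd.tgt) :
    (rightA p.fst * rightA p.snd : FullAlg n) = rightA ⟨_, _, h⟩ := by
  classical
  have hJ : MemJTwo (Pi.single ⟨_, _, h⟩ (-1)) (Pi.single p 1) := by
    unfold MemJTwo
    rw [Finset.sum_eq_single_of_mem (⟨_, _, h⟩ : Edge n) (Finset.mem_univ _) (fun b _ hb => by
        rw [Pi.single_eq_of_ne hb, zero_smul]),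
      Finset.sum_eq_single_of_mem p (Finset.mem_univ _) (fun b _ hb => by
        rw [Pi.single_eq_of_ne hb, zero_smul]), Pi.single_eq_same, Pi.single_eq_same, edgePair_hom]
    simp [Edge.hom]
  have := toFull_rel (Rel.relB _ _ hJ)
  rw [Finset.sum_eq_single_of_mem (⟨_, _, h⟩ : Edge n) (Finset.mem_univ _) (fun b _ hb => by
      rw [Pi.single_eq_of_ne hb, zero_smul]),
    Finset.sum_eq_single_of_mem p (Finset.mem_univ _) (fun b _ hb => by
      rw [Pi.single_eq_of_ne hb, zero_smul]), Pi.single_eq_same, Pi.single_eq_same, one_smul,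
    neg_smul, one_smul, map_add, map_neg, map_mul, map_zero, toFull_rightF, toFull_rightF,
    toFull_rightF] at this
  exact (neg_add_eq_zero.1 this).symm

/-- The algebra is its own universal representation, so everything proved for an `IsRep` applies to
it, and new representations can be built from its elements. -/
theorem isRep_fullAlg : IsRep (idemA (n := n)) rightMat leftMat where
  idem_mul h := by
    have := toFull_rel (Rel.idem_mul h)
    rwa [map_mul] at this
  idem_orth h k hk := by
    have := toFull_rel (Rel.idem_orth h k hk)
    rwa [map_mul, map_zero] at this
  idem_sum := by
    have := toFull_rel (Rel.idem_sum (n := n))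
    rwa [map_sum, map_one] at this
  right_supp h k hk := dif_neg hk
  left_supp h k hk := dif_neg hk
  right_src h k e := by
    have := toFull_rel (Rel.right_src ⟨h, k, e⟩)
    rw [rightMat_of e]
    rwa [map_mul] at this
  right_tgt h k e := by
    have := toFull_rel (Rel.right_tgt ⟨h, k, e⟩)
    rw [rightMat_of e]
    rwa [map_mul] at this
  left_src h k e := by
    have := toFull_rel (Rel.left_src ⟨h.mirror, k.mirror, e⟩)
    rw [leftMat_of e]
    rwa [map_mul] at this
  left_tgt h k e := by
    have := toFull_rel (Rel.left_tgt ⟨h.mirror, k.mirror, e⟩)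
    rw [leftMat_of e]
    rwa [map_mul] at this
  quad := by
    classical
    -- Parallel paths have equal products, so where there is no generator an arbitrary path can be
    -- chosen to define `Q`.
    refine ⟨fun h k => if e : RightEdge h k then rightA ⟨h, k, e⟩ else
      if hp : ∃ p : EdgePair n, p.fst.src = h ∧ p.snd.tgt = k then
        rightA hp.choose.fst * rightA hp.choose.snd else 0, fun h k e => ?_, fun h m k e e' => ?_⟩
    · simp only [dif_pos e, rightMat_of e]
    · rw [rightMat_of e, rightMat_of e']
      let p : EdgePair n := ⟨⟨h, m, e⟩, ⟨m, k, e'⟩, rfl⟩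
      by_cases hk : RightEdge h k
      · simp only [dif_pos hk]
        exact rightA_mul_of_edge p hk
      · have hp : ∃ p : EdgePair n, p.fst.src = h ∧ p.snd.tgt = k := ⟨p, rfl, rfl⟩
        simp only [dif_neg hk, dif_pos hp]
        exact rightA_mul_of_parallel p _ hp.choose_spec.1.symm hp.choose_spec.2.symm
  dual h k hk := by
    classical
    have := toFull_rel (Rel.relDual _ (memIPerp_indicator (h := h.mirror) (k := k.mirror) hk))
    simp only [ite_smul, one_smul, zero_smul, map_sum, map_zero] at this
    rw [Matrix.mul_apply, ← this]
    have h2 : ∀ p : EdgePair n, toFull n (if p.fst.src = h.mirror ∧ p.snd.tgt = k.mirror then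
        leftF p.fst * leftF p.snd else 0)
        = if p.fst.src = h.mirror ∧ p.snd.tgt = k.mirror then
          (fun m => leftMat h m.mirror * leftMat m.mirror k) p.fst.tgt else 0 := by
      intro p
      split_ifs with hp
      · rw [map_mul, toFull_leftF, toFull_leftF, leftA_eq, leftA_eq, hp.1, hp.2, ← p.comp]
        rfl
      · rw [map_zero]
    refine Eq.trans ?_ ((Finset.sum_congr rfl fun p _ => h2 p).trans (sum_edgePair h.mirror k.mirror
      (fun m => leftMat h m.mirror * leftMat m.mirror k) fun m hm => ?_)).symm
    · exact Fintype.sum_equiv mirrorEquiv _ _ fun m => rfl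
    · rw [not_and_or] at hm
      rcases hm with hc | hc
      · have : leftMat h m.mirror = 0 := dif_neg hc
        simp only [this, zero_mul]
      · have : leftMat m.mirror k = 0 := dif_neg hc
        simp only [this, mul_zero]
  square h₁ h₂ h₂' h₃ hc := by
    rcases hc with ⟨c1, c2, c3, c4⟩ | ⟨c1, c2, c3, c4⟩ | ⟨c1, c2, c3, c4, d1, d2⟩ |
      ⟨c1, c2, c3, c4, d1, d2⟩
    · have := toFull_rel (Rel.extra₁ _ _ _ _ _ _ _ _ (rb_from c1).1 (lb_from c2).1 (lb_from c3).1
        (rb_from c4).1 (rb_from c1).2 (lb_from c2).2 (lb_from c3).2 (rb_from c4).2)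
      rw [map_mul, map_mul] at this
      rwa [rightMat_of c1.1, rightMat_of c4.1, leftMat_of c2.leftEdge, leftMat_of c3.leftEdge]
    · have := toFull_rel (Rel.extra₂ _ _ _ _ _ _ _ _ (rd_from c1).1 (lb_from c2).1 (lb_from c3).1
        (rd_from c4).1 (rd_from c1).2 (lb_from c2).2 (lb_from c3).2 (rd_from c4).2)
      rw [map_mul, map_mul] at this
      rwa [rightMat_of c1.1, rightMat_of c4.1, leftMat_of c2.leftEdge, leftMat_of c3.leftEdge]
    · have := toFull_rel (Rel.extra₃ _ _ _ _ _ _ _ _ (rb_from c1).1 (ld_from c2).1 (ld_from c3).1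
        (rb_from c4).1 (rb_from c1).2 (ld_from c2).2 (ld_from c3).2 (rb_from c4).2 d1 d2)
      rw [map_mul, map_mul] at this
      rwa [rightMat_of c1.1, rightMat_of c4.1, leftMat_of c2.leftEdge, leftMat_of c3.leftEdge]
    · have := toFull_rel (Rel.extra₄ _ _ _ _ _ _ _ _ (rd_from c1).1 (ld_from c2).1 (ld_from c3).1
        (rd_from c4).1 (rd_from c1).2 (ld_from c2).2 (ld_from c3).2 (rd_from c4).2 d1 d2)
      rw [map_mul, map_mul] at this
      rwa [rightMat_of c1.1, rightMat_of c4.1, leftMat_of c2.leftEdge, leftMat_of c3.leftEdge]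
  join h₁ h₂ h₂' h₂'' h₃ c1 c2 c3 c4 c5 c6 d1 d2 := by
    have := toFull_rel (Rel.extra₅_join _ _ _ _ _ _ _ _ _ _ _ (rb_from c1).1 (ld_from c2).1
      (ld_from c3).1 (rb_from c4).1 (ld_from c5).1 (rb_from c6).1 (rb_from c1).2 (ld_from c2).2
      (ld_from c3).2 (rb_from c4).2 (ld_from c5).2 (rb_from c6).2 d1 d2)
    rw [map_mul, map_add, map_mul, map_mul] at this
    rwa [rightMat_of c1.1, rightMat_of c4.1, rightMat_of c6.1, leftMat_of c2.leftEdge,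
      leftMat_of c3.leftEdge, leftMat_of c5.leftEdge]
  split h₁ h₂ h₂' h₂'' h₃ c1 c2 c3 c4 c5 c6 d1 d2 := by
    have := toFull_rel (Rel.extra₅_split _ _ _ _ _ _ _ _ _ _ _ (ld_from c1).1 (rb_from c2).1
      (rb_from c3).1 (ld_from c4).1 (rb_from c5).1 (ld_from c6).1 (rb_from c2).2 (ld_from c1).2
      (ld_from c4).2 (rb_from c3).2 (ld_from c6).2 (rb_from c5).2 d1 d2)
    rw [map_mul, map_add, map_mul, map_mul] at this
    rwa [rightMat_of c2.1, rightMat_of c3.1, rightMat_of c5.1, leftMat_of c1.leftEdge,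
      leftMat_of c4.leftEdge, leftMat_of c6.leftEdge]

end Representations

end BorderedKh
end

noncomputable section
namespace BorderedKh

/-! ## Exchanging generators of `B` and of `m(B)^!` -/

section Exchange

variable {n : ℕ} {M : Type*}

/-- An entry of a product of 0-1 matrices counts paths, so this is the commutation of left and right
surgeries read at one entry. The conditions on the matchings in `rbMat` and `lbMat` hold
automatically along such paths. -/
theorem card_bridge_bridge (h₁ h₃ : ArcBasis n) [DecidablePred fun m => RB h₁ m ∧ LB m h₃]
    [DecidablePred fun m => LB h₁ m ∧ RB m h₃] :
    (Finset.univ.filter fun m => RB h₁ m ∧ LB m h₃).card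
      = (Finset.univ.filter fun m => LB h₁ m ∧ RB m h₃).card := by
  classical
  have := congrFun (congrFun (rbMat_mul_lbMat h₃.a h₃.b) h₁) h₃
  rw [Matrix.mul_apply, Matrix.mul_apply] at this
  simp only [rbMat, lbMat, Matrix.of_apply, ← ite_and, mul_ite, mul_one, mul_zero] at this
  rw [← Finset.sum_filter, ← Finset.sum_filter, Finset.sum_const, Finset.sum_const, nsmul_eq_mul,
    nsmul_eq_mul, mul_one, mul_one, Nat.cast_inj] at this
  convert this using 3
  · constructor
    · rintro ⟨h1, h2⟩
      exact ⟨⟨h2, trivial⟩, h1, h2.b_eq⟩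
    · rintro ⟨⟨h2, -⟩, h1, -⟩
      exact ⟨h1, h2⟩
  · constructor
    · rintro ⟨h1, h2⟩
      exact ⟨⟨h2, trivial⟩, h1, h2.a_eq⟩
    · rintro ⟨⟨h2, -⟩, h1, -⟩
      exact ⟨h1, h2⟩

open Classical in
-- The hypothesis, which has the shape of relation (1), identifies every term of one kind with every
-- term of the other. So as soon as there is a path, all terms on both sides are equal, and only
-- their numbers matter.
theorem sum_bridge_bridge [AddCommMonoid M] {h₁ h₃ : ArcBasis n} {F G : ArcBasis n → M}
    (hFG : ∀ m m', RB h₁ m → LB m h₃ → LB h₁ m' → RB m' h₃ → F m = G m') :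
    (∑ m, if RB h₁ m ∧ LB m h₃ then F m else 0) = ∑ m, if LB h₁ m ∧ RB m h₃ then G m else 0 := by
  have hc := card_bridge_bridge h₁ h₃
  rw [← Finset.sum_filter, ← Finset.sum_filter]
  by_cases he : ∃ m, RB h₁ m ∧ LB m h₃
  · obtain ⟨m, hm⟩ := he
    have hpos : 0 < (Finset.univ.filter fun m => LB h₁ m ∧ RB m h₃).card := by
      rw [← hc]
      exact Finset.card_pos.2 ⟨m, by simp [hm]⟩
    obtain ⟨m', hm'⟩ := Finset.card_pos.1 hpos
    rw [Finset.mem_filter] at hm'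
    rw [Finset.sum_congr rfl (g := fun _ => F m), Finset.sum_congr rfl (f := G) (g := fun _ => F m),
      Finset.sum_const, Finset.sum_const, hc]
    · intro x hx
      rw [Finset.mem_filter] at hx
      exact (hFG m x hm.1 hm.2 hx.2.1 hx.2.2).symm
    · intro x hx
      rw [Finset.mem_filter] at hx
      rw [hFG m m' hm.1 hm.2 hm'.2.1 hm'.2.2, hFG x m' hx.2.1 hx.2.2 hm'.2.1 hm'.2.2]
  · have e1 : (Finset.univ.filter fun m => RB h₁ m ∧ LB m h₃) = ∅ :=
      Finset.filter_eq_empty_iff.2 fun m _ hm => he ⟨m, hm⟩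
    have e2 : (Finset.univ.filter fun m => LB h₁ m ∧ RB m h₃) = ∅ := by
      rw [← Finset.card_eq_zero, ← hc, e1, Finset.card_empty]
    rw [e1, e2, Finset.sum_empty, Finset.sum_empty]

open Classical in
theorem sum_dec_bridge [AddCommMonoid M] {x : Fin (2 * n)} {h₁ h₃ : ArcBasis n}
    {F G : ArcBasis n → M}
    (hFG : ∀ m m', DecAt x h₁ m → LB m h₃ → LB h₁ m' → DecAt x m' h₃ → F m = G m') :
    (∑ m, if DecAt x h₁ m ∧ LB m h₃ then F m else 0)
      = ∑ m, if LB h₁ m ∧ DecAt x m h₃ then G m else 0 := by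
  have hex := exists_decAt_lb_iff x h₁ h₃
  by_cases he : ∃ m, DecAt x h₁ m ∧ LB m h₃
  · obtain ⟨m, hm⟩ := he
    obtain ⟨m', hm'⟩ := hex.1 ⟨m, hm⟩
    rw [Finset.sum_eq_single m (fun z _ hz => if_neg fun hh => hz (hh.1.eq hm.1)) (by simp),
      Finset.sum_eq_single m' (fun z _ hz => if_neg fun hh => hz (hh.2.eq_src hm'.2)) (by simp),
      if_pos hm, if_pos hm', hFG m m' hm.1 hm.2 hm'.1 hm'.2]
  · rw [Finset.sum_eq_zero fun m _ => if_neg fun hm => he ⟨m, hm⟩,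
      Finset.sum_eq_zero fun m _ => if_neg fun hm => he (hex.2 ⟨m, hm⟩)]

theorem sum_ite_eq_singleton [AddCommMonoid M] {P : ArcBasis n → Prop} [DecidablePred P]
    {F : ArcBasis n → M} {m : ArcBasis n} (hP : ∀ x, P x ↔ x = m) :
    (∑ x, if P x then F x else 0) = F m := by
  rw [Finset.sum_eq_single m (fun z _ hz => if_neg fun hh => hz ((hP z).1 hh)) (by simp),
    if_pos ((hP m).2 rfl)]

theorem sum_ite_eq_pair [AddCommMonoid M] {P : ArcBasis n → Prop} [DecidablePred P]
    {F : ArcBasis n → M} {m m' : ArcBasis n} (hm : m ≠ m') (hP : ∀ x, P x ↔ x = m ∨ x = m') :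
    (∑ x, if P x then F x else 0) = F m + F m' := by
  rw [← Finset.sum_filter, ← Finset.sum_pair hm]
  congr 1
  ext x
  simp [hP x]

theorem RD.flipped_nonempty {h k : ArcBasis n} (e : RD h k) : (flipped h k).Nonempty := by
  obtain ⟨p, hp⟩ := rd_iff.1 e
  refine ⟨p, ?_⟩
  rw [flipped_of_decAt hp, mem_cls]
  exact h.equivalence.refl p

theorem ne_of_disjoint_src {h m m' : ArcBasis n} (e : RD h m)
    (hd : Disjoint (flipped h m) (flipped h m')) : m ≠ m' := by
  rintro rfl
  exact e.flipped_nonempty.ne_empty (disjoint_self.1 hd)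

theorem ne_of_disjoint_tgt {m m' k : ArcBasis n} (e : RD m k)
    (hd : Disjoint (flipped m k) (flipped m' k)) : m ≠ m' := by
  rintro rfl
  exact e.flipped_nonempty.ne_empty (disjoint_self.1 hd)

open Classical in
-- The hypotheses are the shapes of relation (3) and of the two halves of (5). By `bridgeDecPaths`,
-- if there are paths at all, one of these relations accounts for all of them.
theorem sum_bridge_dec [AddCommMonoid M] {h₁ h₃ : ArcBasis n} {F G : ArcBasis n → M}
    (hsq : ∀ m m', RB h₁ m → RD m h₃ → RD h₁ m' → RB m' h₃ → flipped m h₃ = flipped h₁ m' →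
      (∀ p ∈ flipped m h₃, h₁.b.f p = m.b.f p) → F m = G m')
    (hj : ∀ m m' m'', RB h₁ m → RD m h₃ → RD h₁ m' → RB m' h₃ → RD h₁ m'' → RB m'' h₃ →
      Disjoint (flipped h₁ m') (flipped h₁ m'') → flipped m h₃ = flipped h₁ m' ∪ flipped h₁ m'' →
      F m = G m' + G m'')
    (hs : ∀ m m' m'', RD h₁ m → RB m h₃ → RB h₁ m' → RD m' h₃ → RB h₁ m'' → RD m'' h₃ →
      Disjoint (flipped m' h₃) (flipped m'' h₃) → flipped h₁ m = flipped m' h₃ ∪ flipped m'' h₃ →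
      F m' + F m'' = G m) :
    (∑ m, if RB h₁ m ∧ RD m h₃ then F m else 0) = ∑ m, if RD h₁ m ∧ RB m h₃ then G m else 0 := by
  rcases bridgeDecPaths h₁ h₃ with ⟨e1, e2⟩ | ⟨m, m', e1, e2, d1, d2⟩ | ⟨m, m', m'', e1, e2, d1, d2⟩ |
    ⟨m, m', m'', e1, e2, d1, d2⟩
  · rw [Finset.sum_eq_zero fun m _ => if_neg (e1 m), Finset.sum_eq_zero fun m _ => if_neg (e2 m)]
  · have p1 := (e1 m).2 rfl
    have p2 := (e2 m').2 rfl
    rw [sum_ite_eq_singleton e1, sum_ite_eq_singleton e2]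
    exact hsq m m' p1.1 p1.2 p2.1 p2.2 d1 d2
  · have p1 := (e1 m).2 rfl
    have p2 := (e2 m').2 (.inl rfl)
    have p3 := (e2 m'').2 (.inr rfl)
    rw [sum_ite_eq_singleton e1, sum_ite_eq_pair (ne_of_disjoint_src p2.1 d1) e2]
    exact hj m m' m'' p1.1 p1.2 p2.1 p2.2 p3.1 p3.2 d1 d2
  · have p1 := (e2 m).2 rfl
    have p2 := (e1 m').2 (.inl rfl)
    have p3 := (e1 m'').2 (.inr rfl)
    rw [sum_ite_eq_singleton e2, sum_ite_eq_pair (ne_of_disjoint_tgt p2.2 d1) e1]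
    exact hs m m' m'' p1.1 p1.2 p2.1 p2.2 p3.1 p3.2 d1 d2

theorem not_union_eq {α : Type*} [DecidableEq α] {s t u : Finset α} (hd : Disjoint s t)
    (hs : s.Nonempty) (ht : t.Nonempty) (hu : u = s ∪ t) : u ≠ s ∧ u ≠ t := by
  constructor
  · rintro rfl
    obtain ⟨x, hx⟩ := ht
    exact Finset.disjoint_left.1 hd (hu ▸ Finset.mem_union_right _ hx) hx
  · rintro rfl
    obtain ⟨x, hx⟩ := hs
    exact Finset.disjoint_left.1 hd hx (hu ▸ Finset.mem_union_left _ hx)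

theorem pair_eq {α : Type*} [AddCommMonoid M] {G : α → M} {m m' x x' : α} (hm : m ≠ m')
    (h : m = x ∨ m = x') (h' : m' = x ∨ m' = x') : G x + G x' = G m + G m' := by
  rcases h with rfl | rfl <;> rcases h' with rfl | rfl
  · exact absurd rfl hm
  · rfl
  · exact add_comm _ _
  · exact absurd rfl hm

section

variable [AddCommMonoid M] {h₁ h₃ : ArcBasis n} {F G : ArcBasis n → M}

open Classical in
-- With the next two lemmas, a converse of `sum_bridge_dec`: one identity of sums over paths returns
-- whichever relation the configuration calls for. The derivatives of relations (3) and (5) are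
-- obtained in this way.
theorem square_of_sum_bridge_dec
    (hFG : (∑ m, if RB h₁ m ∧ RD m h₃ then F m else 0) = ∑ m, if RD h₁ m ∧ RB m h₃ then G m else 0)
    {m m' : ArcBasis n} (c1 : RB h₁ m) (c2 : RD m h₃) (c3 : RD h₁ m') (c4 : RB m' h₃)
    (hf : flipped m h₃ = flipped h₁ m') : F m = G m' := by
  rcases bridgeDecPaths h₁ h₃ with ⟨e1, e2⟩ | ⟨x, x', e1, e2, d1, d2⟩ | ⟨x, x', x'', e1, e2, d1, d2⟩ |
    ⟨x, x', x'', e1, e2, d1, d2⟩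
  · exact absurd ⟨c1, c2⟩ (e1 m)
  · rw [sum_ite_eq_singleton e1, sum_ite_eq_singleton e2, ← (e1 m).1 ⟨c1, c2⟩,
      ← (e2 m').1 ⟨c3, c4⟩] at hFG
    exact hFG
  · have hm := (e1 m).1 ⟨c1, c2⟩
    have hne := not_union_eq d1 ((e2 x').2 (.inl rfl)).1.flipped_nonempty
      ((e2 x'').2 (.inr rfl)).1.flipped_nonempty d2
    rw [← hm, hf] at hne
    rcases (e2 m').1 ⟨c3, c4⟩ with h | h
    · exact absurd (by rw [h]) hne.1
    · exact absurd (by rw [h]) hne.2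
  · have hm := (e2 m').1 ⟨c3, c4⟩
    have hne := not_union_eq d1 ((e1 x').2 (.inl rfl)).2.flipped_nonempty
      ((e1 x'').2 (.inr rfl)).2.flipped_nonempty d2
    rw [← hm, ← hf] at hne
    rcases (e1 m).1 ⟨c1, c2⟩ with h | h
    · exact absurd (by rw [h]) hne.1
    · exact absurd (by rw [h]) hne.2

open Classical in
theorem join_of_sum_bridge_dec
    (hFG : (∑ m, if RB h₁ m ∧ RD m h₃ then F m else 0) = ∑ m, if RD h₁ m ∧ RB m h₃ then G m else 0)
    {m m' m'' : ArcBasis n} (c1 : RB h₁ m) (c2 : RD m h₃) (c3 : RD h₁ m') (c4 : RB m' h₃)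
    (c5 : RD h₁ m'') (c6 : RB m'' h₃) (hd : Disjoint (flipped h₁ m') (flipped h₁ m'')) :
    F m = G m' + G m'' := by
  have hne := ne_of_disjoint_src c3 hd
  rcases bridgeDecPaths h₁ h₃ with ⟨e1, e2⟩ | ⟨x, x', e1, e2, d1, d2⟩ | ⟨x, x', x'', e1, e2, d1, d2⟩ |
    ⟨x, x', x'', e1, e2, d1, d2⟩
  · exact absurd ⟨c1, c2⟩ (e1 m)
  · exact absurd (((e2 m').1 ⟨c3, c4⟩).trans ((e2 m'').1 ⟨c5, c6⟩).symm) hne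
  · rw [sum_ite_eq_singleton e1, sum_ite_eq_pair
      (ne_of_disjoint_src ((e2 x').2 (.inl rfl)).1 d1) e2, ← (e1 m).1 ⟨c1, c2⟩,
      pair_eq hne ((e2 m').1 ⟨c3, c4⟩) ((e2 m'').1 ⟨c5, c6⟩)] at hFG
    exact hFG
  · exact absurd (((e2 m').1 ⟨c3, c4⟩).trans ((e2 m'').1 ⟨c5, c6⟩).symm) hne

open Classical in
theorem split_of_sum_bridge_dec
    (hFG : (∑ m, if RB h₁ m ∧ RD m h₃ then F m else 0) = ∑ m, if RD h₁ m ∧ RB m h₃ then G m else 0)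
    {m m' m'' : ArcBasis n} (c1 : RD h₁ m) (c2 : RB m h₃) (c3 : RB h₁ m') (c4 : RD m' h₃)
    (c5 : RB h₁ m'') (c6 : RD m'' h₃) (hd : Disjoint (flipped m' h₃) (flipped m'' h₃)) :
    F m' + F m'' = G m := by
  have hne := ne_of_disjoint_tgt c4 hd
  rcases bridgeDecPaths h₁ h₃ with ⟨e1, e2⟩ | ⟨x, x', e1, e2, d1, d2⟩ | ⟨x, x', x'', e1, e2, d1, d2⟩ |
    ⟨x, x', x'', e1, e2, d1, d2⟩
  · exact absurd ⟨c1, c2⟩ (e2 m)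
  · exact absurd (((e1 m').1 ⟨c3, c4⟩).trans ((e1 m'').1 ⟨c5, c6⟩).symm) hne
  · exact absurd (((e1 m').1 ⟨c3, c4⟩).trans ((e1 m'').1 ⟨c5, c6⟩).symm) hne
  · rw [sum_ite_eq_singleton e2, sum_ite_eq_pair
      (ne_of_disjoint_tgt ((e1 x').2 (.inl rfl)).2 d1) e1, ← (e2 m).1 ⟨c1, c2⟩,
      pair_eq hne ((e1 m').1 ⟨c3, c4⟩) ((e1 m'').1 ⟨c5, c6⟩)] at hFG
    exact hFG

end

/-! ### The commutation relations of a representation -/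

/-- The part of a matrix supported on a relation. -/
def restr {A : Type*} [Zero A] (P : ArcBasis n → ArcBasis n → Prop)
    (r : Matrix (ArcBasis n) (ArcBasis n) A) : Matrix (ArcBasis n) (ArcBasis n) A := fun h k =>
  open Classical in if P h k then r h k else 0

open Classical in
theorem restr_mul_restr_apply {A : Type*} [NonUnitalNonAssocSemiring A]
    (P Q : ArcBasis n → ArcBasis n → Prop) (r l : Matrix (ArcBasis n) (ArcBasis n) A)
    (h k : ArcBasis n) :
    (restr P r * restr Q l) h k = ∑ m, if P h m ∧ Q m k then r h m * l m k else 0 := by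
  rw [Matrix.mul_apply]
  refine Finset.sum_congr rfl fun m _ => ?_
  unfold restr
  by_cases h1 : P h m <;> by_cases h2 : Q m k <;> simp [h1, h2]

variable {A : Type*} [Ring A] {e : ArcBasis n → A} {r l : Matrix (ArcBasis n) (ArcBasis n) A}

theorem IsRep.rb_mul_lb (H : IsRep e r l) :
    restr RB r * restr LB l = restr LB l * restr RB r := by
  ext h k
  rw [restr_mul_restr_apply, restr_mul_restr_apply]
  exact sum_bridge_bridge fun m m' c1 c2 c3 c4 => H.square _ _ _ _ (.inl ⟨c1, c2, c3, c4⟩)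

theorem DecAt.rd {x : Fin (2 * n)} {h k : ArcBasis n} (e : DecAt x h k) : RD h k := rd_iff.2 ⟨x, e⟩

theorem IsRep.dec_mul_lb (H : IsRep e r l) (x : Fin (2 * n)) :
    restr (DecAt x) r * restr LB l = restr LB l * restr (DecAt x) r := by
  ext h k
  rw [restr_mul_restr_apply, restr_mul_restr_apply]
  exact sum_dec_bridge fun m m' c1 c2 c3 c4 =>
    H.square _ _ _ _ (.inr (.inl ⟨c1.rd, c2, c3, c4.rd⟩))

theorem LeftEdge.deg_lt {h k : ArcBasis n} (e : LeftEdge h k) : h.deg < k.deg := by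
  have := RightEdge.deg_lt e
  rwa [ArcBasis.deg_mirror, ArcBasis.deg_mirror] at this

theorem IsRep.sq_eq_zero (H : IsRep e r l) {h k : ArcBasis n} (hd : k.deg ≤ h.deg + 1) :
    (l * l) h k = 0 := by
  rw [Matrix.mul_apply]
  refine Finset.sum_eq_zero fun m _ => ?_
  by_cases h1 : LeftEdge h m
  · by_cases h2 : LeftEdge m k
    · have := h1.deg_lt
      have := h2.deg_lt
      omega
    · rw [H.left_supp m k h2, mul_zero]
  · rw [H.left_supp h m h1, zero_mul]

/-- A decoration alone raises the degree by 2 and any other factor by at least 1. Up to degree 2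
only pairs of bridges contribute to `l²`. -/
theorem IsRep.sq_eq_lb (H : IsRep e r l) {h k : ArcBasis n} (hd : k.deg ≤ h.deg + 2) :
    (restr LB l * restr LB l) h k = (l * l) h k := by
  classical
  rw [restr_mul_restr_apply, Matrix.mul_apply]
  refine Finset.sum_congr rfl fun m _ => ?_
  by_cases h1 : LeftEdge h m
  · by_cases h2 : LeftEdge m k
    · have d1 := h1.deg_lt
      have d2 := h2.deg_lt
      rw [if_pos]
      constructor
      · rcases leftEdge_cases h1 with h | h
        · exact h
        · have := h.deg_eq
          omega
      · rcases leftEdge_cases h2 with h | h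
        · exact h
        · have := h.deg_eq
          omega
    · rw [H.left_supp m k h2, mul_zero, ite_self]
  · rw [H.left_supp h m h1, zero_mul, ite_self]

theorem IsRep.lb_sq_eq_zero (H : IsRep e r l) {h k : ArcBasis n} (hd : k.deg ≤ h.deg + 2)
    (hk : ¬ RD h k) : (restr LB l * restr LB l) h k = 0 := by
  rw [H.sq_eq_lb hd]
  by_cases hl : LeftEdge h k
  · rcases leftEdge_cases hl with h1 | h1
    · exact H.sq_eq_zero h1.deg_eq.le
    · exact absurd h1 hk
  · exact H.dual h k hl

open Classical in
-- The bridge part of `r` commutes with the bridge part of `l`, hence with its square. At an entry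
-- of degree 3 that square has degree 2, where it equals `l²` and, by `I^⊥`, is supported on
-- decorations.
theorem IsRep.sum_bridge_sq (H : IsRep e r l) {h₁ h₃ : ArcBasis n} (hd : h₃.deg = h₁.deg + 3) :
    (∑ m, if RB h₁ m ∧ RD m h₃ then r h₁ m * (l * l) m h₃ else 0)
      = ∑ m, if RD h₁ m ∧ RB m h₃ then (l * l) h₁ m * r m h₃ else 0 := by
  have key : restr RB r * (restr LB l * restr LB l) = (restr LB l * restr LB l) * restr RB r := by
    rw [← mul_assoc, H.rb_mul_lb, mul_assoc, H.rb_mul_lb, mul_assoc]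
  have := congrFun (congrFun key h₁) h₃
  rw [Matrix.mul_apply, Matrix.mul_apply (M := _ * _)] at this
  convert this using 2 with m _ m _
  · unfold restr
    by_cases h1 : RB h₁ m
    · have := h1.deg_eq
      by_cases h2 : RD m h₃
      · rw [if_pos ⟨h1, h2⟩, if_pos h1]
        exact congrArg _ (H.sq_eq_lb (by omega)).symm
      · rw [if_neg (fun hh => h2 hh.2), if_pos h1]
        have h0 := H.lb_sq_eq_zero (by omega) h2
        unfold restr at h0
        rw [h0, mul_zero]
    · rw [if_neg (fun hh => h1 hh.1), if_neg h1, zero_mul]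
  · have hr : restr RB r m h₃ = if RB m h₃ then r m h₃ else 0 := rfl
    rw [hr]
    by_cases h1 : RB m h₃
    · have := h1.deg_eq
      by_cases h2 : RD h₁ m
      · rw [if_pos ⟨h2, h1⟩, if_pos h1, H.sq_eq_lb (by omega)]
      · rw [if_neg (fun hh => h2 hh.1), if_pos h1, H.lb_sq_eq_zero (by omega) h2, zero_mul]
    · rw [if_neg (fun hh => h1 hh.2), if_neg h1, mul_zero]

theorem decAt_of_flipped {x : Fin (2 * n)} {h k h' k' : ArcBasis n} (e : DecAt x h k)
    (e' : RD h' k') (hf : flipped h k = flipped h' k') : DecAt x h' k' := by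
  obtain ⟨p, hp⟩ := rd_iff.1 e'
  refine hp.of_rel ?_
  have hx : x ∈ cls h.rel x := mem_cls.2 (h.equivalence.refl x)
  rw [← flipped_of_decAt e, hf, flipped_of_decAt hp] at hx
  exact mem_cls.1 hx

/-- The same argument with the decorations at a fixed point `x` in place of right bridges. Such a
decoration is determined by either end, so each side has a single term. -/
theorem IsRep.dec_sq (H : IsRep e r l) {h₁ h₂ h₂' h₃ : ArcBasis n} (c1 : RD h₁ h₂)
    (c2 : RD h₂ h₃) (c3 : RD h₁ h₂') (c4 : RD h₂' h₃) (hf : flipped h₁ h₂ = flipped h₂' h₃) :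
    r h₁ h₂ * (l * l) h₂ h₃ = (l * l) h₁ h₂' * r h₂' h₃ := by
  obtain ⟨x, hx⟩ := rd_iff.1 c1
  have hx' := decAt_of_flipped hx c4 hf
  have key : restr (DecAt x) r * (restr LB l * restr LB l)
      = (restr LB l * restr LB l) * restr (DecAt x) r := by
    rw [← mul_assoc, H.dec_mul_lb, mul_assoc, H.dec_mul_lb, mul_assoc]
  have := congrFun (congrFun key h₁) h₃
  rw [Matrix.mul_apply, Matrix.mul_apply (M := _ * _), Finset.sum_eq_single h₂,
    Finset.sum_eq_single h₂', H.sq_eq_lb c2.deg_eq.le, H.sq_eq_lb c3.deg_eq.le] at this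
  · unfold restr at this
    rwa [if_pos hx, if_pos hx'] at this
  · intro m _ hm
    have : restr (DecAt x) r m h₃ = 0 := if_neg fun hh => hm (hh.eq_src hx')
    rw [this, mul_zero]
  · simp
  · intro m _ hm
    have : restr (DecAt x) r h₁ m = 0 := if_neg fun hh => hm (hh.eq hx)
    rw [this, zero_mul]
  · simp

end Exchange

end BorderedKh
end

noncomputable section
namespace BorderedKh

/-! ## The differential of `B ⊙ m(B)^!` -/

section Differential

variable {n : ℕ}

/-- The product of a list of generators. -/
def word (w : List (Letter n)) : FullAlg n := (w.map letterA).prod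

/-- The bidegree of a list of generators. -/
def wordDeg (w : List (Letter n)) : ℚ × ℤ := (w.map Letter.deg).sum

theorem word_nil : word ([] : List (Letter n)) = 1 := rfl

theorem word_cons (x : Letter n) (w : List (Letter n)) : word (x :: w) = letterA x * word w :=
  List.prod_cons

theorem word_append (w w' : List (Letter n)) : word (w ++ w') = word w * word w' := by
  unfold word
  rw [List.map_append, List.prod_append]

theorem word_singleton (x : Letter n) : word [x] = letterA x := by
  rw [word_cons, word_nil, mul_one]

theorem wordDeg_cons (x : Letter n) (w : List (Letter n)) :
    wordDeg (x :: w) = x.deg + wordDeg w := List.sum_cons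

theorem wordDeg_append (w w' : List (Letter n)) : wordDeg (w ++ w') = wordDeg w + wordDeg w' := by
  unfold wordDeg
  rw [List.map_append, List.sum_append]

theorem word_mem (w : List (Letter n)) : word w ∈ fullGr n (wordDeg w) :=
  Submodule.subset_span ⟨w, rfl, rfl⟩

theorem letterA_mem (x : Letter n) : letterA x ∈ fullGr n x.deg := by
  have := word_mem [x]
  rwa [word_singleton, wordDeg_cons, show wordDeg ([] : List (Letter n)) = 0 from rfl,
    add_zero] at this

theorem fullGr_induction {p : ℚ × ℤ} {P : FullAlg n → Prop}
    (word : ∀ w, wordDeg w = p → P (word w)) (zero : P 0)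
    (add : ∀ a b, P a → P b → P (a + b)) (smul : ∀ (c : ℤ) a, P a → P (c • a)) {a : FullAlg n}
    (ha : a ∈ fullGr n p) : P a := by
  induction ha using Submodule.span_induction with
  | mem x hx =>
    obtain ⟨w, hw, rfl⟩ := hx
    exact word w hw
  | zero => exact zero
  | add x y _ _ hx hy => exact add x y hx hy
  | smul c x _ hx => exact smul c x hx

theorem span_word : Submodule.span ℤ (Set.range (word (n := n))) = ⊤ := by
  refine eq_top_iff.2 fun a _ => ?_
  have hs : Function.Surjective (toFull n) := RingQuot.mkRingHom_surjective (Rel n)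
  obtain ⟨x, rfl⟩ := hs a
  induction x using FreeAlgebra.induction with
  | grade0 c =>
    rw [eq_intCast (algebraMap ℤ (FreeAlgebra ℤ (Letter n))), map_intCast, ← zsmul_one]
    exact Submodule.smul_mem _ c (Submodule.subset_span ⟨[], rfl⟩)
  | grade1 x => exact Submodule.subset_span ⟨[x], word_singleton x⟩
  | mul a b ha hb =>
    rw [map_mul]
    replace ha := ha trivial
    replace hb := hb trivial
    have h1 := Submodule.mul_mem_mul ha hb
    rw [Submodule.span_mul_span] at h1
    refine Submodule.span_mono ?_ h1
    rintro _ ⟨_, ⟨w, rfl⟩, _, ⟨w', rfl⟩, rfl⟩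
    exact ⟨w ++ w', word_append w w'⟩
  | add a b ha hb =>
    rw [map_add]
    exact Submodule.add_mem _ (ha trivial) (hb trivial)

theorem linearMap_ext_word {X : Type*} [AddCommGroup X] {f g : FullAlg n →ₗ[ℤ] X}
    (h : ∀ w, f (word w) = g (word w)) : f = g :=
  LinearMap.ext_on_range span_word h

theorem mul_mem_fullGr {p q : ℚ × ℤ} {a b : FullAlg n} (ha : a ∈ fullGr n p)
    (hb : b ∈ fullGr n q) : a * b ∈ fullGr n (p + q) := by
  have h1 := Submodule.mul_mem_mul ha hb
  unfold fullGr at h1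
  rw [Submodule.span_mul_span] at h1
  refine Submodule.span_mono ?_ h1
  rintro _ ⟨_, ⟨w, hw, rfl⟩, _, ⟨w', hw', rfl⟩, rfl⟩
  refine ⟨w ++ w', ?_, (word_append w w').symm⟩
  rw [← hw, ← hw']
  exact wordDeg_append w w'

theorem one_mem_fullGr : (1 : FullAlg n) ∈ fullGr n 0 := word_mem []

/-! ### Existence -/

section

variable {A : Type*} [Ring A] {e : ArcBasis n → A} {r l : Matrix (ArcBasis n) (ArcBasis n) A}

theorem IsRep.src_left (H : IsRep e r l) (h k : ArcBasis n) : e h * l h k = l h k := by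
  by_cases hk : LeftEdge h k
  · exact H.left_src h k hk
  · rw [H.left_supp h k hk, mul_zero]

theorem IsRep.left_mul_tgt (H : IsRep e r l) (h k : ArcBasis n) : l h k * e k = l h k := by
  by_cases hk : LeftEdge h k
  · exact H.left_tgt h k hk
  · rw [H.left_supp h k hk, zero_mul]

theorem sum_fin_two_matrix {ι : Type*} (s : Finset ι) (a b c d : ι → A) :
    ∑ i ∈ s, !![a i, b i; c i, d i] = !![∑ i ∈ s, a i, ∑ i ∈ s, b i; ∑ i ∈ s, c i, ∑ i ∈ s, d i] := by
  ext i j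
  rw [Matrix.sum_apply]
  fin_cases i <;> fin_cases j <;> rfl

open Classical in
/-- The representation by upper triangular matrices which encodes the differential. -/
theorem IsRep.double (H : IsRep e r l) :
    IsRep (fun h => !![e h, 0; 0, e h]) (Matrix.of fun h k => !![r h k, 0; 0, r h k])
      (Matrix.of fun h k => !![l h k, -(l * l) h k; 0, -l h k]) where
  idem_mul h := by simp [H.idem_mul h]
  idem_orth h k hk := by
    simp only [Matrix.mul_fin_two, H.idem_orth h k hk, mul_zero, zero_mul, add_zero]
    exact (Matrix.eta_fin_two 0).symm
  idem_sum := by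
    rw [sum_fin_two_matrix, H.idem_sum, Finset.sum_const_zero]
    exact Matrix.one_fin_two.symm
  right_supp h k hk := by
    rw [Matrix.of_apply, H.right_supp h k hk]
    exact (Matrix.eta_fin_two 0).symm
  left_supp h k hk := by
    rw [Matrix.of_apply, H.left_supp h k hk, H.dual h k hk, neg_zero]
    exact (Matrix.eta_fin_two 0).symm
  right_src h k hk := by simp [H.right_src h k hk]
  right_tgt h k hk := by simp [H.right_tgt h k hk]
  left_src h k hk := by
    have h2 : e h * (l * l) h k = (l * l) h k := by
      rw [Matrix.mul_apply, Finset.mul_sum]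
      exact Finset.sum_congr rfl fun m _ => by rw [← mul_assoc, H.src_left]
    simp [H.left_src h k hk, h2]
  left_tgt h k hk := by
    have h2 : (l * l) h k * e k = (l * l) h k := by
      rw [Matrix.mul_apply, Finset.sum_mul]
      exact Finset.sum_congr rfl fun m _ => by rw [mul_assoc, H.left_mul_tgt]
    simp [H.left_tgt h k hk, h2]
  quad := by
    obtain ⟨Q, h1, h2⟩ := H.quad
    refine ⟨fun h k => !![Q h k, 0; 0, Q h k], fun h k hk => ?_, fun h m k hm hk => ?_⟩
    · rw [Matrix.of_apply, h1 h k hk]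
    · simp [h2 h m k hm hk]
  dual h k hk := by
    have h1 := H.dual h k hk
    -- The off-diagonal entry of the squared matrix is `-l · l² + l² · l`, which vanishes by
    -- associativity. No relation is needed there.
    have h2 : ∑ m, l h m * (l * l) m k = ∑ m, (l * l) h m * l m k := by
      rw [← Matrix.mul_apply, ← Matrix.mul_apply (M := l * l), mul_assoc]
    rw [Matrix.mul_apply] at h1 ⊢
    simp only [Matrix.of_apply, Matrix.mul_fin_two, mul_zero, zero_mul, add_zero, mul_neg, neg_mul,
      neg_neg, sum_fin_two_matrix, Finset.sum_add_distrib, Finset.sum_neg_distrib, h1, h2,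
      Finset.sum_const_zero, neg_add_cancel, neg_zero]
    exact (Matrix.eta_fin_two (0 : Matrix (Fin 2) (Fin 2) A)).symm
  square h₁ h₂ h₂' h₃ hc := by
    have h1 := H.square _ _ _ _ hc
    -- The off-diagonal entry is the derivative of the relation, with `l` replaced by `l²` up to
    -- sign. For left bridges it vanishes for reasons of degree; for decorations it comes from
    -- exchanging twice with bridges.
    have h2 : r h₁ h₂ * (l * l) h₂ h₃ = (l * l) h₁ h₂' * r h₂' h₃ := by
      rcases hc with ⟨c1, c2, c3, c4⟩ | ⟨c1, c2, c3, c4⟩ | ⟨c1, c2, c3, c4, d1, d2⟩ |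
        ⟨c1, c2, c3, c4, d1, d2⟩
      · rw [H.sq_eq_zero c2.deg_eq.le, H.sq_eq_zero c3.deg_eq.le, mul_zero, zero_mul]
      · rw [H.sq_eq_zero c2.deg_eq.le, H.sq_eq_zero c3.deg_eq.le, mul_zero, zero_mul]
      · exact square_of_sum_bridge_dec (F := fun m => r h₁ m * (l * l) m h₃)
          (G := fun m => (l * l) h₁ m * r m h₃)
          (H.sum_bridge_sq (by rw [c2.deg_eq, c1.deg_eq]; ring)) c1 c2 c3 c4 d1
      · exact H.dec_sq c1 c2 c3 c4 d2
    simp [h1, h2]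
  join h₁ h₂ h₂' h₂'' h₃ c1 c2 c3 c4 c5 c6 d1 d2 := by
    have h1 := H.join _ _ _ _ _ c1 c2 c3 c4 c5 c6 d1 d2
    have h2 := join_of_sum_bridge_dec (F := fun m => r h₁ m * (l * l) m h₃)
      (G := fun m => (l * l) h₁ m * r m h₃)
      (H.sum_bridge_sq (by rw [c2.deg_eq, c1.deg_eq]; ring)) c1 c2 c3 c4 c5 c6 d1
    beta_reduce at h2
    simp [h1, h2, add_comm]
  split h₁ h₂ h₂' h₂'' h₃ c1 c2 c3 c4 c5 c6 d1 d2 := by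
    have h1 := H.split _ _ _ _ _ c1 c2 c3 c4 c5 c6 d1 d2
    have h2 := split_of_sum_bridge_dec (F := fun m => r h₁ m * (l * l) m h₃)
      (G := fun m => (l * l) h₁ m * r m h₃)
      (H.sum_bridge_sq (by rw [c2.deg_eq, c1.deg_eq]; ring)) c1 c2 c3 c4 c5 c6 d1
    beta_reduce at h2
    simp [← h1, ← h2, add_comm]

end

/-- The homomorphism into upper triangular matrices which encodes the differential. -/
def doubleHom : FullAlg n →+* Matrix (Fin 2) (Fin 2) (FullAlg n) := isRep_fullAlg.double.lift

/-- The differential of `B ⊙ m(B)^!`. -/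
def diffMap : FullAlg n →ₗ[ℤ] FullAlg n where
  toFun a := doubleHom a 0 1
  map_add' a b := by rw [map_add]; rfl
  map_smul' c a := by rw [map_zsmul]; rfl

/-- A homogeneous `a` goes to the matrix with rows `(a, d a)` and `(0, ±a)`, the sign being that of
its homological degree. The product of two such matrices has off-diagonal entry `a · d b ± d a · b`,
which is the Leibniz rule in the present convention. -/
theorem doubleHom_letter (x : Letter n) : doubleHom (letterA x)
    = !![letterA x, diffMap (letterA x); 0, (x.deg.2.negOnePow : ℤ) • letterA x] := by
  have h : doubleHom (letterA x) = letterVal _ _ _ x := isRep_fullAlg.double.lift_letter x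
  have hd : diffMap (letterA x) = doubleHom (letterA x) 0 1 := rfl
  rw [hd, h]
  cases x with
  | idem k => simp [letterVal, Letter.deg, idemA]
  | right b => simp [letterVal, Letter.deg, ← rightA_eq, rightA]
  | left b => simp [letterVal, Letter.deg, ← leftA_eq, leftA]

theorem doubleHom_word (w : List (Letter n)) : doubleHom (word w)
    = !![word w, diffMap (word w); 0, ((wordDeg w).2.negOnePow : ℤ) • word w] := by
  induction w with
  | nil =>
    have hd : diffMap (word ([] : List (Letter n))) = doubleHom (word []) 0 1 := rfl
    rw [hd, word_nil, map_one, Matrix.one_fin_two]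
    simp [wordDeg]
  | cons x w ih =>
    have hd : diffMap (word (x :: w)) = doubleHom (word (x :: w)) 0 1 := rfl
    rw [hd, word_cons, map_mul, ih, doubleHom_letter, Matrix.mul_fin_two, wordDeg_cons]
    simp only [Matrix.of_apply, Matrix.cons_val', Matrix.cons_val_zero, Matrix.cons_val_one,
      Matrix.cons_val_fin_one, mul_zero, zero_mul, add_zero, zero_add, Prod.snd_add, Int.negOnePow_add,
      smul_mul_smul_comm, Units.val_mul]

theorem doubleHom_apply_zero_zero (a : FullAlg n) : doubleHom a 0 0 = a := by
  have : (Matrix.entryLinearMap ℤ (FullAlg n) (0 : Fin 2) (0 : Fin 2)) ∘ₗ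
      doubleHom.toAddMonoidHom.toIntLinearMap = LinearMap.id :=
    linearMap_ext_word fun w => congrFun (congrFun (doubleHom_word w) 0) 0
  exact LinearMap.congr_fun this a

theorem doubleHom_apply_one_one {p : ℚ × ℤ} {a : FullAlg n} (ha : a ∈ fullGr n p) :
    doubleHom a 1 1 = (p.2.negOnePow : ℤ) • a := by
  refine fullGr_induction (P := fun a => doubleHom a 1 1 = (p.2.negOnePow : ℤ) • a) ?_ ?_ ?_ ?_ ha
  · rintro w rfl
    rw [doubleHom_word]
    rfl
  · rw [map_zero, smul_zero]; rfl
  · intro a b ha hb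
    rw [map_add, Matrix.add_apply, ha, hb, smul_add]
  · intro c a ha
    rw [map_zsmul, Matrix.smul_apply, ha, smul_comm]

/-- The matrix of the products of two generators of `m(B)^!`. -/
def leftSq : Matrix (ArcBasis n) (ArcBasis n) (FullAlg n) := leftMat * leftMat

theorem leftSq_apply (h k : ArcBasis n) : leftSq h k = ∑ m, leftMat h m * leftMat m k :=
  Matrix.mul_apply

/-- The sign is that of `φ`: since `φ(r) + r ∈ J₂`, a path parallel to a generator is sent to minus
this generator. Dually, a generator is sent to minus the sum of all parallel paths. -/
theorem sum_phiStar (x : Edge n) :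
    ∑ p, phiStar x p • (leftA p.fst * leftA p.snd)
      = -leftSq x.src.mirror x.tgt.mirror := by
  classical
  have h2 : ∀ p : EdgePair n, phiStar x p • (leftA p.fst * leftA p.snd)
      = -if p.fst.src = x.src ∧ p.snd.tgt = x.tgt then
        (fun m : ArcBasis n => leftMat x.src.mirror m.mirror * leftMat m.mirror x.tgt.mirror)
          p.fst.tgt else 0 := by
    intro p
    unfold phiStar
    split_ifs with hp
    · rw [neg_smul, one_smul, leftA_eq, leftA_eq, hp.1, hp.2, ← p.comp]
    · rw [zero_smul, neg_zero]
  rw [Finset.sum_congr rfl fun p _ => h2 p, Finset.sum_neg_distrib,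
    sum_edgePair x.src x.tgt
      (fun m : ArcBasis n => leftMat x.src.mirror m.mirror * leftMat m.mirror x.tgt.mirror),
    leftSq_apply]
  · congr 1
    exact Fintype.sum_equiv mirrorEquiv _ _ fun m => rfl
  · intro m hm
    rw [not_and_or] at hm
    rcases hm with hc | hc
    · have : leftMat x.src.mirror m.mirror = 0 := dif_neg hc
      simp only [this, zero_mul]
    · have : leftMat m.mirror x.tgt.mirror = 0 := dif_neg hc
      simp only [this, mul_zero]

theorem isFullDifferential_diffMap : IsFullDifferential (diffMap (n := n)) where
  idem h := congrFun (congrFun (isRep_fullAlg.double.lift_letter (.idem h)) 0) 1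
  right x := congrFun (congrFun (isRep_fullAlg.double.lift_letter (.right x)) 0) 1
  left x := by
    rw [sum_phiStar]
    exact congrFun (congrFun (isRep_fullAlg.double.lift_letter (.left x)) 0) 1
  leibniz a b p hb := by
    change doubleHom (a * b) 0 1 = _
    rw [map_mul, Matrix.mul_apply, Fin.sum_univ_two, doubleHom_apply_zero_zero,
      doubleHom_apply_one_one hb, mul_smul_comm, add_comm]
    rfl

/-! ### Uniqueness and `d² = 0` -/

variable {d : FullAlg n →ₗ[ℤ] FullAlg n}

theorem IsFullDifferential.one (D : IsFullDifferential d) : d 1 = 0 := by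
  have := D.leibniz 1 1 0 one_mem_fullGr
  simpa using this

theorem IsFullDifferential.word_cons (D : IsFullDifferential d) (x : Letter n)
    (w : List (Letter n)) : d (word (x :: w))
      = ((wordDeg w).2.negOnePow : ℤ) • (d (letterA x) * word w) + letterA x * d (word w) := by
  rw [BorderedKh.word_cons, D.leibniz _ _ _ (word_mem w)]

theorem IsFullDifferential.unique (D : IsFullDifferential d) {d' : FullAlg n →ₗ[ℤ] FullAlg n}
    (D' : IsFullDifferential d') : d = d' := by
  refine linearMap_ext_word fun w => ?_
  induction w with
  | nil => rw [word_nil, D.one, D'.one]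
  | cons x w ih =>
    rw [D.word_cons, D'.word_cons, ih]
    congr 3
    cases x with
    | idem h => exact (D.idem h).trans (D'.idem h).symm
    | right b => exact (D.right b).trans (D'.right b).symm
    | left b => exact (D.left b).trans (D'.left b).symm

theorem IsFullDifferential.rightMat (D : IsFullDifferential d) (h k : ArcBasis n) :
    d (rightMat h k) = 0 := by
  by_cases e : RightEdge h k
  · rw [rightMat_of e, D.right]
  · rw [isRep_fullAlg.right_supp h k e, map_zero]

/-- The equation `d l = -l²` holds at every pair, including those which are not generators, where
the right side vanishes by `I^⊥`. This permits matrix computations with the differential. -/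
theorem IsFullDifferential.leftMat (D : IsFullDifferential d) (h k : ArcBasis n) :
    d (leftMat h k) = -leftSq h k := by
  by_cases e : LeftEdge h k
  · rw [leftMat_of e, D.left, sum_phiStar]
    rfl
  · rw [isRep_fullAlg.left_supp h k e, show leftSq h k = 0 from isRep_fullAlg.dual h k e, map_zero,
      neg_zero]

/-- The bidegree of a generator of `B` from `h` to `k`. -/
def rightDeg (h k : ArcBasis n) : ℚ × ℤ := (((h.deg : ℚ) - k.deg) / 2, 0)

/-- The bidegree of a generator of `m(B)^!` from `h` to `k`. -/
def leftDeg (h k : ArcBasis n) : ℚ × ℤ := (-(((h.deg : ℚ) - k.deg) / 2), 1)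

theorem rightMat_mem (h k : ArcBasis n) : rightMat h k ∈ fullGr n (rightDeg h k) := by
  by_cases e : RightEdge h k
  · rw [rightMat_of e]
    have := letterA_mem (n := n) (.right ⟨h, k, e⟩)
    unfold Letter.deg at this
    exact this
  · rw [isRep_fullAlg.right_supp h k e]
    exact Submodule.zero_mem _

theorem leftMat_mem (h k : ArcBasis n) : leftMat h k ∈ fullGr n (leftDeg h k) := by
  by_cases e : LeftEdge h k
  · rw [leftMat_of e]
    have := letterA_mem (n := n) (.left ⟨h.mirror, k.mirror, e⟩)
    unfold Letter.deg at this
    simp only [ArcBasis.deg_mirror] at this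
    exact this
  · rw [isRep_fullAlg.left_supp h k e]
    exact Submodule.zero_mem _

theorem leftDeg_add (h m k : ArcBasis n) : leftDeg h m + leftDeg m k = leftDeg h k + (0, 1) := by
  unfold leftDeg
  refine Prod.ext ?_ rfl
  simp only [Prod.fst_add]
  ring

theorem sq_leftMat_mem (h k : ArcBasis n) :
    leftSq h k ∈ fullGr n (leftDeg h k + (0, 1)) := by
  rw [leftSq_apply]
  refine Submodule.sum_mem _ fun m _ => ?_
  rw [← leftDeg_add h m k]
  exact mul_mem_fullGr (leftMat_mem h m) (leftMat_mem m k)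

theorem letter_deg_left (x : Edge n) :
    (Letter.left x).deg = leftDeg x.src.mirror x.tgt.mirror := by
  unfold Letter.deg leftDeg
  rw [ArcBasis.deg_mirror, ArcBasis.deg_mirror]

theorem IsFullDifferential.letter_mem (D : IsFullDifferential d) (x : Letter n) :
    d (letterA x) ∈ fullGr n (x.deg + (0, 1)) := by
  cases x with
  | idem h => exact (D.idem h).symm ▸ Submodule.zero_mem _
  | right b => exact (D.right b).symm ▸ Submodule.zero_mem _
  | left b =>
    have := D.leftMat b.src.mirror b.tgt.mirror
    rw [← leftA_eq] at this
    change d (leftA b) ∈ _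
    rw [this, letter_deg_left]
    exact Submodule.neg_mem _ (sq_leftMat_mem _ _)

theorem IsFullDifferential.word_mem (D : IsFullDifferential d) (w : List (Letter n)) :
    d (word w) ∈ fullGr n (wordDeg w + (0, 1)) := by
  induction w with
  | nil =>
    rw [word_nil, D.one]
    exact Submodule.zero_mem _
  | cons x w ih =>
    rw [D.word_cons, wordDeg_cons]
    refine Submodule.add_mem _ (Submodule.smul_mem _ _ ?_) ?_
    · rw [add_right_comm]
      exact mul_mem_fullGr (D.letter_mem x) (BorderedKh.word_mem w)
    · rw [add_assoc]
      exact mul_mem_fullGr (letterA_mem x) ih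

theorem IsFullDifferential.mem (D : IsFullDifferential d) {p : ℚ × ℤ} {a : FullAlg n}
    (ha : a ∈ fullGr n p) : d a ∈ fullGr n (p + (0, 1)) := by
  refine fullGr_induction (P := fun a => d a ∈ fullGr n (p + (0, 1))) ?_ ?_ ?_ ?_ ha
  · rintro w rfl
    exact D.word_mem w
  · rw [map_zero]
    exact Submodule.zero_mem _
  · intro a b ha hb
    rw [map_add]
    exact Submodule.add_mem _ ha hb
  · intro c a ha
    rw [map_smul]
    exact Submodule.smul_mem _ c ha

/-- From `d l = -l²` and the Leibniz rule, `d(l²) = l² · l - l · l² = 0`. -/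
theorem IsFullDifferential.d_d_letter (D : IsFullDifferential d) (x : Letter n) :
    d (d (letterA x)) = 0 := by
  cases x with
  | idem h => exact (congrArg d (D.idem h)).trans (map_zero d)
  | right b => exact (congrArg d (D.right b)).trans (map_zero d)
  | left b =>
    change d (d (leftA b)) = 0
    rw [leftA_eq, D.leftMat, map_neg, leftSq_apply, map_sum]
    have : ∀ m, d (BorderedKh.leftMat b.src.mirror m * BorderedKh.leftMat m b.tgt.mirror)
        = leftSq b.src.mirror m * BorderedKh.leftMat m b.tgt.mirror
          - BorderedKh.leftMat b.src.mirror m * leftSq m b.tgt.mirror := by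
      intro m
      rw [D.leibniz _ _ _ (leftMat_mem _ _), D.leftMat, D.leftMat]
      simp [leftDeg, sub_eq_add_neg]
    rw [Finset.sum_congr rfl fun m _ => this m, Finset.sum_sub_distrib, ← Matrix.mul_apply,
      ← Matrix.mul_apply, leftSq, mul_assoc, sub_self, neg_zero]

theorem IsFullDifferential.d_d (D : IsFullDifferential d) (a : FullAlg n) : d (d a) = 0 := by
  have : d ∘ₗ d = 0 := by
    refine linearMap_ext_word fun w => ?_
    induction w with
    | nil => rw [LinearMap.comp_apply, word_nil, D.one, map_zero, LinearMap.zero_apply]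
    | cons x w ih =>
      rw [LinearMap.comp_apply, LinearMap.zero_apply] at ih ⊢
      rw [D.word_cons, map_add, map_smul, D.leibniz _ _ _ (BorderedKh.word_mem w),
        D.leibniz _ _ _ (D.word_mem w), ih, D.d_d_letter, mul_zero, add_zero, zero_mul, smul_zero,
        zero_add, Prod.snd_add, Int.negOnePow_add]
      simp
  exact LinearMap.congr_fun this a

end Differential

end BorderedKh
end

noncomputable section
namespace BorderedKh

/-! ## The bigrading of `B ⊙ m(B)^!` -/

section Grading

variable {n : ℕ}

/-- The map `θ` tags each homogeneous element with its degree, so a sum of homogeneous elements of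
different degrees vanishes only if each of them does. -/
theorem isInternal_of_map {ι X Y : Type*} [DecidableEq ι] [AddCommGroup X] [AddCommGroup Y]
    {gr : ι → Submodule ℤ X} (θ : X →ₗ[ℤ] ι →₀ Y) (g : X →ₗ[ℤ] Y) (hg : Function.Injective g)
    (hθ : ∀ p x, x ∈ gr p → θ x = Finsupp.single p (g x)) (htop : ⊤ ≤ ⨆ p, gr p) :
    DirectSum.IsInternal gr := by
  have key : ∀ (x : DirectSum ι fun p => gr p) (p : ι),
      θ (DirectSum.coeLinearMap gr x) p = g (x p) := by
    intro x p
    induction x using DirectSum.induction_on with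
    | zero => simp
    | of q y =>
      have : DirectSum.coeLinearMap gr (DirectSum.of (fun p => gr p) q y) = (y : X) :=
        DirectSum.coeLinearMap_lof gr q y
      rw [this, hθ q y y.2]
      by_cases hq : q = p
      · subst hq
        rw [Finsupp.single_eq_same, DirectSum.of_eq_same]
      · rw [Finsupp.single_eq_of_ne (Ne.symm hq), DirectSum.of_eq_of_ne _ _ _ (Ne.symm hq),
          Submodule.coe_zero, map_zero]
    | add x y hx hy =>
      rw [map_add, map_add, Finsupp.add_apply, hx, hy, DirectSum.add_apply, Submodule.coe_add,
        map_add]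
  constructor
  · refine (injective_iff_map_eq_zero (DirectSum.coeAddMonoidHom gr)).2 fun x hx => ?_
    refine DFinsupp.ext fun p => ?_
    have h1 := key x p
    have h2 : DirectSum.coeLinearMap gr x = 0 := hx
    rw [h2, map_zero, Finsupp.zero_apply] at h1
    exact Subtype.ext (hg (by rw [← h1]; exact (map_zero g).symm))
  · intro x
    have := htop (Submodule.mem_top (x := x))
    rw [← DirectSum.range_coeLinearMap] at this
    exact this

theorem rightDeg_add (h m k : ArcBasis n) : rightDeg h m + rightDeg m k = rightDeg h k := by
  unfold rightDeg
  refine Prod.ext ?_ rfl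
  simp only [Prod.fst_add]
  ring

theorem deg_square {h₁ h₂ h₂' h₃ : ArcBasis n} (h : h₁.deg + h₃.deg = h₂.deg + h₂'.deg) :
    rightDeg h₁ h₂ + leftDeg h₂ h₃ = leftDeg h₁ h₂' + rightDeg h₂' h₃ := by
  unfold rightDeg leftDeg
  refine Prod.ext ?_ rfl
  have : (h₁.deg : ℚ) + h₃.deg = h₂.deg + h₂'.deg := by exact_mod_cast h
  simp only [Prod.fst_add]
  linarith

section

variable {A : Type*} [Ring A] {e : ArcBasis n → A} {r l : Matrix (ArcBasis n) (ArcBasis n) A}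

open AddMonoidAlgebra in
-- Homogeneity of the relations, phrased as a representation: each generator is multiplied by the
-- monomial of its bidegree. Paths in one kind of generator have a bidegree determined by their ends
-- and length; in the exchange relations the point is that `deg h₁ + deg h₃ = deg h₂ + deg h₂'`.
theorem IsRep.graded (H : IsRep e r l) : IsRep (A := AddMonoidAlgebra A (ℚ × ℤ))
    (fun h => single 0 (e h)) (Matrix.of fun h k => single (rightDeg h k) (r h k))
    (Matrix.of fun h k => single (leftDeg h k) (l h k)) where
  idem_mul h := by rw [single_mul_single, add_zero, H.idem_mul]
  idem_orth h k hk := by rw [single_mul_single, H.idem_orth h k hk, single_zero]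
  idem_sum := by
    have : ∀ h, single (0 : ℚ × ℤ) (e h) = singleAddHom 0 (e h) := fun h => rfl
    rw [Finset.sum_congr rfl fun h _ => this h, ← map_sum, H.idem_sum]
    rfl
  right_supp h k hk := by rw [Matrix.of_apply, H.right_supp h k hk, single_zero]
  left_supp h k hk := by rw [Matrix.of_apply, H.left_supp h k hk, single_zero]
  right_src h k hk := by rw [Matrix.of_apply, single_mul_single, zero_add, H.right_src h k hk]
  right_tgt h k hk := by rw [Matrix.of_apply, single_mul_single, add_zero, H.right_tgt h k hk]
  left_src h k hk := by rw [Matrix.of_apply, single_mul_single, zero_add, H.left_src h k hk]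
  left_tgt h k hk := by rw [Matrix.of_apply, single_mul_single, add_zero, H.left_tgt h k hk]
  quad := by
    obtain ⟨Q, h1, h2⟩ := H.quad
    refine ⟨fun h k => single (rightDeg h k) (Q h k), fun h k hk => ?_, fun h m k hm hk => ?_⟩
    · rw [Matrix.of_apply, h1 h k hk]
    · rw [Matrix.of_apply, Matrix.of_apply, single_mul_single, h2 h m k hm hk, rightDeg_add]
  dual h k hk := by
    have h1 := H.dual h k hk
    rw [Matrix.mul_apply] at h1 ⊢
    have : ∀ m, single (leftDeg h m) (l h m) * single (leftDeg m k) (l m k)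
        = singleAddHom (leftDeg h k + (0, 1)) (l h m * l m k) := fun m => by
      rw [single_mul_single, leftDeg_add]
      rfl
    simp only [Matrix.of_apply]
    rw [Finset.sum_congr rfl fun m _ => this m, ← map_sum, h1, map_zero]
  square h₁ h₂ h₂' h₃ hc := by
    simp only [Matrix.of_apply, single_mul_single, H.square _ _ _ _ hc]
    rw [deg_square]
    rcases hc with ⟨c1, c2, c3, c4⟩ | ⟨c1, c2, c3, c4⟩ | ⟨c1, c2, c3, c4, d1, d2⟩ |
      ⟨c1, c2, c3, c4, d1, d2⟩ <;>
    · have := c1.deg_eq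
      have := c2.deg_eq
      have := c3.deg_eq
      omega
  join h₁ h₂ h₂' h₂'' h₃ c1 c2 c3 c4 c5 c6 d1 d2 := by
    have := c1.deg_eq
    have := c2.deg_eq
    have := c3.deg_eq
    have := c5.deg_eq
    simp only [Matrix.of_apply, single_mul_single, H.join _ _ _ _ _ c1 c2 c3 c4 c5 c6 d1 d2,
      single_add]
    rw [← deg_square (h₁ := h₁) (h₂ := h₂) (h₂' := h₂') (h₃ := h₃) (by omega),
      ← deg_square (h₁ := h₁) (h₂ := h₂) (h₂' := h₂'') (h₃ := h₃) (by omega)]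
  split h₁ h₂ h₂' h₂'' h₃ c1 c2 c3 c4 c5 c6 d1 d2 := by
    have := c1.deg_eq
    have := c2.deg_eq
    have := c3.deg_eq
    have := c5.deg_eq
    simp only [Matrix.of_apply, single_mul_single, ← H.split _ _ _ _ _ c1 c2 c3 c4 c5 c6 d1 d2,
      single_add]
    rw [deg_square (h₁ := h₁) (h₂ := h₂') (h₂' := h₂) (h₃ := h₃) (by omega),
      deg_square (h₁ := h₁) (h₂ := h₂'') (h₂' := h₂) (h₃ := h₃) (by omega)]

end

/-- The homomorphism which records bidegrees. -/
def gradeHom : FullAlg n →+* AddMonoidAlgebra (FullAlg n) (ℚ × ℤ) := isRep_fullAlg.graded.lift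

theorem gradeHom_letter (x : Letter n) :
    gradeHom (letterA x) = AddMonoidAlgebra.single x.deg (letterA x) := by
  have h : gradeHom (letterA x) = letterVal _ _ _ x := isRep_fullAlg.graded.lift_letter x
  rw [h]
  cases x with
  | idem k => rfl
  | right b =>
    change AddMonoidAlgebra.single (rightDeg b.src b.tgt) (rightMat b.src b.tgt) = _
    rw [← rightA_eq]
    rfl
  | left b =>
    change AddMonoidAlgebra.single (leftDeg b.src.mirror b.tgt.mirror)
      (leftMat b.src.mirror b.tgt.mirror) = _
    rw [← leftA_eq, letter_deg_left]
    rfl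

theorem gradeHom_word (w : List (Letter n)) :
    gradeHom (word w) = AddMonoidAlgebra.single (wordDeg w) (word w) := by
  induction w with
  | nil => rw [word_nil, map_one]; rfl
  | cons x w ih =>
    rw [word_cons, map_mul, gradeHom_letter, ih, AddMonoidAlgebra.single_mul_single, wordDeg_cons]

theorem isInternal_fullGr : DirectSum.IsInternal (fullGr n) := by
  refine isInternal_of_map
    (((AddMonoidAlgebra.coeffAddEquiv (R := FullAlg n) (M := ℚ × ℤ)).toAddMonoidHom.comp
      gradeHom.toAddMonoidHom).toIntLinearMap) LinearMap.id Function.injective_id ?_ ?_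
  · intro p x hx
    change (gradeHom x).coeff = Finsupp.single p x
    refine fullGr_induction (P := fun x => (gradeHom x).coeff = Finsupp.single p x) ?_ ?_ ?_ ?_ hx
    · rintro w rfl
      rw [gradeHom_word]
      rfl
    · simp
    · intro a b ha hb
      rw [map_add, AddMonoidAlgebra.coeff_add, ha, hb, Finsupp.single_add]
    · intro c a ha
      rw [map_zsmul, ← Finsupp.smul_single, ← ha]
      rfl
  · rw [← span_word, Submodule.span_le]
    rintro _ ⟨w, rfl⟩
    exact Submodule.mem_iSup_of_mem _ (word_mem w)

/-! ### Paths -/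

/-- Nonempty products of composable generators, and the idempotents. -/
inductive IsPath : ArcBasis n → ArcBasis n → FullAlg n → ℚ × ℤ → ℕ → Prop
  | idem (h) : IsPath h h (idemA h) 0 0
  | right {h m a p N} (k) : IsPath h m a p N → RightEdge m k →
      IsPath h k (a * rightMat m k) (p + rightDeg m k) (N + 1)
  | left {h m a p N} (k) : IsPath h m a p N → LeftEdge m k →
      IsPath h k (a * leftMat m k) (p + leftDeg m k) (N + 1)

theorem IsPath.mul_idem {h k : ArcBasis n} {a : FullAlg n} {p : ℚ × ℤ} {N : ℕ}
    (H : IsPath h k a p N) : a * idemA k = a := by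
  cases H with
  | idem => exact isRep_fullAlg.idem_mul h
  | right _ _ e => rw [mul_assoc, isRep_fullAlg.right_tgt _ _ e]
  | left _ _ e => rw [mul_assoc, isRep_fullAlg.left_tgt _ _ e]

theorem IsPath.eq_idem {h k : ArcBasis n} {a : FullAlg n} {p : ℚ × ℤ} (H : IsPath h k a p 0) :
    a = idemA h := by
  cases H
  rfl

/-- Both kinds of generators raise `deg`, which is bounded on the finite set `β`. Paths therefore
have bounded length, and finitely many of them span the algebra. -/
theorem IsPath.deg_le {h k : ArcBasis n} {a : FullAlg n} {p : ℚ × ℤ} {N : ℕ}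
    (H : IsPath h k a p N) : h.deg + N ≤ k.deg := by
  induction H with
  | idem => simp
  | right k H e ih =>
    have := e.deg_lt
    push_cast
    omega
  | left k H e ih =>
    have := e.deg_lt
    push_cast
    omega

/-- In homological degree zero only generators of `B` occur, so the intrinsic degree is half the
drop of `deg` along the path. In bidegree zero nothing is left but paths of length zero, that is,
idempotents. -/
theorem IsPath.bidegree {h k : ArcBasis n} {a : FullAlg n} {p : ℚ × ℤ} {N : ℕ}
    (H : IsPath h k a p N) : 0 ≤ p.2 ∧ (p.2 = 0 → p = rightDeg h k) := by
  induction H with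
  | idem => exact ⟨le_rfl, fun _ => Prod.ext (by simp [rightDeg]) rfl⟩
  | right k H e ih =>
    simp only [rightDeg, Prod.snd_add, add_zero]
    refine ⟨ih.1, fun h0 => ?_⟩
    rw [ih.2 h0]
    exact rightDeg_add _ _ _
  | left k H e ih =>
    simp only [leftDeg, Prod.snd_add]
    exact ⟨by omega, fun h0 => by omega⟩

theorem IsPath.mul_letter {h k : ArcBasis n} {a : FullAlg n} {p : ℚ × ℤ} {N : ℕ}
    (H : IsPath h k a p N) (x : Letter n) :
    a * letterA x = 0 ∨ ∃ k' N', IsPath h k' (a * letterA x) (p + x.deg) N' := by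
  have hz : ∀ (j : ArcBasis n) (y : FullAlg n), idemA j * y = y → k ≠ j → a * y = 0 := by
    intro j y hy hj
    rw [← H.mul_idem, ← hy, mul_assoc, ← mul_assoc (idemA k), isRep_fullAlg.idem_orth k j hj,
      zero_mul, mul_zero]
  cases x with
  | idem j =>
    by_cases hj : k = j
    · subst hj
      refine .inr ⟨k, N, ?_⟩
      rw [show letterA (.idem k) = idemA k from rfl, H.mul_idem, show (Letter.idem k).deg = 0 from rfl,
        add_zero]
      exact H
    · exact .inl (hz j _ (isRep_fullAlg.idem_mul j) hj)
  | right b =>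
    have hb : letterA (.right b) = rightMat b.src b.tgt := rightA_eq b
    rw [hb]
    by_cases hj : k = b.src
    · subst hj
      exact .inr ⟨b.tgt, N + 1, .right _ H b.edge⟩
    · exact .inl (hz b.src _ (isRep_fullAlg.right_src _ _ b.edge) hj)
  | left b =>
    have hb : letterA (.left b) = leftMat b.src.mirror b.tgt.mirror := leftA_eq b
    rw [hb, letter_deg_left]
    by_cases hj : k = b.src.mirror
    · subst hj
      exact .inr ⟨b.tgt.mirror, N + 1, .left _ H b.edge⟩
    · exact .inl (hz b.src.mirror _ (isRep_fullAlg.src_left _ _) hj)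

theorem word_mem_span_path (w : List (Letter n)) :
    word w ∈ Submodule.span ℤ {a | ∃ h k N, IsPath h k a (wordDeg w) N} := by
  induction w using List.reverseRecOn with
  | nil =>
    rw [word_nil, ← isRep_fullAlg.idem_sum]
    exact Submodule.sum_mem _ fun h _ => Submodule.subset_span ⟨h, h, 0, .idem h⟩
  | append_singleton w x ih =>
    rw [word_append, word_singleton, wordDeg_append]
    have hx : wordDeg [x] = x.deg := add_zero x.deg
    rw [hx]
    refine Submodule.span_induction (p := fun a _ => a * letterA x ∈ _) ?_ ?_ ?_ ?_ ih
    · rintro a ⟨h, k, N, H⟩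
      rcases H.mul_letter x with h0 | ⟨k', N', H'⟩
      · rw [h0]; exact Submodule.zero_mem _
      · exact Submodule.subset_span ⟨h, k', N', H'⟩
    · rw [zero_mul]; exact Submodule.zero_mem _
    · intro a b _ _ ha hb
      rw [add_mul]; exact Submodule.add_mem _ ha hb
    · intro c a _ ha
      rw [smul_mul_assoc]; exact Submodule.smul_mem _ c ha

theorem finite_path (N : ℕ) : {a : FullAlg n | ∃ h k p, IsPath h k a p N}.Finite := by
  induction N with
  | zero =>
    refine (Set.finite_range (idemA (n := n))).subset ?_
    rintro _ ⟨h, k, p, H⟩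
    cases H
    exact ⟨h, rfl⟩
  | succ N ih =>
    refine (Set.Finite.image2 (fun a b => a * b) ih
      ((Set.finite_range fun x : ArcBasis n × ArcBasis n => rightMat x.1 x.2).union
        (Set.finite_range fun x : ArcBasis n × ArcBasis n => leftMat x.1 x.2))).subset ?_
    rintro _ ⟨h, k, p, H⟩
    cases H with
    | right _ H e => exact ⟨_, ⟨_, _, _, H⟩, _, .inl ⟨(_, _), rfl⟩, rfl⟩
    | left _ H e => exact ⟨_, ⟨_, _, _, H⟩, _, .inr ⟨(_, _), rfl⟩, rfl⟩

theorem exists_path_length_le (n : ℕ) : ∃ D : ℕ, ∀ (h k : ArcBasis n) a p N,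
    IsPath h k a p N → N ≤ D := by
  obtain ⟨B, hB⟩ := (Set.finite_range fun x : ArcBasis n × ArcBasis n => x.2.deg - x.1.deg).bddAbove
  refine ⟨B.toNat, fun h k a p N H => ?_⟩
  have h1 := H.deg_le
  have h2 : k.deg - h.deg ≤ B := hB ⟨(h, k), rfl⟩
  omega

instance : Module.Finite ℤ (FullAlg n) := by
  obtain ⟨D, hD⟩ := exists_path_length_le n
  have hf : {a : FullAlg n | ∃ h k p N, IsPath h k a p N}.Finite := by
    refine ((Set.finite_Iic D).biUnion fun N _ => finite_path N).subset ?_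
    rintro a ⟨h, k, p, N, H⟩
    exact Set.mem_biUnion (hD _ _ _ _ _ H) ⟨h, k, p, H⟩
  refine ⟨Submodule.fg_def.2 ⟨_, hf, ?_⟩⟩
  rw [eq_top_iff, ← span_word, Submodule.span_le]
  rintro _ ⟨w, rfl⟩
  refine Submodule.span_mono ?_ (word_mem_span_path w)
  rintro a ⟨h, k, N, H⟩
  exact ⟨h, k, _, N, H⟩

theorem fullGr_zero : fullGr n 0 = Submodule.span ℤ (Set.range idemA) := by
  refine le_antisymm ?_ ?_
  · intro a ha
    refine fullGr_induction ?_ (Submodule.zero_mem _) (fun _ _ => Submodule.add_mem _)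
      (fun c _ => Submodule.smul_mem _ c) ha
    intro w hw
    have := word_mem_span_path w
    rw [hw] at this
    refine Submodule.span_mono ?_ this
    rintro a ⟨h, k, N, H⟩
    have h1 := congrArg Prod.fst (H.bidegree.2 rfl)
    have h2 : (h.deg : ℚ) = k.deg := by
      simp only [rightDeg, Prod.fst_zero] at h1
      linarith
    have h3 : h.deg = k.deg := by exact_mod_cast h2
    have h4 := H.deg_le
    obtain rfl : N = 0 := by omega
    exact ⟨h, H.eq_idem.symm⟩
  · rw [Submodule.span_le]
    rintro _ ⟨h, rfl⟩
    exact letterA_mem (.idem h)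

/-- All relations permit sending the generators to zero. The resulting homomorphism onto `R` shows
that the idempotents are linearly independent. -/
theorem isRep_idem : IsRep (n := n) (A := ArcBasis n → ℤ) (fun h => Pi.single h 1) 0 0 where
  idem_mul h := by rw [← Pi.single_mul, one_mul]
  idem_orth h k hk := by
    ext j
    by_cases hj : j = h
    · subst hj
      simp [hk]
    · simp [Pi.single_apply, hj]
  idem_sum := Finset.univ_sum_single (1 : ArcBasis n → ℤ)
  right_supp _ _ _ := rfl
  left_supp _ _ _ := rfl
  right_src _ _ _ := mul_zero _
  right_tgt _ _ _ := zero_mul _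
  left_src _ _ _ := mul_zero _
  left_tgt _ _ _ := zero_mul _
  quad := ⟨0, fun _ _ _ => rfl, fun _ _ _ _ _ => mul_zero _⟩
  dual _ _ _ := by rw [mul_zero]; rfl
  square _ _ _ _ _ := by simp
  join := by simp
  split := by simp

theorem linearIndependent_idemA : LinearIndependent ℤ (idemA (n := n)) := by
  have h1 : LinearIndependent ℤ fun h : ArcBasis n => (Pi.single h 1 : ArcBasis n → ℤ) :=
    Pi.linearIndependent_single_one _ _
  refine LinearIndependent.of_comp isRep_idem.lift.toAddMonoidHom.toIntLinearMap ?_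
  have h2 : ⇑(isRep_idem (n := n)).lift.toAddMonoidHom.toIntLinearMap ∘ idemA
      = fun h => Pi.single h 1 := funext fun h => isRep_idem.lift_letter (.idem h)
  rw [h2]
  exact h1

theorem IsFullDifferential.idem_mul {d : FullAlg n →ₗ[ℤ] FullAlg n} (D : IsFullDifferential d)
    (h : ArcBasis n) (a : FullAlg n) : d (idemA h * a) = idemA h * d a := by
  have : d ∘ₗ LinearMap.mulLeft ℤ (idemA h) = LinearMap.mulLeft ℤ (idemA h) ∘ₗ d := by
    refine linearMap_ext_word fun w => ?_
    simp only [LinearMap.comp_apply, LinearMap.mulLeft_apply]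
    rw [D.leibniz _ _ _ (BorderedKh.word_mem w), D.idem, zero_mul, smul_zero, zero_add]
  exact LinearMap.congr_fun this a

theorem idemA_mem (h : ArcBasis n) : idemA h ∈ fullGr n 0 := letterA_mem (.idem h)

theorem IsFullDifferential.mul_idem {d : FullAlg n →ₗ[ℤ] FullAlg n} (D : IsFullDifferential d)
    (h : ArcBasis n) (a : FullAlg n) : d (a * idemA h) = d a * idemA h := by
  rw [D.leibniz _ _ _ (idemA_mem h), D.idem, mul_zero, add_zero]
  simp

theorem IsFullDifferential.isDGAlgebra {d : FullAlg n →ₗ[ℤ] FullAlg n} (D : IsFullDifferential d) :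
    IsDGAlgebra (fullDG d) where
  finite := inferInstanceAs (Module.Finite ℤ (FullAlg n))
  idem_mul := isRep_fullAlg.idem_mul
  idem_orth := isRep_fullAlg.idem_orth
  idem_sum := isRep_fullAlg.idem_sum
  internal := isInternal_fullGr
  one_mem := one_mem_fullGr
  mul_mem _ _ _ _ := mul_mem_fullGr
  idem_free := linearIndependent_idemA
  gr_zero := fullGr_zero
  d_mem _ _ := D.mem
  d_d := D.d_d
  d_idem_left := D.idem_mul
  d_idem_right h a := D.mul_idem h a
  leibniz a b p hb := D.leibniz a b p hb

end Grading

end BorderedKh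
end

noncomputable section
namespace BorderedKh

/-! ## The DD bimodule -/

section DDBimodule

variable {n : ℕ}

open Classical in
-- Each path of two decorations is matched with the one that decorates the same two circles in the
-- other order; this is a bijection of the paths from `h` to `k`.
theorem sum_dec_dec {M : Type*} [AddCommMonoid M] {h k : ArcBasis n} {F G : ArcBasis n → M}
    (hFG : ∀ m m', RD h m → RD m k → RD h m' → RD m' k → flipped m k = flipped h m' →
      flipped h m = flipped m' k → F m = G m') :
    (∑ m, if RD h m ∧ RD m k then F m else 0) = ∑ m, if RD h m ∧ RD m k then G m else 0 := by
  have ex : ∀ m, RD h m ∧ RD m k → ∃ m', (RD h m' ∧ RD m' k) ∧ flipped m k = flipped h m' ∧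
      flipped h m = flipped m' k := by
    rintro m ⟨h1, h2⟩
    obtain ⟨p, hp⟩ := rd_iff.1 h1
    obtain ⟨q, hq⟩ := rd_iff.1 h2
    obtain ⟨m', hq', hp'⟩ := exists_decAt_comm ⟨m, hp, hq⟩
    refine ⟨m', ⟨hq'.rd, hp'.rd⟩, ?_, ?_⟩
    · rw [flipped_of_decAt hq, flipped_of_decAt hq', hp.rel_eq]
    · rw [flipped_of_decAt hp, flipped_of_decAt hp', hq'.rel_eq]
  have uniq : ∀ m m', RD h m → RD h m' → flipped h m = flipped h m' → m = m' := by
    intro m m' h1 h2 hf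
    obtain ⟨p, hp⟩ := rd_iff.1 h1
    exact hp.eq (decAt_of_flipped hp h2 hf)
  choose f hf using ex
  rw [← Finset.sum_filter, ← Finset.sum_filter]
  refine Finset.sum_bij (fun m hm => f m (Finset.mem_filter.1 hm).2) ?_ ?_ ?_ ?_
  · intro m hm
    exact Finset.mem_filter.2 ⟨Finset.mem_univ _, (hf m _).1⟩
  · intro m hm m' hm' he
    refine uniq m m' (Finset.mem_filter.1 hm).2.1 (Finset.mem_filter.1 hm').2.1 ?_
    rw [(hf m (Finset.mem_filter.1 hm).2).2.2, (hf m' (Finset.mem_filter.1 hm').2).2.2, he]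
  · intro m hm
    have h1 := hf m (Finset.mem_filter.1 hm).2
    refine ⟨f m (Finset.mem_filter.1 hm).2, Finset.mem_filter.2 ⟨Finset.mem_univ _, h1.1⟩, ?_⟩
    have h2 := hf _ h1.1
    exact uniq _ _ h2.1.1 (Finset.mem_filter.1 hm).2.1 (by rw [← h2.2.1, ← h1.2.2])
  · intro m hm
    have h0 := (Finset.mem_filter.1 hm).2
    have h1 := hf m h0
    exact hFG _ _ h0.1 h0.2 h1.1.1 h1.1.2 h1.2.1 h1.2.2

theorem sum_mirror {M : Type*} [AddCommMonoid M] (F : ArcBasis n → M) :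
    ∑ m : ArcBasis n, F m.mirror = ∑ m, F m := Fintype.sum_equiv mirrorEquiv _ _ fun _ => rfl

theorem lb_mirror {h k : ArcBasis n} : LB h.mirror k.mirror ↔ RB h k := Iff.rfl

section

variable {A : Type*} [Ring A] {e : ArcBasis n → A} {r l : Matrix (ArcBasis n) (ArcBasis n) A}

/-- The second factor depends only on the ends of the path. If `h ⟶ k` is a generator, it equals the
corresponding generator of `B`; otherwise the first factors add up to zero by `I^⊥`. The outcome is
what the differential in the DD equation cancels. -/
theorem IsRep.sum_left_left (H : IsRep e r l) (h k : ArcBasis n) :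
    ∑ m, (l h m * l m k) ⊗ₜ[ℤ] (r h.mirror m.mirror * r m.mirror k.mirror)
      = (l * l) h k ⊗ₜ[ℤ] r h.mirror k.mirror := by
  obtain ⟨Q, h1, h2⟩ := H.quad
  have h3 : ∀ m, (l h m * l m k) ⊗ₜ[ℤ] (r h.mirror m.mirror * r m.mirror k.mirror)
      = (l h m * l m k) ⊗ₜ[ℤ] Q h.mirror k.mirror := by
    intro m
    by_cases e1 : LeftEdge h m
    · by_cases e2 : LeftEdge m k
      · rw [h2 _ _ _ e1 e2]
      · rw [H.left_supp m k e2, mul_zero, TensorProduct.zero_tmul, TensorProduct.zero_tmul]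
    · rw [H.left_supp h m e1, zero_mul, TensorProduct.zero_tmul, TensorProduct.zero_tmul]
  rw [Finset.sum_congr rfl fun m _ => h3 m, ← TensorProduct.sum_tmul, ← Matrix.mul_apply]
  by_cases e1 : LeftEdge h k
  · rw [h1 _ _ e1]
  · rw [H.dual h k e1, TensorProduct.zero_tmul, TensorProduct.zero_tmul]

theorem IsRep.sum_right_right (H : IsRep e r l) (h k : ArcBasis n) :
    ∑ m, (r h m * r m k) ⊗ₜ[ℤ] (l h.mirror m.mirror * l m.mirror k.mirror)
      = r h k ⊗ₜ[ℤ] (l * l) h.mirror k.mirror := by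
  have := congrArg (TensorProduct.comm ℤ A A) (H.sum_left_left h.mirror k.mirror)
  rw [map_sum, ← sum_mirror] at this
  exact this

open Classical in
-- In the mirrored factor the right bridge becomes a left one, so relation (2) alone identifies all
-- terms there. Relations (3) and (5) can then be applied in the first factor as if the second were
-- constant.
theorem IsRep.sum_bridge_dec (H : IsRep e r l) (h k : ArcBasis n) :
    (∑ m, if RB h m ∧ RD m k then
        (r h m * l m k) ⊗ₜ[ℤ] (l h.mirror m.mirror * r m.mirror k.mirror) else 0)
      = ∑ m, if RD h m ∧ RB m k then
        (l h m * r m k) ⊗ₜ[ℤ] (r h.mirror m.mirror * l m.mirror k.mirror) else 0 := by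
  have hm : ∀ {m m'}, RB h m → RD m k → RD h m' → RB m' k →
      l h.mirror m.mirror * r m.mirror k.mirror = r h.mirror m'.mirror * l m'.mirror k.mirror :=
    fun c1 c2 c3 c4 => (H.square _ _ _ _ (.inr (.inl ⟨rd_mirror.2 c3, lb_mirror.2 c4,
      lb_mirror.2 c1, rd_mirror.2 c2⟩))).symm
  refine BorderedKh.sum_bridge_dec ?_ ?_ ?_
  · intro m m' c1 c2 c3 c4 d1 d2
    rw [H.square _ _ _ _ (.inr (.inr (.inl ⟨c1, c2, c3, c4, d1, d2⟩))), hm c1 c2 c3 c4]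
  · intro m m' m'' c1 c2 c3 c4 c5 c6 d1 d2
    rw [H.join _ _ _ _ _ c1 c2 c3 c4 c5 c6 d1 d2, TensorProduct.add_tmul, ← hm c1 c2 c3 c4,
      ← hm c1 c2 c5 c6]
  · intro m m' m'' c1 c2 c3 c4 c5 c6 d1 d2
    rw [← H.split _ _ _ _ _ c1 c2 c3 c4 c5 c6 d1 d2, TensorProduct.add_tmul, hm c3 c4 c1 c2,
      hm c5 c6 c1 c2]

theorem IsRep.right_left_cases [DecidableRel (RB (n := n))] [DecidableRel (RD (n := n))]
    [DecidableRel (LB (n := n))] {M : Type*} [AddCommMonoid M] {h m k : ArcBasis n} {F : M}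
    (hF : ¬ (RightEdge h m ∧ LeftEdge m k) → F = 0) :
    F = ((if RB h m ∧ LB m k then F else 0) + (if RB h m ∧ RD m k then F else 0))
      + ((if RD h m ∧ LB m k then F else 0) + (if RD h m ∧ RD m k then F else 0)) := by
  have x1 : ¬ (RB h m ∧ RD h m) := fun hh => hh.1.2 hh.2.2
  have x2 : ¬ (LB m k ∧ RD m k) := fun hh => hh.1.2 hh.2.a_eq
  by_cases e1 : RightEdge h m
  · by_cases e2 : LeftEdge m k
    · rcases rightEdge_cases e1 with c1 | c1 <;> rcases leftEdge_cases e2 with c2 | c2 <;>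
        simp_all
    · rw [hF fun hh => e2 hh.2]
      simp
  · rw [hF fun hh => e1 hh.1]
    simp

theorem IsRep.left_right_cases [DecidableRel (RB (n := n))] [DecidableRel (RD (n := n))]
    [DecidableRel (LB (n := n))] {M : Type*} [AddCommMonoid M] {h m k : ArcBasis n} {F : M}
    (hF : ¬ (LeftEdge h m ∧ RightEdge m k) → F = 0) :
    F = ((if LB h m ∧ RB m k then F else 0) + (if RD h m ∧ RB m k then F else 0))
      + ((if LB h m ∧ RD m k then F else 0) + (if RD h m ∧ RD m k then F else 0)) := by
  have x1 : ¬ (RB m k ∧ RD m k) := fun hh => hh.1.2 hh.2.2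
  have x2 : ¬ (LB h m ∧ RD h m) := fun hh => hh.1.2 hh.2.a_eq
  by_cases e1 : LeftEdge h m
  · by_cases e2 : RightEdge m k
    · rcases leftEdge_cases e1 with c1 | c1 <;> rcases rightEdge_cases e2 with c2 | c2 <;>
        simp_all
    · rw [hF fun hh => e2 hh.2]
      simp
  · rw [hF fun hh => e1 hh.1]
    simp

/-- The sum is sorted by the types of the two generators. Two bridges use (1) in both factors, two
decorations use (4) in both, and a mixed pair uses (2) in one factor and (3) or (5) in the other. -/
theorem IsRep.sum_right_left (H : IsRep e r l) (h k : ArcBasis n) :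
    ∑ m, (r h m * l m k) ⊗ₜ[ℤ] (l h.mirror m.mirror * r m.mirror k.mirror)
      = ∑ m, (l h m * r m k) ⊗ₜ[ℤ] (r h.mirror m.mirror * l m.mirror k.mirror) := by
  classical
  rw [Finset.sum_congr rfl fun m _ => IsRep.right_left_cases (h := h) (m := m) (k := k)
      (F := (r h m * l m k) ⊗ₜ[ℤ] (l h.mirror m.mirror * r m.mirror k.mirror)) ?_,
    Finset.sum_congr rfl fun m _ => IsRep.left_right_cases (h := h) (m := m) (k := k)
      (F := (l h m * r m k) ⊗ₜ[ℤ] (r h.mirror m.mirror * l m.mirror k.mirror)) ?_]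
  · simp only [Finset.sum_add_distrib]
    congr 1
    · congr 1
      · refine sum_bridge_bridge fun m m' c1 c2 c3 c4 => ?_
        rw [H.square _ _ _ _ (.inl ⟨c1, c2, c3, c4⟩),
          H.square h.mirror m'.mirror m.mirror k.mirror
            (.inl ⟨c3, lb_mirror.2 c4, lb_mirror.2 c1, c2⟩)]
      · exact H.sum_bridge_dec h k
    · congr 1
      -- A right decoration with a left bridge is the previous mixed case with the tensor factors
      -- exchanged.
      · have := congrArg (TensorProduct.comm ℤ A A) (H.sum_bridge_dec h.mirror k.mirror)
        rw [map_sum, map_sum] at this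
        replace this := (sum_mirror _).trans (this.trans (sum_mirror _).symm)
        simp only [apply_ite (TensorProduct.comm ℤ A A), map_zero, TensorProduct.comm_tmul] at this
        refine Eq.trans ?_ (this.symm.trans ?_)
        · exact Finset.sum_congr rfl fun m _ => if_congr (and_congr rd_mirror.symm Iff.rfl) rfl rfl
        · exact Finset.sum_congr rfl fun m _ => if_congr (and_congr Iff.rfl rd_mirror) rfl rfl
      · refine sum_dec_dec fun m m' c1 c2 c3 c4 d1 d2 => ?_
        rw [H.square _ _ _ _ (.inr (.inr (.inr ⟨c1, c2, c3, c4, d1, d2⟩))),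
          H.square h.mirror m'.mirror m.mirror k.mirror (.inr (.inr (.inr ⟨rd_mirror.2 c3,
            rd_mirror.2 c4, rd_mirror.2 c1, rd_mirror.2 c2, d2.symm, d1.symm⟩)))]
  · intro hm
    rw [not_and_or] at hm
    rcases hm with hm | hm
    · rw [H.left_supp h m hm, zero_mul, TensorProduct.zero_tmul]
    · rw [H.right_supp m k hm, mul_zero, TensorProduct.zero_tmul]
  · intro hm
    rw [not_and_or] at hm
    rcases hm with hm | hm
    · rw [H.right_supp h m hm, zero_mul, TensorProduct.zero_tmul]
    · rw [H.left_supp m k hm, mul_zero, TensorProduct.zero_tmul]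

end

/-! ### The operation `δ` -/

theorem evenPart_rightMat (h k : ArcBasis n) :
    evenPart (fullGr n) (rightMat h k) = rightMat h k := by
  refine (degMap_of_mem isInternal_fullGr _ (rightMat_mem h k)).trans ?_
  simp [rightDeg]

theorem oddPart_rightMat (h k : ArcBasis n) : oddPart (fullGr n) (rightMat h k) = 0 := by
  refine (degMap_of_mem isInternal_fullGr _ (rightMat_mem h k)).trans ?_
  simp [rightDeg]

theorem sgn_rightMat (h k : ArcBasis n) : sgn (fullGr n) (rightMat h k) = rightMat h k := by
  refine (degMap_of_mem isInternal_fullGr _ (rightMat_mem h k)).trans ?_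
  simp [rightDeg]

theorem evenPart_leftMat (h k : ArcBasis n) : evenPart (fullGr n) (leftMat h k) = 0 := by
  refine (degMap_of_mem isInternal_fullGr _ (leftMat_mem h k)).trans ?_
  simp [leftDeg]

theorem oddPart_leftMat (h k : ArcBasis n) :
    oddPart (fullGr n) (leftMat h k) = leftMat h k := by
  refine (degMap_of_mem isInternal_fullGr _ (leftMat_mem h k)).trans ?_
  simp [leftDeg]

theorem sgn_leftMat (h k : ArcBasis n) : sgn (fullGr n) (leftMat h k) = -leftMat h k := by
  refine (degMap_of_mem isInternal_fullGr _ (leftMat_mem h k)).trans ?_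
  simp [leftDeg]

open Classical in
theorem sum_edge_src {M : Type*} [AddCommMonoid M] (h : ArcBasis n) (g : ArcBasis n → M)
    (hg : ∀ k, ¬ RightEdge h k → g k = 0) :
    (∑ b : Edge n, if b.src = h then g b.tgt else 0) = ∑ k, g k := by
  rw [← Finset.sum_filter, ← Finset.sum_filter_of_ne (s := Finset.univ) (f := g)
    (p := fun k => RightEdge h k) (fun m _ hm => by by_contra hc; exact hm (hg m hc))]
  refine Finset.sum_bij (fun b _ => b.tgt) ?_ ?_ ?_ (fun _ _ => rfl)
  · intro b hb
    rw [Finset.mem_filter] at hb ⊢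
    exact ⟨Finset.mem_univ _, by rw [← hb.2]; exact b.edge⟩
  · intro b hb c hc hbc
    rw [Finset.mem_filter] at hb hc
    exact Edge.ext (hb.2.trans hc.2.symm) hbc
  · intro k hk
    rw [Finset.mem_filter] at hk
    exact ⟨⟨h, k, hk.2⟩, by simp, rfl⟩

theorem ddMap_eq (d : FullAlg n →ₗ[ℤ] FullAlg n) (h : ArcBasis n) :
    ddMap d h = ∑ k, (rightMat h k ⊗ₜ[ℤ] leftMat h.mirror k.mirror
      + leftMat h k ⊗ₜ[ℤ] rightMat h.mirror k.mirror : FullAlg n ⊗[ℤ] FullAlg n) := by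
  classical
  rw [Finset.sum_add_distrib]
  unfold ddMap
  refine congrArg₂ (HAdd.hAdd (α := FullAlg n ⊗[ℤ] FullAlg n)) ?_ ?_
  · rw [← sum_edge_src h fun k => (rightMat h k ⊗ₜ[ℤ] leftMat h.mirror k.mirror :
      FullAlg n ⊗[ℤ] FullAlg n)]
    · refine Finset.sum_congr rfl fun b _ => ?_
      split_ifs with hb
      · subst hb
        rw [rightA_eq, leftA_eq]
      · rfl
    · intro k hk
      rw [isRep_fullAlg.right_supp h k hk, TensorProduct.zero_tmul]
  · rw [← sum_mirror, ← sum_edge_src h.mirror fun k => (leftMat h k.mirror ⊗ₜ[ℤ]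
      rightMat h.mirror k.mirror.mirror : FullAlg n ⊗[ℤ] FullAlg n)]
    · refine Finset.sum_congr rfl fun b _ => ?_
      refine if_ctx_congr ⟨fun hb => by rw [← hb]; rfl, fun hb => by rw [hb]; rfl⟩ (fun hb => ?_)
        fun _ => rfl
      rw [rightA_eq, leftA_eq, hb]
      rfl
    · intro k hk
      rw [show rightMat h.mirror k.mirror.mirror = 0 from isRep_fullAlg.right_supp h.mirror k hk,
        TensorProduct.tmul_zero]

theorem IsRep.right_mul_right {A : Type*} [Ring A] {e : ArcBasis n → A}
    {r l : Matrix (ArcBasis n) (ArcBasis n) A} (H : IsRep e r l) (h k : ArcBasis n) :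
    e h * r h k = r h k ∧ r h k * e k = r h k := by
  by_cases hk : RightEdge h k
  · exact ⟨H.right_src h k hk, H.right_tgt h k hk⟩
  · rw [H.right_supp h k hk, mul_zero, zero_mul]
    exact ⟨rfl, rfl⟩

theorem mul_eq_zero_of_idem {a b : FullAlg n} {m j : ArcBasis n} (ha : a * idemA m = a)
    (hb : idemA j * b = b) (hmj : m ≠ j) : a * b = 0 := by
  rw [← ha, ← hb, mul_assoc, ← mul_assoc (idemA m), isRep_fullAlg.idem_orth m j hmj, zero_mul,
    mul_zero]

end DDBimodule

end BorderedKh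
end

noncomputable section
namespace BorderedKh

/-! ### The structure equation of the DD bimodule -/

section DDRelation

variable {n : ℕ}

/-- The summand of `δ h` which ends at `k`. -/
def ddTerm (h k : ArcBasis n) : FullAlg n ⊗[ℤ] FullAlg n :=
  rightMat h k ⊗ₜ[ℤ] leftMat h.mirror k.mirror + leftMat h k ⊗ₜ[ℤ] rightMat h.mirror k.mirror

/-- The operation `⋆` for `B ⊙ m(B)^!` and its mirror. -/
def fullStar : (FullAlg n ⊗[ℤ] FullAlg n) →ₗ[ℤ] (FullAlg n ⊗[ℤ] FullAlg n) →ₗ[ℤ]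
    (FullAlg n ⊗[ℤ] FullAlg n) :=
  starProd (fullDG (0 : FullAlg n →ₗ[ℤ] FullAlg n)) (fullDG (0 : FullAlg n →ₗ[ℤ] FullAlg n)).mirror

theorem fullStar_tmul (a b a' b' : FullAlg n) : fullStar (a ⊗ₜ[ℤ] a') (b ⊗ₜ[ℤ] b')
    = (a * b) ⊗ₜ[ℤ] (evenPart (fullGr n) a' * b')
      + (a * sgn (fullGr n) b) ⊗ₜ[ℤ] (oddPart (fullGr n) a' * b') := rfl

/-- A sign arises only when an odd second factor passes an odd first factor, that is, for `(r ⊗ l) ⋆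
(l ⊗ r)`. This minus sign makes the two mixed sums cancel. -/
theorem fullStar_ddTerm (h m j k : ArcBasis n) : fullStar (ddTerm h m) (ddTerm j k)
    = (rightMat h m * rightMat j k) ⊗ₜ[ℤ] (leftMat h.mirror m.mirror * leftMat j.mirror k.mirror)
      - (rightMat h m * leftMat j k) ⊗ₜ[ℤ] (leftMat h.mirror m.mirror * rightMat j.mirror k.mirror)
      + (leftMat h m * rightMat j k) ⊗ₜ[ℤ] (rightMat h.mirror m.mirror * leftMat j.mirror k.mirror)
      + (leftMat h m * leftMat j k) ⊗ₜ[ℤ]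
        (rightMat h.mirror m.mirror * rightMat j.mirror k.mirror) := by
  unfold ddTerm
  simp only [map_add, LinearMap.add_apply, fullStar_tmul, evenPart_rightMat, oddPart_rightMat,
    sgn_rightMat, evenPart_leftMat, oddPart_leftMat, sgn_leftMat, zero_mul, TensorProduct.tmul_zero,
    zero_add, add_zero, mul_neg, TensorProduct.neg_tmul]
  abel

theorem fullStar_ddTerm_of_ne {h m j k : ArcBasis n} (hmj : m ≠ j) :
    fullStar (ddTerm h m) (ddTerm j k) = 0 := by
  have hR := fun h k : ArcBasis n => isRep_fullAlg.right_mul_right h k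
  have hl := fun h k : ArcBasis n => isRep_fullAlg.src_left h k
  have hl' := fun h k : ArcBasis n => isRep_fullAlg.left_mul_tgt h k
  rw [fullStar_ddTerm, mul_eq_zero_of_idem (hR h m).2 (hR j k).1 hmj,
    mul_eq_zero_of_idem (hR h m).2 (hl j k) hmj, mul_eq_zero_of_idem (hl' h m) (hR j k).1 hmj,
    mul_eq_zero_of_idem (hl' h m) (hl j k) hmj]
  simp

theorem fullStar_sum (h : ArcBasis n) :
    fullStar (∑ m, ddTerm h m) (∑ j, ∑ k, ddTerm j k)
      = ∑ k, (rightMat h k ⊗ₜ[ℤ] leftSq h.mirror k.mirror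
        + leftSq h k ⊗ₜ[ℤ] rightMat h.mirror k.mirror) := by
  have h1 : fullStar (∑ m, ddTerm h m) (∑ j, ∑ k, ddTerm j k)
      = ∑ k, ∑ m, fullStar (ddTerm h m) (ddTerm m k) := by
    refine Eq.trans ?_ Finset.sum_comm
    rw [map_sum fullStar, LinearMap.sum_apply]
    refine Finset.sum_congr rfl fun m _ => ?_
    rw [map_sum, Finset.sum_eq_single m]
    · exact map_sum _ _ _
    · intro j _ hj
      rw [map_sum]
      exact Finset.sum_eq_zero fun k _ => fullStar_ddTerm_of_ne (Ne.symm hj)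
    · simp
  rw [h1]
  refine Finset.sum_congr rfl fun k _ => ?_
  simp only [fullStar_ddTerm, Finset.sum_add_distrib, Finset.sum_sub_distrib]
  rw [isRep_fullAlg.sum_right_right, isRep_fullAlg.sum_left_left, isRep_fullAlg.sum_right_left]
  simp only [sub_add_cancel]
  rw [show (leftSq : Matrix (ArcBasis n) (ArcBasis n) _) = leftMat * leftMat from rfl]

theorem degree_swap (h k : ArcBasis n) :
    rightDeg h k + leftDeg h.mirror k.mirror = (0, 1) ∧
    leftDeg h k + rightDeg h.mirror k.mirror = (0, 1) := by
  unfold rightDeg leftDeg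
  rw [ArcBasis.deg_mirror, ArcBasis.deg_mirror]
  constructor <;> refine Prod.ext ?_ ?_ <;> simp

/-- The differential vanishes on `r`, and in `l ⊗ r` the partner of `l` is even, so `sgn` introduces
no sign. -/
theorem ddTerm_relation {d : FullAlg n →ₗ[ℤ] FullAlg n} (D : IsFullDifferential d)
    (h k : ArcBasis n) : TensorProduct.map d (sgn (fullGr n)) (ddTerm h k)
      + TensorProduct.map LinearMap.id d (ddTerm h k)
      = -(rightMat h k ⊗ₜ[ℤ] leftSq h.mirror k.mirror
        + leftSq h k ⊗ₜ[ℤ] rightMat h.mirror k.mirror) := by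
  unfold ddTerm
  simp only [map_add, TensorProduct.map_tmul, D.rightMat, D.leftMat, sgn_rightMat, LinearMap.id_apply,
    TensorProduct.zero_tmul, TensorProduct.tmul_zero, TensorProduct.neg_tmul, TensorProduct.tmul_neg]
  abel

theorem idemA_mul_rightMat_mul (h k : ArcBasis n) :
    idemA h * rightMat h k * idemA k = rightMat h k := by
  rw [(isRep_fullAlg.right_mul_right h k).1, (isRep_fullAlg.right_mul_right h k).2]

theorem idemA_mul_leftMat_mul (h k : ArcBasis n) :
    idemA h * leftMat h k * idemA k = leftMat h k := by
  rw [isRep_fullAlg.src_left, isRep_fullAlg.left_mul_tgt]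

theorem IsFullDifferential.isRankOneDD {d : FullAlg n →ₗ[ℤ] FullAlg n}
    (D : IsFullDifferential d) : IsRankOneDD (fullDG d) (fullDG d).mirror (ddMap d) where
  mem h := by
    rw [ddMap_eq]
    refine Submodule.sum_mem _ fun k _ => Submodule.add_mem _ ?_ ?_
    · refine Submodule.subset_span ⟨k, BorderedKh.rightMat h k, BorderedKh.leftMat h.mirror k.mirror, ?_⟩
      exact (congrArg₂ (TensorProduct.tmul ℤ (M := FullAlg n) (N := FullAlg n))
        (idemA_mul_rightMat_mul h k)
        (idemA_mul_leftMat_mul h.mirror k.mirror)).symm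
    · refine Submodule.subset_span ⟨k, BorderedKh.leftMat h k, BorderedKh.rightMat h.mirror k.mirror, ?_⟩
      exact (congrArg₂ (TensorProduct.tmul ℤ (M := FullAlg n) (N := FullAlg n))
        (idemA_mul_leftMat_mul h k) (idemA_mul_rightMat_mul h.mirror k.mirror)).symm
  degree h := by
    rw [ddMap_eq]
    refine Submodule.sum_mem _ fun k _ => Submodule.add_mem _ ?_ ?_
    · exact Submodule.subset_span ⟨_, _, _, _, rightMat_mem h k, leftMat_mem _ _,
        (degree_swap h k).1, rfl⟩
    · exact Submodule.subset_span ⟨_, _, _, _, leftMat_mem h k, rightMat_mem _ _,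
        (degree_swap h k).2, rfl⟩
  relation h := by
    have h1 : ∀ h, ddMap d h = ∑ k, ddTerm h k := ddMap_eq d
    rw [h1, Finset.sum_congr rfl fun k _ => h1 k]
    change TensorProduct.map d (sgn (fullGr n)) (∑ k, ddTerm h k)
      + TensorProduct.map LinearMap.id d (∑ k, ddTerm h k)
      + fullStar (∑ m, ddTerm h m) (∑ j, ∑ k, ddTerm j k) = 0
    rw [map_sum, map_sum, ← Finset.sum_add_distrib,
      Finset.sum_congr rfl fun k _ => ddTerm_relation D h k, fullStar_sum, Finset.sum_neg_distrib,
      neg_add_cancel]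

end DDRelation

end BorderedKh
end

noncomputable section
namespace BorderedKh

/-! ## Modules -/

section Modules

variable {n : ℕ}

theorem arcMul_bas (h k : ArcBasis n) : arcMul (bas h) (bas k) = ∑ m, mulCoeff h k m • bas m := by
  funext m
  unfold arcMul bas
  rw [Finset.sum_apply, Finset.sum_eq_single h, Finset.sum_eq_single k, Finset.sum_eq_single m]
  · simp
  · intro b _ hb
    rw [Pi.smul_apply, Pi.single_eq_of_ne hb.symm, smul_zero]
  · simp
  · intro b _ hb
    rw [Pi.single_eq_of_ne hb, mul_zero, zero_mul]
  · simp
  · intro b _ hb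
    exact Finset.sum_eq_zero fun k _ => by rw [Pi.single_eq_of_ne hb, zero_mul, zero_mul]
  · simp

theorem mulCoeff_idem_left (a : Matching n) (h k : ArcBasis n) :
    mulCoeff (idemBasis a) h k = if a = h.a ∧ h = k then 1 else 0 := by
  by_cases ha : a = h.a
  · subst ha
    have := mulCoeff_idem (h := h.mirror) (k := k.mirror)
    rw [show idemBasis h.mirror.b = (idemBasis h.a).mirror from rfl, mulCoeff_mirror] at this
    rw [this]
    exact if_congr ⟨fun hh => ⟨rfl, congrArg ArcBasis.mirror hh⟩, fun hh => by rw [hh.2]⟩ rfl rfl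
  · rw [if_neg fun hh => ha hh.1]
    by_contra hc
    exact ha (mulCoeff_ne hc).1

theorem IsMultGen.rightEdge {g : ArcBasis n} (hg : IsMultGen g) : RightEdge (idemBasis g.a) g :=
  ⟨g, hg, by rw [mulCoeff_idem_left, if_pos ⟨rfl, rfl⟩]; exact one_ne_zero⟩

theorem IsMultGen.deg_pos {g : ArcBasis n} (hg : IsMultGen g) : 0 < g.deg := by
  have := hg.rightEdge.deg_lt
  rwa [idemBasis_deg] at this

theorem IsMultGen.mirror {g : ArcBasis n} (hg : IsMultGen g) : IsMultGen g.mirror := by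
  rcases hg with ⟨h1, h2⟩ | ⟨h1, p, hp⟩
  · exact .inl ⟨h1.symm, h2⟩
  · refine .inr ⟨h1.symm, p, fun q => (hp q).trans ?_⟩
    rw [show g.mirror.a = g.a from h1.symm]

theorem IsMultGen.leftEdge {g h k : ArcBasis n} (hg : IsMultGen g) (h0 : mulCoeff g h k ≠ 0) :
    LeftEdge h k := ⟨g.mirror, hg.mirror, by rwa [mulCoeff_mirror]⟩

/-- The element `g` is itself an edge starting at an idempotent, which has degree zero, and this
edge is of the same type as `h ⟶ k`. Both degree differences are therefore 1 or both are 2. -/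
theorem IsMultGen.deg_add {g h k : ArcBasis n} (hg : IsMultGen g) (h0 : mulCoeff g h k ≠ 0) :
    k.deg = h.deg + g.deg := by
  obtain ⟨e1, e2, e3⟩ := mulCoeff_ne h0
  rcases leftEdge_cases (hg.leftEdge h0) with h1 | h1
  · have hne : g.a ≠ g.b := by
      rw [← e2, e1]
      exact Ne.symm h1.2
    have h2 : RB (idemBasis g.a) g := ⟨hg.rightEdge, hne⟩
    have h3 := h2.deg_eq
    rw [idemBasis_deg] at h3
    rw [h1.deg_eq, h3, zero_add]
  · have he : g.a = g.b := by
      rw [← e2, e1]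
      exact h1.a_eq.symm
    have h2 : RD (idemBasis g.a) g := ⟨hg.rightEdge, he⟩
    have h3 := h2.deg_eq
    rw [idemBasis_deg] at h3
    rw [h1.deg_eq, h3, zero_add]

theorem RB.mulCoeff_eq_one {h k : ArcBasis n} (e : RB h k) :
    mulCoeff h (plusElt h.b k.b) k = 1 := by
  classical
  have hk : SameCircle h.a k.b = k.rel := by rw [e.a_eq, ArcBasis.rel]
  obtain ⟨u, v, ⟨hJ, -⟩ | ⟨hJ, -⟩⟩ := e.surgery.joins_or h.a
  · rw [hk] at hJ
    rw [mulCoeff_merge e.surgery e.a_eq hJ, if_pos ((rb_merge e.surgery e.a_eq hJ).1 e)]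
  · rw [hk] at hJ
    rw [mulCoeff_split e.surgery e.a_eq hJ, if_pos ((rb_split e.surgery e.a_eq hJ).1 e)]

/-- On bridges of `m(B)^!`, the structure constants depend only on the matchings. -/
theorem mulCoeff_left_bridge {g h k : ArcBasis n} (hg : IsMultGen g) (e : LB h k) :
    mulCoeff g h k = if g = plusElt k.a h.a then 1 else 0 := by
  split_ifs with hc
  · have := RB.mulCoeff_eq_one e
    rw [hc, ← this, ← mulCoeff_mirror]
    rfl
  · by_contra h0
    obtain ⟨e1, e2, -⟩ := mulCoeff_ne h0
    refine hc ?_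
    rw [e2, ← e1]
    refine (isMultGen_bridge hg ?_).2
    rw [← e2, e1]
    exact Ne.symm e.2

theorem DecAt.of_mem_flipped {h k : ArcBasis n} (e : RD h k) {p : Fin (2 * n)}
    (hp : p ∈ flipped h k) : DecAt p h k := by
  obtain ⟨x, hx⟩ := rd_iff.1 e
  rw [flipped_of_decAt hx, mem_cls] at hp
  exact hx.of_rel hp

theorem mulCoeff_left_decElt {h k : ArcBasis n} (e : RD h k) (p : Fin (2 * n)) :
    mulCoeff (decElt h.a p) h k = if p ∈ flipped h k then 1 else 0 := by
  classical
  have h1 : mulCoeff (decElt h.a p) h k = mulCoeff h.mirror (decElt h.mirror.b p) k.mirror := by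
    rw [← mulCoeff_mirror]
    rfl
  rw [h1, mulCoeff_dec e.2 e.a_eq]
  refine if_congr ⟨fun hh => ?_, fun hh => ?_⟩ rfl rfl
  · have h2 : DecAt p h k := decAt_mirror.1 ⟨e.2, e.a_eq, hh⟩
    rw [flipped_of_decAt h2, mem_cls]
    exact h.equivalence.refl p
  · exact (decAt_mirror.2 (DecAt.of_mem_flipped e hh)).rule

theorem exists_decElt_of_mulCoeff {g h k : ArcBasis n} (hg : IsMultGen g) (e : RD h k)
    (h0 : mulCoeff g h k ≠ 0) : ∃ p, g = decElt h.a p := by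
  obtain ⟨e1, e2, -⟩ := mulCoeff_ne h0
  obtain ⟨p, hp⟩ := isMultGen_dec hg (by rw [e1, ← e2, e.a_eq])
  exact ⟨p, by rw [e.a_eq, e2]; exact hp⟩

theorem mulCoeff_left_dec_congr {g h k h' k' : ArcBasis n} (hg : IsMultGen g) (e : RD h k)
    (e' : RD h' k') (ha : h.a = h'.a) (hf : flipped h k = flipped h' k') :
    mulCoeff g h k = mulCoeff g h' k' := by
  by_cases hp : ∃ p, g = decElt h.a p
  · obtain ⟨p, rfl⟩ := hp
    rw [mulCoeff_left_decElt e, ha, mulCoeff_left_decElt e', hf]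
  · rw [not_imp_comm.1 (exists_decElt_of_mulCoeff hg e) hp,
      not_imp_comm.1 (exists_decElt_of_mulCoeff hg e') (ha ▸ hp)]

/-- The coefficient tests whether the arc of `g` lies on the decorated circle. Testing membership is
additive over disjoint unions, which is how relation (5) comes to hold on modules. -/
theorem mulCoeff_left_dec_add {g h k h' k' h'' k'' : ArcBasis n} (hg : IsMultGen g) (e : RD h k)
    (e' : RD h' k') (e'' : RD h'' k'') (ha' : h.a = h'.a) (ha'' : h.a = h''.a)
    (hd : Disjoint (flipped h' k') (flipped h'' k''))
    (hf : flipped h k = flipped h' k' ∪ flipped h'' k'') :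
    mulCoeff g h k = mulCoeff g h' k' + mulCoeff g h'' k'' := by
  by_cases hp : ∃ p, g = decElt h.a p
  · obtain ⟨p, rfl⟩ := hp
    have h2 := mulCoeff_left_decElt e' p
    have h3 := mulCoeff_left_decElt e'' p
    rw [← ha'] at h2
    rw [← ha''] at h3
    rw [mulCoeff_left_decElt e, h2, h3, hf]
    by_cases h4 : p ∈ flipped h' k'
    · simp [h4, Finset.disjoint_left.1 hd h4]
    · simp [h4]
  · rw [not_imp_comm.1 (exists_decElt_of_mulCoeff hg e) hp,
      not_imp_comm.1 (exists_decElt_of_mulCoeff hg e') (ha' ▸ hp),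
      not_imp_comm.1 (exists_decElt_of_mulCoeff hg e'') (ha'' ▸ hp), add_zero]

namespace RightComplex.Generators

variable {M : RightComplex.{u} n} (X : M.Generators)

theorem el_act (j : X.S) (h' h : ArcBasis n) :
    M.act (X.el j h') (bas h) = ∑ k, mulCoeff h' h k • X.el j k := by
  unfold el
  rw [M.act_mul, arcMul_bas, map_sum]
  exact Finset.sum_congr rfl fun k _ => map_smul _ _ _

theorem el_idem (i : X.S) : X.el i (idemBasis (X.e i)) = X.x i := X.act_idem i

theorem el_eq_zero {i : X.S} {h : ArcBasis n} (hh : h.a ≠ X.e i) : X.el i h = 0 := by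
  unfold el
  rw [← X.el_idem, el_act]
  refine Finset.sum_eq_zero fun k _ => ?_
  rw [mulCoeff_idem_left, if_neg fun hc => hh hc.1.symm, zero_smul]

theorem basis_apply (p : {p : X.S × ArcBasis n // p.2.a = X.e p.1}) :
    X.basis p = X.el p.1.1 p.1.2 := Module.Basis.mk_apply _ _ _

theorem el_eq_basis {i : X.S} {h : ArcBasis n} (hh : h.a = X.e i) :
    X.el i h = X.basis ⟨(i, h), hh⟩ := (X.basis_apply ⟨(i, h), hh⟩).symm

theorem ext_el {Y : Type*} [AddCommGroup Y] {f g : M.M →ₗ[ℤ] Y}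
    (hfg : ∀ i h, h.a = X.e i → f (X.el i h) = g (X.el i h)) : f = g := by
  refine X.basis.ext fun p => ?_
  rw [X.basis_apply]
  exact hfg _ _ p.2

theorem d_x (i : X.S) : M.d (X.x i) = ∑ j, ∑ h, X.coeff i j h • X.el j h := by
  rw [← Fintype.sum_prod_type' fun j h => X.coeff i j h • X.el j h,
    ← Fintype.sum_subtype_add_sum_subtype fun p : X.S × ArcBasis n => p.2.a = X.e p.1,
    Finset.sum_eq_zero (s := (Finset.univ : Finset {p : X.S × ArcBasis n // ¬ p.2.a = X.e p.1}))
      fun p _ => by rw [X.el_eq_zero p.2, smul_zero], add_zero]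
  conv_lhs => rw [← X.basis.sum_repr (M.d (X.x i))]
  refine Finset.sum_congr rfl fun p _ => ?_
  rw [X.basis_apply, coeff, dif_pos p.2]

theorem d_el (i : X.S) (h : ArcBasis n) :
    M.d (X.el i h) = ∑ j, ∑ k, (∑ h', X.coeff i j h' * mulCoeff h' h k) • X.el j k := by
  unfold el
  rw [M.d_act, d_x, map_sum, LinearMap.sum_apply]
  refine Finset.sum_congr rfl fun j _ => ?_
  simp only [Finset.sum_smul]
  rw [Finset.sum_comm, map_sum, LinearMap.sum_apply]
  refine Finset.sum_congr rfl fun h' _ => ?_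
  rw [map_smul, LinearMap.smul_apply, el_act, Finset.smul_sum]
  exact Finset.sum_congr rfl fun k _ => smul_smul _ _ _

theorem mOne_el {i : X.S} {h : ArcBasis n} (hh : h.a = X.e i) :
    X.mOne (X.el i h) = ∑ j, X.c i j • X.el j h := by
  rw [X.el_eq_basis hh]
  exact X.basis.constr_basis ℤ _ _

open Classical in
/-- The matrix entries of the part of the differential given by the multiplicative generators. -/
def tc (i j : X.S) (h k : ArcBasis n) : ℤ :=
  ∑ h' ∈ Finset.univ.filter IsMultGen, X.coeff i j h' * mulCoeff h' h k

/-- The part of the differential given by the multiplicative generators. -/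
def dTil : M.M →ₗ[ℤ] M.M := M.d - X.mOne

variable {X}

theorem CModule.coeff_eq_zero (hC : X.CModule) {i j : X.S} {h : ArcBasis n} (hm : ¬ IsMultGen h)
    (hi : h ≠ idemBasis (X.e j)) : X.coeff i j h = 0 := by
  by_cases hd : h.deg = 0
  · refine dif_neg fun ha => hi ?_
    have h1 := ArcBasis.eq_idem_of_deg hd
    have h2 : h.a = h.b := congrArg ArcBasis.a h1
    rw [h1, ← h2, ha]
  · exact hC i j h hd hm

theorem not_isMultGen_idem (a : Matching n) : ¬ IsMultGen (idemBasis a) := fun h => by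
  have := h.deg_pos
  rw [idemBasis_deg] at this
  exact lt_irrefl _ this

/-- Under `C_module`, the terms of `d(x_i)` outside `β_mult` are multiples of the generators `x_j`,
because elements of degree zero are idempotents. Exactly these are removed by `mOne`. -/
theorem CModule.dTil_el (hC : X.CModule) {i : X.S} {h : ArcBasis n} (hh : h.a = X.e i) :
    X.dTil (X.el i h) = ∑ j, ∑ k, X.tc i j h k • X.el j k := by
  classical
  unfold dTil
  rw [LinearMap.sub_apply, X.mOne_el hh, X.d_el, ← Finset.sum_sub_distrib]
  refine Finset.sum_congr rfl fun j _ => ?_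
  rw [sub_eq_iff_eq_add]
  have h1 : ∀ k, ∑ h', X.coeff i j h' * mulCoeff h' h k
      = X.tc i j h k + X.c i j * mulCoeff (idemBasis (X.e j)) h k := by
    intro k
    rw [← Finset.sum_filter_add_sum_filter_not Finset.univ IsMultGen]
    refine congrArg₂ _ (by unfold tc; congr) ?_
    rw [Finset.sum_eq_single (idemBasis (X.e j))]
    · rfl
    · intro b hb hb'
      rw [hC.coeff_eq_zero (Finset.mem_filter.1 hb).2 hb', zero_mul]
    · exact fun hn => (hn (Finset.mem_filter.2 ⟨Finset.mem_univ _, not_isMultGen_idem _⟩)).elim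
  rw [Finset.sum_congr rfl fun k _ => by rw [h1 k, add_smul], Finset.sum_add_distrib]
  congr 1
  by_cases he : X.e j = h.a
  · rw [Finset.sum_eq_single h]
    · rw [mulCoeff_idem_left, if_pos ⟨he, rfl⟩, mul_one]
    · intro k _ hk
      rw [mulCoeff_idem_left, if_neg fun hc => hk hc.2.symm, mul_zero, zero_smul]
    · simp
  · rw [X.el_eq_zero (Ne.symm he), smul_zero]
    refine Finset.sum_eq_zero fun k _ => ?_
    rw [mulCoeff_idem_left, if_neg fun hc => he hc.1, mul_zero, zero_smul]

variable (X)

/-! ### The action -/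

/-- The action of the elementary idempotents. -/
def proj (h : ArcBasis n) : Module.End ℤ M.M :=
  X.basis.constr ℤ fun p => if p.1.2 = h then X.el p.1.1 h else 0

/-- The action of the generators of `B`. -/
def rOp (h k : ArcBasis n) : Module.End ℤ M.M :=
  X.basis.constr ℤ fun p => if p.1.2 = h then X.el p.1.1 k else 0

/-- The action of the generators of `m(B)^!`. -/
def lOp (h k : ArcBasis n) : Module.End ℤ M.M := X.proj k ∘ₗ X.dTil ∘ₗ X.proj h

theorem proj_el (h : ArcBasis n) (i : X.S) (k : ArcBasis n) :
    X.proj h (X.el i k) = if k = h then X.el i k else 0 := by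
  by_cases hk : k.a = X.e i
  · rw [X.el_eq_basis hk]
    refine (X.basis.constr_basis ℤ _ _).trans ?_
    split_ifs with hc
    · rw [← X.el_eq_basis hk]
      exact congrArg _ hc.symm
    · rfl
  · rw [X.el_eq_zero hk, map_zero, ite_self]

theorem rOp_el {h k : ArcBasis n} (ha : h.a = k.a) (i : X.S) (m : ArcBasis n) :
    X.rOp h k (X.el i m) = if m = h then X.el i k else 0 := by
  by_cases hk : m.a = X.e i
  · rw [X.el_eq_basis hk]
    exact X.basis.constr_basis ℤ _ _
  · rw [X.el_eq_zero hk, map_zero]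
    split_ifs with hc
    · rw [X.el_eq_zero (by rw [← ha, ← hc]; exact hk)]
    · rfl

theorem sum_proj : ∑ h, X.proj h = 1 := by
  refine X.ext_el fun i k _ => ?_
  rw [LinearMap.sum_apply, Finset.sum_eq_single k]
  · rw [X.proj_el, if_pos rfl]
    rfl
  · intro h _ hh
    rw [X.proj_el, if_neg (Ne.symm hh)]
  · simp

theorem proj_proj (h k : ArcBasis n) (x : M.M) :
    X.proj h (X.proj k x) = if h = k then X.proj h x else 0 := by
  split_ifs with hc
  · subst hc
    have : X.proj h ∘ₗ X.proj h = X.proj h := by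
      refine X.ext_el fun i m _ => ?_
      rw [LinearMap.comp_apply, X.proj_el]
      split_ifs with hm
      · rw [X.proj_el, if_pos hm]
      · rw [map_zero]
    exact LinearMap.congr_fun this x
  · have : X.proj h ∘ₗ X.proj k = 0 := by
      refine X.ext_el fun i m _ => ?_
      rw [LinearMap.comp_apply, X.proj_el]
      split_ifs with hm
      · rw [X.proj_el, if_neg fun hh => hc (hh.symm.trans hm)]
        rfl
      · rw [map_zero]
        rfl
    exact LinearMap.congr_fun this x

variable {X}

theorem CModule.lOp_el (hC : X.CModule) {i : X.S} {m : ArcBasis n} (hm : m.a = X.e i)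
    (h k : ArcBasis n) :
    X.lOp h k (X.el i m) = if m = h then ∑ j, X.tc i j h k • X.el j k else 0 := by
  unfold lOp
  rw [LinearMap.comp_apply, LinearMap.comp_apply, X.proj_el]
  split_ifs with hc
  · subst hc
    rw [hC.dTil_el hm, map_sum]
    refine Finset.sum_congr rfl fun j _ => ?_
    rw [map_sum, Finset.sum_eq_single k]
    · rw [map_smul, X.proj_el, if_pos rfl]
    · intro b _ hb
      rw [map_smul, X.proj_el, if_neg hb, smul_zero]
    · simp
  · rw [map_zero, map_zero]

theorem tc_eq_zero (i j : X.S) {h k : ArcBasis n} (hk : ¬ LeftEdge h k) : X.tc i j h k = 0 := by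
  classical
  unfold tc
  refine Finset.sum_eq_zero fun g hg => ?_
  rw [not_imp_comm.1 (Finset.mem_filter.1 hg).2.leftEdge hk, mul_zero]

theorem CModule.lOp_eq_zero (hC : X.CModule) {h k : ArcBasis n} (hk : ¬ LeftEdge h k) :
    X.lOp h k = 0 := by
  refine X.ext_el fun i m hm => ?_
  rw [hC.lOp_el hm]
  split_ifs with hc
  · exact Finset.sum_eq_zero fun j _ => by rw [tc_eq_zero i j hk, zero_smul]
  · rfl

theorem mOne_proj (h : ArcBasis n) (x : M.M) : X.mOne (X.proj h x) = X.proj h (X.mOne x) := by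
  have : X.mOne ∘ₗ X.proj h = X.proj h ∘ₗ X.mOne := by
    refine X.ext_el fun i m hm => ?_
    rw [LinearMap.comp_apply, LinearMap.comp_apply, X.proj_el, X.mOne_el hm, map_sum]
    split_ifs with hc
    · rw [X.mOne_el hm]
      exact Finset.sum_congr rfl fun j _ => by rw [map_smul, X.proj_el, if_pos hc]
    · rw [map_zero, Finset.sum_eq_zero]
      exact fun j _ => by rw [map_smul, X.proj_el, if_neg hc, smul_zero]
  exact LinearMap.congr_fun this x

theorem mOne_rOp {h k : ArcBasis n} (ha : h.a = k.a) (x : M.M) :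
    X.mOne (X.rOp h k x) = X.rOp h k (X.mOne x) := by
  have : X.mOne ∘ₗ X.rOp h k = X.rOp h k ∘ₗ X.mOne := by
    refine X.ext_el fun i m hm => ?_
    rw [LinearMap.comp_apply, LinearMap.comp_apply, X.rOp_el ha, X.mOne_el hm, map_sum]
    split_ifs with hc
    · rw [X.mOne_el (by rw [← ha, ← hc, hm])]
      exact Finset.sum_congr rfl fun j _ => by rw [map_smul, X.rOp_el ha, if_pos hc]
    · rw [map_zero, Finset.sum_eq_zero]
      exact fun j _ => by rw [map_smul, X.rOp_el ha, if_neg hc, smul_zero]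
  exact LinearMap.congr_fun this x

/-- This is `d² = 0` expanded along `d = mOne + dTil`. -/
theorem dTil_dTil (x : M.M) : X.dTil (X.dTil x)
    = -(X.mOne (X.dTil x) + X.dTil (X.mOne x)) - X.mOne (X.mOne x) := by
  have h := M.d_d x
  unfold dTil
  simp only [LinearMap.sub_apply, map_sub, h]
  abel

/-- The block from `h` to `k` of the preceding identity. Since `mOne` commutes with the projections,
its square contributes only to diagonal blocks. -/
theorem sum_lOp_lOp_aux (h k : ArcBasis n) (x : M.M) : ∑ m, X.lOp m k (X.lOp h m x)
    = -(X.mOne (X.lOp h k x) + X.lOp h k (X.mOne x)) - X.proj k (X.proj h (X.mOne (X.mOne x))) := by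
  have h1 : ∀ m, X.lOp m k (X.lOp h m x) = X.proj k (X.dTil (X.proj m (X.dTil (X.proj h x)))) := by
    intro m
    unfold lOp
    simp only [LinearMap.comp_apply]
    rw [X.proj_proj, if_pos rfl]
  have h2 : ∑ m, X.proj m (X.dTil (X.proj h x)) = X.dTil (X.proj h x) := by
    rw [← LinearMap.sum_apply, X.sum_proj]
    rfl
  rw [Finset.sum_congr rfl fun m _ => h1 m, ← map_sum, ← map_sum, h2, dTil_dTil]
  unfold lOp
  simp only [LinearMap.comp_apply, map_sub, map_neg, map_add, mOne_proj]

/-- In a diagonal block, the operators of `m(B)^!` contribute nothing: they raise the degree, so no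
path of one or two steps returns to `h`. Only the square of `mOne` remains. -/
theorem CModule.mOne_mOne (hC : X.CModule) (x : M.M) : X.mOne (X.mOne x) = 0 := by
  have key : ∀ h, X.proj h (X.mOne (X.mOne x)) = 0 := by
    intro h
    have h1 := sum_lOp_lOp_aux (X := X) h h x
    have h2 : ¬ LeftEdge h h := fun e => lt_irrefl _ e.deg_lt
    rw [hC.lOp_eq_zero h2, X.proj_proj, if_pos rfl, Finset.sum_eq_zero] at h1
    · simpa using h1
    · intro m _
      by_cases e1 : LeftEdge h m
      · rw [hC.lOp_eq_zero (h := m) (k := h) fun e2 => absurd e1.deg_lt e2.deg_lt.asymm]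
        rfl
      · rw [hC.lOp_eq_zero e1]
        exact map_zero _
  have h3 := LinearMap.congr_fun X.sum_proj (X.mOne (X.mOne x))
  rw [LinearMap.sum_apply, Finset.sum_eq_zero fun h _ => key h] at h3
  exact h3.symm

/-- One identity with two uses. Off the generators of `m(B)^!` its right side vanishes, which is the
relation `I^⊥` for the action; on the generators it is the Leibniz rule, in view of `d l = -l²`. -/
theorem CModule.sum_lOp_lOp (hC : X.CModule) (h k : ArcBasis n) (x : M.M) :
    ∑ m, X.lOp m k (X.lOp h m x) = -(X.mOne (X.lOp h k x) + X.lOp h k (X.mOne x)) := by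
  rw [sum_lOp_lOp_aux, hC.mOne_mOne, map_zero, map_zero, sub_zero]

end RightComplex.Generators

end Modules

end BorderedKh
end

noncomputable section
namespace BorderedKh

/-! ### The action on `Â(M)` -/

section Actions

variable {n : ℕ}

theorem RightEdge.trans_a {h m k : ArcBasis n} (e : RightEdge h m) (e' : RightEdge m k) :
    h.a = k.a := e.a_eq.trans e'.a_eq

namespace RightComplex.Generators

variable {M : RightComplex.{u} n} {X : M.Generators}

open Classical in
theorem tc_congr {i j : X.S} {h k h' k' : ArcBasis n}
    (hg : ∀ g, IsMultGen g → mulCoeff g h k = mulCoeff g h' k') : X.tc i j h k = X.tc i j h' k' := by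
  unfold tc
  exact Finset.sum_congr rfl fun g hm => by rw [hg g (Finset.mem_filter.1 hm).2]

open Classical in
theorem tc_add {i j : X.S} {h k h' k' h'' k'' : ArcBasis n}
    (hg : ∀ g, IsMultGen g → mulCoeff g h k = mulCoeff g h' k' + mulCoeff g h'' k'') :
    X.tc i j h k = X.tc i j h' k' + X.tc i j h'' k'' := by
  unfold tc
  rw [← Finset.sum_add_distrib]
  exact Finset.sum_congr rfl fun g hm => by rw [hg g (Finset.mem_filter.1 hm).2, mul_add]

variable (X)

/-- The matrix of the generators of `B`, acting on `Â(M)`. -/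
def rMat : Matrix (ArcBasis n) (ArcBasis n) (Module.End ℤ M.M)ᵐᵒᵖ := fun h k =>
  open Classical in if RightEdge h k then MulOpposite.op (X.rOp h k) else 0

/-- The matrix of the generators of `m(B)^!`, acting on `Â(M)`. -/
def lMat : Matrix (ArcBasis n) (ArcBasis n) (Module.End ℤ M.M)ᵐᵒᵖ := fun h k =>
  MulOpposite.op (X.lOp h k)

variable {X}

theorem rMat_of {h k : ArcBasis n} (e : RightEdge h k) :
    X.rMat h k = MulOpposite.op (X.rOp h k) := if_pos e

theorem op_ext {f g : (Module.End ℤ M.M)ᵐᵒᵖ}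
    (h : ∀ i h, h.a = X.e i → f.unop (X.el i h) = g.unop (X.el i h)) : f = g :=
  MulOpposite.unop_injective (X.ext_el h)

theorem CModule.rMat_mul_lMat (hC : X.CModule) {h m : ArcBasis n} (e : RightEdge h m)
    (k : ArcBasis n) {i : X.S} {x : ArcBasis n} (hx : x.a = X.e i) :
    (X.rMat h m * X.lMat m k).unop (X.el i x)
      = if x = h then ∑ j, X.tc i j m k • X.el j k else 0 := by
  rw [rMat_of e]
  change X.lOp m k (X.rOp h m (X.el i x)) = _
  rw [X.rOp_el e.a_eq]
  split_ifs with hc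
  · rw [hC.lOp_el (by rw [← e.a_eq, ← hc, hx]), if_pos rfl]
  · rw [map_zero]

theorem CModule.lMat_mul_rMat (hC : X.CModule) (h : ArcBasis n) {m k : ArcBasis n}
    (e : RightEdge m k) {i : X.S} {x : ArcBasis n} (hx : x.a = X.e i) :
    (X.lMat h m * X.rMat m k).unop (X.el i x)
      = if x = h then ∑ j, X.tc i j h m • X.el j k else 0 := by
  rw [rMat_of e]
  change X.rOp m k (X.lOp h m (X.el i x)) = _
  rw [hC.lOp_el hx]
  split_ifs with hc
  · rw [map_sum]
    exact Finset.sum_congr rfl fun j _ => by rw [map_smul, X.rOp_el e.a_eq, if_pos rfl]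
  · rw [map_zero]

/-- Generators of `B` replace `h` by `k` in `x_i h` without touching `x_i`, so their products depend
only on the ends. The exchange relations compare coefficients of products `h' h`: for a left bridge
these depend only on the left matchings, which right edges preserve, and for a decoration only on
the left matching and the decorated circle. -/
theorem CModule.isRep (hC : X.CModule) :
    IsRep (fun h => MulOpposite.op (X.proj h)) X.rMat X.lMat where
  idem_mul h := MulOpposite.unop_injective <| LinearMap.ext fun x =>
    (X.proj_proj h h x).trans (if_pos rfl)
  idem_orth h k hk := MulOpposite.unop_injective <| LinearMap.ext fun x =>
    (X.proj_proj k h x).trans (if_neg (Ne.symm hk))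
  idem_sum := by
    rw [← MulOpposite.op_one, ← X.sum_proj, Finset.op_sum]
  right_supp h k hk := if_neg hk
  left_supp h k hk := by
    unfold lMat
    rw [hC.lOp_eq_zero hk, MulOpposite.op_zero]
  right_src h k e := by
    rw [rMat_of e]
    refine op_ext (X := X) fun i m _ => ?_
    change X.rOp h k (X.proj h (X.el i m)) = X.rOp h k (X.el i m)
    rw [X.proj_el]
    split_ifs with hc
    · rfl
    · rw [map_zero, X.rOp_el e.a_eq, if_neg hc]
  right_tgt h k e := by
    rw [rMat_of e]
    refine op_ext (X := X) fun i m _ => ?_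
    change X.proj k (X.rOp h k (X.el i m)) = X.rOp h k (X.el i m)
    rw [X.rOp_el e.a_eq]
    split_ifs with hc
    · rw [X.proj_el, if_pos rfl]
    · rw [map_zero]
  left_src h k _ := MulOpposite.unop_injective <| LinearMap.ext fun x => by
    change X.proj k (X.dTil (X.proj h (X.proj h x))) = X.proj k (X.dTil (X.proj h x))
    rw [X.proj_proj, if_pos rfl]
  left_tgt h k _ := MulOpposite.unop_injective <| LinearMap.ext fun x => by
    change X.proj k (X.proj k (X.dTil (X.proj h x))) = X.proj k (X.dTil (X.proj h x))
    rw [X.proj_proj, if_pos rfl]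
  quad := by
    refine ⟨fun h k => MulOpposite.op (X.rOp h k), fun h k e => rMat_of e, fun h m k e e' => ?_⟩
    rw [rMat_of e, rMat_of e']
    refine op_ext (X := X) fun i x _ => ?_
    change X.rOp m k (X.rOp h m (X.el i x)) = X.rOp h k (X.el i x)
    rw [X.rOp_el e.a_eq, X.rOp_el (e.trans_a e')]
    split_ifs with hc
    · rw [X.rOp_el e'.a_eq, if_pos rfl]
    · rw [map_zero]
  dual h k hk := by
    refine MulOpposite.unop_injective <| LinearMap.ext fun x => ?_
    rw [Matrix.mul_apply, Finset.unop_sum, LinearMap.sum_apply]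
    refine (hC.sum_lOp_lOp h k x).trans ?_
    rw [hC.lOp_eq_zero hk]
    simp
  square h₁ h₂ h₂' h₃ hc := by
    have key : RightEdge h₁ h₂ ∧ RightEdge h₂' h₃ ∧
        ∀ g, IsMultGen g → mulCoeff g h₂ h₃ = mulCoeff g h₁ h₂' := by
      have hb : RightEdge h₁ h₂ → LB h₂ h₃ → LB h₁ h₂' → RightEdge h₂' h₃ →
          ∀ g, IsMultGen g → mulCoeff g h₂ h₃ = mulCoeff g h₁ h₂' := by
        intro e1 c2 c3 e4 g hg
        rw [mulCoeff_left_bridge hg c2, mulCoeff_left_bridge hg c3, e1.a_eq, e4.a_eq]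
      rcases hc with ⟨c1, c2, c3, c4⟩ | ⟨c1, c2, c3, c4⟩ | ⟨c1, c2, c3, c4, d1, d2⟩ |
        ⟨c1, c2, c3, c4, d1, d2⟩
      · exact ⟨c1.1, c4.1, hb c1.1 c2 c3 c4.1⟩
      · exact ⟨c1.1, c4.1, hb c1.1 c2 c3 c4.1⟩
      · exact ⟨c1.1, c4.1, fun g hg => mulCoeff_left_dec_congr hg c2 c3 c1.1.a_eq.symm d1⟩
      · exact ⟨c1.1, c4.1, fun g hg => mulCoeff_left_dec_congr hg c2 c3 c1.1.a_eq.symm d1⟩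
    refine op_ext (X := X) fun i x hx => ?_
    rw [hC.rMat_mul_lMat key.1 _ hx, hC.lMat_mul_rMat _ key.2.1 hx]
    simp only [tc_congr key.2.2]
  join h₁ h₂ h₂' h₂'' h₃ c1 c2 c3 c4 c5 c6 d1 d2 := by
    have key : ∀ g, IsMultGen g → mulCoeff g h₂ h₃ = mulCoeff g h₁ h₂' + mulCoeff g h₁ h₂'' :=
      fun g hg => mulCoeff_left_dec_add hg c2 c3 c5 c1.a_eq.symm c1.a_eq.symm d1 d2
    refine op_ext (X := X) fun i x hx => ?_
    rw [MulOpposite.unop_add, LinearMap.add_apply, hC.rMat_mul_lMat c1.1 _ hx,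
      hC.lMat_mul_rMat _ c4.1 hx, hC.lMat_mul_rMat _ c6.1 hx]
    simp only [tc_add key, add_smul, Finset.sum_add_distrib]
    split_ifs
    · rfl
    · rw [add_zero]
  split h₁ h₂ h₂' h₂'' h₃ c1 c2 c3 c4 c5 c6 d1 d2 := by
    have key : ∀ g, IsMultGen g → mulCoeff g h₁ h₂ = mulCoeff g h₂' h₃ + mulCoeff g h₂'' h₃ :=
      fun g hg => mulCoeff_left_dec_add hg c1 c4 c6 c3.a_eq c5.a_eq d1 d2
    refine op_ext (X := X) fun i x hx => ?_
    rw [MulOpposite.unop_add, LinearMap.add_apply, hC.rMat_mul_lMat c3.1 _ hx,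
      hC.rMat_mul_lMat c5.1 _ hx, hC.lMat_mul_rMat _ c2.1 hx]
    simp only [tc_add key, add_smul, Finset.sum_add_distrib]
    split_ifs
    · rfl
    · rw [add_zero]

/-! ### Actions with the prescribed values -/

section

variable {ρ : FullAlg n →+* (Module.End ℤ M.M)ᵐᵒᵖ}

theorem IsFullAction.idem_eq (hρ : X.IsFullAction ρ) (h : ArcBasis n) :
    ρ (idemA h) = MulOpposite.op (X.proj h) := by
  refine op_ext (X := X) fun i m hm => ?_
  rw [hρ.idem h i m hm]
  refine Eq.trans ?_ (X.proj_el h i m).symm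
  exact if_congr eq_comm rfl rfl

theorem IsFullAction.rightMat_eq (hρ : X.IsFullAction ρ) (h k : ArcBasis n) :
    ρ (rightMat h k) = X.rMat h k := by
  by_cases e : RightEdge h k
  · rw [rMat_of e, rightMat_of e]
    refine op_ext (X := X) fun i m hm => ?_
    rw [hρ.right _ i m hm]
    refine Eq.trans ?_ (X.rOp_el e.a_eq i m).symm
    exact if_congr eq_comm rfl rfl
  · rw [isRep_fullAlg.right_supp h k e, map_zero]
    exact (if_neg e).symm

theorem IsFullAction.leftMat_eq (hρ : X.IsFullAction ρ) (hC : X.CModule) (h k : ArcBasis n) :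
    ρ (leftMat h k) = X.lMat h k := by
  by_cases e : LeftEdge h k
  · rw [leftMat_of e]
    refine op_ext (X := X) fun i m hm => ?_
    rw [hρ.left _ i m hm]
    refine Eq.trans ?_ (hC.lOp_el hm h k).symm
    refine if_ctx_congr eq_comm (fun hc => ?_) fun _ => rfl
    refine Finset.sum_congr rfl fun j _ => ?_
    unfold tc
    rw [Finset.sum_smul, hc]
    rfl
  · rw [isRep_fullAlg.left_supp h k e, map_zero, hC.isRep.left_supp h k e]

theorem IsFullAction.letter_eq (hρ : X.IsFullAction ρ) (hC : X.CModule) (x : Letter n) :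
    ρ (letterA x) = letterVal (fun h => MulOpposite.op (X.proj h)) X.rMat X.lMat x := by
  cases x with
  | idem h => exact hρ.idem_eq h
  | right b => exact (congrArg ρ (rightA_eq b)).trans (hρ.rightMat_eq _ _)
  | left b => exact (congrArg ρ (leftA_eq b)).trans (hρ.leftMat_eq hC _ _)

theorem IsFullAction.unique (hρ : X.IsFullAction ρ) (hC : X.CModule)
    {ρ' : FullAlg n →+* (Module.End ℤ M.M)ᵐᵒᵖ} (hρ' : X.IsFullAction ρ') : ρ = ρ' := by
  have h1 : ∀ w, ρ (word w) = ρ' (word w) := by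
    intro w
    induction w with
    | nil => rw [word_nil, map_one, map_one]
    | cons x w ih => rw [word_cons, map_mul, map_mul, ih, hρ.letter_eq hC, hρ'.letter_eq hC]
  have h2 : ρ.toAddMonoidHom.toIntLinearMap = ρ'.toAddMonoidHom.toIntLinearMap :=
    linearMap_ext_word h1
  exact RingHom.ext fun a => LinearMap.congr_fun h2 a

theorem CModule.isFullAction_lift (hC : X.CModule) : X.IsFullAction hC.isRep.lift where
  idem k i h _ := by
    have h1 : hC.isRep.lift (idemA k) = _ := hC.isRep.lift_letter (.idem k)
    rw [h1]
    exact (X.proj_el k i h).trans (if_congr eq_comm rfl rfl)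
  right b i h _ := by
    have h1 : hC.isRep.lift (rightA b) = _ := hC.isRep.lift_letter (.right b)
    rw [h1, letterVal, rMat_of b.edge]
    exact (X.rOp_el b.edge.a_eq i h).trans (if_congr eq_comm rfl rfl)
  left b i h hh := by
    have h1 : hC.isRep.lift (leftA b) = _ := hC.isRep.lift_letter (.left b)
    rw [h1, letterVal]
    refine (hC.lOp_el hh _ _).trans (if_ctx_congr eq_comm (fun hc => ?_) fun _ => rfl)
    refine Finset.sum_congr rfl fun j _ => ?_
    unfold tc
    rw [Finset.sum_smul, hc]

theorem CModule.existsUnique_action (hC : X.CModule) : ∃! ρ, X.IsFullAction ρ :=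
  ⟨_, hC.isFullAction_lift, fun _ hρ => hρ.unique hC hC.isFullAction_lift⟩

end

end RightComplex.Generators

end Actions

end BorderedKh
end

noncomputable section
namespace BorderedKh

/-! ### `Â(M)` as a differential bigraded module and as a Type A structure -/

section DGModules

/-! ### Homogeneous bases -/

/-- Let `π` keep the basis vectors of degree `q`. Then `y - π y` lies in `gr q` and also in the sum
of the other pieces, so it is zero. -/
theorem repr_eq_zero_of_mem {ι T V : Type*} [DecidableEq ι] [AddCommGroup V]
    {gr : ι → Submodule ℤ V} (hgr : DirectSum.IsInternal gr) (B : Module.Basis T ℤ V) {p : T → ι}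
    (hB : ∀ t, B t ∈ gr (p t)) {q : ι} {y : V} (hy : y ∈ gr q) {t : T} (ht : p t ≠ q) :
    B.repr y t = 0 := by
  let π : V →ₗ[ℤ] V := B.constr ℤ fun t => if p t = q then B t else 0
  have hπ : ∀ t, π (B t) = if p t = q then B t else 0 := fun t => B.constr_basis ℤ _ t
  have h1 : ∀ y, π y ∈ gr q := by
    intro y
    induction B.mem_span y using Submodule.span_induction with
    | zero => rw [map_zero]; exact Submodule.zero_mem _
    | add x y _ _ hx hy => rw [map_add]; exact Submodule.add_mem _ hx hy
    | smul c x _ hx => rw [map_smul]; exact Submodule.smul_mem _ c hx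
    | mem x hx =>
      obtain ⟨t, rfl⟩ := hx
      rw [hπ]
      split_ifs with hc
      · rw [← hc]; exact hB t
      · exact Submodule.zero_mem _
  have h2 : ∀ y, y - π y ∈ ⨆ q', ⨆ _ : q' ≠ q, gr q' := by
    intro y
    induction B.mem_span y using Submodule.span_induction with
    | zero => rw [map_zero, sub_zero]; exact Submodule.zero_mem _
    | add x y _ _ hx hy => rw [map_add, add_sub_add_comm]; exact Submodule.add_mem _ hx hy
    | smul c x _ hx => rw [map_smul, ← smul_sub]; exact Submodule.smul_mem _ c hx
    | mem x hx =>
      obtain ⟨t, rfl⟩ := hx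
      rw [hπ]
      split_ifs with hc
      · rw [sub_self]; exact Submodule.zero_mem _
      · rw [sub_zero]
        exact Submodule.mem_iSup_of_mem (p t) (Submodule.mem_iSup_of_mem hc (hB t))
  have h3 : y - π y = 0 := by
    have := hgr.submodule_iSupIndep q
    rw [disjoint_iff] at this
    have h4 : y - π y ∈ gr q ⊓ ⨆ q', ⨆ _ : q' ≠ q, gr q' :=
      ⟨Submodule.sub_mem _ hy (h1 y), h2 y⟩
    rw [this] at h4
    exact h4
  have h5 : B.coord t ∘ₗ π = 0 := by
    refine B.ext fun s => ?_
    rw [LinearMap.comp_apply, hπ]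
    split_ifs with hc
    · rw [B.coord_apply, B.repr_self, Finsupp.single_eq_of_ne (by rintro rfl; exact ht hc)]
      rfl
    · exact map_zero _
  rw [sub_eq_zero.1 h3]
  exact LinearMap.congr_fun h5 y

variable {n : ℕ}

namespace RightComplex.Generators

variable {M : RightComplex.{u} n} (X : M.Generators)

/-- The bidegree of `x_i h` in `Â(M)`. -/
def hatDeg (i : X.S) (h : ArcBasis n) : ℚ × ℤ :=
  (-((X.deg i).1 : ℚ) - (h.deg : ℚ) / 2, (X.deg i).2)

theorem el_mem {i : X.S} {h : ArcBasis n} (hh : h.a = X.e i) : X.el i h ∈ X.hatGr (X.hatDeg i h) :=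
  Submodule.subset_span ⟨i, h, hh, rfl, rfl⟩

theorem hatGr_induction {p : ℚ × ℤ} {P : M.M → Prop}
    (el : ∀ i h, h.a = X.e i → p = X.hatDeg i h → P (X.el i h)) (zero : P 0)
    (add : ∀ x y, P x → P y → P (x + y)) (smul : ∀ (c : ℤ) x, P x → P (c • x)) {x : M.M}
    (hx : x ∈ X.hatGr p) : P x := by
  induction hx using Submodule.span_induction with
  | mem x hx =>
    obtain ⟨i, h, hh, rfl, hp⟩ := hx
    exact el i h hh hp
  | zero => exact zero
  | add x y _ _ hx hy => exact add x y hx hy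
  | smul c x _ hx => exact smul c x hx

theorem isInternal_hatGr : DirectSum.IsInternal X.hatGr := by
  have hb : ∀ i h, h.a = X.e i → (X.basis.constr ℤ fun p =>
      Finsupp.single (X.hatDeg p.1.1 p.1.2) (X.basis p) : M.M →ₗ[ℤ] (ℚ × ℤ) →₀ M.M) (X.el i h)
        = Finsupp.single (X.hatDeg i h) (X.el i h) := by
    intro i h hh
    rw [X.el_eq_basis hh]
    exact X.basis.constr_basis ℤ _ _
  refine isInternal_of_map (X.basis.constr ℤ fun p => Finsupp.single (X.hatDeg p.1.1 p.1.2)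
    (X.basis p)) LinearMap.id Function.injective_id ?_ ?_
  · intro p x hx
    refine X.hatGr_induction (P := fun x => (X.basis.constr ℤ fun p =>
      Finsupp.single (X.hatDeg p.1.1 p.1.2) (X.basis p) : M.M →ₗ[ℤ] (ℚ × ℤ) →₀ M.M) x
        = Finsupp.single p x) ?_ ?_ ?_ ?_ hx
    · rintro i h hh rfl
      exact hb i h hh
    · rw [map_zero, Finsupp.single_zero]
    · intro x y hx hy
      rw [map_add, hx, hy, Finsupp.single_add]
    · intro c x hx
      rw [map_smul, hx, Finsupp.smul_single]
  · refine X.span.trans (Submodule.span_le.2 ?_)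
    rintro _ ⟨p, rfl⟩
    exact Submodule.mem_iSup_of_mem _ (X.el_mem p.2)

variable {X}

/-- The vectors `x_j h` form a homogeneous basis and `d` has bidegree `(0, 1)`, so only basis
vectors of the right bidegree occur in `d(x_i)`. All degree statements about the operators on `Â(M)`
come from this. -/
theorem coeff_deg {i j : X.S} {h : ArcBasis n} (h0 : X.coeff i j h ≠ 0) :
    (X.deg i).1 = (X.deg j).1 + h.deg ∧ (X.deg j).2 = (X.deg i).2 + 1 := by
  unfold coeff at h0
  split_ifs at h0 with hh
  · by_contra hc
    refine h0 (repr_eq_zero_of_mem M.internal X.basis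
      (p := fun p => ((X.deg p.1.1).1 + p.1.2.deg, (X.deg p.1.1).2)) (fun p => ?_)
      (M.d_mem _ _ _ (X.homog i)) ?_)
    · rw [X.basis_apply]
      exact M.act_mem _ _ _ _ (X.homog _)
    · intro he
      exact hc ⟨(congrArg Prod.fst he).symm, congrArg Prod.snd he⟩
  · exact absurd rfl h0

theorem tc_deg {i j : X.S} {h k : ArcBasis n} (h0 : X.tc i j h k ≠ 0) :
    X.hatDeg j k = X.hatDeg i h + leftDeg h k := by
  classical
  obtain ⟨g, hg, h1⟩ := Finset.exists_ne_zero_of_sum_ne_zero h0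
  obtain ⟨e1, e2⟩ := coeff_deg (left_ne_zero_of_mul h1)
  have e3 := (Finset.mem_filter.1 hg).2.deg_add (right_ne_zero_of_mul h1)
  unfold hatDeg leftDeg
  refine Prod.ext ?_ e2
  rw [e1, e3]
  simp only [Prod.fst_add]
  push_cast
  ring

theorem c_deg {i j : X.S} (h : ArcBasis n) (h0 : X.c i j ≠ 0) :
    X.hatDeg j h = X.hatDeg i h + (0, 1) := by
  obtain ⟨e1, e2⟩ := coeff_deg h0
  rw [idemBasis_deg, add_zero] at e1
  unfold hatDeg
  refine Prod.ext ?_ e2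
  rw [e1]
  simp

theorem smul_el_mem {j : X.S} {k : ArcBasis n} {c : ℤ} {p : ℚ × ℤ}
    (h : c ≠ 0 → X.hatDeg j k = p) : c • X.el j k ∈ X.hatGr p := by
  by_cases hc : c = 0
  · rw [hc, zero_smul]
    exact Submodule.zero_mem _
  · by_cases hk : k.a = X.e j
    · rw [← h hc]
      exact Submodule.smul_mem _ _ (X.el_mem hk)
    · rw [X.el_eq_zero hk, smul_zero]
      exact Submodule.zero_mem _

theorem mOne_mem {p : ℚ × ℤ} {x : M.M} (hx : x ∈ X.hatGr p) : X.mOne x ∈ X.hatGr (p + (0, 1)) := by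
  refine X.hatGr_induction (P := fun x => X.mOne x ∈ X.hatGr (p + (0, 1))) ?_ ?_ ?_ ?_ hx
  · rintro i h hh rfl
    rw [X.mOne_el hh]
    exact Submodule.sum_mem _ fun j _ => smul_el_mem (c_deg h)
  · rw [map_zero]; exact Submodule.zero_mem _
  · intro x y hx hy
    rw [map_add]; exact Submodule.add_mem _ hx hy
  · intro c x hx
    rw [map_smul]; exact Submodule.smul_mem _ c hx

section

variable {ρ : FullAlg n →+* (Module.End ℤ M.M)ᵐᵒᵖ} {p q : ℚ × ℤ} {x : M.M}

theorem proj_mem (h : ArcBasis n) (hx : x ∈ X.hatGr p) : X.proj h x ∈ X.hatGr p := by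
  refine X.hatGr_induction (P := fun x => X.proj h x ∈ X.hatGr p) ?_ ?_ ?_ ?_ hx
  · rintro i k hk rfl
    rw [X.proj_el]
    split_ifs
    · exact X.el_mem hk
    · exact Submodule.zero_mem _
  · rw [map_zero]; exact Submodule.zero_mem _
  · intro x y hx hy
    rw [map_add]; exact Submodule.add_mem _ hx hy
  · intro c x hx
    rw [map_smul]; exact Submodule.smul_mem _ c hx

theorem rOp_mem {h k : ArcBasis n} (ha : h.a = k.a) (hx : x ∈ X.hatGr p) :
    X.rOp h k x ∈ X.hatGr (p + rightDeg h k) := by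
  refine X.hatGr_induction (P := fun x => X.rOp h k x ∈ X.hatGr (p + rightDeg h k)) ?_ ?_ ?_ ?_ hx
  · rintro i m hm rfl
    rw [X.rOp_el ha]
    split_ifs with hc
    · have : X.hatDeg i m + rightDeg h k = X.hatDeg i k := by
        subst hc
        unfold hatDeg rightDeg
        refine Prod.ext ?_ (add_zero _)
        simp only [Prod.fst_add]
        ring
      rw [this]
      exact X.el_mem (by rw [← ha, ← hc, hm])
    · exact Submodule.zero_mem _
  · rw [map_zero]; exact Submodule.zero_mem _
  · intro x y hx hy
    rw [map_add]; exact Submodule.add_mem _ hx hy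
  · intro c x hx
    rw [map_smul]; exact Submodule.smul_mem _ c hx

theorem CModule.lOp_mem (hC : X.CModule) (h k : ArcBasis n) (hx : x ∈ X.hatGr p) :
    X.lOp h k x ∈ X.hatGr (p + leftDeg h k) := by
  refine X.hatGr_induction (P := fun x => X.lOp h k x ∈ X.hatGr (p + leftDeg h k)) ?_ ?_ ?_ ?_ hx
  · rintro i m hm rfl
    rw [hC.lOp_el hm]
    split_ifs with hc
    · subst hc
      exact Submodule.sum_mem _ fun j _ => smul_el_mem tc_deg
    · exact Submodule.zero_mem _
  · rw [map_zero]; exact Submodule.zero_mem _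
  · intro x y hx hy
    rw [map_add]; exact Submodule.add_mem _ hx hy
  · intro c x hx
    rw [map_smul]; exact Submodule.smul_mem _ c hx

theorem IsFullAction.letter_mem (hρ : X.IsFullAction ρ) (hC : X.CModule) (y : Letter n)
    (hx : x ∈ X.hatGr p) : (ρ (letterA y)).unop x ∈ X.hatGr (p + y.deg) := by
  rw [hρ.letter_eq hC]
  cases y with
  | idem h =>
    change _ ∈ X.hatGr (p + 0)
    rw [add_zero]
    exact proj_mem h hx
  | right b =>
    rw [letterVal, rMat_of b.edge]
    exact rOp_mem b.edge.a_eq hx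
  | left b =>
    rw [letter_deg_left]
    exact hC.lOp_mem _ _ hx

theorem IsFullAction.word_mem (hρ : X.IsFullAction ρ) (hC : X.CModule) (w : List (Letter n)) :
    ∀ {p x}, x ∈ X.hatGr p → (ρ (word w)).unop x ∈ X.hatGr (p + wordDeg w) := by
  induction w with
  | nil =>
    intro p x hx
    rw [word_nil, map_one]
    change x ∈ X.hatGr (p + 0)
    rwa [add_zero]
  | cons y w ih =>
    intro p x hx
    rw [word_cons, map_mul, wordDeg_cons, ← add_assoc]
    exact ih (hρ.letter_mem hC y hx)

theorem IsFullAction.mem (hρ : X.IsFullAction ρ) (hC : X.CModule) {a : FullAlg n}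
    (hx : x ∈ X.hatGr p) (ha : a ∈ fullGr n q) : (ρ a).unop x ∈ X.hatGr (p + q) := by
  refine fullGr_induction (P := fun a => (ρ a).unop x ∈ X.hatGr (p + q)) ?_ ?_ ?_ ?_ ha
  · rintro w rfl
    exact hρ.word_mem hC w hx
  · rw [map_zero]; exact Submodule.zero_mem _
  · intro a b ha hb
    rw [map_add]; exact Submodule.add_mem _ ha hb
  · intro c a ha
    rw [map_zsmul]; exact Submodule.smul_mem _ c ha

variable {d : FullAlg n →ₗ[ℤ] FullAlg n}

/-- Idempotents and generators of `B` commute with `mOne` and have zero differential. For generators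
of `m(B)^!` the rule is `CModule.sum_lOp_lOp`. -/
theorem IsFullAction.leibniz_letter (hρ : X.IsFullAction ρ) (hC : X.CModule)
    (D : IsFullDifferential d) (y : Letter n) (x : M.M) : X.mOne ((ρ (letterA y)).unop x)
      = (y.deg.2.negOnePow : ℤ) • (ρ (letterA y)).unop (X.mOne x)
        + (ρ (d (letterA y))).unop x := by
  cases y with
  | idem h =>
    have h1 : ρ (letterA (.idem h)) = _ := hρ.idem_eq h
    have h2 : d (letterA (.idem h)) = 0 := D.idem h
    rw [h1, h2, map_zero]
    refine (mOne_proj h x).trans ?_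
    simp [Letter.deg]
  | right b =>
    have h1 : ρ (letterA (.right b)) = _ := hρ.letter_eq hC _
    have h2 : d (letterA (.right b)) = 0 := D.right b
    rw [h1, h2, map_zero, letterVal, rMat_of b.edge]
    refine (mOne_rOp b.edge.a_eq x).trans ?_
    simp [Letter.deg]
  | left b =>
    have h1 : ρ (letterA (.left b)) = _ := hρ.letter_eq hC _
    have h2 : d (letterA (.left b)) = -leftSq b.src.mirror b.tgt.mirror := by
      rw [← D.leftMat, ← leftA_eq]
      rfl
    have h3 : (ρ (leftSq b.src.mirror b.tgt.mirror)).unop x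
        = ∑ m, X.lOp m b.tgt.mirror (X.lOp b.src.mirror m x) := by
      rw [leftSq_apply, map_sum, Finset.unop_sum, LinearMap.sum_apply]
      refine Finset.sum_congr rfl fun m _ => ?_
      rw [map_mul, hρ.leftMat_eq hC, hρ.leftMat_eq hC]
      rfl
    rw [h1, h2, map_neg, MulOpposite.unop_neg, LinearMap.neg_apply, h3, hC.sum_lOp_lOp]
    simp only [letterVal, lMat, MulOpposite.unop_op, Letter.deg, Int.negOnePow_one]
    simp

theorem IsFullAction.leibniz_word (hρ : X.IsFullAction ρ) (hC : X.CModule)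
    (D : IsFullDifferential d) (w : List (Letter n)) : ∀ x, X.mOne ((ρ (word w)).unop x)
      = ((wordDeg w).2.negOnePow : ℤ) • (ρ (word w)).unop (X.mOne x)
        + (ρ (d (word w))).unop x := by
  induction w with
  | nil =>
    intro x
    rw [word_nil, D.one, map_one, map_zero]
    simp [wordDeg]
  | cons y w ih =>
    intro x
    have h1 : ∀ z, (ρ (word (y :: w))).unop z = (ρ (word w)).unop ((ρ (letterA y)).unop z) := by
      intro z
      rw [word_cons, map_mul]
      rfl
    have h2 : (ρ (d (word (y :: w)))).unop x
        = ((wordDeg w).2.negOnePow : ℤ) • (ρ (word w)).unop ((ρ (d (letterA y))).unop x)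
          + (ρ (d (word w))).unop ((ρ (letterA y)).unop x) := by
      rw [D.word_cons, map_add, map_zsmul, map_mul, map_mul]
      rfl
    rw [h1, h1, h2, ih, hρ.leibniz_letter hC D, map_add, map_smul, wordDeg_cons, Prod.snd_add,
      Int.negOnePow_add, Units.val_mul, smul_add, smul_smul, mul_comm, add_assoc]

theorem IsFullAction.leibniz (hρ : X.IsFullAction ρ) (hC : X.CModule) (D : IsFullDifferential d)
    {a : FullAlg n} (ha : a ∈ fullGr n q) (x : M.M) : X.mOne ((ρ a).unop x)
      = (q.2.negOnePow : ℤ) • (ρ a).unop (X.mOne x) + (ρ (d a)).unop x := by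
  refine fullGr_induction (P := fun a => X.mOne ((ρ a).unop x)
      = (q.2.negOnePow : ℤ) • (ρ a).unop (X.mOne x) + (ρ (d a)).unop x) ?_ ?_ ?_ ?_ ha
  · rintro w rfl
    exact hρ.leibniz_word hC D w x
  · simp
  · intro a b ha hb
    simp only [map_add, MulOpposite.unop_add, LinearMap.add_apply, smul_add, ha, hb]
    abel
  · intro c a ha
    simp only [map_zsmul, map_smul, MulOpposite.unop_smul, LinearMap.smul_apply, ha, smul_add]
    rw [smul_comm c]

theorem IsFullAction.isRightDGModule (hρ : X.IsFullAction ρ) (hC : X.CModule)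
    (D : IsFullDifferential d) : IsRightDGModule (X.hatA d ρ) where
  finite := Module.Finite.of_basis X.basis
  internal := X.isInternal_hatGr
  act_mem _ _ _ _ hx ha := hρ.mem hC hx ha
  d_mem _ _ hx := mOne_mem hx
  d_d := hC.mOne_mOne
  leibniz x _ _ ha := hρ.leibniz hC D ha x

end

end RightComplex.Generators

/-! ### Differential modules as Type A structures -/

section

variable {ι : Type} {𝒜 : DGData ι} (ℳ : RightModData.{u} 𝒜)

theorem act_mul (x : ℳ.X) (a b : 𝒜.A) : ℳ.act x (a * b) = ℳ.act (ℳ.act x a) b := by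
  change (ℳ.ρ (a * b)).unop x = (ℳ.ρ b).unop ((ℳ.ρ a).unop x)
  rw [map_mul]
  rfl

theorem act_one (x : ℳ.X) : ℳ.act x 1 = x := by
  change (ℳ.ρ 1).unop x = x
  rw [map_one]
  rfl

/-- The operations of the Type A structure `ℳ.toTypeA`. -/
def typeAOp (x : ℳ.X) (l : List 𝒜.A) : ℳ.X := ℳ.toTypeA.m x l

theorem typeAOp_nil (x : ℳ.X) : typeAOp ℳ x [] = ℳ.d x := rfl

theorem typeAOp_singleton (x : ℳ.X) (a : 𝒜.A) : typeAOp ℳ x [a] = ℳ.act x a := rfl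

theorem typeAOp_eq_zero (x : ℳ.X) {l : List 𝒜.A} (hl : 2 ≤ l.length) : typeAOp ℳ x l = 0 := by
  match l, hl with
  | _ :: _ :: _, _ => rfl

theorem typeAOp_zero (l : List 𝒜.A) : typeAOp ℳ 0 l = 0 := by
  match l with
  | [] => exact map_zero ℳ.d
  | [a] => rw [typeAOp_singleton, map_zero, LinearMap.zero_apply]
  | _ :: _ :: _ => rfl

theorem typeAOp_add_left (x y : ℳ.X) (l : List 𝒜.A) :
    typeAOp ℳ (x + y) l = typeAOp ℳ x l + typeAOp ℳ y l := by
  match l with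
  | [] => exact map_add ℳ.d x y
  | [a] => simp only [typeAOp_singleton, map_add, LinearMap.add_apply]
  | _ :: _ :: _ => exact (add_zero (0 : ℳ.X)).symm

theorem typeAOp_add_right (x : ℳ.X) (l : List 𝒜.A) (a b : 𝒜.A) (l' : List 𝒜.A) :
    typeAOp ℳ x (l ++ (a + b) :: l') = typeAOp ℳ x (l ++ a :: l') + typeAOp ℳ x (l ++ b :: l') := by
  by_cases hl : l = [] ∧ l' = []
  · obtain ⟨rfl, rfl⟩ := hl
    exact map_add (ℳ.act x) a b
  · have hlen : 1 ≤ l.length + l'.length := by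
      by_contra hc
      exact hl ⟨List.length_eq_zero_iff.1 (by omega), List.length_eq_zero_iff.1 (by omega)⟩
    have hlen' : ∀ c : 𝒜.A, 2 ≤ (l ++ c :: l').length := fun c => by
      rw [List.length_append, List.length_cons]
      omega
    rw [typeAOp_eq_zero ℳ x (hlen' _), typeAOp_eq_zero ℳ x (hlen' _),
      typeAOp_eq_zero ℳ x (hlen' _), add_zero]

variable {ℳ}

/-- The terms of the `𝒜_∞` relation of a differential module. -/
theorem IsRightDGModule.relation [Fintype ι] (hM : IsRightDGModule ℳ) (x : ℳ.X)
    (l : List (𝒜.A × (ℚ × ℤ))) (hl : ∀ y ∈ l, y.1 ∈ 𝒜.gr y.2) :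
    (∑ t ∈ Finset.range (l.length + 1),
      (((((t : ℤ) + 1) * (((l.length : ℤ) - t + 1) + 1)
          + ((t : ℤ) + 1) * ((l.drop t).map fun y => y.2.2).sum).negOnePow : ℤˣ) : ℤ) •
        typeAOp ℳ (typeAOp ℳ x ((l.take t).map Prod.fst)) ((l.drop t).map Prod.fst))
    + (∑ k ∈ Finset.range l.length,
        (((((l.length : ℤ) + 2) + ((l.drop (k + 1)).map fun y => y.2.2).sum).negOnePow : ℤˣ) : ℤ) •
        typeAOp ℳ x ((l.take k).map Prod.fst
          ++ 𝒜.d ((l.map Prod.fst).getD k 0) :: (l.drop (k + 1)).map Prod.fst))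
    + (∑ k ∈ Finset.range (l.length - 1),
        ((((k : ℤ) + 1).negOnePow : ℤˣ) : ℤ) •
        typeAOp ℳ x ((l.take k).map Prod.fst
          ++ ((l.map Prod.fst).getD k 0 * (l.map Prod.fst).getD (k + 1) 0)
            :: (l.drop (k + 2)).map Prod.fst)) = 0 := by
  match l, hl with
  -- Without algebra inputs the relation is `d² = 0`.
  | [], _ => simp [typeAOp_nil, hM.d_d]
  -- With one input it is the Leibniz rule. The exponents 3 and 4 are the constant parts for `t = 0`
  -- and `t = 1`; the term with the differential of the algebra also has exponent 3.
  | [y], hl =>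
    have h3 : (3 : ℤ).negOnePow = -1 := Int.negOnePow_odd 3 (by decide)
    have h4 : (4 : ℤ).negOnePow = 1 := Int.negOnePow_even 4 (by decide)
    simp [Finset.sum_range_succ, typeAOp_nil, typeAOp_singleton, Int.negOnePow_add,
      hM.leibniz x y.1 y.2 (hl y (by simp)), h3, h4]
  -- With two inputs it is associativity. Only `t = 1` survives in the first sum, with exponent `6 +
  -- 2 deg_h z`, and it cancels against the product term.
  | [y, z], _ =>
    have h0 : ∀ (x : ℳ.X) (a b : 𝒜.A), typeAOp ℳ x [a, b] = 0 := fun _ _ _ => rfl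
    have h6 : (6 + 2 * z.2.2).negOnePow = 1 :=
      Int.negOnePow_even _ ((by decide : Even (6 : ℤ)).add (even_two_mul _))
    simp [Finset.sum_range_succ, h0, typeAOp_zero, typeAOp_singleton, act_mul, h6]
  -- With three or more inputs, some operation in every term has at least two algebra inputs and
  -- vanishes.
  | y :: z :: t :: l, _ =>
    rw [Finset.sum_eq_zero, Finset.sum_eq_zero, Finset.sum_eq_zero]
    · simp
    · intro k hk
      rw [Finset.mem_range] at hk
      rw [typeAOp_eq_zero, smul_zero]
      simp only [List.length_append, List.length_map, List.length_cons, List.length_take,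
        List.length_drop] at hk ⊢
      omega
    · intro k hk
      rw [Finset.mem_range] at hk
      rw [typeAOp_eq_zero, smul_zero]
      simp only [List.length_append, List.length_map, List.length_cons, List.length_take,
        List.length_drop] at hk ⊢
      omega
    · intro k hk
      rw [Finset.mem_range] at hk
      by_cases h2 : 2 ≤ k
      · rw [typeAOp_eq_zero ℳ x, typeAOp_zero, smul_zero]
        simp only [List.length_map, List.length_cons, List.length_take] at hk ⊢
        omega
      · rw [typeAOp_eq_zero, smul_zero]
        simp only [List.length_map, List.length_cons, List.length_drop] at hk ⊢
        omega

theorem IsRightDGModule.degree [Fintype ι] (hM : IsRightDGModule ℳ) (x : ℳ.X) (p : ℚ × ℤ)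
    (l : List (𝒜.A × (ℚ × ℤ))) (hx : x ∈ ℳ.gr p) (hl : ∀ y ∈ l, y.1 ∈ 𝒜.gr y.2) :
    typeAOp ℳ x (l.map Prod.fst) ∈ ℳ.gr (p + (l.map Prod.snd).sum + (0, 1 - (l.length : ℤ))) := by
  match l, hl with
  | [], _ => simpa [typeAOp_nil] using hM.d_mem p x hx
  | [y], hl => simpa [← Prod.zero_eq_mk, typeAOp_singleton] using hM.act_mem p y.2 x y.1 hx (hl y (by simp))
  | _ :: _ :: _, _ => exact Submodule.zero_mem _

theorem IsDGAlgebra.e_mem [Fintype ι] (hA : IsDGAlgebra 𝒜) (h : ι) : 𝒜.e h ∈ 𝒜.gr 0 := by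
  rw [hA.gr_zero]
  exact Submodule.subset_span ⟨h, rfl⟩

theorem IsDGAlgebra.d_e [Fintype ι] (hA : IsDGAlgebra 𝒜) (h : ι) : 𝒜.d (𝒜.e h) = 0 := by
  have h3 : 𝒜.d 1 = 0 := by simpa using hA.leibniz 1 1 0 hA.one_mem
  rw [← mul_one (𝒜.e h), hA.d_idem_left, h3, mul_zero]

theorem IsRightDGModule.d_act_e [Fintype ι] (hM : IsRightDGModule ℳ) (hA : IsDGAlgebra 𝒜) (x : ℳ.X)
    (h : ι) : ℳ.d (ℳ.act x (𝒜.e h)) = ℳ.act (ℳ.d x) (𝒜.e h) := by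
  rw [hM.leibniz x _ 0 (hA.e_mem h), hA.d_e, map_zero, add_zero]
  simp

open Classical in
theorem act_e_act_e [Fintype ι] (hA : IsDGAlgebra 𝒜) (x : ℳ.X) (h k : ι) :
    ℳ.act (ℳ.act x (𝒜.e k)) (𝒜.e h) = if h = k then ℳ.act x (𝒜.e h) else 0 := by
  rw [← act_mul]
  split_ifs with hc
  · rw [hc, hA.idem_mul]
  · rw [hA.idem_orth k h (Ne.symm hc), map_zero]

theorem sum_act_e [Fintype ι] (hA : IsDGAlgebra 𝒜) (x : ℳ.X) : ∑ h, ℳ.act x (𝒜.e h) = x := by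
  rw [← map_sum, hA.idem_sum, act_one]

theorem typeAOp_balanced (x : ℳ.X) (l : List 𝒜.A) (a b b' : 𝒜.A) (l' : List 𝒜.A) (a' : 𝒜.A) :
    typeAOp ℳ x (l ++ a :: b :: l') = typeAOp ℳ x (l ++ a' :: b' :: l') := by
  have hlen : ∀ c c' : 𝒜.A, 2 ≤ (l ++ c :: c' :: l').length := fun c c' => by
    rw [List.length_append, List.length_cons, List.length_cons]
    omega
  rw [typeAOp_eq_zero ℳ x (hlen _ _), typeAOp_eq_zero ℳ x (hlen _ _)]

theorem typeAOp_balanced_left (x : ℳ.X) (e a : 𝒜.A) (l : List 𝒜.A) :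
    typeAOp ℳ (ℳ.act x e) (a :: l) = typeAOp ℳ x ((e * a) :: l) := by
  match l with
  | [] => exact (act_mul ℳ x e a).symm
  | _ :: _ => rfl

theorem typeAOp_linear (x : ℳ.X) (l : List 𝒜.A) (a e : 𝒜.A) :
    typeAOp ℳ x (l ++ [a * e]) = ℳ.act (typeAOp ℳ x (l ++ [a])) e := by
  match l with
  | [] => exact act_mul ℳ x a e
  | b :: l =>
    rw [typeAOp_eq_zero ℳ x (by simp), typeAOp_eq_zero ℳ x (by simp), map_zero,
      LinearMap.zero_apply]

theorem IsRightDGModule.isTypeA [Fintype ι] (hA : IsDGAlgebra 𝒜) (hM : IsRightDGModule ℳ) :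
    IsTypeA ℳ.toTypeA where
  finite := hM.finite
  internal := hM.internal
  idem_comp h k x := act_e_act_e hA x h k
  idem_sum x := sum_act_e hA x
  idem_mem h p x hx := by
    have := hM.act_mem p 0 x _ hx (hA.e_mem h)
    rwa [add_zero] at this
  add_left x y l := typeAOp_add_left ℳ x y l
  add_right x l a b l' := typeAOp_add_right ℳ x l a b l'
  balanced_left x h a l := typeAOp_balanced_left x (𝒜.e h) a l
  balanced x l a h b l' := typeAOp_balanced x l _ _ _ l' _
  linear_one x h := hM.d_act_e hA x h
  linear x l a h := typeAOp_linear x l a (𝒜.e h)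
  degree x p l hx hl := hM.degree x p l hx hl
  relation x l hl := hM.relation x l hl
  unital x := act_one ℳ x
  unital_higher x _ hl _ := typeAOp_eq_zero ℳ x hl

end

end DGModules

end BorderedKh
end

noncomputable section
namespace BorderedKh

/-! ### The operation of the box tensor product -/

section TypeD

variable {n : ℕ}

namespace RightComplex.Generators

variable {M : RightComplex.{u} n} (X : M.Generators)

/-! ### Signs -/

theorem sgn_el {i : X.S} {h : ArcBasis n} (hh : h.a = X.e i) :
    sgn X.hatGr (X.el i h) = ((X.deg i).2.negOnePow : ℤ) • X.el i h :=
  degMap_of_mem X.isInternal_hatGr _ (X.el_mem hh)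

variable {X}

theorem sgn_mem {p : ℚ × ℤ} {x : M.M} (hx : x ∈ X.hatGr p) : sgn X.hatGr x ∈ X.hatGr p := by
  have h1 : sgn X.hatGr x = _ := degMap_of_mem X.isInternal_hatGr _ hx
  rw [h1]
  exact Submodule.smul_mem _ _ hx

theorem sgn_comm {f : Module.End ℤ M.M} {q : ℚ × ℤ}
    (hf : ∀ {p x}, x ∈ X.hatGr p → f x ∈ X.hatGr (p + q)) (x : M.M) :
    sgn X.hatGr (f x) = (q.2.negOnePow : ℤ) • f (sgn X.hatGr x) := by
  have : sgn X.hatGr ∘ₗ f = (q.2.negOnePow : ℤ) • f ∘ₗ sgn X.hatGr := by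
    refine X.ext_el fun i h hh => ?_
    have h1 : sgn X.hatGr (f (X.el i h)) = _ :=
      degMap_of_mem X.isInternal_hatGr _ (hf (X.el_mem hh))
    rw [LinearMap.comp_apply, h1, LinearMap.smul_apply, LinearMap.comp_apply, X.sgn_el hh, map_smul,
      smul_smul, Prod.snd_add, Int.negOnePow_add, Units.val_mul, mul_comm]
    rfl
  exact LinearMap.congr_fun this x

theorem sgn_sgn (x : M.M) : sgn X.hatGr (sgn X.hatGr x) = x := by
  have : sgn X.hatGr ∘ₗ sgn X.hatGr = LinearMap.id := by
    refine X.ext_el fun i h hh => ?_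
    rw [LinearMap.comp_apply, X.sgn_el hh, map_smul, X.sgn_el hh, smul_smul, ← Units.val_mul,
      Int.units_mul_self, Units.val_one, one_smul, LinearMap.id_apply]
  exact LinearMap.congr_fun this x

theorem sgn_mOne (x : M.M) : sgn X.hatGr (X.mOne x) = -X.mOne (sgn X.hatGr x) := by
  rw [sgn_comm (f := X.mOne) (q := (0, 1)) fun hx => mOne_mem hx]
  simp

theorem sgn_proj (h : ArcBasis n) (x : M.M) :
    sgn X.hatGr (X.proj h x) = X.proj h (sgn X.hatGr x) := by
  rw [sgn_comm (f := X.proj h) (q := 0) fun hx => by rw [add_zero]; exact proj_mem h hx]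
  simp

theorem CModule.sgn_lOp (hC : X.CModule) (h k : ArcBasis n) (x : M.M) :
    sgn X.hatGr (X.lOp h k x) = -X.lOp h k (sgn X.hatGr x) := by
  rw [sgn_comm (f := X.lOp h k) (q := leftDeg h k) fun hx => hC.lOp_mem h k hx]
  simp [leftDeg]

/-! ### The operators of the generators of `B` -/

variable (X)

/-- The action of `rightMat h k` on `Â(M)`. -/
def rAct (h k : ArcBasis n) : Module.End ℤ M.M := (X.rMat h k).unop

variable {X}

theorem rAct_of {h k : ArcBasis n} (e : RightEdge h k) : X.rAct h k = X.rOp h k := by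
  unfold rAct
  rw [rMat_of e, MulOpposite.unop_op]

theorem rAct_eq_zero {h k : ArcBasis n} (e : ¬ RightEdge h k) : X.rAct h k = 0 := by
  unfold rAct rMat
  rw [if_neg e, MulOpposite.unop_zero]

theorem rAct_mem {h k : ArcBasis n} {p : ℚ × ℤ} {x : M.M} (hx : x ∈ X.hatGr p) :
    X.rAct h k x ∈ X.hatGr (p + rightDeg h k) := by
  by_cases e : RightEdge h k
  · rw [rAct_of e]
    exact rOp_mem e.a_eq hx
  · rw [rAct_eq_zero e]
    exact Submodule.zero_mem _

theorem sgn_rAct (h k : ArcBasis n) (x : M.M) :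
    sgn X.hatGr (X.rAct h k x) = X.rAct h k (sgn X.hatGr x) := by
  rw [sgn_comm (f := X.rAct h k) (q := rightDeg h k) fun hx => rAct_mem hx]
  simp [rightDeg]

theorem mOne_rAct (h k : ArcBasis n) (x : M.M) :
    X.mOne (X.rAct h k x) = X.rAct h k (X.mOne x) := by
  by_cases e : RightEdge h k
  · rw [rAct_of e]
    exact mOne_rOp e.a_eq x
  · rw [rAct_eq_zero e]
    exact map_zero _

theorem CModule.rAct_proj (hC : X.CModule) (h k : ArcBasis n) (x : M.M) :
    X.rAct h k (X.proj h x) = X.rAct h k x :=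
  LinearMap.congr_fun (congrArg MulOpposite.unop (hC.isRep.right_mul_right h k).1) x

theorem CModule.proj_rAct (hC : X.CModule) (h k : ArcBasis n) (x : M.M) :
    X.proj k (X.rAct h k x) = X.rAct h k x :=
  LinearMap.congr_fun (congrArg MulOpposite.unop (hC.isRep.right_mul_right h k).2) x

theorem lOp_proj (h k : ArcBasis n) (x : M.M) : X.lOp h k (X.proj h x) = X.lOp h k x := by
  unfold lOp
  rw [LinearMap.comp_apply, LinearMap.comp_apply, LinearMap.comp_apply, LinearMap.comp_apply,
    X.proj_proj, if_pos rfl]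

theorem proj_lOp (h k : ArcBasis n) (x : M.M) : X.proj k (X.lOp h k x) = X.lOp h k x := by
  unfold lOp
  rw [LinearMap.comp_apply, LinearMap.comp_apply, X.proj_proj, if_pos rfl]

/-! ### The operation of the box tensor product -/

variable (X)

/-- The operation `δ^⊠` on the elements with right idempotent `h`. -/
def boxTerm (h : ArcBasis n) : M.M →ₗ[ℤ] FullAlg n ⊗[ℤ] M.M :=
  TensorProduct.mk ℤ (FullAlg n) M.M (idemA h.mirror) ∘ₗ X.mOne
  + ∑ k, (TensorProduct.mk ℤ (FullAlg n) M.M (leftMat h.mirror k.mirror) ∘ₗ sgn X.hatGr ∘ₗ X.rAct h k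
    + TensorProduct.mk ℤ (FullAlg n) M.M (rightMat h.mirror k.mirror) ∘ₗ X.lOp h k)

theorem boxTerm_apply (h : ArcBasis n) (x : M.M) : X.boxTerm h x
    = idemA h.mirror ⊗ₜ[ℤ] X.mOne x
      + ∑ k, (leftMat h.mirror k.mirror ⊗ₜ[ℤ] sgn X.hatGr (X.rAct h k x)
        + rightMat h.mirror k.mirror ⊗ₜ[ℤ] X.lOp h k x) := by
  exact congrArg (fun t : FullAlg n ⊗[ℤ] M.M => idemA h.mirror ⊗ₜ[ℤ] X.mOne x + t)
    (LinearMap.sum_apply _ _ _)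

/-- The operation `δ^⊠` of `Â(M) ⊠ K`. -/
def boxOp : M.M →ₗ[ℤ] FullAlg n ⊗[ℤ] M.M := ∑ h, X.boxTerm h ∘ₗ X.proj h

variable {X}

theorem boxOp_apply (x : M.M) : X.boxOp x = ∑ h, X.boxTerm h (X.proj h x) :=
  LinearMap.sum_apply _ _ _

theorem boxOp_proj (h : ArcBasis n) (x : M.M) : X.boxOp (X.proj h x) = X.boxTerm h (X.proj h x) := by
  rw [boxOp_apply, Finset.sum_eq_single h]
  · rw [X.proj_proj, if_pos rfl]
  · intro k _ hk
    rw [X.proj_proj, if_neg hk, map_zero]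
  · simp

theorem boxOp_of_proj {h : ArcBasis n} {x : M.M} (hx : X.proj h x = x) :
    X.boxOp x = X.boxTerm h x := by
  rw [← hx, boxOp_proj]

/-- The map `x ⊗ a ↦ ± a ⊗ x` for the algebra `m(B ⊙ m(B)^!)`. -/
def fullXi : M.M ⊗[ℤ] FullAlg n →ₗ[ℤ] FullAlg n ⊗[ℤ] M.M :=
  xiMap (fullDG (0 : FullAlg n →ₗ[ℤ] FullAlg n)).mirror X.hatGr

theorem fullXi_tmul (x : M.M) (a : FullAlg n) : fullXi (X := X) (x ⊗ₜ[ℤ] a)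
    = evenPart (fullGr n) a ⊗ₜ[ℤ] x + oddPart (fullGr n) a ⊗ₜ[ℤ] sgn X.hatGr x := by
  change TensorProduct.comm ℤ M.M (FullAlg n) (x ⊗ₜ[ℤ] evenPart (fullGr n) a
    + sgn X.hatGr x ⊗ₜ[ℤ] oddPart (fullGr n) a) = _
  rw [map_add]
  rfl

section

variable {ρ : FullAlg n →+* (Module.End ℤ M.M)ᵐᵒᵖ} {d : FullAlg n →ₗ[ℤ] FullAlg n}

/-- The orbit map `a ↦ x · a`. -/
def orbit (ρ : FullAlg n →+* (Module.End ℤ M.M)ᵐᵒᵖ) (x : M.M) : FullAlg n →ₗ[ℤ] M.M :=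
  (AddMonoidHom.mk' (fun a => (ρ a).unop x) fun a b => by simp).toIntLinearMap

/-- In the explicit form, the sign of `ξ` becomes an operator `sgn` on the terms whose output is a
generator of `m(B)^!`, the odd ones. Terms with output in `B` carry no sign. -/
theorem IsFullAction.boxMap_eq (hρ : X.IsFullAction ρ) (hC : X.CModule) (x : M.M) :
    boxMap (X.hatA d ρ) (fullDG d).mirror (ddMap d) x = X.boxOp x := by
  have e1 : ∀ h, (ρ (idemA h)).unop = X.proj h := fun h =>
    congrArg MulOpposite.unop (hρ.idem_eq h)
  have h1 : boxMap (X.hatA d ρ) (fullDG d).mirror (ddMap d) x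
      = (∑ h : ArcBasis n, idemA h.mirror ⊗ₜ[ℤ] (ρ (idemA h)).unop (X.mOne x))
        + fullXi (X := X) (LinearMap.rTensor (FullAlg n) (orbit ρ x) (∑ h, ddMap d h)) := by
    have key : ∀ (F : ArcBasis n → M.M →ₗ[ℤ] FullAlg n ⊗[ℤ] M.M) (G : M.M →ₗ[ℤ] FullAlg n ⊗[ℤ] M.M),
        (∑ h, F h + G) x = ∑ h, F h x + G x := fun F G => by
      rw [LinearMap.add_apply, LinearMap.sum_apply]
    exact key (fun h => TensorProduct.mk ℤ (FullAlg n) M.M (idemA h.mirror) ∘ₗ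
      (ρ (idemA h)).unop ∘ₗ X.mOne) (fullXi (X := X) ∘ₗ
      (LinearMap.rTensorHom (FullAlg n) ∘ₗ (X.hatA d ρ).act).flip (∑ h, ddMap d h))
  rw [h1, boxOp_apply]
  have h2 : (∑ h, ddMap d h : FullAlg n ⊗[ℤ] FullAlg n) = ∑ h, ∑ k, ddTerm h k :=
    Finset.sum_congr rfl fun h _ => ddMap_eq d h
  have h3 : ∀ h k, fullXi (X := X) (LinearMap.rTensor (FullAlg n) (orbit ρ x) (ddTerm h k))
      = leftMat h.mirror k.mirror ⊗ₜ[ℤ] sgn X.hatGr (X.rAct h k x)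
        + rightMat h.mirror k.mirror ⊗ₜ[ℤ] X.lOp h k x := by
    intro h k
    have c1 : orbit ρ x (rightMat h k) = X.rAct h k x :=
      congrArg (fun f : (Module.End ℤ M.M)ᵐᵒᵖ => f.unop x) (hρ.rightMat_eq h k)
    have c2 : orbit ρ x (leftMat h k) = X.lOp h k x :=
      congrArg (fun f : (Module.End ℤ M.M)ᵐᵒᵖ => f.unop x) (hρ.leftMat_eq hC h k)
    unfold ddTerm
    rw [map_add, LinearMap.rTensor_tmul, LinearMap.rTensor_tmul, c1, c2, map_add, fullXi_tmul,
      fullXi_tmul, evenPart_leftMat, oddPart_leftMat, evenPart_rightMat, oddPart_rightMat]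
    simp
  refine (congrArg (fun t : FullAlg n ⊗[ℤ] FullAlg n => _ + fullXi (X := X)
    (LinearMap.rTensor (FullAlg n) (orbit ρ x) t)) h2).trans ?_
  rw [map_sum, map_sum, ← Finset.sum_add_distrib]
  refine Finset.sum_congr rfl fun h _ => ?_
  rw [map_sum, map_sum, boxTerm_apply, e1, mOne_proj]
  congr 1
  refine Finset.sum_congr rfl fun k _ => ?_
  rw [h3, hC.rAct_proj, lOp_proj]

end

end RightComplex.Generators

end TypeD

end BorderedKh
end

noncomputable section
namespace BorderedKh

/-! ### The Type D structure equation -/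

section TypeDRelation

variable {n : ℕ}

/-- The left action of `FullAlg n` on `FullAlg n ⊗ Y`. -/
def lmulT {Y : Type*} [AddCommGroup Y] (a : FullAlg n) :
    FullAlg n ⊗[ℤ] Y →ₗ[ℤ] FullAlg n ⊗[ℤ] Y :=
  TensorProduct.map (LinearMap.mulLeft ℤ a) LinearMap.id

theorem lmulT_tmul {Y : Type*} [AddCommGroup Y] (a b : FullAlg n) (y : Y) :
    lmulT a (b ⊗ₜ[ℤ] y) = (a * b) ⊗ₜ[ℤ] y := rfl

theorem mul'_assoc_symm {Y : Type*} [AddCommGroup Y] (a : FullAlg n) (t : FullAlg n ⊗[ℤ] Y) :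
    TensorProduct.map (LinearMap.mul' ℤ (FullAlg n)) LinearMap.id
      ((TensorProduct.assoc ℤ (FullAlg n) (FullAlg n) Y).symm (a ⊗ₜ[ℤ] t)) = lmulT a t := by
  induction t using TensorProduct.induction_on with
  | zero => simp
  | tmul b y => rfl
  | add t t' h h' => rw [TensorProduct.tmul_add, map_add, map_add, map_add, h, h']

namespace RightComplex.Generators

variable {M : RightComplex.{u} n} {X : M.Generators}

/-- The composition `(μ₂ ⊗ id) ∘ (id ⊗ δ^⊠)`. -/
def mulBox : FullAlg n ⊗[ℤ] M.M →ₗ[ℤ] FullAlg n ⊗[ℤ] M.M :=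
  TensorProduct.map (LinearMap.mul' ℤ (FullAlg n)) LinearMap.id
    ∘ₗ (TensorProduct.assoc ℤ (FullAlg n) (FullAlg n) M.M).symm.toLinearMap
    ∘ₗ TensorProduct.map LinearMap.id X.boxOp

theorem mulBox_tmul (a : FullAlg n) (x : M.M) :
    mulBox (X := X) (a ⊗ₜ[ℤ] x) = lmulT a (X.boxOp x) := mul'_assoc_symm a _

theorem lmulT_boxTerm (a : FullAlg n) (h : ArcBasis n) (x : M.M) : lmulT a (X.boxTerm h x)
    = (a * idemA h.mirror) ⊗ₜ[ℤ] X.mOne x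
      + ∑ k, ((a * leftMat h.mirror k.mirror) ⊗ₜ[ℤ] sgn X.hatGr (X.rAct h k x)
        + (a * rightMat h.mirror k.mirror) ⊗ₜ[ℤ] X.lOp h k x) := by
  rw [boxTerm_apply, map_add, map_sum, lmulT_tmul]
  refine congrArg _ (Finset.sum_congr rfl fun k _ => ?_)
  rw [map_add, lmulT_tmul, lmulT_tmul]

theorem lmulT_idemA_boxTerm (h k : ArcBasis n) (x : M.M) :
    lmulT (idemA h) (X.boxTerm k x) = if h = k.mirror then X.boxTerm k x else 0 := by
  rw [lmulT_boxTerm]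
  split_ifs with hk
  · subst hk
    rw [boxTerm_apply, isRep_fullAlg.idem_mul]
    refine congrArg _ (Finset.sum_congr rfl fun m _ => ?_)
    rw [isRep_fullAlg.src_left, (isRep_fullAlg.right_mul_right _ _).1]
  · rw [isRep_fullAlg.idem_orth _ _ hk, TensorProduct.zero_tmul, zero_add]
    refine Finset.sum_eq_zero fun m _ => ?_
    rw [← isRep_fullAlg.src_left, ← (isRep_fullAlg.right_mul_right k.mirror m.mirror).1,
      ← mul_assoc, ← mul_assoc, isRep_fullAlg.idem_orth _ _ hk]
    simp

/-- The map `a ⊗ a' ↦ a' ⊗ x · a`. -/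
def flipOrbit (ρ : FullAlg n →+* (Module.End ℤ M.M)ᵐᵒᵖ) (x : M.M) :
    FullAlg n ⊗[ℤ] FullAlg n →ₗ[ℤ] FullAlg n ⊗[ℤ] M.M :=
  (TensorProduct.comm ℤ M.M (FullAlg n)).toLinearMap ∘ₗ LinearMap.rTensor (FullAlg n) (orbit ρ x)

theorem flipOrbit_tmul (ρ : FullAlg n →+* (Module.End ℤ M.M)ᵐᵒᵖ) (x : M.M) (a a' : FullAlg n) :
    flipOrbit ρ x (a ⊗ₜ[ℤ] a') = a' ⊗ₜ[ℤ] (ρ a).unop x := rfl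

section

variable {ρ : FullAlg n →+* (Module.End ℤ M.M)ᵐᵒᵖ}

theorem unop_map_mul (a b : FullAlg n) (x : M.M) :
    (ρ (a * b)).unop x = (ρ b).unop ((ρ a).unop x) := by
  rw [map_mul]
  rfl

theorem IsFullAction.unop_rightMat (hρ : X.IsFullAction ρ) (h k : ArcBasis n) :
    (ρ (rightMat h k)).unop = X.rAct h k := congrArg MulOpposite.unop (hρ.rightMat_eq h k)

theorem IsFullAction.unop_leftMat (hρ : X.IsFullAction ρ) (hC : X.CModule) (h k : ArcBasis n) :
    (ρ (leftMat h k)).unop = X.lOp h k := congrArg MulOpposite.unop (hρ.leftMat_eq hC h k)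

end

/-- This and the next two lemmas are the DD identities with the first tensor factor acting on `x`
and the second kept as output. Outputs come from the second factor, so left and right are
interchanged in the names. -/
theorem CModule.sum_left_left (hC : X.CModule) (h k : ArcBasis n) (x : M.M) :
    ∑ m, (leftMat h.mirror m.mirror * leftMat m.mirror k.mirror) ⊗ₜ[ℤ] X.rAct m k (X.rAct h m x)
      = leftSq h.mirror k.mirror ⊗ₜ[ℤ] X.rAct h k x := by
  have hρ := hC.isFullAction_lift
  have := congrArg (flipOrbit hC.isRep.lift x) (isRep_fullAlg.sum_right_right h k)
  simp only [map_sum, flipOrbit_tmul, unop_map_mul, hρ.unop_rightMat] at this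
  exact this

theorem CModule.sum_left_right (hC : X.CModule) (h k : ArcBasis n) (x : M.M) :
    ∑ m, (leftMat h.mirror m.mirror * rightMat m.mirror k.mirror) ⊗ₜ[ℤ] X.lOp m k (X.rAct h m x)
      = ∑ m, (rightMat h.mirror m.mirror * leftMat m.mirror k.mirror)
        ⊗ₜ[ℤ] X.rAct m k (X.lOp h m x) := by
  have hρ := hC.isFullAction_lift
  have := congrArg (flipOrbit hC.isRep.lift x) (isRep_fullAlg.sum_right_left h k)
  simp only [map_sum, flipOrbit_tmul, unop_map_mul, hρ.unop_rightMat, hρ.unop_leftMat hC] at this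
  exact this

theorem CModule.sum_right_right (hC : X.CModule) (h k : ArcBasis n) (x : M.M) :
    ∑ m, (rightMat h.mirror m.mirror * rightMat m.mirror k.mirror) ⊗ₜ[ℤ] X.lOp m k (X.lOp h m x)
      = -(rightMat h.mirror k.mirror ⊗ₜ[ℤ] (X.mOne (X.lOp h k x) + X.lOp h k (X.mOne x))) := by
  have hρ := hC.isFullAction_lift
  have := congrArg (flipOrbit hC.isRep.lift x) (isRep_fullAlg.sum_left_left h k)
  rw [Matrix.mul_apply, TensorProduct.sum_tmul] at this
  simp only [map_sum, flipOrbit_tmul, unop_map_mul, hρ.unop_leftMat hC] at this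
  rw [this, ← TensorProduct.tmul_sum, hC.sum_lOp_lOp, TensorProduct.tmul_neg]

/-- The operators of `m(B)^!` anticommute with `sgn`, and this supplies the sign by which the mixed
terms cancel. -/
theorem CModule.sum_left_right_sgn (hC : X.CModule) (h k : ArcBasis n) (x : M.M) :
    ∑ m, ((leftMat h.mirror m.mirror * rightMat m.mirror k.mirror)
        ⊗ₜ[ℤ] X.lOp m k (sgn X.hatGr (X.rAct h m x))
      + (rightMat h.mirror m.mirror * leftMat m.mirror k.mirror)
        ⊗ₜ[ℤ] sgn X.hatGr (X.rAct m k (X.lOp h m x))) = 0 := by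
  have h1 := congrArg (TensorProduct.map (LinearMap.id : FullAlg n →ₗ[ℤ] FullAlg n) (sgn X.hatGr))
    (hC.sum_left_right h k x)
  simp only [map_sum, TensorProduct.map_tmul, LinearMap.id_apply, hC.sgn_lOp,
    TensorProduct.tmul_neg] at h1
  rw [Finset.sum_add_distrib, ← h1, ← Finset.sum_add_distrib]
  exact Finset.sum_eq_zero fun m _ => add_neg_cancel _

/-- The terms are sorted by their outputs. Outputs `l l` add up to `l²` and cancel the differential
of the algebra. Mixed outputs cancel among themselves. Outputs `r r` collapse to `-r ⊗ (m₁ l + l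
m₁)` and cancel the terms with output `r` in which `m₁` is applied once. The terms with output `l`
and one `m₁` cancel because `m₁` anticommutes with `sgn`. -/
theorem CModule.relation_of_proj {d : FullAlg n →ₗ[ℤ] FullAlg n} (D : IsFullDifferential d)
    (hC : X.CModule) {h : ArcBasis n} {x : M.M} (hx : X.proj h x = x) :
    TensorProduct.map d (sgn X.hatGr) (X.boxOp x) + mulBox (X := X) (X.boxOp x) = 0 := by
  have h1 : TensorProduct.map d (sgn X.hatGr) (X.boxOp x)
      = -∑ k, leftSq h.mirror k.mirror ⊗ₜ[ℤ] X.rAct h k x := by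
    rw [boxOp_of_proj hx, boxTerm_apply, map_add, TensorProduct.map_tmul, D.idem,
      TensorProduct.zero_tmul, zero_add, map_sum, ← Finset.sum_neg_distrib]
    refine Finset.sum_congr rfl fun k _ => ?_
    rw [map_add, TensorProduct.map_tmul, TensorProduct.map_tmul, D.rightMat, D.leftMat, sgn_sgn,
      TensorProduct.zero_tmul, add_zero, TensorProduct.neg_tmul]
  have h2 : lmulT (idemA h.mirror) (X.boxOp (X.mOne x))
      = ∑ k, (leftMat h.mirror k.mirror ⊗ₜ[ℤ] sgn X.hatGr (X.rAct h k (X.mOne x))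
        + rightMat h.mirror k.mirror ⊗ₜ[ℤ] X.lOp h k (X.mOne x)) := by
    have hx' : X.proj h (X.mOne x) = X.mOne x := by rw [← mOne_proj, hx]
    rw [boxOp_of_proj hx', lmulT_idemA_boxTerm, if_pos rfl, boxTerm_apply, hC.mOne_mOne,
      TensorProduct.tmul_zero, zero_add]
  have h3 : ∀ k, lmulT (leftMat h.mirror k.mirror) (X.boxOp (sgn X.hatGr (X.rAct h k x)))
      = -(leftMat h.mirror k.mirror ⊗ₜ[ℤ] sgn X.hatGr (X.rAct h k (X.mOne x)))
        + ∑ m, ((leftMat h.mirror k.mirror * leftMat k.mirror m.mirror)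
            ⊗ₜ[ℤ] X.rAct k m (X.rAct h k x)
          + (leftMat h.mirror k.mirror * rightMat k.mirror m.mirror)
            ⊗ₜ[ℤ] X.lOp k m (sgn X.hatGr (X.rAct h k x))) := by
    intro k
    have hy : X.proj k (sgn X.hatGr (X.rAct h k x)) = sgn X.hatGr (X.rAct h k x) := by
      rw [← sgn_proj, hC.proj_rAct]
    have hs : X.mOne (sgn X.hatGr (X.rAct h k x)) = -sgn X.hatGr (X.rAct h k (X.mOne x)) := by
      rw [← mOne_rAct, sgn_mOne, neg_neg]
    rw [boxOp_of_proj hy, lmulT_boxTerm, isRep_fullAlg.left_mul_tgt, hs, TensorProduct.tmul_neg]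
    refine congrArg _ (Finset.sum_congr rfl fun m _ => ?_)
    rw [sgn_rAct k m, sgn_sgn]
  have h4 : ∀ k, lmulT (rightMat h.mirror k.mirror) (X.boxOp (X.lOp h k x))
      = rightMat h.mirror k.mirror ⊗ₜ[ℤ] X.mOne (X.lOp h k x)
        + ∑ m, ((rightMat h.mirror k.mirror * leftMat k.mirror m.mirror)
            ⊗ₜ[ℤ] sgn X.hatGr (X.rAct k m (X.lOp h k x))
          + (rightMat h.mirror k.mirror * rightMat k.mirror m.mirror)
            ⊗ₜ[ℤ] X.lOp k m (X.lOp h k x)) := by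
    intro k
    rw [boxOp_of_proj (proj_lOp h k x), lmulT_boxTerm, (isRep_fullAlg.right_mul_right _ _).2]
  have h5 : mulBox (X := X) (X.boxOp x) = lmulT (idemA h.mirror) (X.boxOp (X.mOne x))
      + ∑ k, (lmulT (leftMat h.mirror k.mirror) (X.boxOp (sgn X.hatGr (X.rAct h k x)))
        + lmulT (rightMat h.mirror k.mirror) (X.boxOp (X.lOp h k x))) := by
    conv_lhs => rw [boxOp_of_proj hx]
    rw [boxTerm_apply, map_add, map_sum, mulBox_tmul]
    refine congrArg _ (Finset.sum_congr rfl fun k _ => ?_)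
    rw [map_add, mulBox_tmul, mulBox_tmul]
  have h6 : ∑ k, leftSq h.mirror k.mirror ⊗ₜ[ℤ] X.rAct h k x
      = ∑ k, ∑ m, (leftMat h.mirror k.mirror * leftMat k.mirror m.mirror)
            ⊗ₜ[ℤ] X.rAct k m (X.rAct h k x) := by
    rw [Finset.sum_comm]
    exact Finset.sum_congr rfl fun k _ => (hC.sum_left_left h k x).symm
  have h7 : ∑ k, ∑ m, ((leftMat h.mirror k.mirror * rightMat k.mirror m.mirror)
            ⊗ₜ[ℤ] X.lOp k m (sgn X.hatGr (X.rAct h k x))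
        + (rightMat h.mirror k.mirror * leftMat k.mirror m.mirror)
            ⊗ₜ[ℤ] sgn X.hatGr (X.rAct k m (X.lOp h k x))) = 0 := by
    rw [Finset.sum_comm]
    exact Finset.sum_eq_zero fun k _ => hC.sum_left_right_sgn h k x
  have h8 : ∑ k, ∑ m, (rightMat h.mirror k.mirror * rightMat k.mirror m.mirror)
            ⊗ₜ[ℤ] X.lOp k m (X.lOp h k x)
      = -∑ k, (rightMat h.mirror k.mirror ⊗ₜ[ℤ] X.mOne (X.lOp h k x)
        + rightMat h.mirror k.mirror ⊗ₜ[ℤ] X.lOp h k (X.mOne x)) := by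
    rw [Finset.sum_comm, ← Finset.sum_neg_distrib]
    refine Finset.sum_congr rfl fun k _ => ?_
    rw [hC.sum_right_right, TensorProduct.tmul_add]
  rw [h1, h5, h2, h6]
  simp only [h3, h4, Finset.sum_add_distrib, Finset.sum_neg_distrib] at h7 h8 ⊢
  rw [h8]
  refine Eq.trans ?_ h7
  abel

theorem CModule.relation {d : FullAlg n →ₗ[ℤ] FullAlg n} (D : IsFullDifferential d)
    (hC : X.CModule) (x : M.M) :
    TensorProduct.map d (sgn X.hatGr) (X.boxOp x) + mulBox (X := X) (X.boxOp x) = 0 := by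
  have h1 : x = ∑ h, X.proj h x := by
    have := LinearMap.congr_fun X.sum_proj x
    rw [LinearMap.sum_apply] at this
    exact this.symm
  rw [h1]
  simp only [map_sum, ← Finset.sum_add_distrib]
  exact Finset.sum_eq_zero fun h _ =>
    hC.relation_of_proj D (by rw [X.proj_proj, if_pos rfl] : X.proj h (X.proj h x) = X.proj h x)

end RightComplex.Generators

end TypeDRelation

end BorderedKh
end

noncomputable section
namespace BorderedKh

/-! ### `D̂(N)` as a Type D structure -/

section TypeDStructure

variable {n : ℕ}

namespace RightComplex.Generators

variable {M : RightComplex.{u} n} {X : M.Generators}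

/-- The subgroup `m(B ⊙ m(B)^!) ⊗_R Â(M)` of the tensor product over `ℤ`. -/
def boxBalanced (X : M.Generators) : Submodule ℤ (FullAlg n ⊗[ℤ] M.M) :=
  Submodule.span ℤ {t | ∃ h a x, t = (a * idemA h) ⊗ₜ[ℤ] X.proj h.mirror x}

theorem tmul_mem_boxBalanced {a : FullAlg n} {h : ArcBasis n} {x : M.M}
    (ha : a * idemA h.mirror = a) (hx : X.proj h x = x) : a ⊗ₜ[ℤ] x ∈ X.boxBalanced := by
  refine Submodule.subset_span ⟨h.mirror, a, x, ?_⟩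
  rw [ha]
  exact congrArg _ hx.symm

theorem CModule.boxOp_mem (hC : X.CModule) (x : M.M) : X.boxOp x ∈ X.boxBalanced := by
  rw [boxOp_apply]
  refine Submodule.sum_mem _ fun h _ => ?_
  rw [boxTerm_apply]
  refine Submodule.add_mem _ ?_ (Submodule.sum_mem _ fun k _ => Submodule.add_mem _ ?_ ?_)
  · refine tmul_mem_boxBalanced (h := h) (isRep_fullAlg.idem_mul _) ?_
    rw [← mOne_proj, X.proj_proj, if_pos rfl]
  · refine tmul_mem_boxBalanced (h := k) (isRep_fullAlg.left_mul_tgt _ _) ?_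
    rw [← sgn_proj, hC.proj_rAct]
  · exact tmul_mem_boxBalanced (h := k) (isRep_fullAlg.right_mul_right _ _).2 (proj_lOp _ _ _)

theorem boxOp_proj_mirror (h : ArcBasis n) (x : M.M) :
    X.boxOp (X.proj h.mirror x) = lmulT (idemA h) (X.boxOp x) := by
  rw [boxOp_proj, boxOp_apply, map_sum, Finset.sum_eq_single h.mirror]
  · rw [lmulT_idemA_boxTerm, if_pos h.mirror_mirror.symm]
  · intro k _ hk
    rw [lmulT_idemA_boxTerm, if_neg]
    rintro rfl
    exact hk rfl
  · simp

theorem tmul_mem_tensorGr {p q r : ℚ × ℤ} {a : FullAlg n} {x : M.M} (ha : a ∈ fullGr n q)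
    (hx : x ∈ X.hatGr r) (h : q + r = p) : a ⊗ₜ[ℤ] x ∈ tensorGr (fullGr n) X.hatGr p :=
  Submodule.subset_span ⟨q, r, a, x, ha, hx, h, rfl⟩

theorem CModule.boxOp_mem_tensorGr (hC : X.CModule) {p : ℚ × ℤ} {x : M.M} (hx : x ∈ X.hatGr p) :
    X.boxOp x ∈ tensorGr (fullGr n) X.hatGr (p + (0, 1)) := by
  rw [boxOp_apply]
  refine Submodule.sum_mem _ fun h _ => ?_
  have hp := proj_mem h hx
  rw [boxTerm_apply]
  refine Submodule.add_mem _ ?_ (Submodule.sum_mem _ fun k _ => Submodule.add_mem _ ?_ ?_)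
  · exact tmul_mem_tensorGr (idemA_mem _) (mOne_mem hp) (zero_add _)
  · refine tmul_mem_tensorGr (leftMat_mem _ _) (sgn_mem (rAct_mem hp)) ?_
    rw [← (degree_swap h k).1]
    abel
  · refine tmul_mem_tensorGr (rightMat_mem _ _) (hC.lOp_mem h k hp) ?_
    rw [← (degree_swap h k).2]
    abel

theorem proj_basis (h : ArcBasis n) (t : {p : X.S × ArcBasis n // p.2.a = X.e p.1}) :
    X.proj h.mirror (X.basis t) = if h = t.1.2.mirror then X.basis t else 0 := by
  rw [X.basis_apply, X.proj_el]
  refine if_congr ⟨fun hh => ?_, fun hh => ?_⟩ rfl rfl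
  · rw [hh, ArcBasis.mirror_mirror]
  · rw [hh, ArcBasis.mirror_mirror]

end RightComplex.Generators

namespace LeftComplex.Generators

variable {N : LeftComplex.{u} n} {X : N.Generators} {d : FullAlg n →ₗ[ℤ] FullAlg n}
  {ρ : FullAlg n →+* (Module.End ℤ N.mirror.M)ᵐᵒᵖ}

theorem hatD_δ (hρ : X.mirror.IsFullAction ρ) (hC : X.CModule) :
    (X.hatD d ρ).δ = X.mirror.boxOp := LinearMap.ext fun x => hρ.boxMap_eq hC x

theorem hatD_ε (hρ : X.mirror.IsFullAction ρ) (h : ArcBasis n) :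
    (X.hatD d ρ).ε h = X.mirror.proj h.mirror :=
  LinearMap.ext fun x => congrArg
    (fun f : (Module.End ℤ N.mirror.M)ᵐᵒᵖ => f.unop x) (hρ.idem_eq h.mirror)

theorem isTypeD_hatD (D : IsFullDifferential d) (hρ : X.mirror.IsFullAction ρ) (hC : X.CModule) :
    IsTypeD (X.hatD d ρ) where
  internal := X.mirror.isInternal_hatGr
  free := by
    classical
    refine ⟨{p : X.mirror.S × ArcBasis n // p.2.a = X.mirror.e p.1}, inferInstance, X.mirror.basis,
      -- The idempotent of `x_i h` is `m(h)`: the box product has left idempotents in the mirror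
      -- algebra, and `D̂(N)` is the mirror of that product.
      fun t => t.1.2.mirror, fun t => X.mirror.hatDeg t.1.1 t.1.2, fun t => ⟨?_, fun h => ?_⟩⟩
    · have := X.mirror.el_mem t.2
      rwa [X.mirror.el_eq_basis t.2] at this
    · rw [hatD_ε hρ]
      refine (RightComplex.Generators.proj_basis h t).trans ?_
      exact if_congr Iff.rfl rfl rfl
  δ_mem x := by
    rw [hatD_δ hρ hC]
    have : balancedTensor (fullDG d) (X.hatD d ρ).ε = X.mirror.boxBalanced := by
      rw [funext (hatD_ε hρ)]
      rfl
    rw [this]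
    exact RightComplex.Generators.CModule.boxOp_mem hC x
  δ_linear h x := by
    rw [hatD_δ hρ hC, hatD_ε hρ]
    exact RightComplex.Generators.boxOp_proj_mirror h x
  δ_degree p x hx := by
    rw [hatD_δ hρ hC]
    exact RightComplex.Generators.CModule.boxOp_mem_tensorGr hC hx
  relation x := by
    rw [hatD_δ hρ hC]
    exact RightComplex.Generators.CModule.relation D hC x

end LeftComplex.Generators

end TypeDStructure

end BorderedKh
end

/-! ### The theorem -/

theorem mainTheorem6 (n : ℕ) :
    (∃! d : BorderedKh.FullAlg n →ₗ[ℤ] BorderedKh.FullAlg n, BorderedKh.IsFullDifferential d) ∧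
    ∀ d : BorderedKh.FullAlg n →ₗ[ℤ] BorderedKh.FullAlg n, BorderedKh.IsFullDifferential d →
      BorderedKh.IsDGAlgebra (BorderedKh.fullDG d) ∧
      BorderedKh.IsRankOneDD (BorderedKh.fullDG d) (BorderedKh.fullDG d).mirror
        (BorderedKh.ddMap d) ∧
      (∀ (M : BorderedKh.RightComplex.{u} n) (X : M.Generators), X.CModule →
        (∃! ρ, X.IsFullAction ρ) ∧
        ∀ ρ, X.IsFullAction ρ →
          BorderedKh.IsRightDGModule (X.hatA d ρ) ∧ BorderedKh.IsTypeA (X.hatA d ρ).toTypeA) ∧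
      (∀ (N : BorderedKh.LeftComplex.{u} n) (X : N.Generators), X.CModule →
        (∃! ρ, X.mirror.IsFullAction ρ) ∧
        ∀ ρ, X.mirror.IsFullAction ρ →
          BorderedKh.IsRightDGModule (X.mirror.hatA d ρ) ∧ BorderedKh.IsTypeD (X.hatD d ρ)) := by

  refine ⟨⟨BorderedKh.diffMap, BorderedKh.isFullDifferential_diffMap,
    fun _ D => D.unique BorderedKh.isFullDifferential_diffMap⟩, fun d D => ?_⟩
  refine ⟨D.isDGAlgebra, D.isRankOneDD, fun M X hC => ⟨hC.existsUnique_action, fun ρ hρ => ?_⟩,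
    fun N X hC => ⟨BorderedKh.RightComplex.Generators.CModule.existsUnique_action hC,
      fun ρ hρ => ⟨hρ.isRightDGModule hC D, ?_⟩⟩⟩
  · exact ⟨hρ.isRightDGModule hC D, (hρ.isRightDGModule hC D).isTypeA D.isDGAlgebra⟩
  · exact BorderedKh.LeftComplex.Generators.isTypeD_hatD D hρ hC
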